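/- **Notation.** $B_r(x_0)\subset\mathbb R^3$ is the ball, $\|f\|_{L^2_{uloc}}=\sup_{x_0\in\mathbb R^3}\|f\|_{L^2(B_1(x_0))}$, $\|f\|_{L^{2,2}_{uloc}(t)}=\sup_{x_0\in\mathbb R^3}\|f\|_{L^2((0,t);L^2(B_1(x_0)))}$, and $E^2$ is the space of $f\in L^2_{uloc}$ with $\lim_{|x_0|\to\infty}\|f\|_{L^2(B_1(x_0))}=0$. $\Lambda^\sigma$ is the Fourier multiplier with symbol $|\xi|^\sigma$, extended by duality to fields for which the pairing with $\Lambda^\sigma\theta$ converges absolutely for every test function $\theta$; $[\Lambda^s,\varphi]f=\Lambda^s(\varphi f)-\varphi\Lambda^sf$ and $[\varphi,\Lambda^s]=-[\Lambda^s,\varphi]$, in the sense of distributions. **Local Leray solutions.** Let $s\in[\frac34,1)$, $0<T\le\infty$, and let $u_0\in L^2_{uloc}$ be a divergence-free vector field on $\mathbb R^3$. A vector field $u$ is a local Leray solution of $$\partial_tu+\Lambda^{2s}u+u\cdot\nabla u+\nabla P=0,\qquad \operatorname{div}u=0\qquad\text{on }\mathbb R^3\times(0,T)$$ starting from $u_0$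 if 1. $u\in L^\infty((0,T');L^2_{uloc})$ and $\|\Lambda^su\|_{L^{2,2}_{uloc}(T')}<\infty$ for all $T'<T$; 2. there is a pressure $P$ such that the equations hold in the sense of distributions on $\mathbb R^3\times(0,T)$, and $\nabla P=-\nabla\frac{\operatorname{div}\operatorname{div}}{\Delta}(u\otimes u)$ (such a $P$ is determined up to a function of $t$, and is taken in $L^{3/2}_{loc}(\mathbb R^3\times(0,T))$); 3. $\lim_{t\to0+}\|u(t)-u_0\|_{L^2(K)}=0$ for every compact $K\subset\mathbb R^3$ (essential limit in $t$); 4. for all nonnegative $\psi\in\mathcal D(\mathbb R^3\times(0,\infty))$ and $\tilde\psi\in\mathcal D(\mathbb R^3)$ with $\tilde\psi\psi=\psi$, and all $t\in(0,T)$, $$\begin{aligned}2\int_0^t\!\!\int\psi|\Lambda^su|^2\le{}&\int_0^t\!\!\int|u|^2\partial_t\psi-2\int_0^t\!\!\int[\tilde\psi,\Lambda^s]\Lambda^su\cdot u\psi-2\int_0^t\!\!\int[\Lambda^s,\psi]u\cdot(\tilde\psi\Lambda^su)\\&+\int_0^t\!\!\int|u|^2u\cdot\nabla\psi+2\int_0^t\!\!\int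 P\,u\cdot\nabla\psi.\end{aligned}$$ **Theorem.** Let $\chi\in C^\infty(\mathbb R^3)$ satisfy $0\le\chi\le1$, $\chi=0$ in $B_1(0)$ and $\chi=1$ outside $B_2(0)$, and put $\chi_R(x)=\chi(x/R)$ for $R>0$. Let $s\in[\frac34,1)$, $T'>0$ and $M\ge0$. There is a constant $C>0$ depending only on $s$, $T'$, $M$ (and on the fixed function $\chi$) such that the following holds. Let $T'<T\le\infty$, let $u_0\in E^2$ with $\operatorname{div}u_0=0$, and let $u$ be a local Leray solution on $\mathbb R^3\times(0,T)$ starting from $u_0$ with $$M_{T'}:=\|u\|_{L^\infty((0,T');L^2_{uloc})}+\|u\|_{L^{2,2}_{uloc}(T')}\le M.$$ Then $u$ has a representative with values in $L^2_{uloc}$ that is weakly continuous (continuous in the sense of distributions) in $t\in(0,T)$, and for this representative, all $R>0$ and all $t\in(0,T')$, $$\|\chi_Ru(t)\|_{L^2_{uloc}}+\|\chi_R\Lambda^su\|_{L^{2,2}_{uloc}(t)}\le C\big(\|\chi_Ru_0\|_{L^2_{uloc}}+R^{-1/4}\big).$$ -/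

import Mathlib

open MeasureTheory Filter Topology Set
open scoped ENNReal NNReal FourierTransform RealInnerProductSpace

noncomputable section

namespace FNS

/-- Three-dimensional Euclidean space. -/
abbrev E3 : Type := EuclideanSpace ℝ (Fin 3)

/-! Test functions -/

/-- `θ ∈ 𝓓(ℝ³)`. -/
def IsTest (θ : E3 → ℝ) : Prop :=
  ContDiff ℝ (⊤ : ℕ∞) θ ∧ HasCompactSupport θ

/-- `θ ∈ 𝓓(ℝ³ × I)` for an open set `I` of times; the time variable comes first. -/
def IsSpaceTimeTest (I : Set ℝ) (θ : ℝ → E3 → ℝ) : Prop :=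
  ContDiff ℝ (⊤ : ℕ∞) (Function.uncurry θ) ∧ HasCompactSupport (Function.uncurry θ) ∧
    tsupport (Function.uncurry θ) ⊆ I ×ˢ (univ : Set E3)

/-- The open time interval `(0, T)`, where `T = ∞` is allowed. -/
def timeInterval (T : EReal) : Set ℝ := {t : ℝ | 0 < t ∧ (t : EReal) < T}

/-! Uniformly local spaces -/

/-- `‖f‖_{L²_uloc} = sup_{x₀} ‖f‖_{L²(B₁(x₀))}`. -/
def ulocNorm (f : E3 → E3) : ℝ≥0∞ :=
  ⨆ x₀ : E3, eLpNorm f 2 (volume.restrict (Metric.ball x₀ 1))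

/-- `f ∈ L²_uloc(ℝ³)`. -/
def MemUloc (f : E3 → E3) : Prop :=
  AEStronglyMeasurable f volume ∧ ulocNorm f < ⊤

/-- `f ∈ E²(ℝ³)`: uniformly locally square integrable and vanishing at infinity. -/
def MemE2 (f : E3 → E3) : Prop :=
  MemUloc f ∧
    Tendsto (fun x₀ : E3 => eLpNorm f 2 (volume.restrict (Metric.ball x₀ 1)))
      (cocompact E3) (𝓝 0)

/-- `‖u‖_{L^∞((0,t); L²_uloc)}`. -/
def supUlocNorm (t : ℝ) (u : ℝ → E3 → E3) : ℝ≥0∞ :=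
  essSup (fun τ => ulocNorm (u τ)) (volume.restrict (Ioo 0 t))

/-- `‖f‖_{L^{2,2}_uloc(t)} = sup_{x₀} ‖f‖_{L²((0,t); L²(B₁(x₀)))}`. -/
def ulocNorm22 (t : ℝ) (f : ℝ → E3 → E3) : ℝ≥0∞ :=
  ⨆ x₀ : E3, eLpNorm (Function.uncurry f) 2
    (volume.restrict (Ioo 0 t ×ˢ Metric.ball x₀ 1))

/-! Nonlocal operators -/

/-- The Fourier multiplier operator with real even symbol `m`, on real test functions. The
Fourier transform is `∫ exp(-2πi⟨x, ξ⟩) θ(x) dx`, so the frequency variable is `2πξ`. -/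
def fourierMult (m : E3 → ℝ) (θ : E3 → ℝ) (x : E3) : ℝ :=
  (𝓕⁻ (fun ξ : E3 => (m ξ : ℂ) * 𝓕 (fun y : E3 => (θ y : ℂ)) ξ) x).re

/-- `Λ^σ θ` for a test function `θ`. -/
def fracLap (σ : ℝ) (θ : E3 → ℝ) : E3 → ℝ :=
  fourierMult (fun ξ => (2 * Real.pi * ‖ξ‖) ^ σ) θ

/-- `∂_j ∂_k Δ⁻¹ θ` for a test function `θ`; its symbol is `ξ_j ξ_k / |ξ|²`. -/
def invLapDD (j k : Fin 3) (θ : E3 → ℝ) : E3 → ℝ :=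
  fourierMult (fun ξ => ξ j * ξ k / ‖ξ‖ ^ 2) θ

/-- `Λ^σ f = g` in the sense of distributions: `⟨g, θ⟩ = ⟨f, Λ^σ θ⟩` for all test functions. -/
def HasFracLap (σ : ℝ) (f g : E3 → E3) : Prop :=
  LocallyIntegrable g volume ∧
    ∀ θ : E3 → ℝ, IsTest θ →
      Integrable (fun x => fracLap σ θ x • f x) volume ∧
      ∫ x, θ x • g x = ∫ x, fracLap σ θ x • f x

/-- `c = [Λ^σ, φ] f = Λ^σ (φ f) - φ Λ^σ f` in the sense of distributions:
`⟨c, θ⟩ = ⟨f, φ Λ^σ θ - Λ^σ (φ θ)⟩` for all test functions. -/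
def HasCommutator (σ : ℝ) (φ : E3 → ℝ) (f c : E3 → E3) : Prop :=
  LocallyIntegrable c volume ∧
    ∀ θ : E3 → ℝ, IsTest θ →
      Integrable (fun x => (φ x * fracLap σ θ x - fracLap σ (fun y => φ y * θ y) x) • f x)
        volume ∧
      ∫ x, θ x • c x =
        ∫ x, (φ x * fracLap σ θ x - fracLap σ (fun y => φ y * θ y) x) • f x

/-- Joint (almost everywhere strong) measurability on `(0, T) × ℝ³`. -/
def MeasOn (T : EReal) (f : ℝ → E3 → E3) : Prop :=
  AEStronglyMeasurable (Function.uncurry f)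
    (volume.restrict (timeInterval T ×ˢ (univ : Set E3)))

/-- `g = Λ^σ u` on `(0, T) × ℝ³`, where `Λ^σ` acts in the space variable. -/
def IsFracLapOn (σ : ℝ) (T : EReal) (u g : ℝ → E3 → E3) : Prop :=
  MeasOn T g ∧ ∀ᵐ t ∂(volume.restrict (timeInterval T)), HasFracLap σ (u t) (g t)

/-- `c(t) = [Λ^σ, φ(t)] f(t)` for almost every `t ∈ (0, T)`. -/
def IsCommutatorOn (σ : ℝ) (T : EReal) (φ : ℝ → E3 → ℝ) (f c : ℝ → E3 → E3) : Prop :=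
  MeasOn T c ∧ ∀ᵐ t ∂(volume.restrict (timeInterval T)), HasCommutator σ (φ t) (f t) (c t)

/-! Local Leray solutions -/

/-- `div f = 0` on `ℝ³` in the sense of distributions. -/
def IsSolenoidal (f : E3 → E3) : Prop :=
  ∀ θ : E3 → ℝ, IsTest θ → ∫ x, ⟪f x, gradient θ x⟫ = 0

/-- `div u = 0` on `ℝ³ × (0, T)` in the sense of distributions. -/
def IsDivFreeOn (T : EReal) (u : ℝ → E3 → E3) : Prop :=
  ∀ θ : ℝ → E3 → ℝ, IsSpaceTimeTest (timeInterval T) θ →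
    ∫ t, ∫ x, ⟪u t x, gradient (θ t) x⟫ = 0

/-- `∂ₜu + Λ^{2s}u + u·∇u + ∇P = 0` on `ℝ³ × (0, T)` in the sense of distributions, with
`u·∇u = div(u ⊗ u)`. The identity is vector valued; its `i`-th component is the equation
tested with `θ eᵢ`, multiplied by `-1`. -/
def SolvesMomentum (s : ℝ) (T : EReal) (u : ℝ → E3 → E3) (P : ℝ → E3 → ℝ) : Prop :=
  ∀ θ : ℝ → E3 → ℝ, IsSpaceTimeTest (timeInterval T) θ →
    ∫ t, ∫ x, ((deriv (fun τ => θ τ x) t - fracLap (2 * s) (θ t) x) • u t x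
      + ⟪u t x, gradient (θ t) x⟫ • u t x
      + P t x • gradient (θ t) x) = 0

/-- `∇P = -∇ (div div / Δ)(u ⊗ u)` on `ℝ³ × (0, T)`, tested with `θ eᵢ`: the operator
`div div / Δ` is moved to `∂ᵢθ`, and `∂_j ∂_k Δ⁻¹ ∂ᵢθ` decays like `|x|⁻⁴`, so that the
right-hand side converges absolutely for `u ∈ L^∞_t L²_uloc`. -/
def PressureRelation (T : EReal) (u : ℝ → E3 → E3) (P : ℝ → E3 → ℝ) : Prop :=
  ∀ θ : ℝ → E3 → ℝ, IsSpaceTimeTest (timeInterval T) θ → ∀ i : Fin 3,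
    ∫ t, ∫ x, P t x * gradient (θ t) x i =
      -∫ t, ∫ x, ∑ j, ∑ k, u t x j * u t x k * invLapDD j k (fun y => gradient (θ t) y i) x

/-- `P ∈ L^{3/2}_loc(ℝ³ × (0, T))`. -/
def MemPressure (T : EReal) (P : ℝ → E3 → ℝ) : Prop :=
  ∀ K : Set (ℝ × E3), IsCompact K → K ⊆ timeInterval T ×ˢ (univ : Set E3) →
    MemLp (Function.uncurry P) (3 / 2) (volume.restrict K)

/-- The local energy inequality, with `g = Λ^s u`. Here `c₁ = [Λ^s, ψ'] Λ^s u`, which is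
`-[ψ', Λ^s] Λ^s u`, and `c₂ = [Λ^s, ψ] u`; both fields are determined almost everywhere. -/
def LocalEnergyInequality (s : ℝ) (T : EReal) (u g : ℝ → E3 → E3) (P : ℝ → E3 → ℝ) : Prop :=
  ∀ (ψ : ℝ → E3 → ℝ) (ψ' : E3 → ℝ),
    IsSpaceTimeTest (Ioi 0) ψ → (∀ t x, 0 ≤ ψ t x) →
    IsTest ψ' → (∀ x, 0 ≤ ψ' x) → (∀ t x, ψ' x * ψ t x = ψ t x) →
    ∃ c₁ c₂ : ℝ → E3 → E3,
      IsCommutatorOn s T (fun _ => ψ') g c₁ ∧ IsCommutatorOn s T ψ u c₂ ∧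
      ∀ t ∈ timeInterval T,
        2 * ∫ τ in Ioo 0 t, ∫ x, ψ τ x * ‖g τ x‖ ^ 2 ≤
          (∫ τ in Ioo 0 t, ∫ x, ‖u τ x‖ ^ 2 * deriv (fun r => ψ r x) τ)
          - 2 * (∫ τ in Ioo 0 t, ∫ x, ⟪-c₁ τ x, ψ τ x • u τ x⟫)
          - 2 * (∫ τ in Ioo 0 t, ∫ x, ⟪c₂ τ x, ψ' x • g τ x⟫)
          + (∫ τ in Ioo 0 t, ∫ x, ‖u τ x‖ ^ 2 * ⟪u τ x, gradient (ψ τ) x⟫)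
          + 2 * (∫ τ in Ioo 0 t, ∫ x, P τ x * ⟪u τ x, gradient (ψ τ) x⟫)

/-- `u` is a local Leray solution of the fractional Navier-Stokes equations on
`ℝ³ × (0, T)` starting from `u₀`. As `u` is an element of `L^∞_t L²_uloc`, it is only
determined for almost every time, and the limit at `t = 0+` is the essential limit.
The pressure is only determined up to a function of time; the relation
`∇P = -∇ (div div / Δ)(u ⊗ u)` together with `u ∈ L³_loc` puts it, after the choice of
that function of time, in `L^{3/2}_loc`, as is needed for the last term of the local energy
inequality to have a meaning. -/
structure IsLocalLeraySolution (s : ℝ) (T : EReal) (u₀ : E3 → E3) (u : ℝ → E3 → E3) :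
    Prop where
  exponent : s ∈ Ico (3 / 4 : ℝ) 1
  data_uloc : MemUloc u₀
  data_div : IsSolenoidal u₀
  meas : MeasOn T u
  bounded : ∀ T' : ℝ, (T' : EReal) < T → supUlocNorm T' u < ⊤
  div_free : IsDivFreeOn T u
  initial : ∀ K : Set E3, IsCompact K →
    Tendsto (fun t => eLpNorm (fun x => u t x - u₀ x) 2 (volume.restrict K))
      (𝓝[>] (0 : ℝ) ⊓ ae (volume : Measure ℝ)) (𝓝 0)
  suitable : ∃ g : ℝ → E3 → E3, ∃ P : ℝ → E3 → ℝ,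
    IsFracLapOn s T u g ∧
    (∀ T' : ℝ, (T' : EReal) < T → ulocNorm22 T' g < ⊤) ∧
    MemPressure T P ∧
    SolvesMomentum s T u P ∧
    PressureRelation T u P ∧
    LocalEnergyInequality s T u g P

/-- `v` is the weakly continuous representative of `u` on `(0, T)`: it agrees with `u` for
almost every time, and `t ↦ v(t) ∈ L²_uloc` is continuous in the sense of distributions. -/
def IsWeaklyContinuousRep (T : EReal) (u v : ℝ → E3 → E3) : Prop :=
  (∀ᵐ t ∂(volume.restrict (timeInterval T)), v t =ᵐ[volume] u t) ∧
  (∀ t ∈ timeInterval T, MemUloc (v t)) ∧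
  ∀ θ : E3 → ℝ, IsTest θ → ContinuousOn (fun t => ∫ x, θ x • v t x) (timeInterval T)

/-- A smooth cutoff that vanishes in `B₁(0)` and equals `1` outside `B₂(0)`. -/
def IsCutoff (χ : E3 → ℝ) : Prop :=
  ContDiff ℝ (⊤ : ℕ∞) χ ∧ (∀ x, ‖x‖ < 1 → χ x = 0) ∧ (∀ x, 2 ≤ ‖x‖ → χ x = 1) ∧
    ∀ x, 0 ≤ χ x ∧ χ x ≤ 1

/-- `χ_R f` with `χ_R(x) = χ(x / R)`. -/
def cutoffMul (χ : E3 → ℝ) (R : ℝ) (f : E3 → E3) (x : E3) : E3 :=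
  χ (R⁻¹ • x) • f x

end FNS

end

/-!
The proof is a weighted local energy estimate. Fix the cutoff `χ_R` and let
`u` be the solution, `g = Λ^s u`. The local energy inequality is tested with `η(t) (φ_ρ χ_R)²`, where
`φ_ρ` is a bump of size `ρ` around an arbitrary point and `η` a cutoff in time. Only one property of
`χ_R` is used: it has values in `[0, 1]` and modulus of continuity `κ min(|z|, |z|^{1/2})` with
`κ ~ R^{-1/2}` (`IsMult`, `IsCutoff.exists_isMult`). Errors are then of size `κ` in the squared
norms, which gives `R^{-1/4}`.

*Commutators.* `[Λ^s, φ]` is an integral operator with kernel `(φ x - φ y) |x - y|^{-3-s}`, up to a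
constant (`exists_commutator_duality`). Moving `χ_R` across this kernel costs `κ` times an
integrable kernel `ker s`, hence the commutator terms are bounded by the weighted energy, a small
multiple of the weighted enstrophy, and `O(κ)` (`exists_commutator_terms_le`).

*Transport and pressure.* Both are cubic in `u`. A local Sobolev inequality for `s ≥ 3/4`
(`exists_local_L4`) bounds the weighted `L⁴` norm by energy and enstrophy, and a gradient of `φ_ρ`
yields a factor `ρ⁻¹`, so that for `ρ` large the critical quantity is absorbed
(`exists_cubic_term_le`). In the pressure term the velocity is mollified in space-time, which makes
it an admissible divergence free test field; the Riesz transforms are moved to this field, and the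
result is split into a near part (Plancherel), a middle part, and a far part in which the kernel
decays like `|x|^{-4}` (`exists_pressure_static`). The mollification is removed by `L³`
convergence against `P ∈ L^{3/2}_loc` (`exists_pressure_le`).

*Conclusion.* These bounds (`exists_energy_le`) are turned into bounds at almost every time by
letting `η` approach an indicator function, the initial energy being provided by the strong
convergence to `u₀`. On a short time interval the energy is absorbed, and finitely many intervals
cover `(0, T')` (`exists_energy_bound`). Compactness and the momentum equation give a weakly
continuous representative whose values are weak limits along almost every time; lower
semicontinuity of the weighted energy extends the bound to every time (`exists_weakRep`,
`IsLocalLeraySolution.exists_weaklyContinuousRep`).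
-/

noncomputable section

namespace FNS

open scoped Real
open Function (uncurry)
open Complex (I exp norm_real)
open Finset (mul_sum sum_le_sum)
open Metric (ball closedBall mem_ball isOpen_ball measure_ball_pos ball_mem_nhds ball_subset_ball)
open MeasureTheory.Measure (volume_eq_prod prod_restrict)
open Real (norm_of_nonneg norm_eq_abs cos enorm_of_nonneg rpow_natCast rpow_add rpow_neg rpow_mul mul_rpow
  fourierInv_eq' enorm_eq_ofReal_abs continuous_fourierChar rpow_le_rpow_of_exponent_le rpow_nonneg sqrt_eq_rpow)
open ENNReal (ofReal ofReal_mul ofReal_le_ofReal ofReal_ne_top ofReal_pow ofReal_one ofReal_add ofReal_coe_nnreal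
  ofReal_le_one ofReal_toReal one_le_ofReal ofReal_inv_of_pos ofReal_eq_zero ofReal_lt_top toReal_le_of_le_ofReal
  coe_toNNReal ofReal_sum_of_nonneg ofReal_zero mul_lt_top)
local notation "𝟙" => fun _ => 1
local notation "𝓛" T:max => volume.restrict (Ioo 0 T)
local notation "ϵ[" n "]" => ((n : ℝ) + 1)⁻¹
local notation "𝐩" i:max => (EuclideanSpace.proj (𝕜 := ℝ) i : E3 →L[ℝ] ℝ)

lemma lintegral_cmul {α} [MeasurableSpace α] {μ : Measure α} {c : ℝ≥0∞} {f : α → ℝ≥0∞}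
    (hc : c ≠ ⊤ := by finiteness) : ∫⁻ x, c * f x ∂μ = c * ∫⁻ x, f x ∂μ :=
  lintegral_const_mul' _ _ hc

lemma mulL {a b c : ℝ≥0∞} (h : b ≤ c) : a * b ≤ a * c := mul_le_mul' le_rfl h

lemma mulR {a b c : ℝ≥0∞} (h : b ≤ c) : b * a ≤ c * a := mul_le_mul' h le_rfl

lemma enorm_le_one_of_mem {r : ℝ} (h0 : 0 ≤ r) (h1 : r ≤ 1) : ‖r‖ₑ ≤ 1 := by
  rw [enorm_of_nonneg h0]; exact ofReal_le_one.2 h1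

lemma integral_congr' {α} [MeasurableSpace α] {μ : Measure α} {f g : α → ℝ}
    (h : ∀ x, f x = g x) : ∫ x, f x ∂μ = ∫ x, g x ∂μ := by simp only [h]

lemma lintegral_le_mul_of_support {f v : E3 → ℝ≥0∞} {c V s} (hs : MeasurableSet s) (hc : c ≠ ⊤)
    (h : ∀ x ∈ s, f x ≤ c * v x) (h0 : ∀ x ∉ s, f x = 0) (hV : ∫⁻ x in s, v x ≤ V) :
    ∫⁻ x, f x ≤ c * V := by
  grw [← hV, ← lintegral_const_mul' _ _ hc, ← lintegral_indicator hs]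
  refine lintegral_mono fun x => ?_
  by_cases hx : x ∈ s
  · simpa [hx] using h x hx
  · simp [h0 x hx]

/-! ### Integral inequalities in uniformly local spaces -/

/-- Cauchy-Schwarz for the lower Lebesgue integral, in squared form. -/
lemma sq_lintegral_mul_le {α : Type*} [MeasurableSpace α] (μ : Measure α) {f g}
    (hf : AEMeasurable f μ) (hg : AEMeasurable g μ) :
    (∫⁻ x, f x * g x ∂μ) ^ 2 ≤ (∫⁻ x, f x ^ 2 ∂μ) * ∫⁻ x, g x ^ 2 ∂μ := by
  have h := ENNReal.lintegral_mul_le_Lp_mul_Lq μ Real.HolderConjugate.two_two hf hg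
  simp only [Pi.mul_apply, ENNReal.rpow_two] at h
  calc (∫⁻ x, f x * g x ∂μ) ^ 2
      ≤ ((∫⁻ x, f x ^ 2 ∂μ) ^ (1 / 2 : ℝ) * (∫⁻ x, g x ^ 2 ∂μ) ^ (1 / 2 : ℝ)) ^ 2 := by gcongr
    _ = _ := by
      rw [mul_pow, ← ENNReal.rpow_natCast, ← ENNReal.rpow_natCast, ← ENNReal.rpow_mul,
        ← ENNReal.rpow_mul]
      norm_num

/-- Cauchy-Schwarz with respect to the measure `k μ`. -/
lemma sq_lintegral_weight_le {α : Type*} [MeasurableSpace α] (μ : Measure α) {k f}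
    (hk : AEMeasurable k μ) (hf : AEMeasurable f μ) :
    (∫⁻ x, k x * f x ∂μ) ^ 2 ≤ (∫⁻ x, k x ∂μ) * ∫⁻ x, k x * f x ^ 2 ∂μ := by
  have key : ∀ x, k x ^ (1 / 2 : ℝ) * k x ^ (1 / 2 : ℝ) = k x := fun x => by
    rw [← ENNReal.rpow_add_of_nonneg _ _ (by norm_num) (by norm_num)]; norm_num
  have h := sq_lintegral_mul_le μ (hk.pow_const (1 / 2 : ℝ)) ((hk.pow_const (1 / 2 : ℝ)).mul hf)
  simp only [Pi.mul_apply, mul_pow, sq (_ ^ (1 / 2 : ℝ)), key, ← mul_assoc] at h; exact h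

/-- The convolution `k * f` of nonnegative functions. -/
def lconv (k f : E3 → ℝ≥0∞) (x : E3) : ℝ≥0∞ := ∫⁻ z, k z * f (x - z)

lemma measurable_lconv {k f} (hk : Measurable k) (hf : Measurable f) : Measurable (lconv k f) := by
  unfold lconv
  apply Measurable.lintegral_prod_right' (f := fun p : E3 × E3 => k p.2 * f (p.1 - p.2))
  fun_prop

lemma measurable_lconv_time {T : Type*} [MeasurableSpace T] {k}
    {F : T → E3 → ℝ≥0∞} (hk : Measurable k) (hF : Measurable (uncurry F)) :
    Measurable (uncurry fun τ => lconv k (F τ)) := by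
  unfold lconv
  apply Measurable.lintegral_prod_right'
    (f := fun p : (T × E3) × E3 => k p.2 * F p.1.1 (p.1.2 - p.2))
  have : Measurable fun p : (T × E3) × E3 => uncurry F (p.1.1, p.1.2 - p.2) := hF.comp (by fun_prop)
  exact (hk.comp measurable_snd).mul this

lemma lconv_sq_le {k f} (hk : Measurable k) (hf : Measurable f) (x : E3) :
    lconv k f x ^ 2 ≤ (∫⁻ z, k z) * lconv k (fun y => f y ^ 2) x :=
  sq_lintegral_weight_le volume hk.aemeasurable (f := fun z => f (x - z)) (by fun_prop)

/-- The convolution with the kernel on the other side. -/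
lemma lconv_eq_swap (k f : E3 → ℝ≥0∞) (x : E3) : lconv k f x = ∫⁻ y, k (x - y) * f y := by
  unfold lconv; rw [← lintegral_sub_left_eq_self _ x]; simp

lemma lintegral_lconv {k f} (hk : Measurable k) (hf : Measurable f) :
    ∫⁻ x, lconv k f x = (∫⁻ z, k z) * ∫⁻ x, f x := by
  unfold lconv
  rw [lintegral_lintegral_swap (by unfold uncurry; fun_prop), ← lintegral_mul_const _ hk]
  refine lintegral_congr fun z => ?_
  rw [lintegral_const_mul _ (by fun_prop), lintegral_sub_right_eq_self f z]

/-- Young's inequality `‖k * f‖_2 ≤ ‖k‖_1 ‖f‖_2`, squared. -/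
lemma lintegral_lconv_sq_le {k f} (hk : Measurable k) (hf : Measurable f) :
    ∫⁻ x, lconv k f x ^ 2 ≤ (∫⁻ z, k z) ^ 2 * ∫⁻ x, f x ^ 2 := by
  calc ∫⁻ x, lconv k f x ^ 2 ≤ ∫⁻ x, (∫⁻ z, k z) * lconv k (fun y => f y ^ 2) x :=
    lintegral_mono fun x => lconv_sq_le hk hf x
    _ = _ := by
      rw [lintegral_const_mul _ (measurable_lconv hk (by fun_prop)),
        lintegral_lconv hk (by fun_prop), sq, mul_assoc]

/-- The uniformly local space-time integral `sup_x ∫ ∫_{B_r(x)} F dy dμ(τ)`; the supremum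
is outside the time integral. -/
def ulocSup {T : Type*} [MeasurableSpace T] (μ : Measure T) (r : ℝ) (F : T → E3 → ℝ≥0∞) : ℝ≥0∞ :=
  ⨆ x : E3, ∫⁻ τ, (∫⁻ y in ball x r, F τ y) ∂μ

lemma le_ulocSup {T : Type*} [MeasurableSpace T] (μ : Measure T) (r : ℝ) (F : T → E3 → ℝ≥0∞)
    (x : E3) : ∫⁻ τ, (∫⁻ y in ball x r, F τ y) ∂μ ≤ ulocSup μ r F :=
  le_iSup (fun x : E3 => ∫⁻ τ, (∫⁻ y in ball x r, F τ y) ∂μ) x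

lemma ulocSup_mono_radius {T : Type*} [MeasurableSpace T] (μ : Measure T) {r r'}
    (h : r ≤ r') (F : T → E3 → ℝ≥0∞) : ulocSup μ r F ≤ ulocSup μ r' F :=
  iSup_mono fun _ => lintegral_mono fun _ => lintegral_mono_set (ball_subset_ball h)

lemma setLIntegral_ball_sub (F : E3 → ℝ≥0∞) (o z : E3) (r : ℝ) :
    ∫⁻ x in ball o r, F (x - z) = ∫⁻ y in ball (o - z) r, F y := by
  rw [← lintegral_indicator measurableSet_ball, ← lintegral_indicator measurableSet_ball,
    ← lintegral_sub_right_eq_self ((ball (o - z) r).indicator F) z]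
  refine lintegral_congr fun x => ?_
  simp only [indicator, mem_ball, dist_sub_right]

/-- Convolution with an integrable kernel is bounded on uniformly local spaces, because the
translates of a ball are balls of the same radius. -/
lemma lintegral_ball_lconv_le {T : Type*} [MeasurableSpace T] (μ : Measure T) [SFinite μ]
    {k} {F} (hk : Measurable k)
    (hF : Measurable (uncurry F)) (o : E3) (r : ℝ) :
    ∫⁻ τ, (∫⁻ x in ball o r, lconv k (F τ) x) ∂μ ≤ (∫⁻ z, k z) * ulocSup μ r F := by
  have hF' : ∀ τ, Measurable (F τ) := fun τ => hF.of_uncurry_left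
  have e1 : ∀ τ, ∫⁻ x in ball o r, lconv k (F τ) x
      = ∫⁻ z, k z * ∫⁻ y in ball (o - z) r, F τ y := fun τ => by
    unfold lconv; have := hF' τ
    rw [lintegral_lintegral_swap (by unfold uncurry; fun_prop)]; refine lintegral_congr fun z => ?_
    rw [lintegral_const_mul _ (by fun_prop), setLIntegral_ball_sub]
  have hm : Measurable fun p : T × E3 => ∫⁻ y in ball (o - p.2) r, F p.1 y := by
    simp_rw [← setLIntegral_ball_sub]
    apply Measurable.lintegral_prod_right' (ν := volume.restrict (ball o r))
      (f := fun q : (T × E3) × E3 => F q.1.1 (q.2 - q.1.2))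
    exact hF.comp (f := fun q : (T × E3) × E3 => (q.1.1, q.2 - q.1.2)) (by fun_prop)
  have hm' : Measurable fun p : T × E3 =>
    k p.2 * ∫⁻ y in ball (o - p.2) r, F p.1 y := (hk.comp measurable_snd).mul hm
  simp_rw [e1]; rw [lintegral_lintegral_swap hm'.aemeasurable, ← lintegral_mul_const _ hk]
  refine lintegral_mono fun z => ?_
  have hmz : Measurable fun τ => ∫⁻ y in ball (o - z) r, F τ y :=
    hF.lintegral_prod_right' (ν := volume.restrict (ball (o - z) r))
  rw [lintegral_const_mul _ hmz]; gcongr; exact le_ulocSup μ r F (o - z)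

/-- Finitely many balls of radius `r`, in a number depending only on `a`, cover a ball of
radius `a r`. -/
lemma exists_ulocSup_mul_le (a : ℝ) : ∃ N : ℕ, 1 ≤ N ∧
    ∀ {T : Type} [MeasurableSpace T] (μ : Measure T) (r : ℝ), 0 < r → ∀ F,
      Measurable (uncurry F) → ulocSup μ (a * r) F ≤ N * ulocSup μ r F := by
  obtain ⟨t, ht, hcov⟩ := (isCompact_closedBall (0 : E3) a).elim_nhds_subcover
    (fun p => ball p 1) (fun p _ => ball_mem_nhds p one_pos)
  refine ⟨t.card + 1, by omega, fun μ r hr F hF => iSup_le fun x => ?_⟩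
  have hsub : ball x (a * r) ⊆ ⋃ p ∈ t, ball (x + r • p) r := by
    intro y hy
    have h1 : r⁻¹ • (y - x) ∈ closedBall (0 : E3) a := by
      rw [mem_closedBall_zero_iff, norm_smul, norm_inv, norm_of_nonneg hr.le, ← dist_eq_norm,
        inv_mul_le_iff₀ hr, mul_comm]
      exact (mem_ball.1 hy).le
    obtain ⟨p, hp, hyp⟩ := mem_iUnion₂.1 (hcov h1)
    refine mem_iUnion₂.2 ⟨p, hp, ?_⟩
    rw [mem_ball, dist_eq_norm] at hyp ⊢
    have : y - (x + r • p) = r • (r⁻¹ • (y - x) - p) := by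
      rw [smul_sub, smul_smul, mul_inv_cancel₀ hr.ne', one_smul]; abel
    rw [this, norm_smul, norm_of_nonneg hr.le]; nlinarith
  have h2 : ∀ τ, ∫⁻ y in ball x (a * r), F τ y
      ≤ ∑ p ∈ t, ∫⁻ y in ball (x + r • p) r, F τ y := fun τ => by
    have hle : (volume.restrict (⋃ p ∈ t, ball (x + r • p) r) : Measure E3)
        ≤ ∑ p ∈ t, volume.restrict (ball (x + r • p) r) := by
      have := Measure.restrict_biUnion_le (μ := (volume : Measure E3))
        (s := fun p : E3 => ball (x + r • p) r) (T := (t : Set E3)) t.countable_toSet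
      rw [Measure.sum_fintype] at this
      exact this.trans_eq (Finset.sum_coe_sort t
        fun p => (volume : Measure E3).restrict (ball (x + r • p) r))
    calc _ ≤ _ := lintegral_mono_set hsub
      _ ≤ _ := lintegral_mono' hle le_rfl
      _ = _ := by rw [lintegral_finsetSum_measure]
  have hmeas : ∀ p, Measurable fun τ => ∫⁻ y in ball p r, F τ y := fun p => hF.lintegral_prod_right
  calc ∫⁻ τ, (∫⁻ y in ball x (a * r), F τ y) ∂μ
      ≤ ∫⁻ τ, (∑ p ∈ t, ∫⁻ y in ball (x + r • p) r, F τ y) ∂μ := lintegral_mono h2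
    _ = ∑ p ∈ t, ∫⁻ τ, (∫⁻ y in ball (x + r • p) r, F τ y) ∂μ :=
      lintegral_finsetSum _ fun p _ => hmeas _
    _ ≤ ∑ p ∈ t, ulocSup μ r F := sum_le_sum fun p _ => le_ulocSup μ r F _
    _ ≤ _ := by rw [Finset.sum_const, nsmul_eq_mul]; gcongr; simp

/-- Tonelli for averages over balls: the point `x` is counted with the volume of the centers `m` whose
ball contains it. -/
lemma lintegral_ball_average_eq {F} (hF : Measurable F) (A : Set E3) (a : ℝ) :
    ∫⁻ m in A, ∫⁻ x in ball m a, F x = ∫⁻ x, F x * volume (ball x a ∩ A) := by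
  have hS : MeasurableSet {p : E3 × E3 | dist p.2 p.1 < a} :=
    measurableSet_lt (by fun_prop) measurable_const
  calc _ = ∫⁻ m in A, ∫⁻ x, {p : E3 × E3 | dist p.2 p.1 < a}.indicator (fun p => F p.2) (m, x) :=
    lintegral_congr fun m => (lintegral_indicator measurableSet_ball _).symm
    _ = ∫⁻ x, ∫⁻ m in A, {p : E3 × E3 | dist p.2 p.1 < a}.indicator (fun p => F p.2) (m, x) :=
      lintegral_lintegral_swap ((hF.comp measurable_snd).indicator hS).aemeasurable
    _ = _ := lintegral_congr fun x => by
      rw [← Measure.restrict_apply measurableSet_ball, ← lintegral_indicator_const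
        measurableSet_ball]
      refine lintegral_congr fun m => ?_
      simp only [indicator, mem_ofPred_eq, mem_ball, dist_comm]

/-- Averages over unit balls recover the integral over a large ball. -/
lemma setLIntegral_ball_le_average {F} (hF : Measurable F) (o : E3) (r : ℝ) :
    ∫⁻ x in ball o r, F x ≤ (volume (ball (0 : E3) 1))⁻¹ *
      ∫⁻ m in ball o (r + 1), ∫⁻ x in ball m 1, F x := by
  rw [← ENNReal.mul_le_iff_le_inv (measure_ball_pos _ _ one_pos).ne' measure_ball_lt_top.ne,
    lintegral_ball_average_eq hF, ← lintegral_const_mul _ hF]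
  refine (setLIntegral_mono' measurableSet_ball fun x hx => ?_).trans
    (setLIntegral_le_lintegral (ball o r) _)
  rw [inter_eq_left.2 (Metric.ball_subset_ball' (by linarith [mem_ball.1 hx])),
    Measure.addHaar_ball_center volume x, mul_comm]

lemma lintegral_ball_average_le {F} (hF : Measurable F) (o : E3) (r a : ℝ) :
    ∫⁻ m in ball o r, ∫⁻ x in ball m a, F x ≤ volume (ball (0 : E3) a) *
      ∫⁻ x in ball o (r + a), F x := by
  rw [lintegral_ball_average_eq hF, ← lintegral_const_mul _ hF,
    ← lintegral_indicator measurableSet_ball]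
  refine lintegral_mono fun x => ?_
  by_cases hx : x ∈ ball o (r + a)
  · rw [indicator_of_mem hx, mul_comm, ← Measure.addHaar_ball_center volume x a]
    exact mul_le_mul_left (measure_mono inter_subset_left) _
  · have h : ball x a ∩ ball o r = ∅ := (Metric.ball_disjoint_ball (by
      rw [mem_ball] at hx; linarith)).inter_eq
    simp [h]

/-! ### Power kernels -/

/-- The radial kernel that is `|z|^{-a}` inside the unit ball and `|z|^{-b}` outside. -/
def pker (a b : ℝ) (z : E3) : ℝ := if ‖z‖ < 1 then ‖z‖ ^ (-a) else ‖z‖ ^ (-b)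

lemma pker_nonneg (a b : ℝ) (z : E3) : 0 ≤ pker a b z := by unfold pker; split_ifs <;> positivity

@[fun_prop]
lemma measurable_pker (a b : ℝ) : Measurable (pker a b) :=
  Measurable.ite (measurableSet_lt measurable_norm measurable_const)
    (measurable_norm.pow_const _) (measurable_norm.pow_const _)

lemma pker_neg (a b : ℝ) (z : E3) : pker a b (-z) = pker a b z := by simp [pker]

lemma integrable_pker {a b} (ha : a < 3) (hb : 3 < b) : Integrable (pker a b) := by
  have h := (integrable_fun_norm_addHaar (volume : Measure E3)
    (f := fun r : ℝ => if r < 1 then r ^ (-a) else r ^ (-b))).2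
  refine h ?_
  have hd : Module.finrank ℝ E3 - 1 = 2 := by simp
  rw [hd, ← Ioo_union_Ici_eq_Ioi (zero_lt_one : (0 : ℝ) < 1), integrableOn_union]; constructor
  · have h1 : IntegrableOn (fun r : ℝ => r ^ (2 - a)) (Ioo 0 1) :=
      (intervalIntegral.integrableOn_Ioo_rpow_iff zero_lt_one).2 (by linarith)
    refine h1.congr_fun (fun r hr => ?_) measurableSet_Ioo
    simp only [hr.2, if_true, smul_eq_mul]; rw [← rpow_natCast, ← rpow_add hr.1]; congr 1
  · rw [integrableOn_Ici_iff_integrableOn_Ioi]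
    have h1 : IntegrableOn (fun r : ℝ => r ^ (2 - b)) (Ioi 1) :=
      integrableOn_Ioi_rpow_of_lt (by linarith) zero_lt_one
    refine h1.congr_fun (fun r hr => ?_) measurableSet_Ioi
    have hr' : (1 : ℝ) < r := hr
    simp only [not_lt.2 hr'.le, if_false, smul_eq_mul]
    rw [← rpow_natCast, ← rpow_add (by linarith)]; congr 1

/-- A bound `C |z|^{-a}` near the origin together with a bound `C |z|^{-b}` far away. -/
lemma le_mul_pker {a b C} {z} {x} (h1 : ‖z‖ < 1 → x ≤ C * ‖z‖ ^ (-a))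
    (h2 : 1 ≤ ‖z‖ → x ≤ C * ‖z‖ ^ (-b)) : x ≤ C * pker a b z := by
  unfold pker; split_ifs with h
  · exact h1 h
  · exact h2 (not_lt.1 h)

/-! ### The symbol of the fractional Laplacian as a singular integral -/

lemma two_sub_two_cos_nonneg (u : ℝ) : 0 ≤ 2 - 2 * cos u := by linarith [Real.cos_le_one u]

lemma two_sub_two_cos_le_four (u : ℝ) : 2 - 2 * cos u ≤ 4 := by linarith [Real.neg_one_le_cos u]

lemma two_sub_two_cos_le_sq (u : ℝ) : 2 - 2 * cos u ≤ u ^ 2 := by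
  linarith [Real.one_sub_sq_div_two_le_cos (x := u)]

lemma integrable_symbol {σ : ℝ} (h0 : 0 < σ) (h2 : σ < 2) (ξ : E3) :
    Integrable fun z : E3 => (2 - 2 * cos (2 * π * ⟪ξ, z⟫)) * ‖z‖ ^ (-3 - σ) := by
  refine ((integrable_pker (a := 1 + σ) (b := 3 + σ) (by linarith) (by linarith)).const_mul
    ((2 * π * ‖ξ‖) ^ 2 + 4)).mono' ?_ (.of_forall fun z => ?_)
  · have : Measurable fun z : E3 => ‖z‖ ^ (-3 - σ) := measurable_norm.pow_const _
    exact (Continuous.aestronglyMeasurable (by fun_prop)).mul this.aestronglyMeasurable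
  rw [norm_of_nonneg (mul_nonneg (two_sub_two_cos_nonneg _) (by positivity))]
  refine le_mul_pker (fun hz => ?_) (fun hz => ?_)
  · rcases eq_or_ne z 0 with rfl | hz0
    · simp; positivity
    have hz' : 0 < ‖z‖ := norm_pos_iff.2 hz0
    have h3 : ‖z‖ ^ (-(1 + σ)) = ‖z‖ ^ 2 * ‖z‖ ^ (-3 - σ) := by
      rw [← rpow_natCast, ← rpow_add hz']; congr 1; push_cast; ring
    have h4 : (2 * π * ⟪ξ, z⟫) ^ 2 ≤ (2 * π * ‖ξ‖) ^ 2 * ‖z‖ ^ 2 := by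
      have := abs_real_inner_le_norm ξ z
      rw [← sq_abs, abs_mul, abs_of_pos (by positivity : 0 < 2 * π), ← mul_pow, mul_assoc _ ‖ξ‖]
      gcongr
    rw [h3, ← mul_assoc]; gcongr; nlinarith [two_sub_two_cos_le_sq (2 * π * ⟪ξ, z⟫), sq_nonneg ‖z‖]
  · have h3 : -3 - σ = -(3 + σ) := by ring
    rw [h3]; gcongr; nlinarith [two_sub_two_cos_le_four (2 * π * ⟪ξ, z⟫), sq_nonneg (2 * π * ‖ξ‖)]

/-- `∫ (2 - 2 cos(2π⟨ξ, z⟩)) |z|^{-3-σ} dz = c |ξ|^σ`, by rotation invariance and scaling. -/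
lemma exists_integral_symbol {σ : ℝ} (h0 : 0 < σ) (h2 : σ < 2) : ∃ c, 0 < c ∧ ∀ ξ,
    ∫ z : E3, (2 - 2 * cos (2 * π * ⟪ξ, z⟫)) * ‖z‖ ^ (-3 - σ) = c * ‖ξ‖ ^ σ := by
  set I : E3 → ℝ := fun ξ => ∫ z : E3, (2 - 2 * cos (2 * π * ⟪ξ, z⟫)) * ‖z‖ ^ (-3 - σ) with hI
  set e : E3 := EuclideanSpace.single 0 1 with he
  have hen : ‖e‖ = 1 := by simp [he]
  have hrot : ∀ v w, ‖v‖ = ‖w‖ → I v = I w := by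
    intro v w hvw; set A : E3 ≃ₗᵢ[ℝ] E3 := (Submodule.span ℝ {v - w})ᗮ.reflection
    have hA : A v = w := Submodule.reflection_sub hvw
    rw [hI]; simp only
    rw [← hA, ← (A.measurePreserving.integral_comp A.toHomeomorph.measurableEmbedding
      (fun z => (2 - 2 * cos (2 * π * ⟪A v, z⟫)) * ‖z‖ ^ (-3 - σ)))]
    refine integral_congr' fun z => ?_
    simp only [A.inner_map_map, A.norm_map]
  have hpos : 0 < I e := by
    rw [hI]; simp only
    rw [integral_pos_iff_support_of_nonneg
      (fun z => mul_nonneg (two_sub_two_cos_nonneg _) (by positivity)) (integrable_symbol h0 h2 e)]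
    have hO : IsOpen {z : E3 | 0 < z 0 ∧ z 0 < 1} :=
      (isOpen_lt continuous_const (by fun_prop)).and (isOpen_lt (by fun_prop) continuous_const)
    refine lt_of_lt_of_le (hO.measure_pos volume ⟨EuclideanSpace.single 0 (1 / 2), ?_⟩)
      (measure_mono fun z hz => ?_)
    · simp; norm_num
    · obtain ⟨hz1, hz2⟩ := hz
      have hie : ⟪e, z⟫ = z 0 := by simp [he, EuclideanSpace.inner_single_left]
      rw [Function.mem_support, hie]; have hz0 : z ≠ 0 := by rintro rfl; simp at hz1
      have : 0 < ‖z‖ := norm_pos_iff.2 hz0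
      refine mul_ne_zero ?_ (by positivity)
      have hc := (Real.cos_eq_one_iff_of_lt_of_lt (x := 2 * π * z 0) (by nlinarith [Real.pi_pos])
        (by nlinarith [Real.pi_pos])).not.2 (by positivity)
      exact fun h => hc (by linarith)
  refine ⟨I e, hpos, fun ξ => ?_⟩
  change I ξ = I e * ‖ξ‖ ^ σ
  rcases eq_or_ne ξ 0 with rfl | hξ
  · simp [hI, Real.zero_rpow h0.ne']
  have hr : 0 < ‖ξ‖ := norm_pos_iff.2 hξ
  rw [hrot ξ (‖ξ‖ • e) (by rw [norm_smul, hen]; simp)]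
  have hs := Measure.integral_comp_smul (volume : Measure E3)
    (fun z => (2 - 2 * cos (2 * π * ⟪e, z⟫)) * ‖z‖ ^ (-3 - σ)) ‖ξ‖
  have hs2 : ∀ z, (2 - 2 * cos (2 * π * ⟪e, ‖ξ‖ • z⟫)) * ‖‖ξ‖ • z‖ ^ (-3 - σ)
      = ‖ξ‖ ^ (-3 - σ) * ((2 - 2 * cos (2 * π * ⟪‖ξ‖ • e, z⟫)) * ‖z‖ ^ (-3 - σ)) := by
    intro z
    rw [norm_smul, norm_norm, mul_rpow hr.le (norm_nonneg z), real_inner_smul_left,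
      real_inner_smul_right]
    ring
  simp_rw [hs2] at hs; rw [integral_const_mul] at hs; have hfr : Module.finrank ℝ E3 = 3 := by simp
  rw [hfr, abs_of_pos (by positivity), smul_eq_mul] at hs
  have h5 : ‖ξ‖ ^ (-3 - σ) * I (‖ξ‖ • e) = (‖ξ‖ ^ 3)⁻¹ * I e := hs
  have h6 : (‖ξ‖ ^ 3)⁻¹ = ‖ξ‖ ^ (-3 - σ) * ‖ξ‖ ^ σ := by
    rw [← rpow_add hr, ← rpow_natCast, ← rpow_neg hr.le]; congr 1; push_cast; ring
  rw [h6, mul_assoc] at h5; have := mul_left_cancel₀ (by positivity) h5; rw [this, mul_comm]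

/-! ### Fourier transforms of test functions -/

lemma IsTest.ofReal {θ} (hθ : IsTest θ) :
    HasCompactSupport (fun y => (θ y : ℂ)) ∧ ContDiff ℝ (⊤ : ℕ∞) (fun y => (θ y : ℂ)) :=
  ⟨hθ.2.comp_left (g := ((↑) : ℝ → ℂ)) (by simp), Complex.ofRealCLM.contDiff.comp hθ.1⟩

/-- A test function as a Schwartz function. -/
def IsTest.toS {θ} (hθ : IsTest θ) : SchwartzMap E3 ℂ := hθ.ofReal.1.toSchwartzMap hθ.ofReal.2

/-- The Fourier transform of a real function. -/
def hat (θ : E3 → ℝ) : E3 → ℂ := 𝓕 (fun y : E3 => (θ y : ℂ))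

lemma IsTest.continuous {θ} (hθ : IsTest θ) : Continuous θ := hθ.1.continuous

lemma IsTest.integrable {θ} (hθ : IsTest θ) : Integrable θ :=
  hθ.continuous.integrable_of_hasCompactSupport hθ.2

lemma IsTest.continuous_hat {θ} (hθ : IsTest θ) : Continuous (hat θ) :=
  (𝓕 hθ.toS : SchwartzMap E3 ℂ).continuous

lemma IsTest.integrable_hat {θ} (hθ : IsTest θ) : Integrable (hat θ) :=
  (𝓕 hθ.toS : SchwartzMap E3 ℂ).integrable

lemma rpow_le_one_add_pow {r σ : ℝ} (hr : 0 ≤ r) (h0 : 0 ≤ σ) {n : ℕ} (hn : σ ≤ n) :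
    r ^ σ ≤ 1 + r ^ n := by
  rcases le_total r 1 with h | h
  · have := Real.rpow_le_one hr h h0
    have : 0 ≤ r ^ n := by positivity
    linarith
  · have := rpow_le_rpow_of_exponent_le h hn
    rw [rpow_natCast] at this; linarith

lemma IsTest.integrable_rpow_mul_hat {θ : E3 → ℝ} (hθ : IsTest θ) {σ : ℝ} (h0 : 0 ≤ σ) :
    Integrable fun ξ : E3 => ‖ξ‖ ^ σ * ‖hat θ ξ‖ := by
  obtain ⟨n, hn⟩ := exists_nat_ge σ
  have h1 : Integrable fun ξ : E3 => ‖ξ‖ ^ n * ‖hat θ ξ‖ :=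
    (𝓕 hθ.toS : SchwartzMap E3 ℂ).integrable_pow_mul volume n
  refine (hθ.integrable_hat.norm.add h1).mono' ?_ (.of_forall fun ξ => ?_)
  · have : Measurable fun z : E3 => ‖z‖ ^ σ := measurable_norm.pow_const _
    exact this.aestronglyMeasurable.mul hθ.continuous_hat.norm.aestronglyMeasurable
  · rw [norm_of_nonneg (by positivity)]; have := rpow_le_one_add_pow (norm_nonneg ξ) h0 hn
    simp only [Pi.add_apply]; nlinarith [norm_nonneg (hat θ ξ)]

lemma IsTest.fourierInv_hat {θ} (hθ : IsTest θ) (x : E3) :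
    ∫ ξ : E3, exp (↑(2 * π * ⟪ξ, x⟫) * I) • hat θ ξ = θ x := by
  rw [← fourierInv_eq']
  have := Continuous.fourierInv_fourier_eq (f := fun y : E3 => (θ y : ℂ))
    (Complex.continuous_ofReal.comp hθ.continuous) hθ.integrable.ofReal hθ.integrable_hat
  exact congrFun this x

lemma norm_cexp_mul_I (u : ℝ) : ‖exp ((u : ℂ) * I)‖ = 1 := Complex.norm_exp_ofReal_mul_I u

lemma IsTest.integrable_cexp_hat {θ} (hθ : IsTest θ) (x : E3) :
    Integrable fun ξ : E3 => exp (↑(2 * π * ⟪ξ, x⟫) * I) • hat θ ξ := by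
  refine hθ.integrable_hat.norm.mono' ?_ (.of_forall fun ξ => ?_)
  · exact Continuous.aestronglyMeasurable (by have := hθ.continuous_hat; fun_prop)
  · rw [norm_smul, norm_cexp_mul_I, one_mul]

/-- The fractional Laplacian of a test function as a symmetrized singular integral. -/
lemma exists_fracLap_eq {σ : ℝ} (h0 : 0 < σ) (h2 : σ < 2) : ∃ C, 0 < C ∧ ∀ θ, IsTest θ → ∀ x,
      Integrable (fun z : E3 => (2 * θ x - θ (x + z) - θ (x - z)) * ‖z‖ ^ (-3 - σ)) ∧
      fracLap σ θ x = C * ∫ z : E3, (2 * θ x - θ (x + z) - θ (x - z)) * ‖z‖ ^ (-3 - σ) := by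
  obtain ⟨c, hc, hcI⟩ := exists_integral_symbol h0 h2
  refine ⟨(2 * π) ^ σ / c, by positivity, fun θ hθ x => ?_⟩
  set E : E3 → E3 → ℂ := fun x ξ => exp (↑(2 * π * ⟪ξ, x⟫) * I) with hE
  set S : E3 → E3 → ℝ := fun ξ z => (2 - 2 * cos (2 * π * ⟪ξ, z⟫)) * ‖z‖ ^ (-3 - σ)
    with hS
  have hSn : ∀ ξ z, 0 ≤ S ξ z := fun ξ z => mul_nonneg (two_sub_two_cos_nonneg _) (by positivity)
  have hch := hθ.continuous_hat
  set J : E3 × E3 → ℂ := fun p => E x p.1 * hat θ p.1 * (S p.1 p.2 : ℂ) with hJ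
  have hEc : ∀ y, Continuous (E y) := fun y => by simp only [hE]; fun_prop
  have hJm : AEStronglyMeasurable J (volume.prod volume) := by
    have h1 : Measurable fun p : E3 × E3 => ‖p.2‖ ^ (-3 - σ) :=
      (measurable_norm.comp measurable_snd).pow_const _
    have h2 : Measurable fun p : E3 × E3 => (2 - 2 * cos (2 * π * ⟪p.1, p.2⟫)) :=
      Continuous.measurable (by fun_prop)
    have h3 : Continuous fun p : E3 × E3 => E x p.1 * hat θ p.1 :=
      ((hEc x).mul hch).comp continuous_fst
    exact (h3.measurable.mul (Complex.measurable_ofReal.comp (h2.mul h1))).aestronglyMeasurable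
  have hJn : ∀ p, ‖J p‖ = ‖hat θ p.1‖ * S p.1 p.2 := fun p => by
    simp only [hJ, norm_mul, hE, norm_cexp_mul_I, one_mul, norm_real, norm_of_nonneg (hSn _ _)]
  have hJi : Integrable J (volume.prod volume) := by
    rw [integrable_prod_iff hJm]; constructor
    · refine .of_forall fun ξ => ?_
      exact ((integrable_symbol h0 h2 ξ).ofReal (𝕜 := ℂ)).const_mul (E x ξ * hat θ ξ)
    · simp_rw [hJn, integral_const_mul]; simp_rw [hS, hcI]
      refine ((hθ.integrable_rpow_mul_hat h0.le).const_mul c).congr (.of_forall fun ξ => ?_)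
      change c * (‖ξ‖ ^ σ * ‖hat θ ξ‖) = ‖hat θ ξ‖ * (c * ‖ξ‖ ^ σ)
      ring
  have hin : ∀ z, ∫ ξ, J (ξ, z) = ((2 * θ x - θ (x + z) - θ (x - z)) * ‖z‖ ^ (-3 - σ) : ℝ) := by
    intro z
    have e1 : ∀ ξ, J (ξ, z) = (2 * (E x ξ • hat θ ξ) - E (x + z) ξ • hat θ ξ
        - E (x - z) ξ • hat θ ξ) * ((‖z‖ ^ (-3 - σ) : ℝ) : ℂ) := by
      intro ξ
      have hcos : ((2 * cos (2 * π * ⟪ξ, z⟫) : ℝ) : ℂ) = exp (↑(2 * π * ⟪ξ, z⟫) * I)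
            + exp (-(↑(2 * π * ⟪ξ, z⟫) * I)) := by
        push_cast; rw [Complex.two_cos]
        ring_nf
      simp only [hJ, hS, hE, smul_eq_mul]; rw [inner_add_right, inner_sub_right]
      push_cast at hcos ⊢
      have hp : ∀ A B, exp (2 * π * (A + B) * I) = exp (2 * π * A * I) * exp (2 * π * B * I) :=
        fun A B => by rw [← Complex.exp_add]; ring_nf
      have hm : ∀ A B, exp (2 * π * (A - B) * I) = exp (2 * π * A * I) * exp (-(2 * π * B * I)) :=
        fun A B => by rw [← Complex.exp_add]; ring_nf
      rw [hp, hm]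
      linear_combination (-exp (2 * π * ⟪ξ, x⟫ * I) * hat θ ξ * ((‖z‖ ^ (-3 - σ) : ℝ) : ℂ)) * hcos
    simp_rw [e1]; rw [integral_mul_const]
    have i1 : Integrable fun ξ => 2 * (E x ξ • hat θ ξ) := (hθ.integrable_cexp_hat x).const_mul 2
    have i2 : Integrable fun ξ => E (x + z) ξ • hat θ ξ := hθ.integrable_cexp_hat (x + z)
    have i3 : Integrable fun ξ => E (x - z) ξ • hat θ ξ := hθ.integrable_cexp_hat (x - z)
    have i12 : Integrable fun ξ => 2 * (E x ξ • hat θ ξ) - E (x + z) ξ • hat θ ξ := i1.sub i2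
    rw [integral_sub i12 i3, integral_sub i1 i2, integral_const_mul]; simp only [hE]
    rw [hθ.fourierInv_hat, hθ.fourierInv_hat, hθ.fourierInv_hat]; push_cast; ring
  have hre : Integrable (fun z : E3 => (2 * θ x - θ (x + z) - θ (x - z)) * ‖z‖ ^ (-3 - σ)) := by
    have := hJi.integral_prod_right
    simp_rw [hin] at this; simpa using! this.re
  refine ⟨hre, ?_⟩
  have hswap := integral_integral_swap (f := fun ξ z => J (ξ, z)) hJi
  simp_rw [hin] at hswap; rw [integral_complex_ofReal] at hswap
  have hout : ∀ ξ, ∫ z, J (ξ, z) = E x ξ * hat θ ξ * ((c * ‖ξ‖ ^ σ : ℝ) : ℂ) := fun ξ => by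
    simp only [hJ]; rw [integral_const_mul, integral_complex_ofReal]; simp only [hS, hcI]
  simp_rw [hout] at hswap; unfold fracLap fourierMult; rw [fourierInv_eq']
  have e2 : ∀ ξ, exp (↑(2 * π * ⟪ξ, x⟫) * I) •
      ((((2 * π * ‖ξ‖) ^ σ : ℝ) : ℂ) * 𝓕 (fun y : E3 => (θ y : ℂ)) ξ)
      = (((2 * π) ^ σ / c : ℝ) : ℂ) * (E x ξ * hat θ ξ * ((c * ‖ξ‖ ^ σ : ℝ) : ℂ)) := by
    intro ξ; rw [mul_rpow (by positivity) (norm_nonneg ξ)]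
    simp only [hE, smul_eq_mul, hat]; have : (c : ℂ) ≠ 0 := by exact_mod_cast hc.ne'
    push_cast; field_simp
  simp_rw [e2]; rw [integral_const_mul, hswap, ← Complex.ofReal_mul, Complex.ofReal_re]

section

/-! ### Commutators with the fractional Laplacian -/

lemma IsTest.mul {φ θ} (hφ : IsTest φ) (hθ : IsTest θ) : IsTest fun y => φ y * θ y :=
  ⟨hφ.1.mul hθ.1, hθ.2.mul_left⟩

lemma IsTest.exists_bound {θ} (hθ : IsTest θ) : ∃ B, 0 ≤ B ∧ ∀ x, |θ x| ≤ B := by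
  obtain ⟨C, hC⟩ := hθ.2.exists_bound_of_continuous hθ.continuous
  exact ⟨C, (norm_nonneg _).trans (hC 0), hC⟩

lemma IsTest.exists_lipschitz {θ} (hθ : IsTest θ) :
    ∃ L, 0 ≤ L ∧ ∀ x y, |θ x - θ y| ≤ L * ‖x - y‖ := by
  obtain ⟨C, hC⟩ := hθ.1.lipschitzWith_of_hasCompactSupport hθ.2 (by simp)
  exact ⟨C, C.2, fun x y => by simpa [Real.dist_eq, dist_eq_norm] using hC.dist_le_mul x y⟩

lemma IsTest.exists_radius {θ} (hθ : IsTest θ) : ∃ R, 1 ≤ R ∧ ∀ x, R ≤ ‖x‖ → θ x = 0 := by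
  obtain ⟨R, hR⟩ := hθ.2.isCompact.isBounded.subset_ball (0 : E3)
  refine ⟨max R 1, le_max_right _ _, fun x hx => ?_⟩
  by_contra h
  have := hR (subset_tsupport _ h)
  rw [mem_ball_zero_iff] at this; exact absurd (le_max_left R 1) (by linarith)

/-- A bounded Lipschitz increment against the kernel `|x - y|^{-3-σ}`. -/
lemma mul_rpow_le_pker {σ B L d} (hB : 0 ≤ B) (hL : 0 ≤ L) (z : E3) (hd1 : d ≤ B)
    (hd2 : d ≤ L * ‖z‖) :
    d * ‖z‖ ^ (-3 - σ) ≤ (B + L) * pker (2 + σ) (3 + σ) z := by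
  have h3 : -3 - σ = -(3 + σ) := by ring
  refine le_mul_pker (fun hz => ?_) (fun hz => ?_)
  · rcases eq_or_ne z 0 with rfl | hz0
    · have : d ≤ 0 := by simpa using hd2
      exact (mul_nonpos_of_nonpos_of_nonneg this (by positivity)).trans (by positivity)
    have hz' : 0 < ‖z‖ := norm_pos_iff.2 hz0
    have h4 : ‖z‖ ^ (-(2 + σ)) = ‖z‖ * ‖z‖ ^ (-3 - σ) := by
      nth_rw 2 [← Real.rpow_one ‖z‖]
      rw [← rpow_add hz']; congr 1; ring
    rw [h4, ← mul_assoc]; gcongr; nlinarith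
  · rw [h3]; gcongr; linarith

lemma IsTest.exists_increment_bound {φ} (hφ : IsTest φ) (σ : ℝ) :
    ∃ L, 0 ≤ L ∧ ∀ x y, |φ x - φ y| * ‖x - y‖ ^ (-3 - σ) ≤ L * pker (2 + σ) (3 + σ) (x - y) := by
  obtain ⟨B, hB, hB'⟩ := hφ.exists_bound
  obtain ⟨L, hL, hL'⟩ := hφ.exists_lipschitz
  refine ⟨2 * B + L, by positivity, fun x y => mul_rpow_le_pker (by positivity) hL _ ?_ (hL' x y)⟩
  have := abs_sub (φ x) (φ y)
  linarith [hB' x, hB' y]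

/-- For `σ < 1` the singular integral converges absolutely without symmetrization. -/
lemma exists_fracLap_eq_of_lt_one {σ} (h0 : 0 < σ) (h1 : σ < 1) : ∃ C, 0 < C ∧
    ∀ θ, IsTest θ → ∀ x, Integrable (fun y : E3 => (θ x - θ y) * ‖x - y‖ ^ (-3 - σ)) ∧
      fracLap σ θ x = C * ∫ y : E3, (θ x - θ y) * ‖x - y‖ ^ (-3 - σ) := by
  obtain ⟨C, hC, hC'⟩ := exists_fracLap_eq h0 (by linarith : σ < 2)
  refine ⟨2 * C, by positivity, fun θ hθ x => ?_⟩
  obtain ⟨L, hL, hL'⟩ := hθ.exists_increment_bound σ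
  have hi : Integrable (fun y : E3 => (θ x - θ y) * ‖x - y‖ ^ (-3 - σ)) := by
    have hk := (integrable_pker (a := 2 + σ) (b := 3 + σ) (by linarith) (by linarith)).comp_sub_left x
    refine (hk.const_mul L).mono' ?_ (.of_forall fun y => ?_)
    · have h1 : Measurable fun y : E3 => ‖x - y‖ ^ (-3 - σ) :=
        (measurable_norm.comp (measurable_const.sub measurable_id)).pow_const _
      have := hθ.continuous
      exact ((continuous_const.sub this).measurable.mul h1).aestronglyMeasurable
    · rw [norm_mul, norm_of_nonneg (by positivity : 0 ≤ ‖x - y‖ ^ (-3 - σ))]; exact hL' x y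
  refine ⟨hi, ?_⟩
  have i1 : Integrable fun z : E3 => (θ x - θ (x - z)) * ‖z‖ ^ (-3 - σ) := by
    have := hi.comp_sub_left x
    simpa using! this
  have i2 : Integrable fun z : E3 => (θ x - θ (x + z)) * ‖z‖ ^ (-3 - σ) := by
    have := i1.comp_neg
    simpa using! this
  have e1 : ∫ z : E3, (θ x - θ (x - z)) * ‖z‖ ^ (-3 - σ)
      = ∫ y : E3, (θ x - θ y) * ‖x - y‖ ^ (-3 - σ) := by
    rw [← integral_sub_left_eq_self (fun y : E3 => (θ x - θ y) * ‖x - y‖ ^ (-3 - σ)) volume x]; simp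
  have e2 : ∫ z : E3, (θ x - θ (x + z)) * ‖z‖ ^ (-3 - σ)
      = ∫ z : E3, (θ x - θ (x - z)) * ‖z‖ ^ (-3 - σ) := by
    rw [← integral_neg_eq_self (fun z : E3 => (θ x - θ (x - z)) * ‖z‖ ^ (-3 - σ))]; simp
  rw [(hC' θ hθ x).2]
  have e3 : ∀ z, (2 * θ x - θ (x + z) - θ (x - z)) * ‖z‖ ^ (-3 - σ)
      = (θ x - θ (x + z)) * ‖z‖ ^ (-3 - σ) + (θ x - θ (x - z)) * ‖z‖ ^ (-3 - σ) := fun z => by ring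
  simp_rw [e3]; rw [integral_add i2 i1, e2, e1]; ring

/-- The weight `min(1, |x|^{-7/2})`. -/
def wgt (x : E3) : ℝ≥0∞ := ofReal (pker 0 (7 / 2) x)

@[fun_prop]
lemma measurable_wgt : Measurable wgt := (measurable_pker _ _).ennreal_ofReal

lemma lintegral_wgt_lt_top : ∫⁻ x, wgt x < ⊤ :=
  (integrable_pker (a := 0) (b := 7 / 2) (by norm_num) (by norm_num)).lintegral_lt_top

lemma pker_zero_pos (b : ℝ) (x : E3) : 0 < pker 0 b x := by
  unfold pker; split_ifs with h
  · simp
  · have : 0 < ‖x‖ := by linarith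
    positivity

lemma le_pker_zero {b R} (hb : 0 ≤ b) (hR : 1 ≤ R) {x} (hx : ‖x‖ ≤ R) : R ^ (-b) ≤ pker 0 b x := by
  unfold pker; split_ifs with h
  · simp only [neg_zero, Real.rpow_zero]
    exact Real.rpow_le_one_of_one_le_of_nonpos hR (by linarith)
  · exact Real.rpow_le_rpow_of_nonpos (by linarith) hx (by linarith)

lemma one_le_mul_pker_zero {R : ℝ} (hR : 1 ≤ R) {x} (hx : ‖x‖ ≤ R) :
    1 ≤ R ^ (7 / 2 : ℝ) * pker 0 (7 / 2) x := by
  have h0 : 0 < R := by linarith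
  have h := le_pker_zero (b := 7 / 2) (by norm_num) hR hx
  rwa [rpow_neg h0.le, inv_le_iff_one_le_mul₀' (by positivity)] at h

lemma rpow_le_mul_pker_zero {b : ℝ} (hb : 7 / 2 ≤ b) {x z : E3} (hx : 1 ≤ ‖x‖)
    (hz : 1 ≤ ‖z‖) (hxz : ‖x‖ / 2 ≤ ‖z‖) : ‖z‖ ^ (-b) ≤ 2 ^ (7 / 2 : ℝ) * pker 0 (7 / 2) x := by
  rw [pker, if_neg (not_lt.2 hx)]
  calc ‖z‖ ^ (-b) ≤ ‖z‖ ^ (-(7 / 2) : ℝ) := rpow_le_rpow_of_exponent_le hz (by linarith)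
    _ ≤ (‖x‖ / 2) ^ (-(7 / 2) : ℝ) := Real.rpow_le_rpow_of_nonpos (by linarith) hxz (by norm_num)
    _ = _ := by
      rw [Real.div_rpow (norm_nonneg _) zero_le_two, rpow_neg zero_le_two, div_inv_eq_mul, mul_comm]

/-- The convolution of an integrable power kernel with a bounded compactly supported function
decays like the kernel. -/
lemma exists_lconv_pker_le {a b} (ha : a < 3) (hb : 7 / 2 ≤ b) {θ}
    {B} (hB : B ≠ ⊤) (hθB : ∀ x, θ x ≤ B) {R} (hR : 1 ≤ R)
    (hθR : ∀ x, R ≤ ‖x‖ → θ x = 0) :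
    ∃ C, C ≠ ⊤ ∧ ∀ x, lconv (fun z => ofReal (pker a b z)) θ x ≤ C * wgt x := by
  have hk : ∫⁻ z : E3, ofReal (pker a b z) < ⊤ :=
    (integrable_pker ha (by linarith)).lintegral_lt_top
  set C1 : ℝ≥0∞ := (∫⁻ z : E3, ofReal (pker a b z)) * B * ofReal ((2 * R) ^ (7 / 2 : ℝ)) with hC1
  set C2 : ℝ≥0∞ := B * volume (ball (0 : E3) R) * ofReal ((2 : ℝ) ^ (7 / 2 : ℝ))
    with hC2
  refine ⟨C1 + C2, ?_, fun x => ?_⟩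
  · refine ENNReal.add_ne_top.2 ⟨?_, ?_⟩
    · exact ENNReal.mul_ne_top (ENNReal.mul_ne_top hk.ne hB) ofReal_ne_top
    · exact ENNReal.mul_ne_top (ENNReal.mul_ne_top hB measure_ball_lt_top.ne) ofReal_ne_top
  rcases lt_or_ge ‖x‖ (2 * R) with hx | hx
  · have h1 : lconv (fun z => ofReal (pker a b z)) θ x ≤ (∫⁻ z : E3, ofReal (pker a b z)) * B := by
      unfold lconv; rw [← lintegral_mul_const _ (measurable_pker a b).ennreal_ofReal]
      exact lintegral_mono fun z => by gcongr; exact hθB _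
    have h2 : (1 : ℝ≥0∞) ≤ ofReal ((2 * R) ^ (7 / 2 : ℝ)) * wgt x := by
      unfold wgt; rw [← ofReal_mul (by positivity), one_le_ofReal]
      exact one_le_mul_pker_zero (by linarith) hx.le
    calc _ ≤ (∫⁻ z : E3, ofReal (pker a b z)) * B * 1 := by rw [mul_one]; exact h1
      _ ≤ (∫⁻ z : E3, ofReal (pker a b z)) * B *
          (ofReal ((2 * R) ^ (7 / 2 : ℝ)) * wgt x) := by gcongr
      _ = C1 * wgt x := by rw [hC1]; ring
      _ ≤ _ := by gcongr; exact le_self_add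
  · rw [lconv_eq_swap]
    have h1 : ∀ y, ofReal (pker a b (x - y)) * θ y ≤ (ball (0 : E3) R).indicator
        (fun _ => ofReal ((2 : ℝ) ^ (7 / 2 : ℝ)) * wgt x * B) y := by
      intro y; rcases le_or_gt R ‖y‖ with hy | hy
      · rw [hθR y hy]; simp
      · rw [indicator_of_mem (by simpa using hy)]
        have h2 : ‖x‖ / 2 ≤ ‖x - y‖ := by
          have := norm_sub_norm_le x y
          linarith
        have h3 : (1 : ℝ) ≤ ‖x - y‖ := by linarith
        gcongr
        · unfold wgt; rw [← ofReal_mul (by positivity)]; rw [pker, if_neg (not_lt.2 h3)]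
          exact ofReal_le_ofReal (rpow_le_mul_pker_zero hb (by linarith) h3 h2)
        · exact hθB y
    calc _ ≤ _ := lintegral_mono h1
      _ = ofReal ((2 : ℝ) ^ (7 / 2 : ℝ)) * wgt x * B * volume (ball (0 : E3) R) := by
        rw [lintegral_indicator measurableSet_ball, lintegral_const, Measure.restrict_apply_univ]
      _ = C2 * wgt x := by rw [hC2]; ring
      _ ≤ _ := by gcongr; exact le_add_self

variable {F : Type*} [NormedAddCommGroup F] [NormedSpace ℝ F]

/-- The weighted integrability under which singular integrals of `f` converge absolutely. -/
def WInt (f : E3 → F) : Prop := AEStronglyMeasurable f volume ∧ ∫⁻ x, ‖f x‖ₑ * wgt x < ⊤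

/-- The commutator `[Λ^σ, φ]` as an integral operator, up to a constant. -/
def commK (σ : ℝ) (φ : E3 → ℝ) (f : E3 → F) (x : E3) : F :=
  ∫ y, ((φ x - φ y) * ‖x - y‖ ^ (-3 - σ)) • f y

lemma measurable_rpow_sub (σ : ℝ) : Measurable fun p : E3 × E3 => ‖p.1 - p.2‖ ^ (-3 - σ) :=
  (measurable_norm.comp (measurable_fst.sub measurable_snd)).pow_const _

lemma aestronglyMeasurable_commK_integrand {σ : ℝ} {φ} (hφ : Continuous φ) {f : E3 → F}
    (hf : AEStronglyMeasurable f) :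
    AEStronglyMeasurable (fun p : E3 × E3 => ((φ p.1 - φ p.2) * ‖p.1 - p.2‖ ^ (-3 - σ)) • f p.2)
      (volume.prod volume) := by
  have h1 : Measurable fun p : E3 × E3 => (φ p.1 - φ p.2) * ‖p.1 - p.2‖ ^ (-3 - σ) :=
    (Continuous.measurable (by fun_prop)).mul (measurable_rpow_sub σ)
  exact h1.aestronglyMeasurable.smul hf.comp_snd

/-- Absolute convergence of the commutator form. Since `σ < 1` the Lipschitz bound on `φ` makes the kernel
integrable on the diagonal, and the decay `|x - y|^{-3-σ}` pairs with the growth allowed by `WInt`. -/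
lemma integrable_commK_mul {σ : ℝ} (h0 : 1 / 2 ≤ σ) (h1 : σ < 1) {φ}
    (hφ : IsTest φ) {f : E3 → F} (hf : WInt f) {θ} (hθ : Measurable θ) {B R}
    (hθB : ∀ x, |θ x| ≤ B) (hR : 1 ≤ R) (hθR : ∀ x, R ≤ ‖x‖ → θ x = 0) :
    Integrable (fun p : E3 × E3 => (θ p.1 * ((φ p.1 - φ p.2) * ‖p.1 - p.2‖ ^ (-3 - σ))) • f p.2)
      (volume.prod volume) := by
  obtain ⟨L, hL, hL'⟩ := hφ.exists_increment_bound σ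
  obtain ⟨C, hC, hC'⟩ := exists_lconv_pker_le (a := 2 + σ) (b := 3 + σ) (by linarith) (by linarith)
    (θ := fun x => ‖θ x‖ₑ) (B := ofReal B) ofReal_ne_top
    (fun x => by rw [enorm_eq_ofReal_abs]; exact ofReal_le_ofReal (hθB x)) hR
    (fun x hx => by rw [hθR x hx]; simp)
  have hfm := hf.1
  set k : E3 → ℝ≥0∞ := fun z => ofReal (pker (2 + σ) (3 + σ) z)
  have hk : Measurable k := (measurable_pker _ _).ennreal_ofReal
  refine ⟨?_, ?_⟩
  · have := aestronglyMeasurable_commK_integrand (σ := σ) hφ.continuous hfm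
    simp_rw [mul_smul (θ _)]; exact (hθ.comp measurable_fst).aestronglyMeasurable.smul this
  calc ∫⁻ p : E3 × E3, ‖(θ p.1 * ((φ p.1 - φ p.2) * ‖p.1 - p.2‖ ^ (-3 - σ))) • f p.2‖ₑ
        ∂(volume.prod volume)
      ≤ ∫⁻ p : E3 × E3, ofReal L * (k (p.2 - p.1) * ‖θ p.1‖ₑ * ‖f p.2‖ₑ) ∂(volume.prod volume) := by
        refine lintegral_mono fun p => ?_
        rw [enorm_smul, enorm_mul, mul_comm ‖θ p.1‖ₑ, ← mul_assoc, ← mul_assoc]; gcongr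
        rw [← ofReal_mul hL, enorm_eq_ofReal_abs, abs_mul,
          abs_of_nonneg (by positivity : 0 ≤ ‖p.1 - p.2‖ ^ (-3 - σ)), ← neg_sub p.1 p.2, pker_neg]
        exact ofReal_le_ofReal (hL' _ _)
    _ = ofReal L * ∫⁻ p : E3 × E3, (k (p.2 - p.1) * ‖θ p.1‖ₑ * ‖f p.2‖ₑ) ∂(volume.prod volume) := lintegral_cmul
    _ = ofReal L * ∫⁻ y, ∫⁻ x, (k (y - x) * ‖θ x‖ₑ * ‖f y‖ₑ) := by
        rw [lintegral_prod_symm]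
        have h3 : Measurable fun p : E3 × E3 => k (p.2 - p.1) := hk.comp (measurable_snd.sub measurable_fst)
        exact (h3.mul (hθ.enorm.comp measurable_fst)).aemeasurable.mul hfm.comp_snd.enorm
    _ = ofReal L * ∫⁻ y, lconv k (fun x => ‖θ x‖ₑ) y * ‖f y‖ₑ := by
        congr 1; refine lintegral_congr fun y => ?_
        rw [lconv_eq_swap, lintegral_mul_const _ (by fun_prop)]
    _ ≤ ofReal L * ∫⁻ y, C * (‖f y‖ₑ * wgt y) := by
        refine mul_le_mul_right (lintegral_mono fun y => ?_) _
        rw [mul_comm ‖f y‖ₑ, ← mul_assoc]; gcongr; exact hC' y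
    _ < ⊤ := by
        rw [lintegral_const_mul' _ _ hC]; exact mul_lt_top ofReal_lt_top (mul_lt_top hC.lt_top hf.2)

lemma locallyIntegrable_commK {σ : ℝ} (h0 : 1 / 2 ≤ σ) (h1 : σ < 1) {φ}
    (hφ : IsTest φ) {f : E3 → F} (hf : WInt f) : LocallyIntegrable (commK σ φ f) := by
  rw [locallyIntegrable_iff]; intro K hK; obtain ⟨R, hR⟩ := hK.isBounded.subset_ball (0 : E3)
  have hsub : K ⊆ ball (0 : E3) (max R 1) := hR.trans (ball_subset_ball (le_max_left _ _))
  set θ : E3 → ℝ := (ball (0 : E3) (max R 1)).indicator fun _ => 1 with hθ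
  have hθm : Measurable θ := measurable_const.indicator measurableSet_ball
  have hI : Integrable (fun p : E3 × E3 =>
    (θ p.1 * ((φ p.1 - φ p.2) * ‖p.1 - p.2‖ ^ (-3 - σ))) • f p.2) (volume.prod volume) :=
    integrable_commK_mul h0 h1 hφ hf hθm (B := 1)
      (fun x => by simp only [hθ, indicator]; split_ifs <;> simp) (le_max_right _ _)
      (fun x hx => indicator_of_notMem (by simpa using hx) _)
  have h2 := hI.integral_prod_left
  refine IntegrableOn.mono_set ?_ hsub
  refine (h2.integrableOn (s := ball (0 : E3) (max R 1))).congr_fun (fun x hx => ?_)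
    measurableSet_ball
  simp only [hθ, indicator_of_mem hx, one_mul]; rfl

/-- The defining duality of the commutator, for its representation by an absolutely convergent
integral. -/
lemma exists_commutator_duality [CompleteSpace F] {σ : ℝ} (h0 : 1 / 2 ≤ σ) (h1 : σ < 1) : ∃ C : ℝ, 0 < C ∧
    ∀ (φ θ : E3 → ℝ), IsTest φ → IsTest θ → ∀ f : E3 → F, WInt f →
      Integrable (fun x => (φ x * fracLap σ θ x - fracLap σ (fun y => φ y * θ y) x) • f x) ∧
      ∫ x, (φ x * fracLap σ θ x - fracLap σ (fun y => φ y * θ y) x) • f x =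
        ∫ x, θ x • C • commK σ φ f x := by
  obtain ⟨C, hC, hC'⟩ := exists_fracLap_eq_of_lt_one (by linarith : 0 < σ) h1
  refine ⟨C, hC, fun φ θ hφ hθ f hf => ?_⟩
  obtain ⟨B, hB, hB'⟩ := hθ.exists_bound
  obtain ⟨R, hR, hR'⟩ := hθ.exists_radius
  have hI : Integrable (fun p : E3 × E3 =>
    (θ p.1 * ((φ p.1 - φ p.2) * ‖p.1 - p.2‖ ^ (-3 - σ))) • f p.2) (volume.prod volume) :=
    integrable_commK_mul h0 h1 hφ hf hθ.continuous.measurable hB' hR hR'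
  have e1 : ∀ x, φ x * fracLap σ θ x - fracLap σ (fun y => φ y * θ y) x
      = C * ∫ y, θ y * ((φ y - φ x) * ‖y - x‖ ^ (-3 - σ)) := by
    intro x; obtain ⟨i1, e1⟩ := hC' θ hθ x; obtain ⟨i2, e2⟩ := hC' _ (hφ.mul hθ) x
    rw [e1, e2, mul_left_comm, ← mul_sub, ← integral_const_mul, ← integral_sub (i1.const_mul _) i2]
    congr 1; refine integral_congr' fun y => ?_
    simp only [norm_sub_rev x y]; ring
  have e2 : ∀ x, (φ x * fracLap σ θ x - fracLap σ (fun y => φ y * θ y) x) • f x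
      = C • ∫ y, (θ y * ((φ y - φ x) * ‖y - x‖ ^ (-3 - σ))) • f x := fun x => by
    rw [e1, integral_smul_const, smul_smul]
  have e3 : ∀ x, θ x • C • commK σ φ f x
      = C • ∫ y, (θ x * ((φ x - φ y) * ‖x - y‖ ^ (-3 - σ))) • f y := fun x => by
    simp_rw [mul_smul (θ x)]; rw [integral_smul, smul_comm]; rfl
  simp_rw [e2, e3]; refine ⟨(hI.integral_prod_right).smul C, ?_⟩
  rw [integral_smul, integral_smul]; congr 1
  exact (integral_integral_swap (f := fun x y =>
    (θ x * ((φ x - φ y) * ‖x - y‖ ^ (-3 - σ))) • f y) hI).symm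

lemma enorm_commK_le (σ : ℝ) (φ : E3 → ℝ) (f : E3 → F) (x : E3) :
    ‖commK σ φ f x‖ₑ ≤ ∫⁻ y, ofReal (|φ x - φ y| * ‖x - y‖ ^ (-3 - σ)) * ‖f y‖ₑ := by
  refine (enorm_integral_le_lintegral_enorm _).trans (le_of_eq (lintegral_congr fun y => ?_))
  rw [enorm_smul, enorm_eq_ofReal_abs, abs_mul,
    abs_of_nonneg (by positivity : 0 ≤ ‖x - y‖ ^ (-3 - σ))]

/-- The distributional commutator is given almost everywhere by the integral operator. -/
lemma exists_enorm_commutator_le {σ : ℝ} (h0 : 1 / 2 ≤ σ) (h1 : σ < 1) : ∃ C : ℝ, 0 < C ∧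
    ∀ φ, IsTest φ → ∀ f c : E3 → E3, WInt f → HasCommutator σ φ f c → ∀ᵐ x, ‖c x‖ₑ ≤ ofReal C *
        ∫⁻ y, ofReal (|φ x - φ y| * ‖x - y‖ ^ (-3 - σ)) * ‖f y‖ₑ := by
  obtain ⟨C, hC, hC'⟩ := exists_commutator_duality (F := E3) h0 h1
  refine ⟨C, hC, fun φ hφ f c hf hc => ?_⟩
  have := ae_eq_of_integral_contDiff_smul_eq hc.1 ((locallyIntegrable_commK h0 h1 hφ hf).smul C)
    (fun θ h1 h2 => ((hc.2 θ ⟨h1, h2⟩).2.trans (hC' φ θ hφ ⟨h1, h2⟩ f hf).2))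
  filter_upwards [this] with x hx
  rw [hx]; simp only [Pi.smul_apply]; rw [enorm_smul, enorm_eq_ofReal_abs, abs_of_pos hC]; gcongr
  exact enorm_commK_le σ φ f x

/-- Decay of the fractional Laplacian of a test function. -/
lemma IsTest.exists_fracLap_le {σ} (h0 : 1 / 2 ≤ σ) (h2 : σ < 2) {θ}
    (hθ : IsTest θ) : ∃ C, 0 ≤ C ∧ ∀ x, |fracLap σ θ x| ≤ C * pker 0 (7 / 2) x := by
  obtain ⟨C, hC, hC'⟩ := exists_fracLap_eq (by linarith : 0 < σ) h2
  obtain ⟨R, hR, hR'⟩ := hθ.exists_radius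
  set A : ℝ := ∫ ξ : E3, ‖((((2 * π * ‖ξ‖) ^ σ : ℝ) : ℂ) * hat θ ξ)‖
  set D : ℝ := ∫ y, |θ y|
  have hD : 0 ≤ D := integral_nonneg fun _ => abs_nonneg _
  have hA : 0 ≤ A := integral_nonneg fun _ => norm_nonneg _
  refine ⟨A * (2 * R) ^ (7 / 2 : ℝ) + C * (2 * D * 2 ^ (7 / 2 : ℝ)), by positivity, fun x => ?_⟩
  have hp := pker_zero_pos (7 / 2) x
  rw [add_mul]; rcases lt_or_ge ‖x‖ (2 * R) with hx | hx
  · have h1 : |fracLap σ θ x| ≤ A := by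
      unfold fracLap fourierMult; refine (Complex.abs_re_le_norm _).trans ?_; rw [fourierInv_eq']
      refine (norm_integral_le_integral_norm _).trans_eq (integral_congr' fun ξ => ?_)
      simp only [norm_smul, norm_cexp_mul_I, one_mul]; rfl
    have h4 := one_le_mul_pker_zero (by linarith) hx.le
    have h5 : 0 ≤ C * (2 * D * 2 ^ (7 / 2 : ℝ)) * pker 0 (7 / 2) x := by positivity
    nlinarith
  · obtain ⟨i1, e1⟩ := hC' θ hθ x
    set K := 2 ^ (7 / 2 : ℝ) * pker 0 (7 / 2) x
    have hint : Integrable fun y => |θ y| := hθ.integrable.abs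
    have h7 : |∫ z : E3, (2 * θ x - θ (x + z) - θ (x - z)) * ‖z‖ ^ (-3 - σ)| ≤ (D + D) * K := by
      have e2 : ∫ z, (|θ (x + z)| + |θ (x - z)|) * K = (D + D) * K := by
        rw [integral_mul_const, integral_add (hint.comp_add_left x) (hint.comp_sub_left x),
          integral_add_left_eq_self (fun y => |θ y|) x,
          integral_sub_left_eq_self (fun y => |θ y|) volume x]
      rw [← norm_eq_abs, ← e2]
      refine norm_integral_le_of_norm_le
        (((hint.comp_add_left x).add (hint.comp_sub_left x)).mul_const _) (.of_forall fun z => ?_)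
      have hθx : θ x = 0 := hR' x (by linarith)
      rw [hθx, norm_mul, norm_of_nonneg (by positivity : 0 ≤ ‖z‖ ^ (-3 - σ)), norm_eq_abs]
      rcases lt_or_ge ‖z‖ (‖x‖ / 2) with hz | hz
      · rw [hR' (x + z) (by linarith [norm_sub_le_norm_add x z]),
          hR' (x - z) (by linarith [norm_sub_norm_le x z])]
        simp
      · gcongr
        · rw [mul_zero, zero_sub, ← abs_neg (θ (x + z))]; exact abs_sub _ _
        · rw [show -3 - σ = -(3 + σ) by ring]
          exact rpow_le_mul_pker_zero (by linarith) (by linarith) (by linarith) hz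
    rw [e1, abs_mul, abs_of_pos hC]
    have h9 : 0 ≤ A * (2 * R) ^ (7 / 2 : ℝ) * pker 0 (7 / 2) x := by positivity
    nlinarith

end

/-! ### The Newtonian potential and the operators `∂_j ∂_k Δ⁻¹` -/

/-- The directional derivative `∂_v f`. -/
def dd (v : E3) (f : E3 → ℝ) (x : E3) : ℝ := fderiv ℝ f x v

/-- The standard basis vectors. -/
def bv (i : Fin 3) : E3 := EuclideanSpace.single i 1

lemma inner_bv (x : E3) (i : Fin 3) : ⟪x, bv i⟫ = x i := by
  simp [bv, EuclideanSpace.inner_single_right]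

lemma gradient_apply (f : E3 → ℝ) (x : E3) (i : Fin 3) : gradient f x i = dd (bv i) f x := by
  rw [← inner_bv, gradient, InnerProductSpace.toDual_symm_apply]; rfl

lemma inner_gradient (f : E3 → ℝ) (x v : E3) : ⟪v, gradient f x⟫ = dd v f x := by
  rw [real_inner_comm, gradient, InnerProductSpace.toDual_symm_apply]; rfl

lemma IsTest.dd {θ} (hθ : IsTest θ) (v : E3) : IsTest (dd v θ) :=
  ⟨(hθ.1.fderiv_right (m := (⊤ : ℕ∞)) (by simp)).clm_apply contDiff_const, hθ.2.fderiv_apply ℝ v⟩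

lemma IsTest.hat_dd {θ} (hθ : IsTest θ) (v ξ : E3) :
    hat (FNS.dd v θ) ξ = 2 * π * I * ⟪ξ, v⟫ * hat θ ξ := by
  have h := SchwartzMap.fourier_lineDerivOp_eq hθ.toS v
  have h1 := congrArg (fun f : SchwartzMap E3 ℂ => f ξ) h
  have hg : (fun x : E3 => inner ℝ x v).HasTemperateGrowth :=
    ((innerSL ℝ).flip v).hasTemperateGrowth
  simp only [smul_apply, SchwartzMap.smulLeftCLM_apply_apply hg] at h1
  have e1 : (LineDeriv.lineDerivOp v hθ.toS : SchwartzMap E3 ℂ) = (hθ.dd v).toS := by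
    ext x; rw [SchwartzMap.lineDerivOp_apply_eq_fderiv]
    have := (Complex.ofRealCLM.hasFDerivAt (x := θ x)).comp x
      ((hθ.1.differentiable (by simp)) x).hasFDerivAt
    change fderiv ℝ (Complex.ofRealCLM ∘ θ) x v = _
    rw [this.fderiv]; rfl
  rw [e1] at h1; change hat (FNS.dd v θ) ξ = _ at h1
  rw [h1]; change (2 * π * I : ℂ) • ((⟪ξ, v⟫ : ℝ) • hat θ ξ) = _
  rw [smul_eq_mul, Complex.real_smul]; ring

/-- The Gauss-Weierstrass kernel. -/
def heatK (t : ℝ) (z : E3) : ℝ := (4 * π * t) ^ (-(3 / 2) : ℝ) * Real.exp (-(‖z‖ ^ 2 / (4 * t)))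

lemma heatK_nonneg {t} (ht : 0 ≤ t) (z : E3) : 0 ≤ heatK t z := by unfold heatK; positivity

lemma measurable_heatK : Measurable (uncurry heatK) := by
  unfold heatK uncurry
  have h1 : Measurable fun p : ℝ × E3 => (4 * π * p.1) ^ (-(3 / 2) : ℝ) :=
    (measurable_const.mul measurable_fst).pow_const _
  exact h1.mul (by fun_prop)

/-- The heat semigroup on test functions. -/
lemma integral_heat {θ} (hθ : IsTest θ) {t} (ht : 0 < t) (x : E3) :
    ∫ ξ : E3, exp (↑(2 * π * ⟪ξ, x⟫) * I) *
        ((Real.exp (-(4 * π ^ 2 * ‖ξ‖ ^ 2) * t) : ℝ) : ℂ) * hat θ ξ =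
      ((∫ y, heatK t (x - y) * θ y : ℝ) : ℂ) := by
  set b : ℝ := 4 * π ^ 2 * t with hb
  have hbp : 0 < b := by positivity
  have hbr : 0 < ((b : ℂ)).re := by simpa using hbp
  set g : E3 → ℂ := fun v => exp (-(b : ℂ) * ‖v‖ ^ 2 + 2 * π * I * ⟪x, v⟫)
    with hg
  have hgi : Integrable g := by
    have := GaussianFourier.integrable_cexp_neg_mul_sq_norm_add hbr (2 * π * I) x
    exact this
  have hflip := VectorFourier.integral_fourierIntegral_smul_eq_flip (L := innerₗ E3)
    (μ := volume) (ν := volume) (f := fun y : E3 => (θ y : ℂ)) (g := g)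
    continuous_fourierChar continuous_inner hθ.integrable.ofReal hgi
  rw [flip_innerₗ] at hflip
  have e1 : ∀ ξ, exp (↑(2 * π * ⟪ξ, x⟫) * I) *
        ((Real.exp (-(4 * π ^ 2 * ‖ξ‖ ^ 2) * t) : ℝ) : ℂ) * hat θ ξ = hat θ ξ • g ξ := by
    intro ξ; rw [smul_eq_mul, mul_comm (hat θ ξ)]; congr 1; simp only [hg]
    push_cast; rw [← Complex.exp_add, real_inner_comm x ξ]
    congr 1; simp only [hb]; push_cast; ring
  simp_rw [e1]; refine Eq.trans hflip ?_
  rw [← integral_complex_ofReal]; refine integral_congr_ae (.of_forall fun y => ?_)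
  have h2 := fourier_gaussian_innerProductSpace' hbr x y
  change (θ y : ℂ) • 𝓕 g y = _
  rw [h2]; simp only [smul_eq_mul, heatK]
  have h3 : ((π : ℂ) / (b : ℂ)) ^ ((Module.finrank ℝ E3 : ℂ) / 2)
      = (((4 * π * t) ^ (-(3 / 2) : ℝ) : ℝ) : ℂ) := by
    have h4 : π / b = (4 * π * t)⁻¹ := by simp only [hb]; field_simp
    have h5 : ((Module.finrank ℝ E3 : ℂ) / 2) = ((3 / 2 : ℝ) : ℂ) := by simp
    rw [h5, ← Complex.ofReal_div, h4, ← Complex.ofReal_cpow (by positivity),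
      Real.inv_rpow (by positivity), rpow_neg (by positivity)]
  rw [h3]
  have h6 : exp (-(π : ℂ) ^ 2 * (‖x - y‖ : ℂ) ^ 2 / (b : ℂ))
      = ((Real.exp (-(‖x - y‖ ^ 2 / (4 * t))) : ℝ) : ℂ) := by
    rw [Complex.ofReal_exp]; congr 1; simp only [hb]; push_cast
    have : (π : ℂ) ≠ 0 := by exact_mod_cast Real.pi_ne_zero
    have : (t : ℂ) ≠ 0 := by exact_mod_cast ht.ne'
    field_simp
  rw [h6]; push_cast; ring

lemma integrableOn_heatK {z} (hz : z ≠ 0) : IntegrableOn (fun t => heatK t z) (Ioi 0) := by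
  have hm : Measurable fun t => heatK t z := measurable_heatK.of_uncurry_right
  have hz' : 0 < ‖z‖ := norm_pos_iff.2 hz
  have hu : Ioi (0 : ℝ) = Ioc 0 1 ∪ Ioi 1 := (Ioc_union_Ioi_eq_Ioi zero_le_one).symm
  rw [hu, integrableOn_union]; constructor
  · -- the exponential is at most `2 (4 t)^2 / |z|^4`, which compensates `t^{-3/2}`
    refine Measure.integrableOn_of_bounded (M := (4 * π) ^ (-(3 / 2) : ℝ) *
      (32 / ‖z‖ ^ 4)) (by simp) hm.aestronglyMeasurable ?_
    refine (ae_restrict_iff' measurableSet_Ioc).2 (.of_forall fun t ht => ?_)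
    rw [norm_of_nonneg (heatK_nonneg ht.1.le z)]; unfold heatK
    rw [mul_rpow (by positivity) ht.1.le, mul_assoc]; gcongr; set w := ‖z‖ ^ 2 / (4 * t) with hw
    have ht0 := ht.1
    have hwp : 0 < w := by positivity
    have h1 : Real.exp (-w) ≤ 2 / w ^ 2 := by
      rw [Real.exp_neg, inv_eq_one_div, div_le_div_iff₀ (Real.exp_pos _) (by positivity)]
      have := Real.quadratic_le_exp_of_nonneg hwp.le
      nlinarith
    have h2 : 2 / w ^ 2 = 32 / ‖z‖ ^ 4 * t ^ 2 := by rw [hw]; field_simp; norm_num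
    have h3 : t ^ (-(3 / 2) : ℝ) * t ^ 2 ≤ 1 := by
      rw [← rpow_natCast, ← rpow_add ht0]; exact Real.rpow_le_one ht0.le ht.2 (by norm_num)
    calc t ^ (-(3 / 2) : ℝ) * Real.exp (-w) ≤ t ^ (-(3 / 2) : ℝ) * (32 / ‖z‖ ^ 4 * t ^ 2) := by
          rw [← h2]; gcongr
      _ = 32 / ‖z‖ ^ 4 * (t ^ (-(3 / 2) : ℝ) * t ^ 2) := by ring
      _ ≤ 32 / ‖z‖ ^ 4 * 1 := by gcongr
      _ = _ := mul_one _
  · have h1 : IntegrableOn (fun t : ℝ => t ^ (-(3 / 2) : ℝ)) (Ioi 1) :=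
      integrableOn_Ioi_rpow_of_lt (by norm_num) zero_lt_one
    refine Integrable.mono' (h1.const_mul ((4 * π) ^ (-(3 / 2) : ℝ))) hm.aestronglyMeasurable ?_
    refine (ae_restrict_iff' measurableSet_Ioi).2 (.of_forall fun t ht => ?_)
    have ht' : (0 : ℝ) < t := lt_trans zero_lt_one ht
    rw [norm_of_nonneg (heatK_nonneg ht'.le z)]; unfold heatK; rw [mul_rpow (by positivity) ht'.le]
    have : Real.exp (-(‖z‖ ^ 2 / (4 * t))) ≤ 1 := Real.exp_le_one_iff.2 (by
      have : 0 ≤ ‖z‖ ^ 2 / (4 * t) := by positivity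
      linarith)
    exact mul_le_of_le_one_right (by positivity) this

/-- `∫₀^∞ G_t(z) dt` is a multiple of `1 / |z|`. -/
lemma exists_integral_heatK : ∃ c, ∀ z, z ≠ 0 → ∫ t in Ioi (0 : ℝ), heatK t z = c * ‖z‖⁻¹ := by
  refine ⟨∫ t in Ioi (0 : ℝ), heatK t (bv 0), fun z hz => ?_⟩
  have hz' : 0 < ‖z‖ := norm_pos_iff.2 hz
  have h := integral_comp_mul_left_Ioi (fun t => heatK t z) 0 (by positivity : 0 < ‖z‖ ^ 2)
  rw [mul_zero] at h
  have e1 : ∀ t ∈ Ioi (0 : ℝ), heatK (‖z‖ ^ 2 * t) z = ‖z‖ ^ (-3 : ℝ) * heatK t (bv 0) := by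
    intro t ht; have ht' : (0 : ℝ) < t := ht; unfold heatK; have hn : ‖bv 0‖ = 1 := by simp [bv]
    have e2 : 4 * π * (‖z‖ ^ 2 * t) = ‖z‖ ^ 2 * (4 * π * t) := by ring
    have e3 : (‖z‖ ^ 2) ^ (-(3 / 2) : ℝ) = ‖z‖ ^ (-3 : ℝ) := by
      rw [← rpow_natCast, ← rpow_mul hz'.le]; norm_num
    rw [hn, e2, mul_rpow (by positivity) (by positivity), e3, mul_assoc]; congr 4; field_simp
  rw [setIntegral_congr_fun measurableSet_Ioi e1, integral_const_mul] at h
  have e4 : ‖z‖ ^ (-3 : ℝ) = (‖z‖ ^ 2)⁻¹ * ‖z‖⁻¹ := by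
    rw [show (-3 : ℝ) = ((-3 : ℤ) : ℝ) by norm_num, Real.rpow_intCast, ← mul_inv, ← pow_succ]; rfl
  rw [e4, smul_eq_mul, mul_assoc] at h; have := mul_left_cancel₀ (by positivity) h
  rw [← this, mul_comm]

lemma integrable_rpow_mul {f : E3 → ℝ} {a B : ℝ} (hf : Integrable f) (hB : ∀ z, |f z| ≤ B)
    (ha : 0 ≤ a) (ha3 : a < 3) : Integrable fun z => ‖z‖ ^ (-a) * f z := by
  refine (((integrable_pker (b := 4) ha3 (by norm_num)).const_mul B).add hf.norm).mono'
    ((by fun_prop : Measurable fun z : E3 => ‖z‖ ^ (-a)).aestronglyMeasurable.mul hf.1)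
    (.of_forall fun z => ?_)
  rw [norm_mul, norm_of_nonneg (by positivity), norm_eq_abs, Pi.add_apply, pker]
  have h0 := (abs_nonneg _).trans (hB z)
  split_ifs with h
  · rw [mul_comm B]
    exact (mul_le_mul_of_nonneg_left (hB z) (by positivity)).trans
      (le_add_of_nonneg_right (norm_nonneg _))
  · exact (mul_le_of_le_one_left (abs_nonneg _) (Real.rpow_le_one_of_one_le_of_nonpos
      (not_lt.1 h) (by linarith))).trans (le_add_of_nonneg_left (by positivity))

/-- The multiplier with symbol `1 / (4π²|ξ|²)` is convolution with a multiple of `1 / |z|`. -/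
lemma exists_newton : ∃ c, ∀ ψ, IsTest ψ → ∀ x, ∫ ξ : E3, exp (↑(2 * π * ⟪ξ, x⟫) * I) *
        (((4 * π ^ 2 * ‖ξ‖ ^ 2)⁻¹ : ℝ) : ℂ) * hat ψ ξ =
      ((c * ∫ y, ‖x - y‖⁻¹ * ψ y : ℝ) : ℂ) := by
  obtain ⟨c, hc⟩ := exists_integral_heatK
  refine ⟨c, fun ψ hψ x => ?_⟩
  have hch := hψ.continuous_hat
  have hcc := hψ.continuous
  set a : E3 → ℝ := fun ξ => 4 * π ^ 2 * ‖ξ‖ ^ 2 with ha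
  have hap : ∀ ξ, ξ ≠ 0 → 0 < a ξ := fun ξ hξ => by
    have : 0 < ‖ξ‖ := norm_pos_iff.2 hξ
    positivity
  have hne : ∀ᵐ ξ : E3, ξ ≠ 0 := by simp [ae_iff]
  set J : E3 × ℝ → ℂ := fun p => exp (↑(2 * π * ⟪p.1, x⟫) * I) *
    ((Real.exp (-(a p.1) * p.2) : ℝ) : ℂ) * hat ψ p.1 with hJ
  have hJn : ∀ p, ‖J p‖ = Real.exp (-(a p.1) * p.2) * ‖hat ψ p.1‖ := fun p => by
    simp only [hJ, norm_mul, norm_cexp_mul_I, one_mul, norm_real,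
      norm_of_nonneg (Real.exp_pos _).le]
  have hJm : AEStronglyMeasurable J (volume.prod (volume.restrict (Ioi 0))) := by
    refine Continuous.aestronglyMeasurable ?_
    simp only [hJ, ha]; fun_prop
  have hexp : ∀ ξ, ξ ≠ 0 → IntegrableOn (fun t : ℝ => Real.exp (-(a ξ) * t)) (Ioi 0) ∧
      ∫ t in Ioi (0 : ℝ), Real.exp (-(a ξ) * t) = (a ξ)⁻¹ := fun ξ hξ => by
    have h := hap ξ hξ
    refine ⟨integrableOn_exp_mul_Ioi (by linarith) 0, ?_⟩
    rw [integral_exp_mul_Ioi (by linarith)]; simp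
  have hJi : Integrable J (volume.prod (volume.restrict (Ioi 0))) := by
    rw [integrable_prod_iff hJm]; constructor
    · filter_upwards [hne] with ξ hξ
      refine Integrable.mono' ((hexp ξ hξ).1.mul_const ‖hat ψ ξ‖) ?_
        (.of_forall fun t => (hJn (ξ, t)).le)
      refine Continuous.aestronglyMeasurable ?_
      simp only [hJ, ha]; fun_prop
    · simp_rw [hJn, integral_mul_const]
      refine ((integrable_rpow_mul (B := ∫ y, ‖(ψ y : ℂ)‖) hψ.integrable_hat.norm (fun ξ => ?_)
        zero_le_two (by norm_num)).const_mul (4 * π ^ 2)⁻¹).congr ?_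
      · rw [abs_norm]; exact VectorFourier.norm_fourierIntegral_le_integral_norm _ _ _ _ _
      · filter_upwards [hne] with ξ hξ
        rw [(hexp ξ hξ).2, rpow_neg (norm_nonneg ξ), Real.rpow_two, ← mul_assoc, ← mul_inv]
  have hswap := integral_integral_swap (f := fun ξ t => J (ξ, t)) hJi
  have e1 : ∫ ξ : E3, exp (↑(2 * π * ⟪ξ, x⟫) * I) * (((4 * π ^ 2 * ‖ξ‖ ^ 2)⁻¹ : ℝ) : ℂ) * hat ψ ξ
      = ∫ ξ, ∫ t in Ioi (0 : ℝ), J (ξ, t) := by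
    refine integral_congr_ae ?_
    filter_upwards [hne] with ξ hξ
    simp only [hJ]
    rw [integral_mul_const, integral_const_mul, integral_complex_ofReal, (hexp ξ hξ).2]
  rw [e1, hswap]
  have e2 : ∫ t in Ioi (0 : ℝ), ∫ ξ, J (ξ, t)
      = ∫ t in Ioi (0 : ℝ), ((∫ y, heatK t (x - y) * ψ y : ℝ) : ℂ) :=
    setIntegral_congr_fun measurableSet_Ioi fun t ht => integral_heat hψ ht x
  rw [e2, integral_complex_ofReal]; congr 1
  have hnx : ∀ᵐ y : E3, x - y ≠ 0 := by
    have : {y : E3 | ¬ (x - y ≠ 0)} = {x} := by ext y; simp [sub_eq_zero, eq_comm]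
    rw [ae_iff, this]; simp
  have hK : Integrable (fun p : E3 × ℝ => heatK p.2 (x - p.1) * ψ p.1)
      (volume.prod (volume.restrict (Ioi 0))) := by
    have hm : Measurable fun p : E3 × ℝ => heatK p.2 (x - p.1) * ψ p.1 :=
      (measurable_heatK.comp (f := fun p : E3 × ℝ => (p.2, x - p.1)) (by fun_prop)).mul
        (by fun_prop)
    rw [integrable_prod_iff hm.aestronglyMeasurable]; constructor
    · filter_upwards [hnx] with y hy
      exact (integrableOn_heatK hy).mul_const _
    · obtain ⟨B, -, hB⟩ := hψ.exists_bound
      refine (((integrable_rpow_mul (a := 1) (B := B) (hψ.integrable.comp_sub_left x).abs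
        (fun z => (abs_abs _).trans_le (hB _)) zero_le_one (by norm_num)).comp_sub_left
        x).const_mul c).congr ?_
      filter_upwards [hnx] with y hy
      simp only [sub_sub_cancel]
      rw [Real.rpow_neg_one, ← mul_assoc, ← hc _ hy, ← integral_mul_const]
      refine setIntegral_congr_fun measurableSet_Ioi fun t ht => ?_
      rw [norm_mul, norm_of_nonneg (heatK_nonneg (le_of_lt ht) _), norm_eq_abs]
  rw [← integral_integral_swap (f := fun y t => heatK t (x - y) * ψ y) hK, ← integral_const_mul]
  refine integral_congr_ae ?_
  filter_upwards [hnx] with y hy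
  rw [integral_mul_const, hc _ hy, mul_assoc]

lemma IsTest.integrable_symbol_mul_hat {θ} (hθ : IsTest θ) {m}
    (hm : Measurable m) {B : ℝ} (hB : ∀ ξ, |m ξ| ≤ B) :
    Integrable fun ξ => (m ξ : ℂ) * hat θ ξ := by
  refine hθ.integrable_hat.norm.const_mul B |>.mono' ?_ (.of_forall fun ξ => ?_)
  · exact (Complex.measurable_ofReal.comp hm).aestronglyMeasurable.mul
      hθ.continuous_hat.aestronglyMeasurable
  · rw [norm_mul, norm_real, norm_eq_abs]; gcongr; exact hB ξ

/-- The symbol of `∂_j ∂_k Δ⁻¹`. -/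
def rieszSymbol (j k : Fin 3) (ξ : E3) : ℝ := ξ j * ξ k / ‖ξ‖ ^ 2

lemma measurable_rieszSymbol (j k : Fin 3) : Measurable (rieszSymbol j k) := by
  unfold rieszSymbol; exact Measurable.div (Continuous.measurable (by fun_prop)) (by fun_prop)

lemma abs_apply_le_norm (ξ : E3) (j : Fin 3) : |ξ j| ≤ ‖ξ‖ := by
  have := PiLp.norm_apply_le ξ j
  rwa [norm_eq_abs] at this

lemma abs_rieszSymbol_le (j k : Fin 3) (ξ : E3) : |rieszSymbol j k ξ| ≤ 1 := by
  unfold rieszSymbol; rw [abs_div, abs_mul, abs_of_nonneg (sq_nonneg ‖ξ‖)]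
  refine div_le_one_of_le₀ ?_ (sq_nonneg _)
  rw [sq]
  exact mul_le_mul (abs_apply_le_norm ξ j) (abs_apply_le_norm ξ k) (abs_nonneg _) (norm_nonneg _)

lemma invLapDD_eq (j k : Fin 3) (θ : E3 → ℝ) (x : E3) : invLapDD j k θ x =
    (∫ ξ : E3, exp (↑(2 * π * ⟪ξ, x⟫) * I) * ((rieszSymbol j k ξ : ℂ) * hat θ ξ)).re := by
  unfold invLapDD fourierMult; rw [fourierInv_eq']; rfl

lemma IsTest.integrable_riesz {θ} (hθ : IsTest θ) (j k : Fin 3) (x : E3) :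
    Integrable fun ξ : E3 => exp (↑(2 * π * ⟪ξ, x⟫) * I) * ((rieszSymbol j k ξ : ℂ) * hat θ ξ) := by
  have h := hθ.integrable_symbol_mul_hat (measurable_rieszSymbol j k) (abs_rieszSymbol_le j k)
  refine h.norm.mono' ?_ (Eventually.of_forall fun ξ => ?_)
  · exact (Continuous.aestronglyMeasurable (by fun_prop)).mul h.1
  · rw [norm_mul, norm_cexp_mul_I, one_mul]

lemma IsTest.add {θ φ} (hθ : IsTest θ) (hφ : IsTest φ) : IsTest fun x => θ x + φ x :=
  ⟨hθ.1.add hφ.1, hθ.2.add hφ.2⟩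

lemma hat_add {θ φ} (hθ : IsTest θ) (hφ : IsTest φ) (ξ : E3) :
    hat (fun x => θ x + φ x) ξ = hat θ ξ + hat φ ξ := by
  have h := VectorFourier.fourierIntegral_add continuous_fourierChar
    (L := innerₗ E3) continuous_inner (hθ.integrable.ofReal (𝕜 := ℂ))
    (hφ.integrable.ofReal (𝕜 := ℂ))
  have h1 := congrFun h ξ
  simp only [Pi.add_apply] at h1; unfold hat; simp only [Complex.ofReal_add]; exact h1

lemma invLapDD_add (j k : Fin 3) {θ φ} (hθ : IsTest θ) (hφ : IsTest φ) (x : E3) :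
    invLapDD j k (fun x => θ x + φ x) x = invLapDD j k θ x + invLapDD j k φ x := by
  simp only [invLapDD_eq, hat_add hθ hφ, mul_add]
  rw [integral_add (hθ.integrable_riesz j k x) (hφ.integrable_riesz j k x), Complex.add_re]

/-- `∂_j ∂_k Δ⁻¹ θ` as a Newtonian potential. -/
lemma exists_invLapDD_eq : ∃ c, ∀ j k θ, IsTest θ → ∀ x,
    invLapDD j k θ x = c * ∫ y, ‖x - y‖⁻¹ * dd (bv j) (dd (bv k) θ) y := by
  obtain ⟨c, hc⟩ := exists_newton
  refine ⟨-c, fun j k θ hθ x => ?_⟩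
  have h := hc _ ((hθ.dd (bv k)).dd (bv j)) x
  rw [invLapDD_eq, ← Complex.ofReal_re (-c * _), neg_mul, Complex.ofReal_neg, ← h, ← integral_neg]
  congr 1; refine integral_congr_ae ?_; have hne : ∀ᵐ ξ : E3, ξ ≠ 0 := by simp [ae_iff]
  filter_upwards [hne] with ξ hξ
  have hξ' : (‖ξ‖ : ℂ) ≠ 0 := by simpa using hξ
  have hpi : (π : ℂ) ≠ 0 := by exact_mod_cast Real.pi_ne_zero
  rw [(hθ.dd (bv k)).hat_dd, hθ.hat_dd, inner_bv, inner_bv]; unfold rieszSymbol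
  push_cast; field_simp
  linear_combination (4 * (ξ.ofLp j * ξ.ofLp k * hat θ ξ : ℂ)) * Complex.I_sq

/-- `f` is smooth away from the origin and homogeneous of degree `-d`. -/
def IsHom (d : ℕ) (f : E3 → ℝ) : Prop := (∀ z, z ≠ 0 → ContDiffAt ℝ (⊤ : ℕ∞) f z) ∧
    ∀ r, 0 < r → ∀ z, f (r • z) = (r ^ d)⁻¹ * f z

lemma isHom_inv_norm : IsHom 1 fun z => ‖z‖⁻¹ := by
  refine ⟨fun z hz => (contDiffAt_norm ℝ hz).inv (norm_ne_zero_iff.2 hz), fun r hr z => ?_⟩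
  simp only [norm_smul, norm_of_nonneg hr.le, mul_inv, pow_one]

lemma IsHom.dd {d} {f} (hf : IsHom d f) (v : E3) : IsHom (d + 1) (dd v f) := by
  refine ⟨fun z hz => ?_, fun r hr z => ?_⟩
  · exact ((hf.1 z hz).fderiv_right (m := (⊤ : ℕ∞)) (by simp)).clm_apply contDiffAt_const
  · have h1 : (fun z => f (r • z)) = fun z => (r ^ d)⁻¹ * f z := funext (hf.2 r hr)
    have h2 := fderiv_comp_smul (𝕜 := ℝ) (f := f) (x := z) r
    rw [h1] at h2
    have h3 : fderiv ℝ (fun z => (r ^ d)⁻¹ * f z) z = (r ^ d)⁻¹ • fderiv ℝ f z :=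
      congrFun (fderiv_const_smul_field (𝕜 := ℝ) ((r ^ d)⁻¹) (f := f)) z
    rw [h3] at h2; have h4 := congrArg (fun L : E3 →L[ℝ] ℝ => L v) h2
    simp only [_root_.smul_apply, smul_eq_mul] at h4
    change fderiv ℝ f (r • z) v = _ * fderiv ℝ f z v
    rw [pow_succ, mul_inv, mul_comm (r ^ d)⁻¹, mul_assoc, h4, ← mul_assoc, inv_mul_cancel₀ hr.ne',
      one_mul]

lemma IsHom.exists_bound {d} {f} (hf : IsHom d f) : ∃ C, 0 ≤ C ∧
    ∀ z, z ≠ 0 → |f z| ≤ C * (‖z‖ ^ d)⁻¹ := by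
  have hcont : ContinuousOn f (Metric.sphere 0 1) := fun z hz =>
    (hf.1 z (fun h => by simp [h] at hz)).continuousAt.continuousWithinAt
  obtain ⟨C, hC⟩ := (isCompact_sphere (0 : E3) 1).exists_bound_of_continuousOn hcont
  refine ⟨max C 0, le_max_right _ _, fun z hz => ?_⟩
  have hz' : 0 < ‖z‖ := norm_pos_iff.2 hz
  have h1 := hf.2 ‖z‖ hz' (‖z‖⁻¹ • z)
  rw [smul_smul, mul_inv_cancel₀ hz'.ne', one_smul] at h1
  rw [h1, abs_mul, abs_of_pos (by positivity), mul_comm]; gcongr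
  refine (hC _ ?_).trans (le_max_left C 0)
  rw [mem_sphere_zero_iff_norm, norm_smul, norm_inv, norm_norm, inv_mul_cancel₀ hz'.ne']

/-- Integration by parts off the singularity of a homogeneous kernel. -/
lemma IsHom.integral_mul_dd {d} {f} (hf : IsHom d f) {θ} (hθ : IsTest θ)
    {x} (hx : x ∉ tsupport θ) (v : E3) :
    ∫ y, f (x - y) * FNS.dd v θ y = ∫ y, FNS.dd v f (x - y) * θ y := by
  have hne : ∀ y ∈ tsupport θ, x - y ≠ 0 := fun y hy h => hx (by rwa [sub_eq_zero.1 h])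
  have hsm : ∀ {d'} {f'}, IsHom d' f' → ∀ {θ'}, IsTest θ' →
      tsupport θ' ⊆ tsupport θ → Integrable fun y => f' (x - y) * θ' y := by
    intro d' f' hf' θ' hθ' hs
    have hc : ContDiff ℝ (⊤ : ℕ∞) fun y => f' (x - y) * θ' y := by
      refine contDiff_iff_contDiffAt.2 fun y => ?_
      by_cases hy : y ∈ tsupport θ'
      · exact ((hf'.1 _ (hne y (hs hy))).comp y (contDiffAt_const.sub contDiffAt_id)).mul
          hθ'.1.contDiffAt
      · refine contDiffAt_const (c := (0 : ℝ)) |>.congr_of_eventuallyEq ?_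
        filter_upwards [(isClosed_tsupport θ').isOpen_compl.mem_nhds hy] with z hz
        rw [image_eq_zero_of_notMem_tsupport hz, mul_zero]
    exact hc.continuous.integrable_of_hasCompactSupport hθ'.2.mul_left
  have hder : ∀ y ∈ tsupport θ, fderiv ℝ (fun y => f (x - y)) y v = - FNS.dd v f (x - y) := by
    intro y hy
    have h1 : HasFDerivAt (fun y => f (x - y)) ((fderiv ℝ f (x - y)).comp
        (-(ContinuousLinearMap.id ℝ E3))) y :=
      ((hf.1 _ (hne y hy)).differentiableAt (by simp)).hasFDerivAt.comp y
        ((hasFDerivAt_id y).const_sub x)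
    rw [h1.fderiv]; simp [FNS.dd]
  have hsub : tsupport (FNS.dd v θ) ⊆ tsupport θ := tsupport_fderiv_apply_subset ℝ v
  have e1 : ∀ y, fderiv ℝ (fun y => f (x - y)) y v * θ y = -(FNS.dd v f (x - y) * θ y) := by
    intro y; by_cases hy : y ∈ tsupport θ
    · rw [hder y hy]; ring
    · rw [image_eq_zero_of_notMem_tsupport hy]; simp
  have h := integral_mul_fderiv_eq_neg_fderiv_mul_of_integrable (μ := (volume : Measure E3))
    (f := fun y => f (x - y)) (g := θ) (v := v)
    (by simp_rw [e1]; exact (hsm (hf.dd v) hθ le_rfl).neg)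
    (hsm hf (hθ.dd v) hsub) (hsm hf hθ le_rfl)
    (fun y hy => ((hf.1 _ (hne y hy)).comp y
      (contDiffAt_const.sub contDiffAt_id)).differentiableAt (by simp))
    (fun y _ => hθ.1.differentiable (by simp) y)
  simp_rw [e1, integral_neg, neg_neg] at h; exact h

lemma IsTest.abs_integral_mul_le {θ} (hθ : IsTest θ) {K : E3 → ℝ} {B}
    (hK : ∀ y ∈ tsupport θ, |K y| ≤ B) : |∫ y, K y * θ y| ≤ B * ∫ y, |θ y| := by
  rw [← integral_const_mul, ← norm_eq_abs]
  refine norm_integral_le_of_norm_le (hθ.integrable.abs.const_mul _) (.of_forall fun y => ?_)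
  rw [norm_mul, norm_eq_abs, norm_eq_abs]; by_cases hy : y ∈ tsupport θ
  · exact mul_le_mul_of_nonneg_right (hK y hy) (abs_nonneg _)
  · simp [image_eq_zero_of_notMem_tsupport hy]

/-- Away from the support of `θ`, the operators `∂_j ∂_k Δ⁻¹` are integral operators with a
kernel of size `|x|^{-3}`. -/
lemma exists_invLapDD_le_of_eq_zero : ∃ C, 0 ≤ C ∧ ∀ j k θ,
    IsTest θ → ∀ x, (∀ y, dist y x < 1 → θ y = 0) → |invLapDD j k θ x| ≤ C * ∫ y, |θ y| := by
  obtain ⟨c, hc⟩ := exists_invLapDD_eq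
  choose C hC0 hC using fun j k : Fin 3 => ((isHom_inv_norm.dd (bv j)).dd (bv k)).exists_bound
  obtain ⟨B, hB⟩ := Finite.exists_le fun p : Fin 3 × Fin 3 => C p.1 p.2
  have hB0 : 0 ≤ B := (hC0 0 0).trans (hB (0, 0))
  refine ⟨|c| * B, by positivity, fun j k θ hθ x hx => ?_⟩
  have hnt : tsupport θ ⊆ {y | 1 ≤ ‖x - y‖} := closure_minimal (fun y hy => by
    by_contra h
    exact hy (hx y (by rwa [dist_comm, dist_eq_norm, ← not_le]))) (isClosed_le continuous_const
      (by fun_prop))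
  have hx1 : x ∉ tsupport θ := fun h => absurd (hnt h) (by simp)
  have hx2 : x ∉ tsupport (dd (bv k) θ) := fun h => hx1 (tsupport_fderiv_apply_subset ℝ _ h)
  rw [hc j k θ hθ x, isHom_inv_norm.integral_mul_dd (hθ.dd _) hx2,
    (isHom_inv_norm.dd _).integral_mul_dd hθ hx1, abs_mul, mul_assoc]
  refine mul_le_mul_of_nonneg_left (hθ.abs_integral_mul_le fun y hy => ?_) (abs_nonneg c)
  have h2 : 1 ≤ ‖x - y‖ := hnt hy
  refine (hC j k _ fun h => ?_).trans ((mul_le_of_le_one_right (hC0 j k)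
    (inv_le_one_of_one_le₀ (one_le_pow₀ h2))).trans (hB (j, k)))
  rw [h, norm_zero] at h2; linarith

/-- On derivatives the kernel of `∂_j ∂_k Δ⁻¹` gains one power of decay. -/
lemma exists_invLapDD_dd_le : ∃ C, 0 ≤ C ∧ ∀ i j k θ,
    IsTest θ → ∀ x o r, 0 < r → (∀ y, r ≤ dist y o → θ y = 0) →
      2 * r ≤ dist x o → |invLapDD j k (dd (bv i) θ) x| ≤ C * (dist x o ^ 4)⁻¹ * ∫ y, |θ y| := by
  obtain ⟨c, hc⟩ := exists_invLapDD_eq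
  choose C hC0 hC using fun i j k : Fin 3 =>
    (((isHom_inv_norm.dd (bv j)).dd (bv k)).dd (bv i)).exists_bound
  obtain ⟨B, hB⟩ := Finite.exists_le fun p : Fin 3 × Fin 3 × Fin 3 => C p.1 p.2.1 p.2.2
  have hB0 : 0 ≤ B := (hC0 0 0 0).trans (hB (0, 0, 0))
  refine ⟨|c| * (B * 16), by positivity, fun i j k θ hθ x o r hr h0 hx => ?_⟩
  have hnt : tsupport θ ⊆ {y | dist y o ≤ r} := closure_minimal (fun y hy => by
    by_contra h
    exact hy (h0 y (not_le.1 h).le)) (isClosed_le (by fun_prop) continuous_const)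
  have hx1 : x ∉ tsupport θ := fun h => by linarith [show dist x o ≤ r from hnt h]
  have hx2 : x ∉ tsupport (dd (bv i) θ) := fun h => hx1 (tsupport_fderiv_apply_subset ℝ _ h)
  have hx3 : x ∉ tsupport (dd (bv k) (dd (bv i) θ)) := fun h =>
    hx2 (tsupport_fderiv_apply_subset ℝ _ h)
  rw [hc j k _ (hθ.dd _) x, isHom_inv_norm.integral_mul_dd ((hθ.dd _).dd _) hx3,
    (isHom_inv_norm.dd _).integral_mul_dd (hθ.dd _) hx2,
    ((isHom_inv_norm.dd _).dd _).integral_mul_dd hθ hx1, abs_mul, mul_assoc |c|, mul_assoc |c|]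
  refine mul_le_mul_of_nonneg_left (hθ.abs_integral_mul_le fun y hy => ?_) (abs_nonneg c)
  have hd : 0 < dist x o := by linarith
  have h2 : dist x o / 2 ≤ ‖x - y‖ := by
    rw [← dist_eq_norm]; linarith [show dist y o ≤ r from hnt hy, dist_triangle x y o]
  refine (hC i j k _ (norm_pos_iff.1 (by linarith))).trans ?_
  calc _ ≤ B * ((dist x o / 2) ^ 4)⁻¹ := by gcongr; exact hB (i, j, k)
    _ = _ := by rw [div_pow, inv_div]; ring

/-! ### Plancherel's theorem for integrable and square integrable functions -/

/-- Plancherel's theorem for the integral defining the inverse Fourier transform of a function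
that is integrable and square integrable. -/
lemma lintegral_fourierInv_sq {f : E3 → ℂ} (h1 : Integrable f) (h2 : MemLp f 2) :
    ∫⁻ x, ‖𝓕⁻ f x‖ₑ ^ 2 = ∫⁻ x, ‖f x‖ₑ ^ 2 := by
  set F : Lp ℂ 2 (volume : Measure E3) := h2.toLp f with hF
  set G : Lp ℂ 2 (volume : Measure E3) := 𝓕⁻ F with hG
  have hL : Continuous fun p : E3 × E3 => -⟪p.1, p.2⟫ := continuous_inner.neg
  have hcont : Continuous (𝓕⁻ f) := VectorFourier.fourierIntegral_continuous (L := -(innerₗ E3))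
    continuous_fourierChar hL h1
  have hae : (G : E3 → ℂ) =ᵐ[volume] 𝓕⁻ f := by
    have hGl : LocallyIntegrable (G : E3 → ℂ) volume := (Lp.memLp G).locallyIntegrable (by norm_num)
    refine ae_eq_of_integral_contDiff_smul_eq hGl hcont.locallyIntegrable fun θ hθ1 hθ2 => ?_
    have hθ : IsTest θ := ⟨hθ1, hθ2⟩
    have e1 : ∫ x, θ x • (G : E3 → ℂ) x = Lp.toTemperedDistribution G hθ.toS := by
      rw [Lp.toTemperedDistribution_apply]; rfl
    rw [e1, hG, ← Lp.fourierInv_toTemperedDistribution_eq, TemperedDistribution.fourierInv_apply,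
      Lp.toTemperedDistribution_apply]
    have e2 : ∫ x, (𝓕⁻ hθ.toS : SchwartzMap E3 ℂ) x • (F : E3 → ℂ) x
        = ∫ x, (𝓕⁻ hθ.toS : SchwartzMap E3 ℂ) x • f x := by
      refine integral_congr_ae ?_
      filter_upwards [h2.coeFn_toLp] with x hx
      rw [hF, hx]
    rw [e2]
    have hflip := VectorFourier.integral_fourierIntegral_smul_eq_flip (L := -(innerₗ E3))
      (μ := volume) (ν := volume) (f := fun y : E3 => (θ y : ℂ)) (g := f)
      continuous_fourierChar hL hθ.integrable.ofReal h1
    have e3 : (-(innerₗ E3)).flip = -(innerₗ E3) := by ext a b; simp [real_inner_comm]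
    rw [e3] at hflip; simp only [Complex.real_smul]; rw [SchwartzMap.fourierInv_coe]; exact hflip
  have hn : ‖G‖ = ‖F‖ := by
    have := Lp.norm_fourier_eq G
    rw [hG, FourierTransform.fourier_fourierInv_eq] at this; exact this.symm
  have hnn : eLpNorm (𝓕⁻ f) 2 volume = eLpNorm f 2 volume := by
    rw [← eLpNorm_congr_ae hae, ← eLpNorm_congr_ae h2.coeFn_toLp, ← Lp.enorm_def, ← Lp.enorm_def,
      ← ofReal_norm, ← ofReal_norm, hn]
  rw [eLpNorm_eq_lintegral_rpow_enorm_toReal (by norm_num) (by norm_num),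
    eLpNorm_eq_lintegral_rpow_enorm_toReal (by norm_num) (by norm_num)] at hnn
  have := ENNReal.rpow_left_injective (x := 1 / (2 : ℝ≥0∞).toReal) (by norm_num) hnn
  simpa using this

/-- Boundedness of `∂_j ∂_k Δ⁻¹` in `L²`. -/
lemma lintegral_invLapDD_sq_le (j k : Fin 3) {θ} (hθ : IsTest θ) :
    ∫⁻ x, ‖invLapDD j k θ x‖ₑ ^ 2 ≤ ∫⁻ x, ‖θ x‖ₑ ^ 2 := by
  set f : E3 → ℂ := fun ξ => (rieszSymbol j k ξ : ℂ) * hat θ ξ with hf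
  have h1 : Integrable f :=
    hθ.integrable_symbol_mul_hat (measurable_rieszSymbol j k) (abs_rieszSymbol_le j k)
  have hle : ∀ ξ, ‖f ξ‖ ≤ ‖hat θ ξ‖ := fun ξ => by
    simp only [hf, norm_mul, norm_real, norm_eq_abs]
    exact mul_le_of_le_one_left (norm_nonneg _) (abs_rieszSymbol_le j k ξ)
  have hh2 : MemLp (hat θ) 2 volume := (𝓕 hθ.toS : SchwartzMap E3 ℂ).memLp 2 volume
  have h2 : MemLp f 2 volume := hh2.mono h1.1 (Eventually.of_forall hle)
  calc ∫⁻ x, ‖invLapDD j k θ x‖ₑ ^ 2 ≤ ∫⁻ x, ‖𝓕⁻ f x‖ₑ ^ 2 := by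
        refine lintegral_mono fun x => ?_
        gcongr; rw [enorm_le_iff_norm_le, norm_eq_abs]
        exact Complex.abs_re_le_norm _
    _ = ∫⁻ ξ, ‖f ξ‖ₑ ^ 2 := lintegral_fourierInv_sq h1 h2
    _ ≤ ∫⁻ ξ, ‖hat θ ξ‖ₑ ^ 2 := by
        refine lintegral_mono fun x => ?_
        gcongr; rw [enorm_le_iff_norm_le]
        exact hle x
    _ = ∫⁻ x, ‖𝓕⁻ (hat θ) x‖ₑ ^ 2 := (lintegral_fourierInv_sq hθ.integrable_hat hh2).symm
    _ = ∫⁻ x, ‖θ x‖ₑ ^ 2 := by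
        refine lintegral_congr fun x => ?_
        have h3 : 𝓕⁻ (hat θ) x = θ x := by rw [fourierInv_eq']; exact hθ.fourierInv_hat x
        rw [h3, ← ofReal_norm, ← ofReal_norm, norm_real]

/-! ### The fractional Laplacian in `L²` and the Gagliardo seminorm -/

lemma IsTest.lintegral_hat_sq {θ} (hθ : IsTest θ) : ∫⁻ ξ, ‖hat θ ξ‖ₑ ^ 2 = ∫⁻ x, ‖θ x‖ₑ ^ 2 := by
  have hh2 : MemLp (hat θ) 2 volume := (𝓕 hθ.toS : SchwartzMap E3 ℂ).memLp 2 volume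
  rw [← lintegral_fourierInv_sq hθ.integrable_hat hh2]; refine lintegral_congr fun x => ?_
  have h3 : 𝓕⁻ (hat θ) x = θ x := by rw [fourierInv_eq']; exact hθ.fourierInv_hat x
  rw [h3, ← ofReal_norm, ← ofReal_norm, norm_real]

lemma IsTest.translate {θ} (hθ : IsTest θ) (z : E3) : IsTest fun x => θ (x - z) :=
  ⟨hθ.1.comp (contDiff_id.sub contDiff_const), hθ.2.comp_homeomorph (Homeomorph.subRight z)⟩

lemma IsTest.neg {θ} (hθ : IsTest θ) : IsTest fun x => -θ x := ⟨hθ.1.neg, hθ.2.neg⟩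

lemma IsTest.sub {θ φ} (hθ : IsTest θ) (hφ : IsTest φ) : IsTest fun x => θ x - φ x := by
  simpa [sub_eq_add_neg] using hθ.add hφ.neg

lemma hat_eq (θ : E3 → ℝ) (ξ : E3) :
    hat θ ξ = ∫ v : E3, exp (↑(-2 * π * ⟪v, ξ⟫) * I) * (θ v : ℂ) := by
  unfold hat; rw [Real.fourier_eq']; rfl

lemma IsTest.integrable_hat_integrand {θ} (hθ : IsTest θ) (ξ : E3) :
    Integrable fun v : E3 => exp (↑(-2 * π * ⟪v, ξ⟫) * I) * (θ v : ℂ) := by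
  refine hθ.integrable.norm.mono' ?_ (.of_forall fun v => ?_)
  · exact (Continuous.aestronglyMeasurable (by fun_prop)).mul (hθ.integrable.ofReal (𝕜 := ℂ)).1
  · rw [norm_mul, norm_cexp_mul_I, one_mul, norm_real]

lemma IsTest.hat_sub_translate {θ} (hθ : IsTest θ) (z ξ : E3) : hat (fun x => θ x - θ (x - z)) ξ =
      (1 - exp (↑(-2 * π * ⟪z, ξ⟫) * I)) * hat θ ξ := by
  have h1 : ∫ v : E3, exp (↑(-2 * π * ⟪v, ξ⟫) * I) * (θ (v - z) : ℂ) =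
      exp (↑(-2 * π * ⟪z, ξ⟫) * I) * hat θ ξ := by
    rw [hat_eq, ← integral_const_mul, ← integral_sub_right_eq_self (fun v : E3 =>
      exp (↑(-2 * π * ⟪z, ξ⟫) * I) *
      (exp (↑(-2 * π * ⟪v, ξ⟫) * I) * (θ v : ℂ))) z]
    refine integral_congr_ae (.of_forall fun v => ?_)
    simp only; rw [← mul_assoc, ← Complex.exp_add, ← add_mul, ← Complex.ofReal_add, inner_sub_left]
    congr 4; ring
  rw [sub_mul, one_mul, ← h1, hat_eq, hat_eq, ← integral_sub (hθ.integrable_hat_integrand ξ)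
    ((hθ.translate z).integrable_hat_integrand ξ)]
  refine integral_congr_ae (.of_forall fun v => ?_)
  simp only [Complex.ofReal_sub, mul_sub]

lemma enorm_one_sub_cexp_sq (u : ℝ) : ‖1 - exp ((u : ℂ) * I)‖ₑ ^ 2 = ofReal (2 - 2 * cos u) := by
  rw [← ofReal_norm, ← ofReal_pow (norm_nonneg _), Complex.sq_norm, Complex.normSq_apply]; congr 1
  simp only [Complex.sub_re, Complex.one_re, Complex.exp_ofReal_mul_I_re, Complex.sub_im,
    Complex.one_im, Complex.exp_ofReal_mul_I_im]
  nlinarith [Real.sin_sq_add_cos_sq u]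

/-- Since the symbol of `Λ^s` is even, `Λ^s θ` is real valued before taking real parts. -/
lemma fourierInv_symbol_eq (θ : E3 → ℝ) (s : ℝ) (x : E3) :
    𝓕⁻ (fun ξ : E3 => (((2 * π * ‖ξ‖) ^ s : ℝ) : ℂ) * hat θ ξ) x = (fracLap s θ x : ℂ) := by
  have hre : (𝓕⁻ (fun ξ : E3 => (((2 * π * ‖ξ‖) ^ s : ℝ) : ℂ) * hat θ ξ) x).re
      = fracLap s θ x := rfl
  rw [← hre]; refine (Complex.conj_eq_iff_re.1 ?_).symm; rw [fourierInv_eq', ← integral_conj]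
  have hc : ∀ ξ, (starRingEnd ℂ) (hat θ ξ) = hat θ (-ξ) := by
    intro ξ; rw [hat_eq, hat_eq, ← integral_conj]; refine integral_congr_ae (.of_forall fun v => ?_)
    simp only [map_mul, Complex.conj_ofReal, ← Complex.exp_conj, Complex.conj_I, inner_neg_right]
    push_cast; ring_nf
  rw [← integral_neg_eq_self]; refine integral_congr_ae (.of_forall fun ξ => ?_)
  simp only [smul_eq_mul, map_mul, Complex.conj_ofReal, ← Complex.exp_conj, Complex.conj_I, hc,
    norm_neg, neg_neg, inner_neg_left]
  push_cast; ring_nf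

lemma IsTest.memLp_symbol {θ} (hθ : IsTest θ) {s : ℝ} (hs : 0 ≤ s) :
    Integrable (fun ξ : E3 => (((2 * π * ‖ξ‖) ^ s : ℝ) : ℂ) * hat θ ξ) ∧
    MemLp (fun ξ : E3 => (((2 * π * ‖ξ‖) ^ s : ℝ) : ℂ) * hat θ ξ) 2 := by
  have hpi := Real.pi_pos
  have hm : AEStronglyMeasurable
      (fun ξ : E3 => (((2 * π * ‖ξ‖) ^ s : ℝ) : ℂ) * hat θ ξ) volume := by
    refine AEStronglyMeasurable.mul ?_ hθ.continuous_hat.aestronglyMeasurable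
    exact (Complex.measurable_ofReal.comp
      (Measurable.pow_const (by fun_prop) s)).aestronglyMeasurable
  have hnorm : ∀ ξ, ‖(((2 * π * ‖ξ‖) ^ s : ℝ) : ℂ) * hat θ ξ‖ =
      (2 * π) ^ s * (‖ξ‖ ^ s * ‖hat θ ξ‖) := fun ξ => by
    rw [norm_mul, norm_real, norm_of_nonneg (by positivity),
      mul_rpow (by positivity) (norm_nonneg _), mul_assoc]
  refine ⟨((hθ.integrable_rpow_mul_hat hs).const_mul ((2 * π) ^ s)).mono' hm
    (.of_forall fun ξ => (hnorm ξ).le), ?_⟩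
  rw [memLp_two_iff_integrable_sq_norm hm]
  have h2 : ∀ ξ, ‖hat θ ξ‖ ≤ ∫ x, ‖(θ x : ℂ)‖ := fun ξ =>
    VectorFourier.norm_fourierIntegral_le_integral_norm _ _ _ _ _
  refine ((hθ.integrable_rpow_mul_hat (σ := 2 * s) (by positivity)).const_mul
    (((2 * π) ^ s) ^ 2 * ∫ x, ‖(θ x : ℂ)‖)).mono' (hm.norm.pow 2)
    (.of_forall fun ξ => ?_)
  rw [hnorm, norm_of_nonneg (by positivity), mul_comm 2 s, rpow_mul (norm_nonneg _),
    Real.rpow_two, mul_pow, mul_pow]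
  calc _ = ((2 * π) ^ s) ^ 2 * ((‖ξ‖ ^ s) ^ 2 * (‖hat θ ξ‖ * ‖hat θ ξ‖)) := by ring
    _ ≤ ((2 * π) ^ s) ^ 2 * ((‖ξ‖ ^ s) ^ 2 * (‖hat θ ξ‖ * ∫ x, ‖(θ x : ℂ)‖)) := by
      gcongr; exact h2 ξ
    _ = _ := by ring

/-- The Gagliardo seminorm of order `s` is controlled by `‖Λ^s f‖_{L²}`. -/
lemma exists_gagliardo_le {s} (h0 : 0 < s) (h1 : s < 1) : ∃ C : ℝ≥0∞, C ≠ ⊤ ∧ ∀ f, IsTest f →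
      ∫⁻ x, ∫⁻ z, ‖f x - f (x - z)‖ₑ ^ 2 * ofReal (‖z‖ ^ (-3 - 2 * s)) ≤
        C * ∫⁻ x, ‖fracLap s f x‖ₑ ^ 2 := by
  obtain ⟨c, hc0, hc⟩ := exists_integral_symbol (σ := 2 * s) (by linarith) (by linarith)
  have hpi := Real.pi_pos
  refine ⟨ofReal (c * (((2 * π) ^ s) ^ 2)⁻¹), ofReal_ne_top, fun f hf => ?_⟩
  have hfm : Measurable f := hf.continuous.measurable
  have hkm : Measurable fun z : E3 => ofReal (‖z‖ ^ (-3 - 2 * s)) :=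
    (Measurable.pow_const (by fun_prop) _).ennreal_ofReal
  have hin : ∀ z, ∫⁻ x, ‖f x - f (x - z)‖ₑ ^ 2 =
      ∫⁻ ξ, ofReal (2 - 2 * cos (2 * π * ⟪ξ, z⟫)) * ‖hat f ξ‖ₑ ^ 2 := by
    intro z; rw [← (hf.sub (hf.translate z)).lintegral_hat_sq]; refine lintegral_congr fun ξ => ?_
    rw [hf.hat_sub_translate, enorm_mul, mul_pow, enorm_one_sub_cexp_sq,
      show -2 * π * ⟪z, ξ⟫ = -(2 * π * ⟪ξ, z⟫) by rw [real_inner_comm]; ring,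
      Real.cos_neg]
  calc ∫⁻ x, ∫⁻ z, ‖f x - f (x - z)‖ₑ ^ 2 * ofReal (‖z‖ ^ (-3 - 2 * s))
      = ∫⁻ z, ∫⁻ x, ‖f x - f (x - z)‖ₑ ^ 2 * ofReal (‖z‖ ^ (-3 - 2 * s)) := by
        refine lintegral_lintegral_swap (Measurable.aemeasurable ?_)
        exact (((hfm.comp measurable_fst).sub (hfm.comp (measurable_fst.sub
          measurable_snd))).enorm.pow_const 2).mul (hkm.comp measurable_snd)
    _ = ∫⁻ z, ∫⁻ ξ, ofReal (2 - 2 * cos (2 * π * ⟪ξ, z⟫)) * ‖hat f ξ‖ₑ ^ 2 *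
          ofReal (‖z‖ ^ (-3 - 2 * s)) := by
        refine lintegral_congr fun z => ?_
        rw [lintegral_mul_const' _ _ ofReal_ne_top, hin z, ← lintegral_mul_const' _ _ ofReal_ne_top]
    _ = ∫⁻ ξ, ∫⁻ z, ofReal (2 - 2 * cos (2 * π * ⟪ξ, z⟫)) * ‖hat f ξ‖ₑ ^ 2 *
          ofReal (‖z‖ ^ (-3 - 2 * s)) := by
        refine lintegral_lintegral_swap (Measurable.aemeasurable ?_)
        refine Measurable.mul (Measurable.mul ?_ ?_) (hkm.comp measurable_fst)
        · exact (Continuous.measurable (by fun_prop)).ennreal_ofReal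
        · exact (hf.continuous_hat.measurable.comp measurable_snd).enorm.pow_const 2
    _ = ∫⁻ ξ, ofReal (c * ‖ξ‖ ^ (2 * s)) * ‖hat f ξ‖ₑ ^ 2 := by
        refine lintegral_congr fun ξ => ?_
        rw [← hc ξ, ofReal_integral_eq_lintegral_ofReal
          (integrable_symbol (by linarith) (by linarith) ξ) (.of_forall fun z =>
            mul_nonneg (two_sub_two_cos_nonneg _) (rpow_nonneg (norm_nonneg _) _)),
          ← lintegral_mul_const' _ _ (by finiteness)]
        refine lintegral_congr fun z => ?_
        rw [ofReal_mul (two_sub_two_cos_nonneg _)]; ring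
    _ = ∫⁻ ξ, ofReal (c * (((2 * π) ^ s) ^ 2)⁻¹) *
          ‖(((2 * π * ‖ξ‖) ^ s : ℝ) : ℂ) * hat f ξ‖ₑ ^ 2 := by
        refine lintegral_congr fun ξ => ?_
        rw [enorm_mul, mul_pow, ← mul_assoc]; congr 1
        rw [← ofReal_norm, norm_real, norm_of_nonneg (by positivity),
          ← ofReal_pow (by positivity), ← ofReal_mul (by positivity),
          mul_rpow (by positivity) (norm_nonneg _), mul_comm 2 s,
          rpow_mul (norm_nonneg _), Real.rpow_two]
        congr 1; have : (2 * π) ^ s ≠ 0 := (by positivity : (0 : ℝ) < (2 * π) ^ s).ne'; field_simp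
    _ = ofReal (c * (((2 * π) ^ s) ^ 2)⁻¹) * ∫⁻ x, ‖fracLap s f x‖ₑ ^ 2 := by
        rw [lintegral_cmul,
          ← lintegral_fourierInv_sq (hf.memLp_symbol h0.le).1 (hf.memLp_symbol h0.le).2]
        congr 1; refine lintegral_congr fun x => ?_
        rw [fourierInv_symbol_eq, ← ofReal_norm, ← ofReal_norm, norm_real]
    _ ≤ _ := le_rfl

lemma ennreal_add_sq_le (a b : ℝ≥0∞) : (a + b) ^ 2 ≤ 2 * a ^ 2 + 2 * b ^ 2 := by
  have := ENNReal.rpow_add_le_mul_rpow_add_rpow a b (p := 2) (by norm_num)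
  norm_num at this; rwa [mul_add] at this

/-- Optimization in the free parameter `t`. -/
lemma ennreal_sq_le_of_forall_mul_le {a d n} (hn0 : n ≠ 0) (hn : n ≠ ⊤)
    (h : ∀ t, 0 < t → ofReal t * a ≤ ofReal (t ^ 2) * d + n) :
    a ^ 2 ≤ 4 * d * n := by
  by_cases hd : d = ⊤
  · rw [hd, ENNReal.mul_top (by norm_num), ENNReal.top_mul hn0]; exact le_top
  have ha : a ≠ ⊤ := by
    have := h 1 one_pos
    simp only [ofReal_one, one_pow, one_mul] at this; exact ne_top_of_le_ne_top (by finiteness) this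
  lift a to ℝ≥0 using ha
  lift d to ℝ≥0 using hd
  lift n to ℝ≥0 using hn
  have h' : ∀ t, 0 ≤ (d : ℝ) * (t * t) + (-a : ℝ) * t + n := by
    intro t; rcases le_or_gt t 0 with ht | ht
    · have : 0 ≤ (a : ℝ) * (-t) := mul_nonneg a.2 (by linarith)
      have h2 : 0 ≤ (d : ℝ) * (t * t) := mul_nonneg d.2 (mul_self_nonneg t)
      have h3 : (0 : ℝ) ≤ n := n.2
      linarith
    · have h1 := h t ht
      lift t to ℝ≥0 using ht.le
      rw [← NNReal.coe_pow, ofReal_coe_nnreal, ofReal_coe_nnreal] at h1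
      have h2 : t * a ≤ t ^ 2 * d + n := by exact_mod_cast h1
      have h3 : (t : ℝ) * a ≤ t ^ 2 * d + n := by exact_mod_cast h2
      nlinarith
  have := discrim_le_zero h'
  unfold discrim at this; have h2 : (a : ℝ) ^ 2 ≤ 4 * d * n := by nlinarith
  exact_mod_cast h2

lemma volume_ball_eq (x : E3) {r} (hr : 0 < r) :
    volume (ball x r) = ofReal (r ^ 3) * volume (ball (0 : E3) 1) := by
  have := Measure.addHaar_ball_of_pos (volume : Measure E3) x hr
  simpa using this

lemma IsTest.lintegral_pow_four_ne_top {f} (hf : IsTest f) : ∫⁻ x, ‖f x‖ₑ ^ 4 ≠ ⊤ := by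
  have h := ((hf.mul hf).mul (hf.mul hf)).integrable.2
  unfold HasFiniteIntegral at h
  have e : ∀ x, ‖f x * f x * (f x * f x)‖ₑ = ‖f x‖ₑ ^ 4 := fun x => by simp only [enorm_mul]; ring
  simp only [e] at h; exact h.ne

/-- The Sobolev embedding `Ḣ^{3/4} ⊂ L⁴` in terms of the Gagliardo seminorm: with `D(x)` the
inner integral, averaging over a ball of radius `r` gives
`|f(x)|² ≲ r^{3/2} D(x) + r^{-3/2} ‖f‖₄²`, and the best choice of `r` gives
`|f(x)|⁴ ≲ D(x) ‖f‖₄²`. -/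
lemma exists_lintegral_pow_four_le : ∃ C, C ≠ ⊤ ∧ ∀ f, IsTest f → ∫⁻ x, ‖f x‖ₑ ^ 4 ≤
      C * (∫⁻ x, ∫⁻ z, ‖f x - f (x - z)‖ₑ ^ 2 * ofReal (‖z‖ ^ (-(9 / 2) : ℝ))) ^ 2 := by
  set V : ℝ≥0∞ := volume (ball (0 : E3) 1) with hV
  have hV0 : V ≠ 0 := (measure_ball_pos volume _ one_pos).ne'
  have hVt : V ≠ ⊤ := measure_ball_lt_top.ne
  set W : ℝ≥0∞ := V ^ (1 / 2 : ℝ) with hW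
  have hW2 : W ^ 2 = V := by rw [hW, ← ENNReal.rpow_two, ← ENNReal.rpow_mul]; norm_num
  have hW0 : W ≠ 0 := fun h => hV0 (by rw [← hW2, h]; simp)
  have hWt : W ≠ ⊤ := fun h => hVt (by rw [← hW2, h]; simp)
  refine ⟨((V ^ 2)⁻¹ * (16 * W)) ^ 2, by finiteness [ENNReal.inv_ne_top.2 (pow_ne_zero 2 hV0)], fun f hf => ?_⟩
  have hfm : Measurable f := hf.continuous.measurable
  set D : E3 → ℝ≥0∞ := fun x => ∫⁻ z, ‖f x - f (x - z)‖ₑ ^ 2 * ofReal (‖z‖ ^ (-(9 / 2) : ℝ)) with hD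
  have hkm : Measurable fun z : E3 => ofReal (‖z‖ ^ (-(9 / 2) : ℝ)) :=
    (Measurable.pow_const (by fun_prop) _).ennreal_ofReal
  have hDm : Measurable D := by
    refine Measurable.lintegral_prod_right' (f := fun p : E3 × E3 =>
      ‖f p.1 - f (p.1 - p.2)‖ₑ ^ 2 * ofReal (‖p.2‖ ^ (-(9 / 2) : ℝ))) ?_
    exact (((hfm.comp measurable_fst).sub (hfm.comp (measurable_fst.sub
          measurable_snd))).enorm.pow_const 2).mul (hkm.comp measurable_snd)
  set A := ∫⁻ x, ‖f x‖ₑ ^ 4 with hA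
  set N : ℝ≥0∞ := A ^ (1 / 2 : ℝ) with hN
  have hN2 : N ^ 2 = A := by rw [hN, ← ENNReal.rpow_two, ← ENNReal.rpow_mul]; norm_num
  have hAt : A ≠ ⊤ := hf.lintegral_pow_four_ne_top
  by_cases hA0 : A = 0
  · rw [hA0]; exact zero_le
  have hN0 : N ≠ 0 := fun h => hA0 (by rw [← hN2, h]; simp)
  have hNt : N ≠ ⊤ := fun h => hAt (by rw [← hN2, h]; simp)
  have hpt : ∀ x, ‖f x‖ₑ ^ 4 ≤ (V ^ 2)⁻¹ * (16 * W) * N * D x := by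
    intro x
    have key : (V * ‖f x‖ₑ ^ 2) ^ 2 ≤ 4 * (2 * D x) * (2 * (W * N)) := by
      refine ennreal_sq_le_of_forall_mul_le (by simp [hW0, hN0]) (by finiteness) fun t ht => ?_
      set r : ℝ := t ^ (2 / 3 : ℝ) with hr
      have hr0 : 0 < r := Real.rpow_pos_of_pos ht _
      have hr3 : r ^ 3 = t ^ 2 := by
        rw [hr, ← rpow_natCast, ← rpow_mul ht.le, ← rpow_natCast]; norm_num
      have hr9 : r ^ (9 / 2 : ℝ) = t ^ 3 := by rw [hr, ← rpow_mul ht.le, ← rpow_natCast]; norm_num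
      have hvol : volume (ball (0 : E3) r) = ofReal t ^ 2 * V := by
        rw [volume_ball_eq _ hr0, hr3, ofReal_pow ht.le]
      have e1 : ∫⁻ z in ball (0 : E3) r, ‖f x - f (x - z)‖ₑ ^ 2 ≤ ofReal t ^ 3 * D x := by
        rw [← ofReal_pow ht.le, ← hr9, hD, ← lintegral_cmul]
        refine (setLIntegral_mono' measurableSet_ball fun z hz => ?_).trans
          (setLIntegral_le_lintegral (ball (0 : E3) r) _)
        by_cases hz0 : z = 0
        · simp [hz0]
        · have hz1 : 0 < ‖z‖ := norm_pos_iff.2 hz0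
          have hz2 : ‖z‖ ≤ r := by simpa using (mem_ball_zero_iff.1 hz).le
          have : 1 ≤ ofReal (r ^ (9 / 2 : ℝ)) * ofReal (‖z‖ ^ (-(9 / 2) : ℝ)) := by
            rw [← ofReal_mul (by positivity), ← ofReal_one]; refine ofReal_le_ofReal ?_
            rw [rpow_neg hz1.le, ← div_eq_mul_inv, one_le_div (by positivity)]; gcongr
          calc ‖f x - f (x - z)‖ₑ ^ 2 = ‖f x - f (x - z)‖ₑ ^ 2 * 1 := (mul_one _).symm
            _ ≤ ‖f x - f (x - z)‖ₑ ^ 2 * (ofReal (r ^ (9 / 2 : ℝ)) *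
                  ofReal (‖z‖ ^ (-(9 / 2) : ℝ))) := by gcongr
            _ = _ := by ring
      have e2 : ∫⁻ z in ball (0 : E3) r, ‖f (x - z)‖ₑ ^ 2 ≤ ofReal t * (W * N) := by
        have h1 := sq_lintegral_mul_le (volume.restrict (ball (0 : E3) r))
          (f := fun _ => 1) (g := fun z => ‖f (x - z)‖ₑ ^ 2) (by fun_prop)
          ((hfm.comp (measurable_const.sub measurable_id)).enorm.pow_const 2).aemeasurable
        simp only [one_mul, one_pow, lintegral_const, Measure.restrict_apply MeasurableSet.univ,
          univ_inter, ← pow_mul] at h1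
        have h2 : ∫⁻ z in ball (0 : E3) r, ‖f (x - z)‖ₑ ^ 4 ≤ A := by
          refine (setLIntegral_le_lintegral _ _).trans ?_
          rw [hA, lintegral_sub_left_eq_self (fun y => ‖f y‖ₑ ^ 4) x]
        rw [hvol] at h1
        have h3 : (∫⁻ z in ball (0 : E3) r, ‖f (x - z)‖ₑ ^ 2) ^ 2 ≤ (ofReal t * (W * N)) ^ 2 := by
          refine h1.trans ?_
          rw [mul_pow, mul_pow, hW2, hN2, ← mul_assoc]; norm_num; gcongr
        exact (ENNReal.pow_le_pow_left_iff (by norm_num)).1 h3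
      have e3 : ofReal t ^ 2 * V * ‖f x‖ₑ ^ 2 ≤
          2 * (ofReal t ^ 3 * D x) + 2 * (ofReal t * (W * N)) := by
        calc ofReal t ^ 2 * V * ‖f x‖ₑ ^ 2 = ∫⁻ z in ball (0 : E3) r, ‖f x‖ₑ ^ 2 := by
              rw [lintegral_const, Measure.restrict_apply MeasurableSet.univ, univ_inter, hvol,
                mul_comm]
          _ ≤ ∫⁻ z in ball (0 : E3) r, (2 * ‖f x - f (x - z)‖ₑ ^ 2 + 2 * ‖f (x - z)‖ₑ ^ 2) := by
              refine lintegral_mono fun z => ?_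
              have h1 : ‖f x‖ₑ ≤ ‖f x - f (x - z)‖ₑ + ‖f (x - z)‖ₑ := by
                simpa using enorm_add_le (f x - f (x - z)) (f (x - z))
              exact (pow_le_pow_left' h1 2).trans (ennreal_add_sq_le _ _)
          _ ≤ _ := by
              rw [lintegral_add_left (by fun_prop), lintegral_cmul, lintegral_cmul]; gcongr
      have ht0 : ofReal t ≠ 0 := by simpa using ht
      have e4 : ofReal t * (ofReal t * (V * ‖f x‖ₑ ^ 2)) ≤
          ofReal t * (ofReal (t ^ 2) * (2 * D x) + 2 * (W * N)) := by
        rw [ofReal_pow ht.le]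
        calc _ = ofReal t ^ 2 * V * ‖f x‖ₑ ^ 2 := by ring
          _ ≤ _ := e3
          _ = _ := by ring
      exact (ENNReal.mul_le_mul_iff_right ht0 ofReal_ne_top).1 e4
    rw [mul_pow, ← pow_mul] at key; have hV20 : V ^ 2 ≠ 0 := pow_ne_zero 2 hV0
    have hV2t : V ^ 2 ≠ ⊤ := by finiteness
    calc ‖f x‖ₑ ^ 4 = (V ^ 2)⁻¹ * (V ^ 2 * ‖f x‖ₑ ^ (2 * 2)) := by
          rw [← mul_assoc, ENNReal.inv_mul_cancel hV20 hV2t, one_mul]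
      _ ≤ (V ^ 2)⁻¹ * (4 * (2 * D x) * (2 * (W * N))) := by gcongr
      _ = _ := by ring
  have hint : N * N ≤ N * ((V ^ 2)⁻¹ * (16 * W) * ∫⁻ x, D x) := by
    calc N * N = A := by rw [← sq, hN2]
      _ ≤ ∫⁻ x, (V ^ 2)⁻¹ * (16 * W) * N * D x := lintegral_mono hpt
      _ = _ := by rw [lintegral_const_mul _ hDm]; ring
  have hfin := (ENNReal.mul_le_mul_iff_right hN0 hNt).1 hint
  calc A = N ^ 2 := hN2.symm
    _ ≤ ((V ^ 2)⁻¹ * (16 * W) * ∫⁻ x, D x) ^ 2 := by gcongr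
    _ = _ := by rw [mul_pow]

section

/-! ### The Sobolev inequality and mollification in space -/

lemma lintegral_ofReal_pker_lt_top {a b} (ha : a < 3) (hb : 3 < b) :
    ∫⁻ z, ofReal (pker a b z) < ⊤ := by
  have h := (integrable_pker ha hb).2
  unfold HasFiniteIntegral at h; simpa only [enorm_of_nonneg (pker_nonneg a b _)] using h

/-- The Sobolev inequality for `s ≥ 3/4`, on test functions. -/
lemma exists_sobolev {s} (hs : s ∈ Ico (3 / 4) 1) : ∃ C, C ≠ ⊤ ∧ ∀ f, IsTest f →
      ∫⁻ x, ‖f x‖ₑ ^ 4 ≤ C * ((∫⁻ x, ‖fracLap s f x‖ₑ ^ 2) + ∫⁻ x, ‖f x‖ₑ ^ 2) ^ 2 := by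
  obtain ⟨C1, hC1, h1⟩ := exists_lintegral_pow_four_le
  obtain ⟨C2, hC2, h2⟩ := exists_gagliardo_le (s := s) (by linarith [hs.1]) hs.2
  set k : E3 → ℝ≥0∞ := fun z => ofReal (pker 0 (9 / 2) z) with hk
  have hkm : Measurable k := (measurable_pker _ _).ennreal_ofReal
  have hkt : ∫⁻ z, k z ≠ ⊤ := (lintegral_ofReal_pker_lt_top (by norm_num) (by norm_num)).ne
  refine ⟨C1 * (C2 + 4 * ∫⁻ z, k z) ^ 2, by finiteness, fun f hf => (h1 f hf).trans ?_⟩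
  have hfm : Measurable f := hf.continuous.measurable
  rw [mul_assoc, ← mul_pow]; gcongr
  have hrm : Measurable fun z : E3 => ofReal (‖z‖ ^ (-3 - 2 * s)) :=
    (Measurable.pow_const (by fun_prop) _).ennreal_ofReal
  have hdm : Measurable fun p : E3 × E3 => ‖f p.1 - f (p.1 - p.2)‖ₑ ^ 2 :=
    ((hfm.comp measurable_fst).sub (hfm.comp (measurable_fst.sub measurable_snd))).enorm.pow_const 2
  -- increments with `|z| < 1` go into the seminorm of order `s`, the others into the `L²` norm
  have hker : ∀ z, ofReal (‖z‖ ^ (-(9 / 2) : ℝ)) ≤ ofReal (‖z‖ ^ (-3 - 2 * s)) + k z := by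
    intro z; rcases lt_or_ge ‖z‖ 1 with hz | hz
    · refine le_trans (ofReal_le_ofReal ?_) le_self_add
      rcases (norm_nonneg z).eq_or_lt with h0 | h0
      · rw [← h0, Real.zero_rpow (by norm_num), Real.zero_rpow (by linarith [hs.1])]
      · exact Real.rpow_le_rpow_of_exponent_ge h0 hz.le (by linarith [hs.1])
    · refine le_trans (le_of_eq ?_) le_add_self
      simp only [hk, pker, not_lt.2 hz, if_false]
  have hfar : ∫⁻ x, ∫⁻ z, ‖f x - f (x - z)‖ₑ ^ 2 * k z ≤ 4 * (∫⁻ z, k z) * ∫⁻ x, ‖f x‖ₑ ^ 2 := by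
    rw [lintegral_lintegral_swap (hdm.mul (hkm.comp measurable_snd)).aemeasurable]
    calc ∫⁻ z, ∫⁻ x, ‖f x - f (x - z)‖ₑ ^ 2 * k z ≤ ∫⁻ z, (4 * ∫⁻ x, ‖f x‖ₑ ^ 2) * k z := by
          refine lintegral_mono fun z => ?_
          rw [lintegral_mul_const' _ _ ofReal_ne_top]; gcongr
          calc ∫⁻ x, ‖f x - f (x - z)‖ₑ ^ 2 ≤ ∫⁻ x, (2 * ‖f x‖ₑ ^ 2 + 2 * ‖f (x - z)‖ₑ ^ 2) := by
                refine lintegral_mono fun x => ?_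
                exact (pow_le_pow_left' enorm_sub_le 2).trans (ennreal_add_sq_le _ _)
            _ = 4 * ∫⁻ x, ‖f x‖ₑ ^ 2 := by
                rw [lintegral_add_left (by fun_prop), lintegral_cmul, lintegral_cmul,
                  lintegral_sub_right_eq_self (fun x => ‖f x‖ₑ ^ 2) z]
                ring
      _ = _ := by rw [lintegral_const_mul _ hkm]; ring
  calc ∫⁻ x, ∫⁻ z, ‖f x - f (x - z)‖ₑ ^ 2 * ofReal (‖z‖ ^ (-(9 / 2) : ℝ))
      ≤ ∫⁻ x, ∫⁻ z, (‖f x - f (x - z)‖ₑ ^ 2 * ofReal (‖z‖ ^ (-3 - 2 * s)) +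
          ‖f x - f (x - z)‖ₑ ^ 2 * k z) := by
        refine lintegral_mono fun x => lintegral_mono fun z => ?_
        rw [← mul_add]; gcongr; exact hker z
    _ = ∫⁻ x, ((∫⁻ z, ‖f x - f (x - z)‖ₑ ^ 2 * ofReal (‖z‖ ^ (-3 - 2 * s))) +
          ∫⁻ z, ‖f x - f (x - z)‖ₑ ^ 2 * k z) := by
        refine lintegral_congr fun x => ?_
        exact lintegral_add_left ((hdm.comp (measurable_const.prodMk measurable_id)).mul hrm) _
    _ = (∫⁻ x, ∫⁻ z, ‖f x - f (x - z)‖ₑ ^ 2 * ofReal (‖z‖ ^ (-3 - 2 * s))) +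
          ∫⁻ x, ∫⁻ z, ‖f x - f (x - z)‖ₑ ^ 2 * k z := by
        refine lintegral_add_left ?_ _
        exact Measurable.lintegral_prod_right' (hdm.mul (hrm.comp measurable_snd))
    _ ≤ C2 * (∫⁻ x, ‖fracLap s f x‖ₑ ^ 2) + 4 * (∫⁻ z, k z) * ∫⁻ x, ‖f x‖ₑ ^ 2 :=
        add_le_add (h2 f hf) hfar
    _ ≤ (C2 + 4 * ∫⁻ z, k z) * (∫⁻ x, ‖fracLap s f x‖ₑ ^ 2) +
          (C2 + 4 * ∫⁻ z, k z) * ∫⁻ x, ‖f x‖ₑ ^ 2 := by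
        gcongr
        · exact le_self_add
        · exact le_add_self
    _ = _ := (mul_add _ _ _).symm

variable {F : Type*} [NormedAddCommGroup F] [NormedSpace ℝ F]

lemma exists_enorm_le_wgt {F : Type*} [NormedAddCommGroup F] {θ : E3 → F} (hc : Continuous θ) (hs : HasCompactSupport θ) :
    ∃ C, C ≠ ⊤ ∧ ∀ x, ‖θ x‖ₑ ≤ C * wgt x := by
  obtain ⟨B, hB⟩ := hs.exists_bound_of_continuous hc
  obtain ⟨R, hR⟩ := hs.isCompact.isBounded.exists_norm_le
  set R' := max R 1
  refine ⟨ofReal (B * R' ^ (7 / 2 : ℝ)), ofReal_ne_top, fun x => ?_⟩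
  have hR0 : 0 < R' := lt_max_of_lt_right one_pos
  by_cases hx : x ∈ tsupport θ
  · have h1 := le_pker_zero (b := 7 / 2) (by norm_num) (le_max_right R 1)
      ((hR x hx).trans (le_max_left R 1))
    have hB0 : 0 ≤ B := (norm_nonneg _).trans (hB x)
    unfold wgt; rw [← ofReal_mul (by positivity), ← ofReal_norm]
    refine ofReal_le_ofReal ((hB x).trans ?_)
    rw [rpow_neg hR0.le] at h1
    calc B = B * R' ^ (7 / 2 : ℝ) * (R' ^ (7 / 2 : ℝ))⁻¹ := by field_simp
      _ ≤ _ := by gcongr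
  · simp [image_eq_zero_of_notMem_tsupport hx]

lemma WInt.integrable_smul {f : E3 → F} (hf : WInt f) {θ} (hθ : IsTest θ) :
    Integrable fun x => θ x • f x := by
  obtain ⟨C, hC, h⟩ := exists_enorm_le_wgt hθ.continuous hθ.2
  refine ⟨hθ.continuous.aestronglyMeasurable.smul hf.1, ?_⟩
  refine lt_of_le_of_lt (b := ∫⁻ x, C * (‖f x‖ₑ * wgt x)) (lintegral_mono fun x => ?_) ?_
  · rw [enorm_smul]
    calc ‖θ x‖ₑ * ‖f x‖ₑ ≤ C * wgt x * ‖f x‖ₑ := by gcongr; exact h x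
      _ = _ := by ring
  · rw [lintegral_const_mul' _ _ hC]; exact mul_lt_top hC.lt_top hf.2

/-- The convolution of an integrable function with a test function. -/
def moll (η : E3 → ℝ) (g : E3 → ℝ) (x : E3) : ℝ := ∫ y, η (x - y) * g y

lemma moll_eq_convolution (η g : E3 → ℝ) :
    moll η g = MeasureTheory.convolution η g (ContinuousLinearMap.lsmul ℝ ℝ) volume := by
  funext x; rw [convolution_eq_swap]; rfl

lemma IsTest.moll {η} (hη : IsTest η) {g} (hg : LocallyIntegrable g)
    (hgc : HasCompactSupport g) : IsTest (moll η g) := by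
  rw [moll_eq_convolution]; exact ⟨hη.2.contDiff_convolution_left _ hη.1 hg, hη.2.convolution _ hgc⟩

lemma IsTest.reflect {η} (hη : IsTest η) (x : E3) : IsTest fun y => η (x - y) :=
  ⟨hη.1.comp (contDiff_const.sub contDiff_id), hη.2.comp_homeomorph (Homeomorph.subLeft x)⟩

/-- The fractional Laplacian of a mollification. -/
lemma fracLap_moll {s} (h0 : 0 < s) (h1 : s < 1) {η} (hη : IsTest η) {g}
    (hg : Integrable g) (hgc : HasCompactSupport g) (x : E3) :
    fracLap s (moll η g) x = ∫ y, fracLap s (fun y' => η (x - y')) y * g y := by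
  obtain ⟨c, -, hc⟩ := exists_fracLap_eq_of_lt_one h0 h1
  obtain ⟨L, hL, hinc⟩ := hη.exists_increment_bound s
  rw [(hc _ (hη.moll hg.locallyIntegrable hgc) x).2]
  have hηi : ∀ x, Integrable fun y => η (x - y) * g y := fun x => by
    obtain ⟨B, hB, hB'⟩ := hη.exists_bound
    refine hg.bdd_mul (c := B) (hη.reflect x).continuous.aestronglyMeasurable
      (.of_forall fun y => hB' _)
  have e1 : ∀ z, (moll η g x - moll η g z) * ‖x - z‖ ^ (-3 - s) =
      ∫ y, (η (x - y) - η (z - y)) * ‖x - z‖ ^ (-3 - s) * g y := by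
    intro z; unfold moll; rw [← integral_sub (hηi x) (hηi z), ← integral_mul_const]; congr 1
    funext y; ring
  have e2 : ∀ y, fracLap s (fun y' => η (x - y')) y * g y =
      c * ∫ z, (η (x - y) - η (z - y)) * ‖x - z‖ ^ (-3 - s) * g y := by
    intro y
    rw [(hc _ (hη.reflect x) y).2, ← integral_sub_left_eq_self _ volume (x + y), mul_assoc,
      ← integral_mul_const]
    congr 2; funext z; have i1 : x - (x + y - z) = z - y := by abel
    have i2 : y - (x + y - z) = -(x - z) := by abel
    simp only [i1, i2, norm_neg]
  simp_rw [e1, e2]; rw [integral_const_mul, integral_integral_swap]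
  have hmaj : Integrable (fun p : E3 × E3 => L * pker (2 + s) (3 + s) (x - p.1) * ‖g p.2‖)
      (volume.prod volume) := by
    have hk : Integrable fun z : E3 => L * pker (2 + s) (3 + s) (x - z) :=
      ((integrable_pker (by linarith) (by linarith)).comp_sub_left x).const_mul L
    exact hk.mul_prod hg.norm
  refine hmaj.mono' ?_ (.of_forall fun p => ?_)
  · refine AEStronglyMeasurable.mul ?_ hg.1.comp_snd
    refine Measurable.aestronglyMeasurable ?_
    have := hη.continuous.measurable
    refine Measurable.mul ?_ (Measurable.pow_const (by fun_prop) _)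
    exact (this.comp (by fun_prop)).sub (this.comp (by fun_prop))
  · simp only [uncurry]
    rw [norm_mul, norm_mul, norm_eq_abs, norm_of_nonneg (rpow_nonneg (norm_nonneg _) _)]
    have := hinc (x - p.2) (p.1 - p.2)
    rw [sub_sub_sub_cancel_right] at this; gcongr

lemma lintegral_lconv_sq_le_of_aemeasurable {k f} (hk : Measurable k)
    (hf : AEMeasurable f) : ∫⁻ x, lconv k f x ^ 2 ≤ (∫⁻ z, k z) ^ 2 * ∫⁻ x, f x ^ 2 := by
  have e : ∀ x, lconv k f x = lconv k (hf.mk f) x := fun x => by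
    rw [lconv_eq_swap, lconv_eq_swap]
    exact lintegral_congr_ae (by filter_upwards [hf.ae_eq_mk] with y hy; rw [hy])
  simp_rw [e]; refine (lintegral_lconv_sq_le hk hf.measurable_mk).trans (le_of_eq ?_)
  congr 1; exact lintegral_congr_ae (by filter_upwards [hf.ae_eq_mk] with y hy; rw [hy])

lemma lintegral_moll_sq_le {η} (hη : IsTest η) {g} (hg : AEStronglyMeasurable g) :
    ∫⁻ x, ‖moll η g x‖ₑ ^ 2 ≤ (∫⁻ z, ‖η z‖ₑ) ^ 2 * ∫⁻ x, ‖g x‖ₑ ^ 2 := by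
  refine le_trans (lintegral_mono fun x => ?_) (lintegral_lconv_sq_le_of_aemeasurable
    hη.continuous.measurable.enorm hg.enorm)
  gcongr; rw [lconv_eq_swap]
  refine (enorm_integral_le_lintegral_enorm _).trans (le_of_eq ?_)
  simp only [enorm_mul]

/-- Localization of the Sobolev inequality to `w U`, where `Λ^s U = G`; the commutator `[Λ^s, w] U`
enters through its kernel. -/
lemma exists_sobolev_mul {s} (hs : s ∈ Ico (3 / 4) 1) : ∃ C, C ≠ ⊤ ∧
    ∀ U G w, WInt U → LocallyIntegrable G → IsTest w →
      (∀ θ, IsTest θ → Integrable (fun x => fracLap s θ x * U x) ∧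
        ∫ x, θ x * G x = ∫ x, fracLap s θ x * U x) →
      ∫⁻ x, ‖w x * U x‖ₑ ^ 4 ≤ C * ((∫⁻ x, ‖w x * G x‖ₑ ^ 2) + (∫⁻ x, ‖commK s w U x‖ₑ ^ 2) +
        ∫⁻ x, ‖w x * U x‖ₑ ^ 2) ^ 2 := by
  have h0 : 1 / 2 ≤ s := by linarith [hs.1]
  obtain ⟨C, hC, hsob⟩ := exists_sobolev hs
  obtain ⟨c, hc0, hcomm⟩ := exists_commutator_duality (F := ℝ) h0 hs.2
  refine ⟨C * (2 + 2 * ofReal c ^ 2) ^ 2, by finiteness, fun U G w hU hG hw hUG => ?_⟩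
  have hcK : LocallyIntegrable fun x => c * commK s w U x :=
    (locallyIntegrable_commK h0 hs.2 hw hU).smul c
  have hg : Integrable fun x => w x * U x := hU.integrable_smul hw
  have hgc : HasCompactSupport fun x => w x * U x := hw.2.mul_right
  have hwG : Integrable fun x => w x * G x :=
    hG.integrable_smul_left_of_hasCompactSupport hw.continuous hw.2
  set h : E3 → ℝ := fun x => w x * G x + c * commK s w U x with hh
  have hhl : LocallyIntegrable h := hwG.locallyIntegrable.add hcK
  -- the identity `Λ^s (η * (w U)) = η * (w G + c [Λ^s, w] U)`
  have hid : ∀ η, IsTest η → ∀ x, fracLap s (moll η fun x => w x * U x) x = moll η h x := by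
    intro η hη x; have hη' := hη.reflect x; obtain ⟨i1, e1⟩ := hcomm w _ hw hη' U hU
    obtain ⟨i2, e2⟩ := hUG _ (hw.mul hη')
    rw [fracLap_moll (by linarith) hs.2 hη hg hgc x]; simp only [smul_eq_mul] at e1 i1
    have e3 : ∀ y, fracLap s (fun y' => η (x - y')) y * (w y * U y) =
        (w y * fracLap s (fun y' => η (x - y')) y -
          fracLap s (fun y' => w y' * η (x - y')) y) * U y +
          fracLap s (fun y' => w y' * η (x - y')) y * U y := fun y => by ring
    simp_rw [e3]; rw [integral_add i1 i2, e1, ← e2]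
    have j1 : Integrable fun y => η (x - y) * (c * commK s w U y) :=
      hcK.integrable_smul_left_of_hasCompactSupport hη'.continuous hη'.2
    have j2 : Integrable fun y => w y * η (x - y) * G y :=
      hG.integrable_smul_left_of_hasCompactSupport (hw.mul hη').continuous (hw.mul hη').2
    rw [← integral_add j1 j2]; unfold moll; congr 1; funext y; simp only [hh]; ring
  -- mollifiers
  let b : ℕ → ContDiffBump (0 : E3) := fun n =>
    ⟨ϵ[n] / 2, ϵ[n], by positivity, half_lt_self (by positivity)⟩
  have hb0 : Tendsto (fun n => (b n).rOut) atTop (𝓝 0) := by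
    have := tendsto_one_div_add_atTop_nhds_zero_nat (𝕜 := ℝ)
    simpa [b] using this
  have hbt : ∀ n, IsTest ((b n).normed volume) := fun n =>
    ⟨(b n).contDiff_normed, (b n).hasCompactSupport_normed⟩
  have hb1 : ∀ n, ∫⁻ z, ‖(b n).normed volume z‖ₑ = 1 := fun n => by
    simp only [enorm_of_nonneg ((b n).nonneg_normed _)]
    rw [← ofReal_integral_eq_lintegral_ofReal (b n).integrable_normed
      (.of_forall fun x => (b n).nonneg_normed x), (b n).integral_normed,
      ofReal_one]
  have hlim : ∀ᵐ x, Tendsto (fun n => moll ((b n).normed volume) (fun x => w x * U x) x) atTop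
      (𝓝 (w x * U x)) := by
    have := ContDiffBump.ae_convolution_tendsto_right_of_locallyIntegrable (μ := volume) (K := 2)
      (φ := b) (g := fun x => w x * U x) hb0 (.of_forall fun n => by
        simp only [b]; linarith [mul_div_cancel₀ (ϵ[n]) (two_ne_zero' ℝ)]) hg.locallyIntegrable
    simpa only [← moll_eq_convolution] using this
  set X := (∫⁻ x, ‖w x * G x‖ₑ ^ 2) + (∫⁻ x, ‖commK s w U x‖ₑ ^ 2) + ∫⁻ x, ‖w x * U x‖ₑ ^ 2 with hX
  have hbound : ∀ n, ∫⁻ x, ‖moll ((b n).normed volume) (fun x => w x * U x) x‖ₑ ^ 4 ≤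
      C * (2 + 2 * ofReal c ^ 2) ^ 2 * X ^ 2 := by
    intro n; refine (hsob _ ((hbt n).moll hg.locallyIntegrable hgc)).trans ?_
    rw [mul_assoc, ← mul_pow]; gcongr
    have hh2 : ∫⁻ x, ‖h x‖ₑ ^ 2 ≤ 2 * (∫⁻ x, ‖w x * G x‖ₑ ^ 2) +
        2 * (ofReal c ^ 2 * ∫⁻ x, ‖commK s w U x‖ₑ ^ 2) := by
      rw [← lintegral_cmul, ← lintegral_cmul, ← lintegral_cmul,
        ← lintegral_add_left' ((hwG.1.enorm.pow_const 2).const_mul 2)]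
      refine lintegral_mono fun x => ?_
      refine (pow_le_pow_left' (enorm_add_le _ _) 2).trans ((ennreal_add_sq_le _ _).trans ?_)
      rw [enorm_mul c, mul_pow (‖c‖ₑ), enorm_of_nonneg hc0.le]
    calc _ ≤ (∫⁻ x, ‖h x‖ₑ ^ 2) + ∫⁻ x, ‖w x * U x‖ₑ ^ 2 := by
          simp only [hid _ (hbt n)]
          have a1 := lintegral_moll_sq_le (hbt n) hhl.aestronglyMeasurable
          have a2 := lintegral_moll_sq_le (hbt n) hg.1
          rw [hb1, one_pow, one_mul] at a1 a2; exact add_le_add a1 a2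
      _ ≤ _ := add_le_add_left hh2 _
      _ ≤ (2 + 2 * ofReal c ^ 2) * (∫⁻ x, ‖w x * G x‖ₑ ^ 2) +
            (2 + 2 * ofReal c ^ 2) * (∫⁻ x, ‖commK s w U x‖ₑ ^ 2) +
            (2 + 2 * ofReal c ^ 2) * ∫⁻ x, ‖w x * U x‖ₑ ^ 2 := by
          rw [← mul_assoc 2]; gcongr
          · exact le_self_add
          · exact le_add_self
          · refine le_mul_of_one_le_left zero_le ?_
            exact le_trans (by norm_num) (le_self_add (a := (2 : ℝ≥0∞)))
      _ = _ := by rw [hX]; ring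
  calc ∫⁻ x, ‖w x * U x‖ₑ ^ 4
      = ∫⁻ x, liminf (fun n => ‖moll ((b n).normed volume) (fun x => w x * U x) x‖ₑ ^ 4) atTop := by
        refine lintegral_congr_ae ?_
        filter_upwards [hlim] with x hx
        exact (((ENNReal.continuous_pow 4).tendsto _).comp
          ((continuous_enorm.tendsto _).comp hx)).liminf_eq.symm
    _ ≤ liminf (fun n => ∫⁻ x, ‖moll ((b n).normed volume) (fun x => w x * U x) x‖ₑ ^ 4) atTop :=
        lintegral_liminf_le fun n => by
          have := ((hbt n).moll hg.locallyIntegrable hgc).continuous.measurable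
          exact this.enorm.pow_const 4
    _ ≤ _ := by
        refine (liminf_le_liminf (.of_forall hbound)).trans ?_
        simp

end

/-! ### Multipliers and local `L⁴` bounds -/

/-- The modulus of continuity `min (|z|, |z|^{1/2})`. Multiplied by `|z|^{-3-s}` it is integrable for
`1/2 < s < 1`. -/
def modc (z : E3) : ℝ := min ‖z‖ (√‖z‖)

lemma modc_nonneg (z : E3) : 0 ≤ modc z := le_min (norm_nonneg _) (Real.sqrt_nonneg _)

lemma modc_neg (z : E3) : modc (-z) = modc z := by simp [modc]

lemma modc_le_norm (z : E3) : modc z ≤ ‖z‖ := min_le_left _ _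

lemma le_modc {d A} {z} (hA : 0 ≤ A) (h1 : d ≤ A * ‖z‖) (h2 : d ≤ A) : d ≤ A * modc z := by
  unfold modc; rcases le_or_gt ‖z‖ 1 with h | h
  · rw [min_eq_left]
    · exact h1
    · exact Real.le_sqrt_of_sq_le (by nlinarith [norm_nonneg z])
  · have h3 : 1 ≤ √‖z‖ := Real.one_le_sqrt.2 h.le
    refine h2.trans (le_mul_of_one_le_right hA (le_min h.le h3))

lemma modc_mul_rpow_le (s : ℝ) (z : E3) : modc z * ‖z‖ ^ (-3 - s) ≤ pker (2 + s) (5 / 2 + s) z := by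
  have hz := norm_nonneg z
  rw [← one_mul (pker _ _ _)]; refine le_mul_pker (fun h => ?_) (fun h => ?_)
  · rcases hz.eq_or_lt with h0 | h0
    · have : modc z = 0 := le_antisymm (by simpa [← h0] using modc_le_norm z) (modc_nonneg z)
      rw [this, zero_mul, one_mul]; exact rpow_nonneg hz _
    · calc modc z * ‖z‖ ^ (-3 - s) ≤ ‖z‖ * ‖z‖ ^ (-3 - s) := by gcongr; exact modc_le_norm z
        _ = ‖z‖ ^ (1 + (-3 - s)) := by rw [rpow_add h0, Real.rpow_one]
        _ = _ := by rw [one_mul]; ring_nf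
  · have h0 : 0 < ‖z‖ := by linarith
    calc modc z * ‖z‖ ^ (-3 - s) ≤ √‖z‖ * ‖z‖ ^ (-3 - s) := by gcongr; exact min_le_right _ _
      _ = ‖z‖ ^ ((1 / 2 : ℝ) + (-3 - s)) := by rw [rpow_add h0, sqrt_eq_rpow]
      _ = _ := by rw [one_mul]; ring_nf

/-- The integrable kernel that dominates all commutators. -/
def ker (s : ℝ) (z : E3) : ℝ≥0∞ := ofReal (pker (2 + s) (5 / 2 + s) z)

@[fun_prop]
lemma measurable_ker (s : ℝ) : Measurable (ker s) := (measurable_pker _ _).ennreal_ofReal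

lemma lintegral_ker_lt_top {s} (h0 : 1 / 2 < s) (h1 : s < 1) : ∫⁻ z, ker s z < ⊤ :=
  lintegral_ofReal_pker_lt_top (by linarith) (by linarith)

lemma ofReal_modc_le_ker {A d} {s} {z} (hA : 0 ≤ A) (h : d ≤ A * modc z) :
    ofReal (d * ‖z‖ ^ (-3 - s)) ≤ ofReal A * ker s z := by
  unfold ker; rw [← ofReal_mul hA]; refine ofReal_le_ofReal ?_
  calc d * ‖z‖ ^ (-3 - s) ≤ A * modc z * ‖z‖ ^ (-3 - s) := by gcongr
    _ = A * (modc z * ‖z‖ ^ (-3 - s)) := mul_assoc _ _ _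
    _ ≤ _ := by gcongr; exact modc_mul_rpow_le s z

/-- A smooth multiplier with values in `[0, 1]` whose modulus of continuity is at most
`κ min (|z|, |z|^{1/2})`. The cutoffs `χ_R` satisfy this with `κ` of order `R^{-1/2}`. -/
structure IsMult (κ : ℝ) (χ : E3 → ℝ) : Prop where
  smooth : ContDiff ℝ (⊤ : ℕ∞) χ
  nonneg : ∀ x, 0 ≤ χ x
  le_one : ∀ x, χ x ≤ 1
  kappa_nonneg : 0 ≤ κ
  sub_le : ∀ x y, |χ x - χ y| ≤ κ * modc (x - y)

lemma IsMult.measurable {κ χ} (hχ : IsMult κ χ) : Measurable χ := hχ.smooth.continuous.measurable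

lemma IsMult.one : IsMult 0 fun _ => 1 :=
  ⟨contDiff_const, fun _ => zero_le_one, fun _ => le_rfl, le_rfl, fun x y => by simp⟩

/-- The standard bump: `1` on the unit ball and supported in the ball of radius `2`. -/
def bump0 : ContDiffBump (0 : E3) := ⟨1, 2, one_pos, one_lt_two⟩

/-- The bump adapted to the ball `B_r(m)`. -/
def bumpAt (r : ℝ) (m : E3) (x : E3) : ℝ := bump0 (r⁻¹ • (x - m))

lemma bump0_isTest : IsTest bump0 := ⟨bump0.contDiff, bump0.hasCompactSupport⟩

lemma bumpAt_isTest {r} (hr : 0 < r) (m : E3) : IsTest (bumpAt r m) := by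
  have hc : ContDiff ℝ (⊤ : ℕ∞) fun x : E3 => r⁻¹ • (x - m) := by fun_prop
  refine ⟨bump0_isTest.1.comp hc, ?_⟩
  have h := bump0_isTest.2.comp_homeomorph
    ((Homeomorph.subRight m).trans (Homeomorph.smulOfNeZero r⁻¹ (inv_ne_zero hr.ne')))
  exact h

lemma bumpAt_nonneg (r : ℝ) (m x : E3) : 0 ≤ bumpAt r m x := bump0.nonneg

lemma bumpAt_le_one (r : ℝ) (m x : E3) : bumpAt r m x ≤ 1 := bump0.le_one

lemma bumpAt_eq_one {r} (hr : 0 < r) {m x} (h : dist x m ≤ r) : bumpAt r m x = 1 := by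
  refine bump0.one_of_mem_closedBall ?_
  rw [mem_closedBall_zero_iff, norm_smul, norm_inv, norm_of_nonneg hr.le, ← dist_eq_norm]
  exact (inv_mul_le_one₀ hr).2 h

lemma bumpAt_eq_zero {r} (hr : 0 < r) {m x} (h : 2 * r ≤ dist x m) : bumpAt r m x = 0 := by
  refine bump0.zero_of_le_dist ?_
  rw [dist_zero_right, norm_smul, norm_inv, norm_of_nonneg hr.le, ← dist_eq_norm]
  rw [le_inv_mul_iff₀ hr, mul_comm]; exact h

lemma exists_bumpAt_lipschitz : ∃ L, 1 ≤ L ∧ ∀ r, 0 < r → ∀ m x y,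
    |bumpAt r m x - bumpAt r m y| ≤ L / r * ‖x - y‖ := by
  obtain ⟨L, hL, h⟩ := bump0_isTest.exists_lipschitz
  refine ⟨L + 1, by linarith, fun r hr m x y => ?_⟩
  refine (h _ _).trans ?_
  rw [← smul_sub, norm_smul, norm_inv, norm_of_nonneg hr.le, sub_sub_sub_cancel_right,
    ← mul_assoc, div_eq_mul_inv]
  gcongr; linarith

/-- The constant in `exists_bumpAt_lipschitz`. -/
def bumpL : ℝ := exists_bumpAt_lipschitz.choose

lemma one_le_bumpL : 1 ≤ bumpL := exists_bumpAt_lipschitz.choose_spec.1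

lemma bumpAt_lipschitz {r} (hr : 0 < r) (m x y : E3) :
    |bumpAt r m x - bumpAt r m y| ≤ bumpL / r * ‖x - y‖ :=
  exists_bumpAt_lipschitz.choose_spec.2 r hr m x y

lemma bumpAt_modc {r} (hr : 1 ≤ r) (m x y : E3) :
    |bumpAt r m x - bumpAt r m y| ≤ bumpL * modc (x - y) := by
  have h1 := one_le_bumpL
  have hr0 : 0 < r := by linarith
  refine le_modc (by linarith) ((bumpAt_lipschitz hr0 m x y).trans ?_) ?_
  · gcongr; exact div_le_self (by linarith) hr
  · refine le_trans ?_ h1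
    rw [abs_le]
    constructor <;> linarith [bumpAt_nonneg r m x, bumpAt_nonneg r m y, bumpAt_le_one r m x,
      bumpAt_le_one r m y]

lemma IsMult.isTest_mul {κ} {χ} (hχ : IsMult κ χ) {θ} (hθ : IsTest θ) :
    IsTest fun x => θ x * χ x := ⟨hθ.1.mul hχ.smooth, hθ.2.mul_right⟩

lemma enorm_pow_four_le_sum (v : E3) : ‖v‖ₑ ^ 4 ≤ 3 * ∑ i, ‖v i‖ₑ ^ 4 := by
  have h1 : ‖v‖ ^ 4 ≤ 3 * ∑ i, ‖v i‖ ^ 4 := by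
    have h := EuclideanSpace.norm_sq_eq v
    have h2 := sq_sum_le_card_mul_sum_sq (s := Finset.univ) (f := fun i : Fin 3 => ‖v i‖ ^ 2)
    rw [← h] at h2; simp only [← pow_mul, Finset.card_univ, Fintype.card_fin] at h2
    exact_mod_cast h2
  have h3 := ofReal_le_ofReal h1
  rw [ofReal_mul (by norm_num), ofReal_sum_of_nonneg (fun i _ => by positivity),
    ofReal_pow (norm_nonneg _), ofReal_norm] at h3
  simp only [ofReal_pow (norm_nonneg _), ofReal_norm] at h3; simpa using h3

lemma enorm_apply_le (v : E3) (i : Fin 3) : ‖v i‖ₑ ≤ ‖v‖ₑ := by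
  rw [enorm_le_iff_norm_le]; exact PiLp.norm_apply_le v i

lemma integral_apply_E3 {α : Type*} [MeasurableSpace α] {μ : Measure α} {f : α → E3}
    (hf : Integrable f μ) (i : Fin 3) : (∫ x, f x ∂μ) i = ∫ x, f x i ∂μ :=
  ((𝐩 i).integral_comp_comm hf).symm

lemma HasFracLap.apply {s} {U G} (h : HasFracLap s U G) (i : Fin 3)
    {θ} (hθ : IsTest θ) : Integrable (fun x => fracLap s θ x * U x i) ∧
      ∫ x, θ x * G x i = ∫ x, fracLap s θ x * U x i := by
  obtain ⟨h1, h2⟩ := h.2 θ hθ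
  refine ⟨(𝐩 i).integrable_comp h1, ?_⟩
  have h3 : Integrable fun x => θ x • G x :=
    h.1.integrable_smul_left_of_hasCompactSupport hθ.continuous hθ.2
  have h4 := congrArg (fun v : E3 => v i) h2
  simp only at h4; rw [integral_apply_E3 h3, integral_apply_E3 h1] at h4; exact h4

lemma WInt.apply {U : E3 → E3} (h : WInt U) (i : Fin 3) : WInt fun x => U x i :=
  ⟨(𝐩 i).continuous.comp_aestronglyMeasurable h.1,
    lt_of_le_of_lt (lintegral_mono fun x => by gcongr; exact enorm_apply_le _ _) h.2⟩

/-- The local bound of a commutator with a cutoff supported in `B = B₂(m)`. -/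
lemma lintegral_commK_sq_le {s κ} {χ}
    (hχ : IsMult κ χ) (m : E3) {U : E3 → ℝ} {H} (hH : Measurable H)
    (hUH : ∀ y, ofReal (χ y + κ) * ‖U y‖ₑ ≤ H y) :
    ∫⁻ x, ‖commK s (fun x => bumpAt 1 m x * χ x) U x‖ₑ ^ 2 ≤
      ofReal bumpL ^ 2 * (2 * ((∫⁻ z, ker s z) *
        ∫⁻ x in ball m 2, lconv (ker s) (fun y => H y ^ 2) x) +
        2 * ((∫⁻ z, ker s z) ^ 2 * ∫⁻ x in ball m 2, H x ^ 2)) := by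
  set B := ball m 2 with hB
  have hBm : MeasurableSet B := measurableSet_ball
  have hL := one_le_bumpL
  have hκ := hχ.kappa_nonneg
  have hw : ∀ x y, |bumpAt 1 m x * χ x - bumpAt 1 m y * χ y| ≤
      bumpL * (χ y + κ) * modc (x - y) := by
    intro x y
    have e : bumpAt 1 m x * χ x - bumpAt 1 m y * χ y =
        bumpAt 1 m x * (χ x - χ y) + χ y * (bumpAt 1 m x - bumpAt 1 m y) := by ring
    have hm := modc_nonneg (x - y)
    have h1 := bumpAt_nonneg 1 m x
    have h2 := hχ.nonneg y
    have h3 := bumpAt_le_one 1 m x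
    calc _ ≤ bumpAt 1 m x * |χ x - χ y| + χ y * |bumpAt 1 m x - bumpAt 1 m y| := by
          rw [e]; refine (abs_add_le _ _).trans (le_of_eq ?_)
          rw [abs_mul, abs_mul, abs_of_nonneg h1, abs_of_nonneg h2]
      _ ≤ 1 * (κ * modc (x - y)) + χ y * (bumpL * modc (x - y)) := by
          have a1 := hχ.sub_le x y
          have a2 := bumpAt_modc le_rfl m x y
          gcongr
      _ ≤ bumpL * (κ * modc (x - y)) + χ y * (bumpL * modc (x - y)) := by gcongr
      _ = _ := by ring
  have hpt : ∀ x, ‖commK s (fun x => bumpAt 1 m x * χ x) U x‖ₑ ≤ ofReal bumpL *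
      (B.indicator (lconv (ker s) H) x + lconv (ker s) (B.indicator H) x) := by
    intro x; refine (enorm_commK_le _ _ _ _).trans ?_
    have hpp : ∀ y, ofReal (|bumpAt 1 m x * χ x - bumpAt 1 m y * χ y| *
        ‖x - y‖ ^ (-3 - s)) * ‖U y‖ₑ ≤ ofReal bumpL * (ker s (x - y) * H y) := by
      intro y
      calc _ ≤ ofReal (bumpL * (χ y + κ)) * ker s (x - y) * ‖U y‖ₑ := by
            gcongr
            exact ofReal_modc_le_ker (mul_nonneg (by linarith) (add_nonneg (hχ.nonneg y) hκ))
              (hw x y)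
        _ = ofReal bumpL * (ker s (x - y) * (ofReal (χ y + κ) * ‖U y‖ₑ)) := by
            rw [ofReal_mul (by linarith)]; ring
        _ ≤ _ := by gcongr; exact hUH y
    by_cases hx : x ∈ B
    · rw [indicator_of_mem hx]; refine le_trans (lintegral_mono hpp) ?_
      rw [lintegral_cmul, ← lconv_eq_swap]; gcongr; exact le_self_add
    · rw [indicator_of_notMem hx, zero_add, lconv_eq_swap, ← lintegral_cmul]
      refine lintegral_mono fun y => ?_
      by_cases hy : y ∈ B
      · rw [indicator_of_mem hy]; exact hpp y
      · have hz : ∀ z, z ∉ B → bumpAt 1 m z = 0 := fun z hz =>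
          bumpAt_eq_zero one_pos (by simpa [hB] using hz)
        simp [hz x hx, hz y hy]
  set K := ∫⁻ z, ker s z
  calc _ ≤ ∫⁻ x, ofReal bumpL ^ 2 * (2 * (B.indicator (fun x => lconv (ker s) H x ^ 2) x) +
        2 * lconv (ker s) (B.indicator H) x ^ 2) := by
        refine lintegral_mono fun x => ?_
        refine (pow_le_pow_left' (hpt x) 2).trans ?_
        rw [mul_pow]; gcongr; refine (ennreal_add_sq_le _ _).trans (le_of_eq ?_)
        congr 2; by_cases hx : x ∈ B <;> simp [hx]
    _ = ofReal bumpL ^ 2 * (2 * (∫⁻ x in B, lconv (ker s) H x ^ 2) +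
        2 * ∫⁻ x, lconv (ker s) (B.indicator H) x ^ 2) := by
        have m1 : Measurable fun x => lconv (ker s) H x ^ 2 :=
          (measurable_lconv (measurable_ker s) hH).pow_const 2
        rw [lintegral_cmul, lintegral_add_left ((m1.indicator hBm).const_mul 2),
          lintegral_cmul, lintegral_cmul,
          lintegral_indicator hBm]
    _ ≤ _ := by
        gcongr ofReal bumpL ^ 2 * (2 * ?_ + 2 * ?_)
        · rw [← lintegral_const_mul _ (measurable_lconv (measurable_ker s) (hH.pow_const 2))]
          exact lintegral_mono fun x => lconv_sq_le (measurable_ker s) hH x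
        · refine (lintegral_lconv_sq_le (measurable_ker s) (hH.indicator hBm)).trans (le_of_eq ?_)
          rw [← lintegral_indicator hBm]; congr 2; funext x; by_cases hx : x ∈ B <;> simp [hx]

/-- The localized Sobolev inequality in `L⁴(B₁(m))` for `χ U`, where `Λ^s U = G`. -/
lemma exists_local_L4 {s} (hs : s ∈ Ico (3 / 4) 1) : ∃ C, C ≠ ⊤ ∧
    ∀ κ χ, IsMult κ χ → ∀ U G, Measurable U → WInt U → HasFracLap s U G → ∀ m,
      ∫⁻ x in ball m 1, (ofReal (χ x) * ‖U x‖ₑ) ^ 4 ≤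
        C * ((∫⁻ x in ball m 2, (ofReal (χ x) * ‖G x‖ₑ) ^ 2) +
          (∫⁻ x in ball m 2, (ofReal (χ x + κ) * ‖U x‖ₑ) ^ 2) +
          ∫⁻ x in ball m 2, lconv (ker s) (fun y => (ofReal (χ y + κ) * ‖U y‖ₑ) ^ 2) x) ^ 2 := by
  have h0 : 1 / 2 < s := by linarith [hs.1]
  obtain ⟨C, hC, hsob⟩ := exists_sobolev_mul hs
  set K := ∫⁻ z, ker s z with hK
  have hKt : K ≠ ⊤ := (lintegral_ker_lt_top h0 hs.2).ne
  set D : ℝ≥0∞ := 1 + ofReal bumpL ^ 2 * (2 * K) + ofReal bumpL ^ 2 * (2 * K ^ 2) with hD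
  refine ⟨9 * (C * D ^ 2), by finiteness, fun κ χ hχ U G hUm hU hUG m => ?_⟩
  set B := ball m 2 with hB
  set H : E3 → ℝ≥0∞ := fun x => ofReal (χ x + κ) * ‖U x‖ₑ with hHdef
  have hχm : Measurable χ := hχ.measurable
  have hH : Measurable H := (hχm.add_const κ).ennreal_ofReal.mul hUm.enorm
  set IG := ∫⁻ x in B, (ofReal (χ x) * ‖G x‖ₑ) ^ 2
  set IH := ∫⁻ x in B, H x ^ 2
  set IK := ∫⁻ x in B, lconv (ker s) (fun y => H y ^ 2) x
  set w : E3 → ℝ := fun x => bumpAt 1 m x * χ x with hw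
  have hwt : IsTest w := hχ.isTest_mul (bumpAt_isTest one_pos m)
  have hwB : ∀ x, x ∉ B → w x = 0 := fun x hx => by
    simp only [hw]; rw [bumpAt_eq_zero one_pos (by simpa [hB] using hx), zero_mul]
  have hwle : ∀ x, ‖w x‖ₑ ≤ ofReal (χ x) := fun x => by
    rw [enorm_of_nonneg (mul_nonneg (bumpAt_nonneg _ _ _) (hχ.nonneg x))]
    exact ofReal_le_ofReal (mul_le_of_le_one_left (hχ.nonneg x) (bumpAt_le_one _ _ _))
  have hlocal : ∀ i (V : E3 → E3),
      ∫⁻ x, ‖w x * V x i‖ₑ ^ 2 ≤ ∫⁻ x in B, (ofReal (χ x) * ‖V x‖ₑ) ^ 2 := by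
    intro i V; rw [← lintegral_indicator measurableSet_ball]; refine lintegral_mono fun x => ?_
    by_cases hx : x ∈ B
    · rw [indicator_of_mem hx, enorm_mul]; gcongr
      · exact hwle x
      · exact enorm_apply_le _ _
    · simp [hwB x hx]
  have hcomp : ∀ i, ∫⁻ x, ‖w x * U x i‖ₑ ^ 4 ≤ C * D ^ 2 * (IG + IH + IK) ^ 2 := by
    intro i
    have hGi : LocallyIntegrable fun x => G x i := fun x => by
      obtain ⟨t, ht, hi⟩ := hUG.1 x
      exact ⟨t, ht, (𝐩 i).integrable_comp hi⟩
    refine (hsob _ _ w (hU.apply i) hGi hwt fun θ hθ => hUG.apply i hθ).trans ?_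
    rw [mul_assoc, ← mul_pow]; gcongr; have c1 : ∫⁻ x, ‖w x * G x i‖ₑ ^ 2 ≤ IG := hlocal i G
    have c2 : ∫⁻ x, ‖w x * U x i‖ₑ ^ 2 ≤ IH := (hlocal i U).trans (lintegral_mono fun x => by
      simp only [hHdef]; gcongr; linarith [hχ.kappa_nonneg])
    have c3 := lintegral_commK_sq_le (s := s) hχ m (U := fun x => U x i) hH (fun y => by
      simp only [hHdef]; gcongr; exact enorm_apply_le _ _)
    calc _ ≤ IG + (ofReal bumpL ^ 2 * (2 * (K * IK) + 2 * (K ^ 2 * IH))) + IH := by gcongr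
      _ ≤ (IG + ofReal bumpL ^ 2 * (2 * (K * IK) + 2 * (K ^ 2 * IH)) + IH) +
            (IK + ofReal bumpL ^ 2 * (2 * (K * IH) + 2 * (K ^ 2 * IK)) +
              ofReal bumpL ^ 2 * (2 * (K * IG) + 2 * (K ^ 2 * IG))) := le_self_add
      _ = _ := by rw [hD]; ring
  calc ∫⁻ x in ball m 1, (ofReal (χ x) * ‖U x‖ₑ) ^ 4
      ≤ ∫⁻ x in ball m 1, 3 * ∑ i, ‖w x * U x i‖ₑ ^ 4 := by
        refine setLIntegral_mono' measurableSet_ball fun x hx => ?_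
        have e : ofReal (χ x) = ‖w x‖ₑ := by
          simp only [hw]
          rw [bumpAt_eq_one one_pos (mem_ball.1 hx).le, one_mul, enorm_of_nonneg (hχ.nonneg x)]
        rw [e, ← enorm_smul]; exact enorm_pow_four_le_sum (w x • U x)
    _ ≤ ∫⁻ x, 3 * ∑ i, ‖w x * U x i‖ₑ ^ 4 := setLIntegral_le_lintegral _ _
    _ = 3 * ∑ i, ∫⁻ x, ‖w x * U x i‖ₑ ^ 4 := by
        have hwm := hwt.continuous.measurable
        rw [lintegral_cmul, lintegral_finsetSum]; intro i _; refine ((hwm.mul ?_).enorm.pow_const 4)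
        exact (𝐩 i).continuous.measurable.comp hUm
    _ ≤ 3 * ∑ _i : Fin 3, C * D ^ 2 * (IG + IH + IK) ^ 2 := by gcongr with i; exact hcomp i
    _ = _ := by
        simp only [Finset.sum_const, Finset.card_univ, Fintype.card_fin, nsmul_eq_mul]; push_cast
        ring

/-! ### Uniformly local bounds with weights -/

lemma wgt_neg (y : E3) : wgt (-y) = wgt y := by simp only [wgt, pker_neg]

lemma wgt_le_twelve_mul {y p} (hp : ‖p‖ ≤ 1) : wgt y ≤ 12 * wgt (y - p) := by
  have h12 : (12 : ℝ≥0∞) = ofReal 12 := by norm_num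
  have h2 : (2 : ℝ) ^ (7 / 2 : ℝ) ≤ 12 := by
    rw [show (7 / 2 : ℝ) = (3 : ℕ) + 1 / 2 by norm_num, rpow_add two_pos, rpow_natCast,
      ← sqrt_eq_rpow]
    have : √2 ≤ 3 / 2 := Real.sqrt_le_iff.2 ⟨by norm_num, by norm_num⟩
    linarith
  unfold wgt; rw [h12, ← ofReal_mul (by norm_num)]; refine ofReal_le_ofReal ?_
  have hR : ∀ R, 1 ≤ R → ‖y - p‖ ≤ 2 * R → R ^ (-(7 / 2) : ℝ) ≤ 12 * pker 0 (7 / 2) (y - p) := by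
    intro R hR1 hR2; have h3 := le_pker_zero (b := 7 / 2) (by norm_num) (by linarith) hR2
    rw [mul_rpow (by norm_num) (by linarith), rpow_neg (by norm_num)] at h3
    have h4 : 0 ≤ R ^ (-(7 / 2) : ℝ) := rpow_nonneg (by linarith) _
    have h5 : (1 / 12 : ℝ) ≤ (2 ^ (7 / 2 : ℝ))⁻¹ := by rw [one_div]; gcongr
    nlinarith
  have htri : ‖y - p‖ ≤ ‖y‖ + ‖p‖ := norm_sub_le y p
  by_cases hy : ‖y‖ < 1
  · have := hR 1 le_rfl (by linarith)
    simp only [Real.one_rpow] at this; simpa [pker, hy] using this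
  · have := hR ‖y‖ (not_lt.1 hy) (by linarith [not_lt.1 hy])
    simpa only [pker, hy, if_false] using this

lemma exists_lintegral_wgt_le : ∃ C, C ≠ ⊤ ∧
    ∀ {T : Type} [MeasurableSpace T] (μ : Measure T) [SFinite μ] (F : T → E3 → ℝ≥0∞),
      Measurable (uncurry F) → ∀ o, ∫⁻ τ, (∫⁻ x, wgt (x - o) * F τ x) ∂μ ≤ C * ulocSup μ 1 F := by
  set V := volume (ball (0 : E3) 1) with hV
  have hV0 : V ≠ 0 := (measure_ball_pos volume _ one_pos).ne'
  have hVt : V ≠ ⊤ := measure_ball_lt_top.ne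
  have hwt := lintegral_wgt_lt_top
  refine ⟨V⁻¹ * (12 * ∫⁻ x, wgt x), by finiteness, fun {T} _ μ _ F hF o => ?_⟩
  have hpt : ∀ τ, ∫⁻ x, wgt (x - o) * F τ x ≤ V⁻¹ * (12 * ∫⁻ p in ball o 1, lconv wgt (F τ) p) := by
    intro τ
    have h1 : V * ∫⁻ x, wgt (x - o) * F τ x ≤ 12 * ∫⁻ p in ball o 1, lconv wgt (F τ) p := by
      have hvb : volume (ball o 1) = V := by rw [volume_ball_eq o one_pos]; simp [hV]
      calc V * ∫⁻ x, wgt (x - o) * F τ x = ∫⁻ _p in ball o 1, ∫⁻ x, wgt (x - o) * F τ x := by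
            rw [lintegral_const, Measure.restrict_apply MeasurableSet.univ, univ_inter, hvb,
              mul_comm]
        _ ≤ ∫⁻ p in ball o 1, 12 * lconv wgt (F τ) p := by
            refine setLIntegral_mono' measurableSet_ball fun p hp => ?_
            rw [lconv_eq_swap, ← lintegral_cmul]; refine lintegral_mono fun x => ?_
            have h2 : ‖p - o‖ ≤ 1 := by rw [← dist_eq_norm]; exact (mem_ball.1 hp).le
            have h3 := wgt_le_twelve_mul (y := x - o) h2
            rw [sub_sub_sub_cancel_right, ← wgt_neg (x - p), neg_sub] at h3; rw [← mul_assoc]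
            gcongr
        _ = _ := lintegral_cmul
    calc ∫⁻ x, wgt (x - o) * F τ x = V⁻¹ * (V * ∫⁻ x, wgt (x - o) * F τ x) := by
          rw [← mul_assoc, ENNReal.inv_mul_cancel hV0 hVt, one_mul]
      _ ≤ _ := by gcongr
  calc _ ≤ ∫⁻ τ, V⁻¹ * (12 * ∫⁻ p in ball o 1, lconv wgt (F τ) p) ∂μ := lintegral_mono hpt
    _ = V⁻¹ * (12 * ∫⁻ τ, (∫⁻ p in ball o 1, lconv wgt (F τ) p) ∂μ) := by
        rw [lintegral_const_mul' _ _ (by finiteness), lintegral_cmul]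
    _ ≤ V⁻¹ * (12 * ((∫⁻ x, wgt x) * ulocSup μ 1 F)) := by
        gcongr; exact lintegral_ball_lconv_le μ measurable_wgt hF o 1
    _ = _ := by ring

lemma ulocSup_unit (r : ℝ) (F : E3 → ℝ≥0∞) :
    ulocSup (Measure.dirac ()) r (fun _ => F) = ⨆ x, ∫⁻ y in ball x r, F y := by
  simp [ulocSup]

/-- Uniformly local `L¹` bounds on unit balls give bounds on balls of radius `r`. -/
lemma exists_setLIntegral_ball_le (r : ℝ) : ∃ N : ℕ, 1 ≤ N ∧ ∀ F : E3 → ℝ≥0∞, Measurable F →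
    ∀ A, (∀ m, ∫⁻ x in ball m 1, F x ≤ A) → ∀ m, ∫⁻ x in ball m r, F x ≤ N * A := by
  obtain ⟨N, hN, h⟩ := exists_ulocSup_mul_le r
  refine ⟨N, hN, fun F hF A hA m => ?_⟩
  have h1 := h (Measure.dirac ()) 1 one_pos (fun _ => F) (hF.comp measurable_snd)
  rw [ulocSup_unit, ulocSup_unit, mul_one] at h1
  refine (le_iSup (fun x => ∫⁻ y in ball x r, F y) m).trans (h1.trans ?_)
  gcongr; exact iSup_le hA

lemma exists_lintegral_wgt_static_le : ∃ C, C ≠ ⊤ ∧ ∀ F, Measurable F →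
    ∀ A, (∀ m, ∫⁻ x in ball m 1, F x ≤ A) → ∀ o, ∫⁻ x, wgt (x - o) * F x ≤ C * A := by
  obtain ⟨C, hC, h⟩ := exists_lintegral_wgt_le
  refine ⟨C, hC, fun F hF A hA o => ?_⟩
  have h1 := h (Measure.dirac ()) (fun _ => F) (hF.comp measurable_snd) o
  rw [ulocSup_unit] at h1; simp only [lintegral_dirac] at h1; refine h1.trans ?_
  gcongr; exact iSup_le hA

lemma WInt.of_lintegral_sq {f : E3 → E3} (hf : Measurable f)
    (h : ∫⁻ x, wgt x * ‖f x‖ₑ ^ 2 < ⊤) : WInt f := by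
  refine ⟨hf.aestronglyMeasurable, ?_⟩
  have h1 := sq_lintegral_weight_le volume measurable_wgt.aemeasurable hf.enorm.aemeasurable
  have h2 : (∫⁻ x, wgt x * ‖f x‖ₑ) ^ 2 < ⊤ := h1.trans_lt (mul_lt_top lintegral_wgt_lt_top h)
  simp only [mul_comm (‖f _‖ₑ)]; by_contra h3; rw [not_lt, top_le_iff] at h3; rw [h3] at h2
  simp at h2

/-! ### Averaged `L⁴` bounds -/

/-- `‖χ U‖²` in `L⁴(B₁(m))`. -/
def l4 (χ : E3 → ℝ) (U : E3 → E3) (m : E3) : ℝ≥0∞ :=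
  (∫⁻ x in ball m 1, (ofReal (χ x) * ‖U x‖ₑ) ^ 4) ^ (1 / 2 : ℝ)

lemma l4_sq (χ : E3 → ℝ) (U : E3 → E3) (m : E3) :
    l4 χ U m ^ 2 = ∫⁻ x in ball m 1, (ofReal (χ x) * ‖U x‖ₑ) ^ 4 := by
  rw [l4, ← ENNReal.rpow_two, ← ENNReal.rpow_mul]; norm_num

/-- The density `χ² |f|²`. -/
def sqd (χ : E3 → ℝ) (f : E3 → E3) (x : E3) : ℝ≥0∞ := (ofReal (χ x) * ‖f x‖ₑ) ^ 2

lemma measurable_sqd {χ} (hχ : Measurable χ) {f} (hf : Measurable f) :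
    Measurable (sqd χ f) := (hχ.ennreal_ofReal.mul hf.enorm).pow_const 2

lemma measurable_sqd_uncurry {χ} (hχ : Measurable χ) {f : ℝ → E3 → E3}
    (hf : Measurable (uncurry f)) :
    Measurable (uncurry fun τ => sqd χ (f τ)) :=
  ((hχ.comp measurable_snd).ennreal_ofReal.mul hf.enorm).pow_const 2

lemma le_of_sq_le_mul_sq {a b} {C : ℝ≥0∞} (h : a ^ 2 ≤ C * b ^ 2) : a ≤ (1 + C) * b := by
  refine (ENNReal.pow_le_pow_left_iff two_ne_zero).1 (h.trans ?_)
  rw [mul_pow]; gcongr; rw [sq]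
  refine le_trans (le_add_self (a := C) (b := 1)) (le_mul_of_one_le_left zero_le le_self_add)

lemma exists_lintegral_l4_le {s} (hs : s ∈ Ico (3 / 4) 1) : ∃ C, C ≠ ⊤ ∧
    ∀ κ χ, IsMult κ χ → ∀ U G, Measurable U → Measurable G → WInt U → HasFracLap s U G → ∀ o r,
      ∫⁻ m in ball o r, l4 χ U m ≤ C * ((∫⁻ x in ball o (r + 2), sqd χ G x) +
          (∫⁻ x in ball o (r + 2), sqd (χ · + κ) U x) +
          ∫⁻ x in ball o (r + 2), lconv (ker s) (sqd (χ · + κ) U) x) := by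
  obtain ⟨C, hC, h⟩ := exists_local_L4 hs
  have hVt : volume (ball (0 : E3) 2) ≠ ⊤ := measure_ball_lt_top.ne
  refine ⟨(1 + C) * volume (ball (0 : E3) 2), by finiteness, fun κ χ hχ U G hU hG hUw hUG o r => ?_⟩
  have hχm : Measurable χ := hχ.measurable
  have m1 : Measurable (sqd χ G) := measurable_sqd hχm hG
  have m2 : Measurable (sqd (χ · + κ) U) := measurable_sqd (hχm.add_const κ) hU
  have m3 : Measurable (lconv (ker s) (sqd (χ · + κ) U)) := measurable_lconv (measurable_ker s) m2
  have hsum : ∀ B, (∫⁻ x in B, sqd χ G x) + (∫⁻ x in B, sqd (χ · + κ) U x) +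
      (∫⁻ x in B, lconv (ker s) (sqd (χ · + κ) U) x) =
      ∫⁻ x in B, (sqd χ G x + sqd (χ · + κ) U x + lconv (ker s) (sqd (χ · + κ) U) x) := fun B => by
    rw [lintegral_add_right _ m3, lintegral_add_right _ m2]
  rw [hsum]
  calc ∫⁻ m in ball o r, l4 χ U m ≤ ∫⁻ m in ball o r, (1 + C) * ∫⁻ x in ball m 2, (sqd χ G x +
          sqd (χ · + κ) U x + lconv (ker s) (sqd (χ · + κ) U) x) := by
        refine lintegral_mono fun m => ?_
        refine le_of_sq_le_mul_sq ?_
        rw [l4_sq, ← hsum]; exact h κ χ hχ U G hU hUw hUG m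
    _ = (1 + C) * ∫⁻ m in ball o r, ∫⁻ x in ball m 2, (sqd χ G x +
          sqd (χ · + κ) U x + lconv (ker s) (sqd (χ · + κ) U) x) :=
        lintegral_cmul
    _ ≤ (1 + C) * (volume (ball (0 : E3) 2) * ∫⁻ x in ball o (r + 2), (sqd χ G x +
          sqd (χ · + κ) U x + lconv (ker s) (sqd (χ · + κ) U) x)) := by
        gcongr; exact lintegral_ball_average_le ((m1.add m2).add m3) o r 2
    _ = _ := by rw [mul_assoc]

/-- The time integrated form of `exists_lintegral_l4_le`. -/
lemma exists_lintegral_time_l4_le {s} (hs : s ∈ Ico (3 / 4) 1) : ∃ C, C ≠ ⊤ ∧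
    ∀ κ χ, IsMult κ χ → ∀ u g, Measurable (uncurry u) →
      Measurable (uncurry g) → (∀ t, WInt (u t)) → (∀ t, HasFracLap s (u t) (g t)) →
      ∀ (μ : Measure ℝ) [SFinite μ] (o : E3) (r : ℝ),
      ∫⁻ τ, (∫⁻ m in ball o r, l4 χ (u τ) m) ∂μ ≤ C * (ulocSup μ (r + 2) (fun τ => sqd χ (g τ)) +
          ulocSup μ (r + 2) (fun τ => sqd (χ · + κ) (u τ))) := by
  obtain ⟨C, hC, h⟩ := exists_lintegral_l4_le hs
  set K := ∫⁻ z, ker s z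
  have hK : K ≠ ⊤ := (lintegral_ker_lt_top (by linarith [hs.1]) hs.2).ne
  refine ⟨C * (1 + K), by finiteness, fun κ χ hχ u g hu hg hw hug μ _ o r => ?_⟩
  have hχm : Measurable χ := hχ.measurable
  set SG := ulocSup μ (r + 2) (fun τ => sqd χ (g τ))
  set SU := ulocSup μ (r + 2) (fun τ => sqd (χ · + κ) (u τ))
  have m1 := measurable_sqd_uncurry hχm hg
  have m2 := measurable_sqd_uncurry (hχm.add_const κ) hu
  have m3 := measurable_lconv_time (measurable_ker s) m2
  have hmI : ∀ {F : ℝ → E3 → ℝ≥0∞}, Measurable (uncurry F) →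
      Measurable fun τ => ∫⁻ x in ball o (r + 2), F τ x := fun hF =>
    hF.lintegral_prod_right'
  calc _ ≤ ∫⁻ τ, C * ((∫⁻ x in ball o (r + 2), sqd χ (g τ) x) +
          (∫⁻ x in ball o (r + 2), sqd (χ · + κ) (u τ) x) +
          ∫⁻ x in ball o (r + 2), lconv (ker s) (sqd (χ · + κ) (u τ)) x) ∂μ := by
        refine lintegral_mono fun τ => ?_
        exact h κ χ hχ (u τ) (g τ) (hu.of_uncurry_left) (hg.of_uncurry_left) (hw τ) (hug τ) o r
    _ = C * ((∫⁻ τ, (∫⁻ x in ball o (r + 2), sqd χ (g τ) x) ∂μ) +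
          (∫⁻ τ, (∫⁻ x in ball o (r + 2), sqd (χ · + κ) (u τ) x) ∂μ) +
          ∫⁻ τ, (∫⁻ x in ball o (r + 2), lconv (ker s) (sqd (χ · + κ) (u τ)) x) ∂μ) := by
        rw [lintegral_const_mul' _ _ hC, lintegral_add_right _ (hmI m3),
          lintegral_add_right _ (hmI m2)]
    _ ≤ C * (SG + SU + K * SU) := by
        gcongr
        · exact le_ulocSup μ (r + 2) _ o
        · exact le_ulocSup μ (r + 2) _ o
        · exact lintegral_ball_lconv_le μ (measurable_ker s) m2 o (r + 2)
    _ ≤ C * (SG + SU + K * SU + K * SG) := mul_le_mul_right le_self_add C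
    _ = _ := by ring

/-- The critical cubic term: in `L² · L⁴ · L⁴` on unit balls, with one factor in `L²_uloc`. -/
lemma setLIntegral_cubic_le {χ} (hχ : Measurable χ) {U} (hU : Measurable U)
    {M : ℝ≥0} (hM : ∀ m, ∫⁻ x in ball m 1, ‖U x‖ₑ ^ 2 ≤ (M : ℝ≥0∞) ^ 2) (o : E3) (r : ℝ) :
    ∫⁻ x in ball o r, ofReal (χ x) ^ 2 * ‖U x‖ₑ ^ 3 ≤
      (volume (ball (0 : E3) 1))⁻¹ * (M * ∫⁻ m in ball o (r + 1), l4 χ U m) := by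
  have hχ' : Measurable fun x => ofReal (χ x) := hχ.ennreal_ofReal
  have hUe : Measurable fun x => ‖U x‖ₑ := hU.enorm
  refine (setLIntegral_ball_le_average (by fun_prop) o r).trans ?_
  refine mul_le_mul_right ?_ _
  have hpt : ∀ m, ∫⁻ x in ball m 1, ofReal (χ x) ^ 2 * ‖U x‖ₑ ^ 3 ≤ l4 χ U m * M := by
    intro m; refine (ENNReal.pow_le_pow_left_iff two_ne_zero).1 ?_
    have h := sq_lintegral_mul_le (volume.restrict (ball m 1))
      (f := fun x => (ofReal (χ x) * ‖U x‖ₑ) ^ 2) (g := fun x => ‖U x‖ₑ)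
      (by fun_prop) (by fun_prop)
    calc _ = (∫⁻ x in ball m 1, (ofReal (χ x) * ‖U x‖ₑ) ^ 2 * ‖U x‖ₑ) ^ 2 := by
          congr 2; funext x; ring
      _ ≤ _ := h
      _ = l4 χ U m ^ 2 * ∫⁻ x in ball m 1, ‖U x‖ₑ ^ 2 := by rw [l4_sq]; congr 3; funext x; ring
      _ ≤ l4 χ U m ^ 2 * M ^ 2 := by gcongr; exact hM m
      _ = _ := (mul_pow _ _ _).symm
  refine (lintegral_mono fun m => hpt m).trans ?_
  rw [lintegral_mul_const' _ _ ENNReal.coe_ne_top, mul_comm]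

/-! ### The pressure at a fixed time -/

lemma continuous_re_fourierInv {h : E3 → ℂ} (hh : Integrable h) :
    Continuous fun x => (𝓕⁻ h x).re := by
  have hc : Continuous (𝓕⁻ h) :=
    VectorFourier.fourierIntegral_continuous (L := -(innerₗ E3)) continuous_fourierChar
      (show Continuous fun p : E3 × E3 => -⟪p.1, p.2⟫ from continuous_inner.neg) hh
  exact Complex.continuous_re.comp hc

lemma IsTest.continuous_invLapDD (j k : Fin 3) {θ : E3 → ℝ} (hθ : IsTest θ) :
    Continuous (invLapDD j k θ) :=
  continuous_re_fourierInv
    (hθ.integrable_symbol_mul_hat (measurable_rieszSymbol j k) (abs_rieszSymbol_le j k))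

lemma modc_sq_le (z : E3) : modc z ^ 2 ≤ ‖z‖ := by
  have h1 : modc z ≤ √‖z‖ := min_le_right _ _
  calc modc z ^ 2 ≤ √‖z‖ ^ 2 := by gcongr; exact modc_nonneg z
    _ = ‖z‖ := Real.sq_sqrt (norm_nonneg z)

lemma IsMult.le_add {κ} {χ} (hχ : IsMult κ χ) (x y : E3) : χ y ≤ χ x + κ * modc (x - y) := by
  have := (abs_le.1 (hχ.sub_le x y)).1
  linarith

lemma IsMult.sq_le {κ} {χ} (hχ : IsMult κ χ) (x y : E3) :
    χ y ^ 2 ≤ 2 * χ x ^ 2 + 2 * κ ^ 2 * ‖x - y‖ := by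
  have h1 := hχ.le_add x y
  have h2 := hχ.nonneg y
  have h3 := modc_sq_le (x - y)
  have h4 : χ y ^ 2 ≤ (χ x + κ * modc (x - y)) ^ 2 := by gcongr
  have h5 : κ ^ 2 * modc (x - y) ^ 2 ≤ κ ^ 2 * ‖x - y‖ := by gcongr
  nlinarith [sq_nonneg (χ x - κ * modc (x - y))]

/-- Only the first power of `κ |x - y|^{1/2}` is lost, which is what keeps the far field of the
pressure integrable. -/
lemma IsMult.sq_le_sqrt {κ} {χ} (hχ : IsMult κ χ) (x y : E3) :
    χ y ^ 2 ≤ 2 * χ x ^ 2 + 2 * κ * √‖x - y‖ := by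
  have hx := hχ.nonneg x
  have hy := hχ.nonneg y
  have hy1 := hχ.le_one y
  have h1 := hχ.le_add x y
  have h2 : κ * modc (x - y) ≤ κ * √‖x - y‖ :=
    mul_le_mul_of_nonneg_left (min_le_right _ _) hχ.kappa_nonneg
  have h3 : 0 ≤ κ * √‖x - y‖ := mul_nonneg hχ.kappa_nonneg (Real.sqrt_nonneg _)
  have h4 : (χ y - χ x) ≤ κ * √‖x - y‖ := by linarith
  rcases le_or_gt (χ y) (χ x) with h | h
  · nlinarith
  · have h5 : (χ y - χ x) ^ 2 ≤ κ * √‖x - y‖ := by nlinarith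
    nlinarith [sq_nonneg (χ y - 2 * χ x)]

lemma lintegral_test_eq {h} (hh : IsTest h) : ofReal (∫ y, |h y|) = ∫⁻ y, ‖h y‖ₑ := by
  rw [ofReal_integral_eq_lintegral_ofReal hh.integrable.abs (.of_forall fun y => abs_nonneg _)]
  refine lintegral_congr fun y => ?_
  rw [← ofReal_norm, norm_eq_abs]

/-- Near field of the pressure: `L²` boundedness of the Riesz transforms. -/
lemma exists_pressure_near (K₀ b : ℝ) (hb : 0 ≤ b) : ∃ C, C ≠ ⊤ ∧
    ∀ ρ, 1 ≤ ρ → ∀ κ χ, IsMult κ χ → κ ≤ K₀ → ∀ U, Measurable U →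
    ∀ h v Mv, IsTest h → Measurable v → (∀ m, ∫⁻ x in ball m 1, v x ^ 2 ≤ (Mv : ℝ≥0∞) ^ 2) →
      (∀ y, ‖h y‖ₑ ≤ ofReal (b * (χ y ^ 2 / ρ + κ * χ y)) * v y) →
      ∀ m j k, ∫⁻ x in ball m 1, ‖U x‖ₑ ^ 2 * ‖invLapDD j k (fun y => bumpAt 2 m y * h y) x‖ₑ ≤
          C * Mv * (ofReal ρ⁻¹ * l4 χ U m + ofReal κ * l4 𝟙 U m) := by
  obtain ⟨N, hN, hN4⟩ := exists_setLIntegral_ball_le 4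
  refine ⟨ofReal b * (3 + ofReal (26 * |K₀|) + ofReal (1 + 2 * |K₀|)) * (1 + N), by finiteness,
    fun ρ hρ κ χ hχ hκ U hU h v Mv hh hv hMv hhv m j k => ?_⟩
  have hκ0 := hχ.kappa_nonneg
  have hK : κ ≤ |K₀| := hκ.trans (le_abs_self _)
  have hρ0 : 0 < ρ := by linarith
  set c : ℝ := χ m + 2 * κ with hc
  have hc0 : 0 ≤ c := add_nonneg (hχ.nonneg m) (by linarith)
  have hc1 : c ≤ 1 + 2 * |K₀| := by linarith [hχ.le_one m]
  have hχc : ∀ y, dist y m < 4 → χ y ≤ c := fun y hy => by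
    have h1 := hχ.le_add m y
    have h2 : modc (m - y) ≤ 2 := by
      have h3 := modc_sq_le (m - y)
      rw [← dist_eq_norm, dist_comm] at h3; nlinarith [modc_nonneg (m - y)]
    nlinarith
  have hcx : ∀ x, dist x m < 1 → c ≤ χ x + 3 * κ := fun x hx => by
    have h1 := hχ.le_add x m
    have h2 : modc (x - m) ≤ 1 := (modc_le_norm _).trans (by rw [← dist_eq_norm]; exact hx.le)
    nlinarith
  set hz : E3 → ℝ := fun y => bumpAt 2 m y * h y with hhz
  have hzt : IsTest hz := (bumpAt_isTest two_pos m).mul hh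
  set q : ℝ := b * (c ^ 2 / ρ + κ * c) with hq
  have hq0 : 0 ≤ q := by positivity
  have hL2 : ∫⁻ x, ‖invLapDD j k hz x‖ₑ ^ 2 ≤ ofReal q ^ 2 * (N * (Mv : ℝ≥0∞) ^ 2) := by
    refine (lintegral_invLapDD_sq_le j k hzt).trans ?_
    refine lintegral_le_mul_of_support measurableSet_ball (by finiteness) (fun x hx => ?_)
      (fun x hx => ?_) (hN4 _ (hv.pow_const 2) _ hMv m)
    · have hx' := hχc x (mem_ball.1 hx)
      have := hχ.nonneg x
      rw [← mul_pow]; gcongr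
      calc ‖hz x‖ₑ ≤ 1 * ‖h x‖ₑ := by
            rw [enorm_mul]
            exact mulR (enorm_le_one_of_mem (bumpAt_nonneg _ _ _) (bumpAt_le_one _ _ _))
        _ ≤ ofReal (b * (χ x ^ 2 / ρ + κ * χ x)) * v x := by rw [one_mul]; exact hhv x
        _ ≤ _ := by rw [hq]; gcongr
    · have := not_lt.1 fun h => hx (mem_ball.2 h)
      simp [hhz, bumpAt_eq_zero two_pos (by linarith : 2 * 2 ≤ dist x m)]
  have hm1 : Measurable fun x => ‖U x‖ₑ := hU.enorm
  have hm2 : Measurable fun x => ‖invLapDD j k hz x‖ₑ :=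
    (hzt.continuous_invLapDD j k).measurable.enorm
  have hstep : ∫⁻ x in ball m 1, ‖U x‖ₑ ^ 2 * ‖invLapDD j k hz x‖ₑ ≤
      (1 + N) * (l4 𝟙 U m * (ofReal q * Mv)) := by
    refine le_of_sq_le_mul_sq ?_
    refine (sq_lintegral_mul_le _ (hm1.pow_const 2).aemeasurable hm2.aemeasurable).trans ?_
    rw [mul_pow, l4_sq]
    calc _ ≤ (∫⁻ x in ball m 1, (‖U x‖ₑ ^ 2) ^ 2) * (ofReal q ^ 2 * (N * (Mv : ℝ≥0∞) ^ 2)) := by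
          gcongr; exact (setLIntegral_le_lintegral _ _).trans hL2
      _ = _ := by simp only [ofReal_one, one_mul, ← pow_mul]; norm_num; ring
  have hl4 : ofReal (c ^ 2) * l4 𝟙 U m ≤ 3 * l4 χ U m + ofReal (26 * κ ^ 2) * l4 𝟙 U m := by
    refine (ENNReal.pow_le_pow_left_iff two_ne_zero).1 ?_
    have hpt : ofReal (c ^ 2) ^ 2 * l4 𝟙 U m ^ 2 ≤
        8 * l4 χ U m ^ 2 + ofReal (8 * (3 * κ) ^ 4) * l4 𝟙 U m ^ 2 := by
      rw [l4_sq, l4_sq]; have hχm : Measurable χ := hχ.measurable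
      have hm3 : Measurable fun x => ofReal (χ x) := hχm.ennreal_ofReal
      rw [← lintegral_cmul, ← lintegral_cmul, ← lintegral_cmul, ← lintegral_add_left (by fun_prop)]
      refine setLIntegral_mono' measurableSet_ball fun x hx => ?_
      simp only [ofReal_one, one_mul, mul_pow]; have hx1 := hcx x (mem_ball.1 hx)
      have hx0 := hχ.nonneg x
      have h8 : (8 : ℝ≥0∞) = ofReal 8 := by norm_num
      rw [← mul_assoc, ← add_mul, h8, ← ofReal_pow hx0, ← ofReal_mul (by norm_num),
        ← ofReal_add (by positivity) (by positivity), ← ofReal_pow (by positivity)]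
      gcongr
      calc (c ^ 2) ^ 2 = c ^ 4 := by ring
        _ ≤ (χ x + 3 * κ) ^ 4 := by gcongr
        _ ≤ 2 ^ (4 - 1) * (χ x ^ 4 + (3 * κ) ^ 4) := add_pow_le hx0 (by positivity) 4
        _ = _ := by norm_num; ring
    rw [mul_pow]; refine hpt.trans ?_
    have e : ofReal (8 * (3 * κ) ^ 4) ≤ ofReal (26 * κ ^ 2) ^ 2 := by
      rw [← ofReal_pow (by positivity)]; refine ofReal_le_ofReal ?_; nlinarith [sq_nonneg (κ ^ 2)]
    calc _ ≤ 9 * l4 χ U m ^ 2 + ofReal (26 * κ ^ 2) ^ 2 * l4 𝟙 U m ^ 2 := by gcongr; norm_num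
      _ ≤ 9 * l4 χ U m ^ 2 + ofReal (26 * κ ^ 2) ^ 2 * l4 𝟙 U m ^ 2 +
          2 * (3 * l4 χ U m) * (ofReal (26 * κ ^ 2) * l4 𝟙 U m) := le_self_add
      _ = _ := by ring
  refine hstep.trans ?_
  have hqe : ofReal q = ofReal b * (ofReal ρ⁻¹ * ofReal (c ^ 2)) + ofReal b * ofReal (κ * c) := by
    rw [← mul_add, ← ofReal_mul (by positivity), ← ofReal_add (by positivity)
      (by positivity), ← ofReal_mul hb, hq]
    congr 2; field_simp
  have hr1 : ofReal ρ⁻¹ ≤ 1 := ofReal_le_one.2 (inv_le_one_of_one_le₀ hρ)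
  have hA : 0 ≤ |K₀| := abs_nonneg _
  set L1 := l4 𝟙 U m
  set Lχ := l4 χ U m
  set rr := ofReal ρ⁻¹
  set bb := ofReal b
  set p := ofReal (26 * |K₀|)
  set p' := ofReal (1 + 2 * |K₀|)
  set k := ofReal κ with hk
  have e1 : ofReal (26 * κ ^ 2) ≤ p * k := by
    rw [← ofReal_mul (by positivity)]; exact ofReal_le_ofReal (by nlinarith)
  have e2 : ofReal (κ * c) ≤ p' * k := by
    rw [← ofReal_mul (by positivity)]; exact ofReal_le_ofReal (by nlinarith)
  calc _ = (1 + N) * Mv * bb * (rr * (ofReal (c ^ 2) * L1) + ofReal (κ * c) * L1) := by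
        rw [hqe]; ring
    _ ≤ (1 + N) * Mv * bb * (rr * (3 * Lχ) + 1 * (p * k * L1) + p' * k * L1) := by
        grw [hl4, e1, e2, mul_add rr]; gcongr
    _ ≤ (1 + N) * Mv * bb * (rr * (3 * Lχ) + 1 * (p * k * L1) + p' * k * L1 +
          ((p + p') * (rr * Lχ) + 3 * (k * L1))) := mulL le_self_add
    _ = _ := by ring

/-- The mass of `v` in a ball of radius `r`, bounded uniformly in the center. -/
lemma exists_lintegral_ball_le_mul (r : ℝ) : ∃ C, C ≠ ⊤ ∧ ∀ (v : E3 → ℝ≥0∞) Mv,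
    Measurable v → (∀ m, ∫⁻ x in ball m 1, v x ^ 2 ≤ (Mv : ℝ≥0∞) ^ 2) →
      ∀ o, ∫⁻ x in ball o r, v x ≤ C * Mv := by
  obtain ⟨N, hN, hN4⟩ := exists_setLIntegral_ball_le r
  have hV : volume (ball (0 : E3) r) ≠ ⊤ := measure_ball_lt_top.ne
  refine ⟨1 + volume (ball (0 : E3) r) * N, by finiteness, fun v Mv hv hMv o => ?_⟩
  refine le_of_sq_le_mul_sq ?_
  have h := sq_lintegral_mul_le (volume.restrict (ball o r)) (f := fun _ => 1) (g := v)
    (by fun_prop) hv.aemeasurable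
  simp only [one_mul, one_pow, lintegral_const, Measure.restrict_apply MeasurableSet.univ,
    univ_inter] at h
  rw [Measure.addHaar_ball_center] at h; refine h.trans ?_; rw [mul_assoc]; gcongr
  exact hN4 _ (hv.pow_const 2) _ hMv o

/-- The part of the pressure generated at distance at least one. -/
lemma exists_pressure_mid (K₀ b : ℝ) (hb : 0 ≤ b) {ρ} (hρ : 1 ≤ ρ) : ∃ C, C ≠ ⊤ ∧
    ∀ κ χ, IsMult κ χ → κ ≤ K₀ →
    ∀ h v Mv o, IsTest h → Measurable v → (∀ m, ∫⁻ x in ball m 1, v x ^ 2 ≤ (Mv : ℝ≥0∞) ^ 2) →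
      (∀ y, ‖h y‖ₑ ≤ ofReal (b * (χ y ^ 2 / ρ + κ * χ y)) * v y) →
      (∀ y, 2 * ρ ≤ dist y o → h y = 0) →
      ∀ m x j k, dist x o ≤ 4 * ρ + 2 → dist x m < 1 →
        ‖invLapDD j k (fun y => h y - bumpAt 2 m y * h y) x‖ₑ ≤ C * Mv * ofReal (χ x ^ 2 + κ) := by
  obtain ⟨C1, hC1, hR⟩ := exists_invLapDD_le_of_eq_zero
  obtain ⟨C2, hC2, hV⟩ := exists_lintegral_ball_le_mul (2 * ρ)
  set D : ℝ := b * (2 + 2 * |K₀| * (6 * ρ + 2) + 1) with hD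
  have hD0 : 0 ≤ D := by positivity
  refine ⟨ofReal C1 * (ofReal D * C2), by finiteness,
    fun κ χ hχ hκ h v Mv o hh hv hMv hhv hh0 m x j k hxx₀ hxm => ?_⟩
  have hκ0 := hχ.kappa_nonneg
  have hK : κ ≤ |K₀| := hκ.trans (le_abs_self _)
  set h2 : E3 → ℝ := fun y => h y - bumpAt 2 m y * h y with hh2
  have hh2t : IsTest h2 := hh.sub ((bumpAt_isTest two_pos m).mul hh)
  have hzero : ∀ y, dist y x < 1 → h2 y = 0 := fun y hy => by
    simp only [hh2]; rw [bumpAt_eq_one two_pos, one_mul, sub_self]; linarith [dist_triangle y x m]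
  have h1 := hR j k h2 hh2t x hzero
  have e : ‖invLapDD j k h2 x‖ₑ ≤ ofReal C1 * ∫⁻ y, ‖h2 y‖ₑ := by
    rw [← lintegral_test_eq hh2t, ← ofReal_mul hC1, ← ofReal_norm, norm_eq_abs]
    exact ofReal_le_ofReal h1
  refine e.trans ?_
  have e2 : ∫⁻ y, ‖h2 y‖ₑ ≤ ofReal (D * (χ x ^ 2 + κ)) * (C2 * Mv) := by
    refine lintegral_le_mul_of_support measurableSet_ball (by finiteness) (fun y hy => ?_)
      (fun y hy => ?_) (hV v Mv hv hMv o)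
    · have hle : ‖h2 y‖ₑ ≤ ‖h y‖ₑ := by
        have : h2 y = (1 - bumpAt 2 m y) * h y := by simp only [hh2]; ring
        rw [this, enorm_mul]
        exact mul_le_of_le_one_left zero_le (enorm_le_one_of_mem (by
          linarith [bumpAt_le_one 2 m y]) (by linarith [bumpAt_nonneg 2 m y]))
      refine hle.trans ((hhv y).trans ?_)
      gcongr ofReal ?_ * v y; have a1 := hχ.sq_le x y
      have a2 : ‖x - y‖ ≤ 6 * ρ + 2 := by
        rw [← dist_eq_norm]; linarith [dist_triangle x o y, Metric.mem_ball'.1 hy]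
      have a3 := hχ.nonneg y
      have a5 : χ y ^ 2 / ρ ≤ χ y ^ 2 := div_le_self (sq_nonneg _) hρ
      have a6 : 2 * κ ^ 2 * ‖x - y‖ ≤ 2 * (|K₀| * κ) * (6 * ρ + 2) := by rw [sq]; gcongr
      have a7 : κ * χ y ≤ κ := mul_le_of_le_one_right hκ0 (hχ.le_one y)
      have a8 : 0 ≤ 2 * |K₀| * (6 * ρ + 2) := by positivity
      rw [hD, mul_assoc]; refine mul_le_mul_of_nonneg_left ?_ hb; nlinarith [sq_nonneg (χ x)]
    · simp [hh2, hh0 y (not_lt.1 hy)]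
  calc _ ≤ ofReal C1 * (ofReal (D * (χ x ^ 2 + κ)) * (C2 * Mv)) := by gcongr
    _ = _ := by rw [ofReal_mul hD0]; ring

lemma invLapDD_sum (j k : Fin 3) {θ : Fin 3 → E3 → ℝ} (hθ : ∀ i, IsTest (θ i)) (x : E3) :
    invLapDD j k (fun y => ∑ i, θ i y) x = ∑ i, invLapDD j k (θ i) x := by
  simp only [Fin.sum_univ_three]
  rw [invLapDD_add j k ((hθ 0).add (hθ 1)) (hθ 2), invLapDD_add j k (hθ 0) (hθ 1)]

lemma wgt_eq {x} (hx : 1 ≤ ‖x‖) : wgt x = ofReal (‖x‖ ^ (-(7 / 2) : ℝ)) := by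
  simp only [wgt, pker, not_lt.2 hx, if_false]

/-- The far field of the pressure: for a divergence the kernel decays like `|x|^{-4}`. -/
lemma exists_pressure_far {ρ : ℝ} (hρ : 1 ≤ ρ) : ∃ C, C ≠ ⊤ ∧ ∀ κ χ, IsMult κ χ →
    ∀ (θ : Fin 3 → E3 → ℝ) v Mv o, (∀ i, IsTest (θ i)) → Measurable v →
      (∀ m, ∫⁻ x in ball m 1, v x ^ 2 ≤ (Mv : ℝ≥0∞) ^ 2) →
      (∀ i y, ‖θ i y‖ₑ ≤ ofReal (χ y ^ 2) * v y) →
      (∀ i y, 2 * ρ ≤ dist y o → θ i y = 0) →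
      ∀ x j k, 4 * ρ ≤ dist x o → ‖invLapDD j k (fun y => ∑ i, dd (bv i) (θ i) y) x‖ₑ ≤
          C * Mv * (wgt (x - o) * ofReal (χ x ^ 2 + κ)) := by
  obtain ⟨C1, hC1, hR⟩ := exists_invLapDD_dd_le
  obtain ⟨C2, hC2, hV⟩ := exists_lintegral_ball_le_mul (2 * ρ)
  refine ⟨3 * (ofReal C1 * (4 * C2)), by finiteness,
    fun κ χ hχ θ v Mv o hθ hv hMv hθv hθ0 x j k hx => ?_⟩
  have hκ0 := hχ.kappa_nonneg
  set d := dist x o with hd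
  have hd1 : 1 ≤ d := by linarith
  have hd0 : 0 < d := by linarith
  have hsq : √(2 * d) ≤ 2 * d ^ (1 / 2 : ℝ) := by
    rw [← sqrt_eq_rpow]; refine Real.sqrt_le_iff.2 ⟨by positivity, ?_⟩
    rw [mul_pow, Real.sq_sqrt hd0.le]; linarith
  have hone : 1 ≤ d ^ (1 / 2 : ℝ) := Real.one_le_rpow hd1 (by norm_num)
  have hI : ∀ i, ∫⁻ y, ‖θ i y‖ₑ ≤ ofReal (4 * ((χ x ^ 2 + κ) * d ^ (1 / 2 : ℝ))) * (C2 * Mv) := by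
    intro i
    refine lintegral_le_mul_of_support measurableSet_ball (by finiteness) (fun y hy => ?_)
      (fun y hy => ?_) (hV v Mv hv hMv o)
    · refine (hθv i y).trans ?_
      gcongr; have a1 := hχ.sq_le_sqrt x y
      have a2 : √‖x - y‖ ≤ √(2 * d) := by
        rw [← dist_eq_norm]; gcongr; linarith [dist_triangle x o y, Metric.mem_ball'.1 hy]
      have a3 : κ * √‖x - y‖ ≤ κ * (2 * d ^ (1 / 2 : ℝ)) := by gcongr; exact a2.trans hsq
      nlinarith [sq_nonneg (χ x)]
    · rw [hθ0 i y (not_lt.1 hy), enorm_zero]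
  have hterm : ∀ i, ‖invLapDD j k (dd (bv i) (θ i)) x‖ₑ ≤
      ofReal C1 * (4 * C2) * Mv * (wgt (x - o) * ofReal (χ x ^ 2 + κ)) := by
    intro i; have h1 := hR i j k (θ i) (hθ i) x o (2 * ρ) (by linarith) (hθ0 i) (by linarith)
    rw [← hd] at h1
    have h2 : ‖invLapDD j k (dd (bv i) (θ i)) x‖ₑ ≤
        ofReal C1 * ofReal (d ^ 4)⁻¹ * ∫⁻ y, ‖θ i y‖ₑ := by
      rw [← lintegral_test_eq (hθ i), ← ofReal_mul hC1, ← ofReal_mul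
        (by positivity), ← ofReal_norm, norm_eq_abs]
      exact ofReal_le_ofReal h1
    have hw : wgt (x - o) = ofReal (d ^ 4)⁻¹ * ofReal (d ^ (1 / 2 : ℝ)) := by
      rw [wgt_eq (by rw [← dist_eq_norm]; exact hd1), ← dist_eq_norm, ← hd,
        ← ofReal_mul (by positivity)]
      congr 1
      rw [show (-(7 / 2) : ℝ) = -(4 : ℕ) + 1 / 2 by norm_num, rpow_add hd0,
        rpow_neg hd0.le, rpow_natCast]
    refine h2.trans ?_
    have hx0 : 0 ≤ χ x ^ 2 + κ := by positivity
    calc _ ≤ ofReal C1 * ofReal (d ^ 4)⁻¹ *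
          (ofReal (4 * ((χ x ^ 2 + κ) * d ^ (1 / 2 : ℝ))) * (C2 * Mv)) := by
          gcongr; exact hI i
      _ = _ := by rw [hw, ofReal_mul (by norm_num), ofReal_mul hx0]; norm_num; ring
  rw [invLapDD_sum j k (fun i => (hθ i).dd _)]
  refine (enorm_sum_le _ _).trans ((sum_le_sum fun i _ => hterm i).trans (le_of_eq ?_))
  simp only [Finset.sum_const, Finset.card_univ, Fintype.card_fin, nsmul_eq_mul]; push_cast; ring

lemma measurable_lintegral_ball {F : E3 → ℝ≥0∞} (hF : Measurable F) (r : ℝ) :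
    Measurable fun m => ∫⁻ x in ball m r, F x := by
  have hS : MeasurableSet {p : E3 × E3 | dist p.2 p.1 < r} :=
    measurableSet_lt (by fun_prop) measurable_const
  have h : Measurable fun m => ∫⁻ x, {p : E3 × E3 | dist p.2 p.1 < r}.indicator
      (fun p => F p.2) (m, x) :=
    Measurable.lintegral_prod_right' ((hF.comp measurable_snd).indicator hS)
  convert h using 2 with m
  rw [← lintegral_indicator measurableSet_ball]; rfl

lemma measurable_l4 {χ} (hχ : Measurable χ) {U} (hU : Measurable U) : Measurable (l4 χ U) := by
  have h1 : Measurable fun x => (ofReal (χ x) * ‖U x‖ₑ) ^ 4 :=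
    (hχ.ennreal_ofReal.mul hU.enorm).pow_const 4
  exact (measurable_lintegral_ball h1 1).pow_const _

/-- The pressure term at a fixed time. Here `∑ i, ∂_i θ_i` stands for `div (Φ V)` with a cutoff
`Φ ≤ χ²` and a divergence free field `V` of size `v`. -/
lemma exists_pressure_static (K₀ b : ℝ) (hb : 0 ≤ b) : ∃ C, C ≠ ⊤ ∧ ∀ ρ, 1 ≤ ρ → ∃ Cρ, Cρ ≠ ⊤ ∧
    ∀ κ χ, IsMult κ χ → κ ≤ K₀ → ∀ U, Measurable U →
    ∀ (θ : Fin 3 → E3 → ℝ) (v : E3 → ℝ≥0∞) (Mv : ℝ≥0) o, (∀ i, IsTest (θ i)) → Measurable v →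
      (∀ m, ∫⁻ x in ball m 1, v x ^ 2 ≤ (Mv : ℝ≥0∞) ^ 2) →
      (∀ i y, ‖θ i y‖ₑ ≤ ofReal (χ y ^ 2) * v y) →
      (∀ i y, 2 * ρ ≤ dist y o → θ i y = 0) →
      (∀ y, ‖∑ i, dd (bv i) (θ i) y‖ₑ ≤ ofReal (b * (χ y ^ 2 / ρ + κ * χ y)) * v y) →
      (∀ y, 2 * ρ ≤ dist y o → ∑ i, dd (bv i) (θ i) y = 0) →
      ∀ j k, ∫⁻ x, ‖U x‖ₑ ^ 2 * ‖invLapDD j k (fun y => ∑ i, dd (bv i) (θ i) y) x‖ₑ ≤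
          C * Mv * (ofReal ρ⁻¹ * (∫⁻ m in ball o (4 * ρ + 1), l4 χ U m) +
            ofReal κ * ∫⁻ m in ball o (4 * ρ + 1), l4 𝟙 U m) +
          Cρ * Mv * ∫⁻ x, wgt (x - o) * (ofReal (χ x ^ 2 + κ) * ‖U x‖ₑ ^ 2) := by
  obtain ⟨C1, hC1, hnear⟩ := exists_pressure_near K₀ b hb
  set V := volume (ball (0 : E3) 1) with hV
  have hV0 : V ≠ 0 := (measure_ball_pos volume _ one_pos).ne'
  have hVt : V ≠ ⊤ := measure_ball_lt_top.ne
  refine ⟨V⁻¹ * C1, by finiteness, fun ρ hρ => ?_⟩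
  obtain ⟨C2, hC2, hmid⟩ := exists_pressure_mid K₀ b hb hρ
  obtain ⟨C3, hC3, hfar⟩ := exists_pressure_far hρ
  set W : ℝ≥0∞ := ofReal ((4 * ρ + 2) ^ (7 / 2 : ℝ)) with hW
  refine ⟨C2 * W + C3, by finiteness, fun κ χ hχ hκ U hU θ v Mv o hθ hv hMv hθv hθ0 hhv hh0 j k => ?_⟩
  set h : E3 → ℝ := fun y => ∑ i, dd (bv i) (θ i) y with hh
  have hht : IsTest h := by
    have := (((hθ 0).dd (bv 0)).add ((hθ 1).dd (bv 1))).add ((hθ 2).dd (bv 2))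
    simpa only [hh, Fin.sum_univ_three] using this
  have hm1 : Measurable fun x => ‖U x‖ₑ := hU.enorm
  have hm2 : Measurable fun x => ‖invLapDD j k h x‖ₑ :=
    (hht.continuous_invLapDD j k).measurable.enorm
  have hχm : Measurable χ := hχ.measurable
  have hχm2 : Measurable fun x => ofReal (χ x ^ 2 + κ) := by fun_prop
  set Q : E3 → ℝ≥0∞ := fun x => ofReal (χ x ^ 2 + κ) * ‖U x‖ₑ ^ 2 with hQ
  have hQm : Measurable Q := by fun_prop
  set I := ∫⁻ x, wgt (x - o) * Q x with hI
  set A1 := ∫⁻ m in ball o (4 * ρ + 1), l4 χ U m with hA1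
  set A2 := ∫⁻ m in ball o (4 * ρ + 1), l4 𝟙 U m with hA2
  -- the integral over the complement of `B_{4ρ}(o)`
  have hout : ∫⁻ x in (ball o (4 * ρ))ᶜ, ‖U x‖ₑ ^ 2 * ‖invLapDD j k h x‖ₑ ≤ C3 * Mv * I := by
    rw [hI, ← lintegral_cmul]
    refine (setLIntegral_mono' measurableSet_ball.compl fun x hx => ?_).trans
      (setLIntegral_le_lintegral _ _)
    have hx' : 4 * ρ ≤ dist x o := not_lt.1 fun h => hx (mem_ball.2 h)
    calc _ ≤ ‖U x‖ₑ ^ 2 * (C3 * Mv * (wgt (x - o) * ofReal (χ x ^ 2 + κ))) := by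
          gcongr; exact hfar κ χ hχ θ v Mv o hθ hv hMv hθv hθ0 x j k hx'
      _ = _ := by rw [hQ]; ring
  have hQball : ∫⁻ x in ball o (4 * ρ + 2), Q x ≤ W * I := by
    rw [hI, ← lintegral_cmul]
    refine (setLIntegral_mono' measurableSet_ball fun x hx => ?_).trans
      (setLIntegral_le_lintegral (ball o (4 * ρ + 2)) _)
    have h1 : ‖x - o‖ ≤ 4 * ρ + 2 := by rw [← dist_eq_norm]; exact (mem_ball.1 hx).le
    have h2 := le_pker_zero (b := 7 / 2) (by norm_num) (by linarith) h1
    have h3 : 1 ≤ W * wgt (x - o) := by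
      unfold wgt; rw [hW, ← ofReal_mul (by positivity), ← ofReal_one]; refine ofReal_le_ofReal ?_
      rw [rpow_neg (by positivity), inv_le_iff_one_le_mul₀' (by positivity)] at h2; exact h2
    calc Q x = 1 * Q x := (one_mul _).symm
      _ ≤ W * wgt (x - o) * Q x := by gcongr
      _ = _ := mul_assoc _ _ _
  have hin : ∫⁻ x in ball o (4 * ρ), ‖U x‖ₑ ^ 2 * ‖invLapDD j k h x‖ₑ ≤
      V⁻¹ * (C1 * Mv * (ofReal ρ⁻¹ * A1 + ofReal κ * A2)) + C2 * Mv * (W * I) := by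
    refine (setLIntegral_ball_le_average (by fun_prop) o (4 * ρ)).trans ?_
    have hm : ∀ m ∈ ball o (4 * ρ + 1), ∫⁻ x in ball m 1, ‖U x‖ₑ ^ 2 * ‖invLapDD j k h x‖ₑ ≤
          C1 * Mv * (ofReal ρ⁻¹ * l4 χ U m + ofReal κ * l4 𝟙 U m) +
          C2 * Mv * ∫⁻ x in ball m 1, Q x := by
      intro m hm; have hzt := (bumpAt_isTest two_pos m).mul hht
      have hm3 : Measurable fun x => ‖invLapDD j k (fun y => bumpAt 2 m y * h y) x‖ₑ :=
        (hzt.continuous_invLapDD j k).measurable.enorm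
      calc ∫⁻ x in ball m 1, ‖U x‖ₑ ^ 2 * ‖invLapDD j k h x‖ₑ ≤ ∫⁻ x in ball m 1, (‖U x‖ₑ ^ 2 *
              ‖invLapDD j k (fun y => bumpAt 2 m y * h y) x‖ₑ + C2 * Mv * Q x) := by
            refine setLIntegral_mono' measurableSet_ball fun x hx => ?_
            have e : invLapDD j k h x = invLapDD j k (fun y => bumpAt 2 m y * h y) x +
                invLapDD j k (fun y => h y - bumpAt 2 m y * h y) x := by
              rw [← invLapDD_add j k hzt (hht.sub hzt)]; simp only [add_sub_cancel]
            have hx' := mem_ball.1 hx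
            have hm' := mem_ball.1 hm
            have h2 := hmid κ χ hχ hκ h v Mv o hht hv hMv hhv hh0 m x j k
              (by linarith [dist_triangle x m o]) hx'
            calc _ ≤ ‖U x‖ₑ ^ 2 * (‖invLapDD j k (fun y => bumpAt 2 m y * h y) x‖ₑ +
                  C2 * Mv * ofReal (χ x ^ 2 + κ)) := by
                  gcongr; rw [e]
                  exact (enorm_add_le _ _).trans (by gcongr)
              _ = _ := by rw [hQ]; ring
        _ = (∫⁻ x in ball m 1, ‖U x‖ₑ ^ 2 * ‖invLapDD j k (fun y => bumpAt 2 m y * h y) x‖ₑ) +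
              C2 * Mv * ∫⁻ x in ball m 1, Q x := by
            rw [lintegral_add_left (by fun_prop), lintegral_cmul]
        _ ≤ _ := by gcongr; exact hnear ρ hρ κ χ hχ hκ U hU h v Mv hht hv hMv hhv m j k
    calc V⁻¹ * ∫⁻ m in ball o (4 * ρ + 1), ∫⁻ x in ball m 1, ‖U x‖ₑ ^ 2 * ‖invLapDD j k h x‖ₑ
        ≤ V⁻¹ * ∫⁻ m in ball o (4 * ρ + 1), (C1 * Mv * (ofReal ρ⁻¹ * l4 χ U m +
            ofReal κ * l4 𝟙 U m) + C2 * Mv * ∫⁻ x in ball m 1, Q x) := by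
          gcongr V⁻¹ * ?_; exact setLIntegral_mono' measurableSet_ball hm
      _ = V⁻¹ * (C1 * Mv * (ofReal ρ⁻¹ * A1 + ofReal κ * A2) +
            C2 * Mv * ∫⁻ m in ball o (4 * ρ + 1), ∫⁻ x in ball m 1, Q x) := by
          have p1 := measurable_l4 hχm hU
          have p2 := measurable_l4 (χ := fun _ => 1) measurable_const hU
          rw [lintegral_add_left (by fun_prop), lintegral_cmul,
            lintegral_add_left (by fun_prop), lintegral_cmul,
            lintegral_cmul, lintegral_cmul]
      _ ≤ V⁻¹ * (C1 * Mv * (ofReal ρ⁻¹ * A1 + ofReal κ * A2) + C2 * Mv * (V * (W * I))) := by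
          gcongr; refine (lintegral_ball_average_le hQm o (4 * ρ + 1) 1).trans ?_
          rw [show 4 * ρ + 1 + 1 = 4 * ρ + 2 by ring]; gcongr
      _ = V⁻¹ * (C1 * Mv * (ofReal ρ⁻¹ * A1 + ofReal κ * A2)) +
            V⁻¹ * V * (C2 * Mv * (W * I)) := by ring
      _ = _ := by rw [ENNReal.inv_mul_cancel hV0 hVt, one_mul]
  calc _ = (∫⁻ x in ball o (4 * ρ), ‖U x‖ₑ ^ 2 * ‖invLapDD j k h x‖ₑ) +
        ∫⁻ x in (ball o (4 * ρ))ᶜ, ‖U x‖ₑ ^ 2 * ‖invLapDD j k h x‖ₑ :=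
        (lintegral_add_compl _ measurableSet_ball).symm
    _ ≤ _ := add_le_add hin hout
    _ = _ := by ring

section

/-! ### Mollification in space and time -/

/-- Space-time, with the time variable first. -/
abbrev ST : Type := ℝ × E3

instance : (volume : Measure ST).IsAddHaarMeasure :=
  inferInstanceAs ((volume : Measure ℝ).prod (volume : Measure E3)).IsAddHaarMeasure

/-- A mollifier on space-time. -/
def stBump (n : ℕ) : ContDiffBump (0 : ST) :=
  ⟨ϵ[n] / 2, ϵ[n], by positivity, half_lt_self (by positivity)⟩

/-- The normalized mollifier. -/
def stj (n : ℕ) : ST → ℝ := (stBump n).normed volume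

/-- The mollification of a function on space-time. -/
def stm {F : Type*} [NormedAddCommGroup F] [NormedSpace ℝ F] (n : ℕ) (f : ST → F) : ST → F :=
  MeasureTheory.convolution (stj n) f (ContinuousLinearMap.lsmul ℝ ℝ) volume

/-- The probability measure with density `stj n`. -/
def stμ (n : ℕ) : Measure ST := volume.withDensity fun w => ofReal (stj n w)

lemma stj_nonneg (n : ℕ) (w : ST) : 0 ≤ stj n w := (stBump n).nonneg_normed w

lemma contDiff_stj (n : ℕ) : ContDiff ℝ (⊤ : ℕ∞) (stj n) := (stBump n).contDiff_normed

lemma hasCompactSupport_stj (n : ℕ) : HasCompactSupport (stj n) :=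
  (stBump n).hasCompactSupport_normed

lemma stj_eq_zero {n : ℕ} {w} (h : ϵ[n] ≤ ‖w‖) : stj n w = 0 := by
  have h1 : w ∉ Function.support (stj n) := by
    unfold stj; rw [ContDiffBump.support_normed_eq]; simpa [stBump] using h
  simpa using h1

lemma measurable_stj (n : ℕ) : Measurable (stj n) := (contDiff_stj n).continuous.measurable

instance (n : ℕ) : IsProbabilityMeasure (stμ n) := by
  refine ⟨?_⟩
  have hi : Integrable (stj n) := (stBump n).integrable_normed
  have h1 : ∫ x, stj n x = 1 := (stBump n).integral_normed
  rw [stμ, withDensity_apply _ MeasurableSet.univ, Measure.restrict_univ,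
    ← ofReal_integral_eq_lintegral_ofReal hi (.of_forall fun x => stj_nonneg n x),
    h1, ofReal_one]

lemma lintegral_stμ (n : ℕ) {F} (hF : Measurable F) :
    ∫⁻ w, F w ∂(stμ n) = ∫⁻ w, ofReal (stj n w) * F w :=
  lintegral_withDensity_eq_lintegral_mul _ (measurable_stj n).ennreal_ofReal hF

variable {F : Type*} [NormedAddCommGroup F] [NormedSpace ℝ F]

lemma enorm_stm_le [MeasurableSpace F] [BorelSpace F] (n : ℕ) {f : ST → F} (hf : Measurable f)
    (z : ST) : ‖stm n f z‖ₑ ≤ ∫⁻ w, ‖f (z - w)‖ₑ ∂(stμ n) := by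
  have hm : Measurable fun w => ‖f (z - w)‖ₑ := (hf.comp (measurable_const.sub measurable_id)).enorm
  rw [lintegral_stμ n hm]
  refine (enorm_integral_le_lintegral_enorm _).trans (le_of_eq (lintegral_congr fun w => ?_))
  simp only [ContinuousLinearMap.lsmul_apply, enorm_smul, enorm_of_nonneg (stj_nonneg n w)]

lemma contDiff_stm (n : ℕ) {f : ST → F} (hf : LocallyIntegrable f) :
    ContDiff ℝ (⊤ : ℕ∞) (stm n f) :=
  (hasCompactSupport_stj n).contDiff_convolution_left _ (contDiff_stj n) hf

lemma ae_tendsto_stm [CompleteSpace F] {f : ST → F} (hf : LocallyIntegrable f) :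
    ∀ᵐ z, Tendsto (fun n => stm n f z) atTop (𝓝 (f z)) := by
  have hb0 : Tendsto (fun n => (stBump n).rOut) atTop (𝓝 0) := by
    have := tendsto_one_div_add_atTop_nhds_zero_nat (𝕜 := ℝ)
    simpa [stBump] using this
  exact ContDiffBump.ae_convolution_tendsto_right_of_locallyIntegrable (μ := volume) (K := 2)
    (φ := stBump) hb0 (.of_forall fun n => by
    simp only [stBump]; linarith [mul_div_cancel₀ (ϵ[n]) (two_ne_zero' ℝ)]) hf

lemma lintegral_sq_le_of_prob {α : Type*} [MeasurableSpace α] (μ : Measure α)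
    [IsProbabilityMeasure μ] {F} (hF : Measurable F) :
    (∫⁻ x, F x ∂μ) ^ 2 ≤ ∫⁻ x, F x ^ 2 ∂μ := by
  have h := sq_lintegral_mul_le μ (f := fun _ => 1) (g := F) (by fun_prop) hF.aemeasurable
  simpa using h

lemma lintegral_cube_le_of_prob {α : Type*} [MeasurableSpace α] (μ : Measure α)
    [IsProbabilityMeasure μ] {F} (hF : Measurable F) :
    (∫⁻ x, F x ∂μ) ^ 3 ≤ ∫⁻ x, F x ^ 3 ∂μ := by
  have hpq : (3 : ℝ).HolderConjugate (3 / 2) := by rw [Real.holderConjugate_iff]; norm_num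
  have h := ENNReal.lintegral_mul_le_Lp_mul_Lq μ hpq hF.aemeasurable (g := fun _ => 1) (by fun_prop)
  simp only [Pi.mul_apply, mul_one, ENNReal.one_rpow, lintegral_const, measure_univ] at h
  calc (∫⁻ x, F x ∂μ) ^ 3 ≤ ((∫⁻ x, F x ^ (3 : ℝ) ∂μ) ^ (1 / 3 : ℝ)) ^ 3 := by gcongr
    _ = ∫⁻ x, F x ^ (3 : ℝ) ∂μ := by rw [← ENNReal.rpow_natCast, ← ENNReal.rpow_mul]; norm_num
    _ = _ := by
      refine lintegral_congr fun x => ?_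
      rw [← ENNReal.rpow_natCast]; norm_num

/-- Mollification converges in `L³`. By Jensen's inequality the third powers are dominated by
`stm n |f|³`, which has constant integral and converges almost everywhere, so that Fatou's lemma
applies to `4 (stm n |f|³ + |f|³) - |stm n f - f|³`. -/
lemma tendsto_lintegral_stm_sub [CompleteSpace F] [MeasurableSpace F] [BorelSpace F]
    [SecondCountableTopology F] {f : ST → F}
    (hf : Measurable f) (h3 : ∫⁻ z, ‖f z‖ₑ ^ 3 < ⊤) :
    Tendsto (fun n => ∫⁻ z, ‖stm n f z - f z‖ₑ ^ 3) atTop (𝓝 0) := by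
  set S := ∫⁻ z, ‖f z‖ₑ ^ 3 with hS
  have hcube : Integrable fun z => ‖f z‖ ^ 3 := by
    refine ⟨(hf.norm.pow_const 3).aestronglyMeasurable, ?_⟩
    unfold HasFiniteIntegral; simpa [enorm_pow] using h3
  have hfl : LocallyIntegrable f := by
    have : MemLp f 3 := by
      refine ⟨hf.aestronglyMeasurable, ?_⟩
      rw [eLpNorm_lt_top_iff_lintegral_rpow_enorm_lt_top (by norm_num) (by norm_num)]
      simpa using h3
    exact this.locallyIntegrable (by norm_num)
  set Fn : ℕ → ST → ℝ := fun n => stm n fun z => ‖f z‖ ^ 3 with hFn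
  have hFnc : ∀ n, Continuous (Fn n) := fun n => (contDiff_stm n hcube.locallyIntegrable).continuous
  have hfc : ∀ n, Continuous (stm n f) := fun n => (contDiff_stm n hfl).continuous
  have hFn0 : ∀ n z, 0 ≤ Fn n z := fun n z => by
    refine integral_nonneg fun w => ?_
    simp only [ContinuousLinearMap.lsmul_apply, smul_eq_mul]
    exact mul_nonneg (stj_nonneg n w) (by positivity)
  have hFne : ∀ n z, ofReal (Fn n z) = ∫⁻ w, ‖f (z - w)‖ₑ ^ 3 ∂(stμ n) := by
    intro n z
    have hm : Measurable fun w => ‖f (z - w)‖ₑ ^ 3 :=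
      (hf.comp (measurable_const.sub measurable_id)).enorm.pow_const 3
    rw [lintegral_stμ n hm]
    have hi : Integrable fun w => stj n w * ‖f (z - w)‖ ^ 3 :=
      (hasCompactSupport_stj n).convolutionExists_left (ContinuousLinearMap.lsmul ℝ ℝ)
        (contDiff_stj n).continuous hcube.locallyIntegrable z
    have h1 := ofReal_integral_eq_lintegral_ofReal hi (.of_forall fun w =>
      mul_nonneg (stj_nonneg n w) (by positivity))
    refine (show ofReal (Fn n z) = _ from h1).trans (lintegral_congr fun w => ?_)
    rw [ofReal_mul (stj_nonneg n w), ofReal_pow (norm_nonneg _), ofReal_norm]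
  have hjen : ∀ n z, ‖stm n f z‖ₑ ^ 3 ≤ ofReal (Fn n z) := by
    intro n z; rw [hFne]
    exact (pow_le_pow_left' (enorm_stm_le n hf z) 3).trans (lintegral_cube_le_of_prob _
      (hf.comp (measurable_const.sub measurable_id)).enorm)
  have hFnI : ∀ n, ∫⁻ z, ofReal (Fn n z) = S := by
    intro n
    have hi : Integrable (Fn n) := Integrable.integrable_convolution (ContinuousLinearMap.lsmul ℝ ℝ)
        (stBump n).integrable_normed hcube
    rw [← ofReal_integral_eq_lintegral_ofReal hi (.of_forall (hFn0 n))]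
    have h1 := integral_convolution (ContinuousLinearMap.lsmul ℝ ℝ) (μ := volume) (ν := volume)
      (f := stj n) (g := fun z : ST => ‖f z‖ ^ 3) (stBump n).integrable_normed hcube
    have h2 : ∫ z, stj n z = 1 := (stBump n).integral_normed
    rw [h2] at h1; simp only [ContinuousLinearMap.lsmul_apply, one_smul] at h1
    refine (congrArg ofReal h1).trans ?_
    rw [ofReal_integral_eq_lintegral_ofReal hcube (.of_forall fun z => by positivity)]
    refine lintegral_congr fun z => ?_
    rw [ofReal_pow (norm_nonneg _), ofReal_norm]
  have hadd : ∀ a b : ℝ≥0∞, (a + b) ^ 3 ≤ 4 * (a ^ 3 + b ^ 3) := by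
    intro a b; have := ENNReal.rpow_add_le_mul_rpow_add_rpow a b (p := 3) (by norm_num)
    norm_num at this; exact_mod_cast this
  set A : ℕ → ST → ℝ≥0∞ := fun n z => ‖stm n f z - f z‖ₑ ^ 3 with hA
  set B : ℕ → ST → ℝ≥0∞ := fun n z => 4 * (ofReal (Fn n z) + ‖f z‖ₑ ^ 3) with hB
  have hAm : ∀ n, Measurable (A n) := fun n => (((hfc n).measurable).sub hf).enorm.pow_const 3
  have hBm : ∀ n, Measurable (B n) := fun n =>
    ((hFnc n).measurable.ennreal_ofReal.add (hf.enorm.pow_const 3)).const_mul 4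
  have hAB : ∀ n z, A n z ≤ B n z := fun n z => by
    refine (pow_le_pow_left' enorm_sub_le 3).trans ((hadd _ _).trans ?_)
    simp only [hB]; gcongr; exact hjen n z
  have hBI : ∀ n, ∫⁻ z, B n z = 8 * S := fun n => by
    simp only [hB]; rw [lintegral_cmul, lintegral_add_right _ (hf.enorm.pow_const 3), hFnI]; ring
  have hAt : ∀ n, ∫⁻ z, A n z ≠ ⊤ := fun n =>
    ne_top_of_le_ne_top (by rw [hBI]; finiteness) (lintegral_mono (hAB n))
  have hlim : ∀ᵐ z, Tendsto (fun n => B n z - A n z) atTop (𝓝 (8 * ‖f z‖ₑ ^ 3)) := by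
    filter_upwards [ae_tendsto_stm hfl, ae_tendsto_stm hcube.locallyIntegrable] with z hz1 hz2
    have l1 : Tendsto (fun n => A n z) atTop (𝓝 0) := by
      have : Tendsto (fun n => ‖stm n f z - f z‖ₑ ^ 3) atTop (𝓝 (‖f z - f z‖ₑ ^ 3)) :=
        ((ENNReal.continuous_pow 3).tendsto _).comp
          ((continuous_enorm.tendsto _).comp (hz1.sub_const (f z)))
      simpa using this
    have l2 : Tendsto (fun n => B n z) atTop (𝓝 (4 * (‖f z‖ₑ ^ 3 + ‖f z‖ₑ ^ 3))) := by
      refine ENNReal.Tendsto.const_mul (Tendsto.add ?_ tendsto_const_nhds) (Or.inr (by norm_num))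
      have := (ENNReal.continuous_ofReal.tendsto _).comp hz2
      rw [ofReal_pow (norm_nonneg _), ofReal_norm] at this; exact this
    have := ENNReal.Tendsto.sub l2 l1 (Or.inr (by norm_num))
    rw [tsub_zero] at this; convert this using 2; ring
  have hfatou : 8 * S ≤ liminf (fun n => 8 * S - ∫⁻ z, A n z) atTop := by
    calc 8 * S = ∫⁻ z, liminf (fun n => B n z - A n z) atTop := by
          rw [hS, ← lintegral_cmul]; refine lintegral_congr_ae ?_; filter_upwards [hlim] with z hz
          exact hz.liminf_eq.symm
      _ ≤ liminf (fun n => ∫⁻ z, (B n z - A n z)) atTop :=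
          lintegral_liminf_le fun n => (hBm n).sub (hAm n)
      _ = _ := by
          congr 1; funext n; rw [lintegral_sub (hAm n) (hAt n) (.of_forall (hAB n)), hBI]
  rw [ENNReal.tendsto_nhds_zero]; intro ε hε; by_contra hcon
  rw [not_eventually] at hcon; have h8 : 8 * S ≠ ⊤ := by finiteness
  have h1 : liminf (fun n => 8 * S - ∫⁻ z, A n z) atTop ≤ 8 * S - ε := by
    exact liminf_le_of_frequently_le' (hcon.mono fun n hn => (tsub_le_tsub_left (not_le.1 hn).le _))
  have h2 := hfatou.trans h1
  have h0 : 8 * S = 0 := by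
    by_contra hne
    exact absurd h2 (not_le.2 (ENNReal.sub_lt_self h8 hne hε.ne'))
  obtain ⟨n, hn⟩ := hcon.exists
  refine hn (le_trans ?_ zero_le)
  rw [← h0, ← hBI n]; exact lintegral_mono (hAB n)

/-- Mollification does not increase uniformly local norms. -/
lemma setLIntegral_stm_sq_le (n : ℕ) {u : ℝ → E3 → E3} (hu : Measurable (uncurry u))
    {M} (hM : ∀ t m, ∫⁻ x in ball m 1, ‖u t x‖ₑ ^ 2 ≤ M) (t : ℝ) (m : E3) :
    ∫⁻ x in ball m 1, ‖stm n (uncurry u) (t, x)‖ₑ ^ 2 ≤ M := by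
  have hum : Measurable fun p : E3 × ST => ‖uncurry u ((t, p.1) - p.2)‖ₑ ^ 2 :=
    (hu.comp (by fun_prop : Measurable fun p : E3 × ST => ((t, p.1) - p.2 : ST))).enorm.pow_const 2
  calc _ ≤ ∫⁻ x in ball m 1, ∫⁻ w, ‖uncurry u ((t, x) - w)‖ₑ ^ 2 ∂(stμ n) := by
        refine lintegral_mono fun x => ?_
        exact (pow_le_pow_left' (enorm_stm_le n hu _) 2).trans (lintegral_sq_le_of_prob _
          (hu.comp (measurable_const.sub measurable_id)).enorm)
    _ = ∫⁻ w, (∫⁻ x in ball m 1, ‖uncurry u ((t, x) - w)‖ₑ ^ 2) ∂(stμ n) :=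
        lintegral_lintegral_swap hum.aemeasurable
    _ ≤ ∫⁻ _w, M ∂(stμ n) := by
        refine lintegral_mono fun w => ?_
        have h1 := setLIntegral_ball_sub (fun y => ‖u (t - w.1) y‖ₑ ^ 2) m w.2 1
        exact (le_of_eq h1).trans (hM _ _)
    _ = M := by simp

lemma locallyIntegrable_uncurry {u : ℝ → E3 → E3} (hu : Measurable (uncurry u))
    {M} (hMt : M ≠ ⊤) (hM : ∀ t m, ∫⁻ x in ball m 1, ‖u t x‖ₑ ^ 2 ≤ M) :
    LocallyIntegrable (uncurry u) := by
  have h2 : ∀ z : ST, MemLp (uncurry u) 2 (volume.restrict (ball z.1 1 ×ˢ ball z.2 1)) := by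
    intro z; refine ⟨hu.aestronglyMeasurable, ?_⟩
    rw [eLpNorm_lt_top_iff_lintegral_rpow_enorm_lt_top (by norm_num) (by norm_num),
      volume_eq_prod, ← prod_restrict]
    simp only [ENNReal.toReal_ofNat, ENNReal.rpow_ofNat]
    rw [lintegral_prod _ (hu.enorm.pow_const 2).aemeasurable]
    calc _ ≤ ∫⁻ _t in ball z.1 1, M := lintegral_mono fun t => hM t z.2
      _ < ⊤ := by
        rw [lintegral_const]; have : volume (ball z.1 1) ≠ ⊤ := measure_ball_lt_top.ne
        simp only [Measure.restrict_apply MeasurableSet.univ, univ_inter]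
        exact mul_lt_top hMt.lt_top this.lt_top
  intro z
  refine ⟨ball z.1 1 ×ˢ ball z.2 1,
    prod_mem_nhds (ball_mem_nhds _ one_pos) (ball_mem_nhds _ one_pos), ?_⟩
  have : IsFiniteMeasure (volume.restrict (ball z.1 1 ×ˢ ball z.2 1)) := by
    refine ⟨?_⟩
    rw [Measure.restrict_apply MeasurableSet.univ, univ_inter, volume_eq_prod, Measure.prod_prod]
    exact mul_lt_top measure_ball_lt_top measure_ball_lt_top
  exact (h2 z).integrable (by norm_num)

/-- The mollification of a divergence free field is divergence free. -/
lemma sum_fderiv_stm_eq_zero (n : ℕ) {u} (hul : LocallyIntegrable (uncurry u)) {I}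
    (hdiv : ∀ θ, IsSpaceTimeTest I θ → ∫ t, ∫ x, ⟪u t x, gradient (θ t) x⟫ = 0)
    (t : ℝ) (x : E3) (hI : closedBall t ϵ[n] ⊆ I) :
    ∑ i, fderiv ℝ (fun y => stm n (uncurry u) (t, y) i) x (bv i) = 0 := by
  set L : ℝ →L[ℝ] E3 →L[ℝ] E3 := ContinuousLinearMap.lsmul ℝ ℝ
  have hjd : ContDiff ℝ 1 (stj n) := (contDiff_stj n).of_le (by simp)
  have hfd := (hasCompactSupport_stj n).hasFDerivAt_convolution_left L hjd hul (t, x)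
  have hce : Integrable fun w => (L.precompL ST) (fderiv ℝ (stj n) w) (uncurry u ((t, x) - w)) :=
    ((hasCompactSupport_stj n).fderiv ℝ).convolutionExists_left (L.precompL ST)
      (hjd.continuous_fderiv one_ne_zero) hul (t, x)
  have hcomp : ∀ i, fderiv ℝ (fun y => stm n (uncurry u) (t, y) i) x (bv i) =
      ∫ w, fderiv ℝ (stj n) w (0, bv i) * (uncurry u ((t, x) - w)) i := by
    intro i
    have h1 : HasFDerivAt (fun y : E3 => ((t, y) : ST)) (ContinuousLinearMap.inr ℝ ℝ E3) x :=
      hasFDerivAt_prodMk_right t x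
    have h2 := ((𝐩 i).hasFDerivAt).comp x (hfd.comp x h1)
    have h3 : fderiv ℝ (fun y => stm n (uncurry u) (t, y) i) x = _ := h2.fderiv
    rw [h3]; simp only [ContinuousLinearMap.comp_apply, ContinuousLinearMap.inr_apply]
    have h4 : (MeasureTheory.convolution (fderiv ℝ (stj n)) (uncurry u)
        (L.precompL ST) volume (t, x)) ((0, bv i) : ST) =
        ∫ w, fderiv ℝ (stj n) w (0, bv i) • uncurry u ((t, x) - w) := by
      unfold MeasureTheory.convolution; rw [ContinuousLinearMap.integral_apply hce]; rfl
    rw [h4, ← (𝐩 i).integral_comp_comm]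
    · rfl
    · exact (ContinuousLinearMap.apply ℝ E3 ((0, bv i) : ST)).integrable_comp hce
  have hint : ∀ i, Integrable fun w =>
    fderiv ℝ (stj n) w (0, bv i) * (uncurry u ((t, x) - w)) i := fun i =>
    (𝐩 i).integrable_comp ((ContinuousLinearMap.apply ℝ E3 ((0, bv i) : ST)).integrable_comp hce)
  simp_rw [hcomp]
  rw [← integral_finsetSum _ fun i _ => hint i, ← integral_sub_left_eq_self _ volume ((t, x) : ST)]
  simp only [sub_sub_cancel]
  -- the test function is the reflected mollifier
  set θ : ℝ → E3 → ℝ := fun τ y => stj n ((t, x) - (τ, y)) with hθ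
  have hθt : IsSpaceTimeTest I θ := by
    refine ⟨(contDiff_stj n).comp (contDiff_const.sub contDiff_id),
      (hasCompactSupport_stj n).comp_homeomorph (Homeomorph.subLeft ((t, x) : ST)), ?_⟩
    have hsub : tsupport (uncurry θ) ⊆ closedBall t ϵ[n] ×ˢ (univ : Set E3) := by
      refine closure_minimal (fun p hp => ?_) (Metric.isClosed_closedBall.prod isClosed_univ)
      refine ⟨?_, mem_univ _⟩
      by_contra hcon
      refine hp (stj_eq_zero ?_)
      rw [Metric.mem_closedBall, not_le, dist_comm, dist_eq_norm] at hcon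
      exact hcon.le.trans (norm_fst_le ((t, x) - p : ST))
    exact hsub.trans (prod_mono hI le_rfl)
  have h0 := hdiv θ hθt
  have hgrad : ∀ τ y, ⟪u τ y, gradient (θ τ) y⟫ =
      - ∑ i, fderiv ℝ (stj n) ((t, x) - (τ, y)) (0, bv i) * u τ y i := by
    intro τ y
    have h1 : HasFDerivAt (fun y : E3 => ((t, x) - (τ, y) : ST))
        (-(ContinuousLinearMap.inr ℝ ℝ E3)) y :=
      (hasFDerivAt_prodMk_right τ y).const_sub ((t, x) : ST)
    have h2 : HasFDerivAt (stj n) (fderiv ℝ (stj n) ((t, x) - (τ, y))) ((t, x) - (τ, y)) :=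
      ((contDiff_stj n).differentiable (by simp) _).hasFDerivAt
    have h3 : fderiv ℝ (θ τ) y = _ := (h2.comp y h1).fderiv
    rw [PiLp.inner_apply, ← Finset.sum_neg_distrib]; refine Finset.sum_congr rfl fun i _ => ?_
    rw [gradient_apply, dd, h3]
    simp only [ContinuousLinearMap.comp_apply, neg_apply, map_neg, ContinuousLinearMap.inr_apply,
      RCLike.inner_apply, conj_trivial, neg_mul]
  simp_rw [hgrad, integral_neg] at h0; rw [neg_eq_zero] at h0; refine Eq.trans ?_ h0
  rw [volume_eq_prod, integral_prod]
  · rfl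
  · have hi := (integrable_finsetSum Finset.univ fun i _ => hint i).comp_sub_left ((t, x) : ST)
    simp only [sub_sub_cancel] at hi; exact hi

end

local notation "𝓤[" T "," ρ "," χ "," u "]" => ulocSup (volume.restrict (Ioo 0 T)) ρ (fun τ => sqd χ (u τ))

/-! ### The pressure in space and time -/

lemma stronglyMeasurable_hat_time {θ : ℝ → E3 → ℝ} (hθ : Continuous (uncurry θ)) :
    StronglyMeasurable fun p : ℝ × E3 => hat (θ p.1) p.2 := by
  simp only [hat_eq]
  refine StronglyMeasurable.integral_prod_right (f := fun (p : ℝ × E3) (v : E3) =>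
    exp (↑(-2 * π * ⟪v, p.2⟫) * I) * (θ p.1 v : ℂ)) ?_
  have h : Continuous fun q : (ℝ × E3) × E3 => θ q.1.1 q.2 :=
    hθ.comp (by fun_prop : Continuous fun q : (ℝ × E3) × E3 => (q.1.1, q.2))
  exact Continuous.stronglyMeasurable (by fun_prop)

lemma measurable_invLapDD_time (j k : Fin 3) {θ : ℝ → E3 → ℝ} (hθ : Continuous (uncurry θ)) :
    Measurable fun p : ℝ × E3 => invLapDD j k (θ p.1) p.2 := by
  simp only [invLapDD_eq]; refine Complex.measurable_re.comp (StronglyMeasurable.measurable ?_)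
  refine StronglyMeasurable.integral_prod_right (f := fun (p : ℝ × E3) (ξ : E3) =>
    exp (↑(2 * π * ⟪ξ, p.2⟫) * I) * ((rieszSymbol j k ξ : ℂ) * hat (θ p.1) ξ)) ?_
  have h1 : Measurable fun q : (ℝ × E3) × E3 => exp (↑(2 * π * ⟪q.2, q.1.2⟫) * I) :=
    Continuous.measurable (by fun_prop)
  have h2 : Measurable fun q : (ℝ × E3) × E3 => (rieszSymbol j k q.2 : ℂ) :=
    Complex.measurable_ofReal.comp ((measurable_rieszSymbol j k).comp measurable_snd)
  have h0 : Measurable fun q : (ℝ × E3) × E3 => ((q.1.1, q.2) : ℝ × E3) := by fun_prop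
  have h3 := (stronglyMeasurable_hat_time hθ).measurable.comp h0
  simp only [Function.comp_def] at h3; exact (h1.mul (h2.mul h3)).stronglyMeasurable

lemma IsSpaceTimeTest.slice {I : Set ℝ} {θ : ℝ → E3 → ℝ} (hθ : IsSpaceTimeTest I θ) (t : ℝ) :
    IsTest (θ t) := by
  refine ⟨hθ.1.comp (contDiff_prodMk_right t), ?_⟩
  refine HasCompactSupport.intro (K := Prod.snd '' tsupport (uncurry θ))
    (hθ.2.1.isCompact.image continuous_snd) fun x hx => ?_
  by_contra h
  exact hx ⟨(t, x), subset_tsupport _ h, rfl⟩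

lemma IsSpaceTimeTest.eq_zero {I : Set ℝ} {θ : ℝ → E3 → ℝ} (hθ : IsSpaceTimeTest I θ) {t : ℝ}
    (ht : t ∉ I) : θ t = fun _ => 0 := by
  funext x; by_contra h; exact ht (hθ.2.2 (subset_tsupport (uncurry θ) (a := (t, x)) h)).1

lemma IsSpaceTimeTest.dd_eq {I : Set ℝ} {θ : ℝ → E3 → ℝ} (hθ : IsSpaceTimeTest I θ) (v : E3)
    (t : ℝ) (x : E3) : dd v (θ t) x = fderiv ℝ (uncurry θ) (t, x) (0, v) := by
  have h1 : HasFDerivAt (fun y : E3 => ((t, y) : ST)) (ContinuousLinearMap.inr ℝ ℝ E3) x :=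
    hasFDerivAt_prodMk_right t x
  have h2 := ((hθ.1.differentiable (by simp) (t, x)).hasFDerivAt).comp x h1
  have h3 : fderiv ℝ (θ t) x = _ := h2.fderiv
  rw [dd, h3]; rfl

lemma IsSpaceTimeTest.dd {I : Set ℝ} {θ : ℝ → E3 → ℝ} (hθ : IsSpaceTimeTest I θ) (v : E3) :
    IsSpaceTimeTest I fun t => FNS.dd v (θ t) := by
  have e : (uncurry fun t => FNS.dd v (θ t)) = fun p => fderiv ℝ (uncurry θ) p (0, v) := by
    funext p; exact hθ.dd_eq v p.1 p.2
  unfold IsSpaceTimeTest; rw [e]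
  have hs := tsupport_fderiv_apply_subset ℝ (f := uncurry θ) ((0, v) : ST)
  refine ⟨?_, hθ.2.1.of_isClosed_subset (isClosed_tsupport _) hs, hs.trans hθ.2.2⟩
  exact (hθ.1.fderiv_right (m := (⊤ : ℕ∞)) (by simp)).clm_apply contDiff_const

lemma IsSpaceTimeTest.exists_bound {I : Set ℝ} {θ : ℝ → E3 → ℝ} (hθ : IsSpaceTimeTest I θ) :
    ∃ B : ℝ≥0, ∀ t x, ‖θ t x‖ₑ ≤ B := by
  obtain ⟨B, hB⟩ := hθ.2.1.exists_bound_of_continuous hθ.1.continuous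
  refine ⟨B.toNNReal, fun t x => ?_⟩
  rw [← ofReal_norm]; exact ofReal_le_ofReal (hB (t, x))

lemma dd_zero (v : E3) : dd v (fun _ => (0 : ℝ)) = fun _ => 0 := by funext x; simp [dd]

lemma invLapDD_zero (j k : Fin 3) (x : E3) : invLapDD j k (fun _ => 0) x = 0 := by
  have h0 : IsTest fun _ : E3 => (0 : ℝ) := ⟨contDiff_const, HasCompactSupport.zero⟩
  have := invLapDD_add j k h0 h0 x
  simp only [add_zero] at this; linarith

lemma dd_eq_sum (v : E3) (f : E3 → ℝ) (x : E3) : dd v f x = ∑ i, v i * dd (bv i) f x := by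
  rw [← inner_gradient, PiLp.inner_apply]; refine Finset.sum_congr rfl fun i _ => ?_
  rw [gradient_apply]; simp [mul_comm]

lemma measurable_l4_time {χ : E3 → ℝ} (hχ : Measurable χ) {u : ℝ → E3 → E3}
    (hu : Measurable (uncurry u)) :
    Measurable fun p : ℝ × E3 => l4 χ (u p.1) p.2 := by
  have hS : MeasurableSet {p : (ℝ × E3) × E3 | dist p.2 p.1.2 < 1} :=
    measurableSet_lt (by fun_prop) measurable_const
  have hF : Measurable fun p : (ℝ × E3) × E3 => (ofReal (χ p.2) * ‖u p.1.1 p.2‖ₑ) ^ 4 := by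
    have h1 : Measurable fun p : (ℝ × E3) × E3 => u p.1.1 p.2 :=
      hu.comp (by fun_prop : Measurable fun p : (ℝ × E3) × E3 => (p.1.1, p.2))
    exact ((hχ.comp measurable_snd).ennreal_ofReal.mul h1.enorm).pow_const 4
  have h : Measurable fun m : ℝ × E3 => ∫⁻ x, {p : (ℝ × E3) × E3 | dist p.2 p.1.2 < 1}.indicator
      (fun p => (ofReal (χ p.2) * ‖u p.1.1 p.2‖ₑ) ^ 4) (m, x) :=
    Measurable.lintegral_prod_right' (hF.indicator hS)
  refine Measurable.pow_const ?_ _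
  convert h using 2 with m
  rw [← lintegral_indicator measurableSet_ball]; rfl

lemma lintegral_eq_setLIntegral_of_zero {α : Type*} [MeasurableSpace α] {μ : Measure α}
    {F : α → ℝ≥0∞} {I : Set α} (hI : MeasurableSet I) (h : ∀ t, t ∉ I → F t = 0) :
    ∫⁻ t, F t ∂μ = ∫⁻ t in I, F t ∂μ := by
  rw [← lintegral_indicator hI]; refine lintegral_congr fun t => ?_
  by_cases ht : t ∈ I
  · rw [indicator_of_mem ht]
  · rw [indicator_of_notMem ht, h t ht]

lemma IsSpaceTimeTest.exists_radius {I : Set ℝ} {θ : ℝ → E3 → ℝ} (hθ : IsSpaceTimeTest I θ) :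
    ∃ R : ℝ, 1 ≤ R ∧ ∀ t x, R ≤ ‖x‖ → θ t x = 0 := by
  obtain ⟨R, hR⟩ := hθ.2.1.isCompact.isBounded.exists_norm_le
  refine ⟨max 1 (R + 1), le_max_left _ _, fun t x hx => ?_⟩
  by_contra h
  have h1 := hR (t, x) (subset_tsupport _ h)
  have h2 : ‖x‖ ≤ ‖(t, x)‖ := norm_snd_le (t, x)
  have h3 := le_max_right 1 (R + 1)
  linarith

/-- The static pressure estimate for a single scalar test function. -/
lemma exists_pressure_single (B : ℝ≥0) {ρ : ℝ} (hρ : 1 ≤ ρ) : ∃ C : ℝ≥0∞, C ≠ ⊤ ∧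
    ∀ (i : Fin 3) (U : E3 → E3), Measurable U → ∀ θ : E3 → ℝ, IsTest θ → (∀ x, ‖θ x‖ₑ ≤ B) →
      (∀ x, ‖dd (bv i) θ x‖ₑ ≤ B) → (∀ x, 2 * ρ ≤ ‖x‖ → θ x = 0) →
      (∀ x, 2 * ρ ≤ ‖x‖ → dd (bv i) θ x = 0) → ∀ j k : Fin 3,
      ∫⁻ x, ‖U x‖ₑ ^ 2 * ‖invLapDD j k (dd (bv i) θ) x‖ₑ ≤
        C * ((∫⁻ m in ball 0 (4 * ρ + 1), l4 𝟙 U m) + ∫⁻ x, wgt (x - 0) * ‖U x‖ₑ ^ 2) := by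
  obtain ⟨C, hC, hst⟩ := exists_pressure_static 0 ρ (by linarith)
  obtain ⟨Cρ, hCρ, hst⟩ := hst ρ hρ
  have hvt : volume (ball (0 : E3) 1) ≠ ⊤ := measure_ball_lt_top.ne
  obtain ⟨W, hW⟩ : ∃ W : ℝ≥0, (W : ℝ≥0∞) = volume (ball (0 : E3) 1) := ⟨_, coe_toNNReal hvt⟩
  let Mv : ℝ≥0 := B * (1 + W)
  refine ⟨C * Mv + Cρ * Mv, by finiteness, fun i U hU θ hθ h1 h2 h3 h4 j k => ?_⟩
  let θ' : Fin 3 → E3 → ℝ := fun l => if l = i then θ else fun _ => 0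
  have hi : θ' i = θ := if_pos rfl
  have hni : ∀ l, l ≠ i → θ' l = fun _ => 0 := fun l hl => if_neg hl
  have hsum' : ∀ y, ∑ l, dd (bv l) (θ' l) y = dd (bv i) θ y := by
    intro y; rw [Finset.sum_eq_single i, hi]
    · intro l _ hl; rw [hni l hl, dd_zero]
    · simp
  have h := hst 0 𝟙 IsMult.one le_rfl U hU θ' (fun _ => B) Mv 0 ?_ measurable_const
    ?_ ?_ ?_ ?_ ?_ j k
  · simp only [hsum'] at h
    simp only [ofReal_zero, zero_mul, add_zero, one_pow, ofReal_one, one_mul] at h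
    refine h.trans ?_
    rw [mul_add, add_mul, add_mul]
    have hρ1 : ofReal ρ⁻¹ ≤ 1 := ofReal_le_one.2 (inv_le_one_of_one_le₀ hρ)
    calc _ ≤ C * Mv * (1 * ∫⁻ m in ball 0 (4 * ρ + 1), l4 𝟙 U m) +
          Cρ * Mv * ∫⁻ x, wgt (x - 0) * ‖U x‖ₑ ^ 2 := by gcongr
      _ ≤ _ := by rw [one_mul]; exact add_le_add le_self_add le_add_self
  · intro l; by_cases hl : l = i
    · rw [hl, hi]; exact hθ
    · rw [hni l hl]; exact ⟨contDiff_const, HasCompactSupport.zero⟩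
  · intro m; have hv : volume (ball m 1) = W := by rw [hW]; exact Measure.addHaar_ball_center _ _ _
    rw [lintegral_const, Measure.restrict_apply MeasurableSet.univ, univ_inter, hv]
    have : B ^ 2 * W ≤ Mv ^ 2 := by
      have hW2 : W ≤ (1 + W) ^ 2 := by
        rw [sq]; exact le_trans le_add_self (le_mul_of_one_le_left zero_le le_self_add)
      calc B ^ 2 * W ≤ B ^ 2 * (1 + W) ^ 2 := by gcongr
        _ = Mv ^ 2 := by ring
    exact_mod_cast this
  · intro l y; simp only [one_pow, ofReal_one, one_mul]; by_cases hl : l = i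
    · rw [hl, hi]; exact h1 y
    · rw [hni l hl]; simp
  · intro l y hy; rw [dist_zero_right] at hy; by_cases hl : l = i
    · rw [hl, hi]; exact h3 y hy
    · rw [hni l hl]
  · intro y; rw [hsum']
    have : ρ * ((1 : ℝ) ^ 2 / ρ + 0 * 1) = 1 := by
      have : ρ ≠ 0 := by linarith
      field_simp; ring
    rw [this, ofReal_one, one_mul]; exact h2 y
  · intro y hy; rw [dist_zero_right] at hy; rw [hsum']; exact h4 y hy

lemma integrable_uncurry_of_slices {f : ℝ → E3 → ℝ} (hf : Measurable (uncurry f))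
    {I : Set ℝ} (hI : MeasurableSet I) (hz : ∀ t, t ∉ I → ∀ x, f t x = 0) {F : ℝ → ℝ≥0∞}
    (hb : ∀ t, ∫⁻ x, ‖f t x‖ₑ ≤ F t) (hF : ∫⁻ t in I, F t < ⊤) :
    Integrable (uncurry f) := by
  refine ⟨hf.aestronglyMeasurable, ?_⟩
  unfold HasFiniteIntegral; rw [volume_eq_prod, lintegral_prod _ hf.enorm.aemeasurable]
  rw [lintegral_eq_setLIntegral_of_zero hI fun t ht => by simp [hz t ht]]
  exact (lintegral_mono hb).trans_lt hF

/-- The data of a local Leray solution on a time interval `(0, T')`, after the choice of jointly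
measurable representatives that are good at every time. -/
structure LerayData (s T' : ℝ) (M : ℝ≥0) (u g : ℝ → E3 → E3) (P : ℝ → E3 → ℝ) : Prop where
  meas_u : Measurable (uncurry u)
  meas_g : Measurable (uncurry g)
  uloc : ∀ t m, ∫⁻ x in ball m 1, ‖u t x‖ₑ ^ 2 ≤ (M : ℝ≥0∞) ^ 2
  wint_u : ∀ t, WInt (u t)
  wint_g : ∀ t, WInt (g t)
  fracLap : ∀ t, HasFracLap s (u t) (g t)
  g_fin : 𝓤[T', 1, 𝟙, g] < ⊤
  div_free : ∀ θ : ℝ → E3 → ℝ, IsSpaceTimeTest (Ioo 0 T') θ →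
    ∫ t, ∫ x, ⟪u t x, gradient (θ t) x⟫ = 0
  memP : ∀ K : Set (ℝ × E3), IsCompact K → K ⊆ Ioo 0 T' ×ˢ (univ : Set E3) →
    MemLp (uncurry P) (3 / 2) (volume.restrict K)
  pressure : ∀ θ : ℝ → E3 → ℝ, IsSpaceTimeTest (Ioo 0 T') θ → ∀ i : Fin 3,
    ∫ t, ∫ x, P t x * gradient (θ t) x i =
      -∫ t, ∫ x, ∑ j, ∑ k, u t x j * u t x k * invLapDD j k (fun y => gradient (θ t) y i) x
  energy : ∀ (ψ : ℝ → E3 → ℝ) (ψ' : E3 → ℝ), IsSpaceTimeTest (Ioo 0 T') ψ → (∀ t x, 0 ≤ ψ t x) →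
    IsTest ψ' → (∀ x, 0 ≤ ψ' x) → (∀ t x, ψ' x * ψ t x = ψ t x) →
    ∃ c₁ c₂ : ℝ → E3 → E3, (∀ᵐ t ∂(𝓛 T'), HasCommutator s ψ' (g t) (c₁ t)) ∧
      (∀ᵐ t ∂(𝓛 T'), HasCommutator s (ψ t) (u t) (c₂ t)) ∧
      ∀ t, 0 < t → t ≤ T' → 2 * ∫ τ in Ioo 0 t, ∫ x, ψ τ x * ‖g τ x‖ ^ 2 ≤
          (∫ τ in Ioo 0 t, ∫ x, ‖u τ x‖ ^ 2 * deriv (fun r => ψ r x) τ)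
          - 2 * (∫ τ in Ioo 0 t, ∫ x, ⟪-c₁ τ x, ψ τ x • u τ x⟫)
          - 2 * (∫ τ in Ioo 0 t, ∫ x, ⟪c₂ τ x, ψ' x • g τ x⟫)
          + (∫ τ in Ioo 0 t, ∫ x, ‖u τ x‖ ^ 2 * ⟪u τ x, gradient (ψ τ) x⟫)
          + 2 * (∫ τ in Ioo 0 t, ∫ x, P τ x * ⟪u τ x, gradient (ψ τ) x⟫)

namespace LerayData

variable {s T' : ℝ} {M : ℝ≥0} {u g : ℝ → E3 → E3} {P : ℝ → E3 → ℝ}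

lemma sqd_one (f : E3 → E3) : sqd 𝟙 f = fun x => ‖f x‖ₑ ^ 2 := by funext x; simp [sqd]

lemma ulocSup_u_le (D : LerayData s T' M u g P) {N : ℕ} {r : ℝ}
    (hN : ∀ F : E3 → ℝ≥0∞, Measurable F → ∀ A : ℝ≥0∞,
      (∀ m, ∫⁻ x in ball m 1, F x ≤ A) → ∀ m, ∫⁻ x in ball m r, F x ≤ N * A)
    (I : Set ℝ) :
    ulocSup (volume.restrict I) r (fun τ => sqd 𝟙 (u τ)) ≤ N * (M : ℝ≥0∞) ^ 2 * volume I := by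
  refine iSup_le fun x => ?_
  calc _ ≤ ∫⁻ _τ in I, N * (M : ℝ≥0∞) ^ 2 := by
        refine lintegral_mono fun τ => ?_
        simp only [sqd_one]; exact hN _ (D.meas_u.of_uncurry_left.enorm.pow_const 2) _ (D.uloc τ) x
    _ = _ := by simp

lemma ulocSup_u_lt_top (D : LerayData s T' M u g P) (r : ℝ) :
    𝓤[T', r, 𝟙, u] < ⊤ := by
  obtain ⟨N, -, hN⟩ := exists_setLIntegral_ball_le r
  refine (D.ulocSup_u_le hN _).trans_lt ?_
  have : volume (Ioo 0 T') ≠ ⊤ := by simp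
  finiteness

lemma ulocSup_g_lt_top (D : LerayData s T' M u g P) (r : ℝ) :
    𝓤[T', r, 𝟙, g] < ⊤ := by
  obtain ⟨N, -, hN⟩ := exists_ulocSup_mul_le r
  have h := hN (𝓛 T') 1 one_pos (fun τ => sqd 𝟙 (g τ))
    (measurable_sqd_uncurry measurable_const D.meas_g)
  rw [mul_one] at h; exact h.trans_lt (mul_lt_top (by simp) D.g_fin)

lemma lintegral_l4_lt_top (D : LerayData s T' M u g P) (hs : s ∈ Ico (3 / 4) 1) (o : E3) (r : ℝ) :
    ∫⁻ τ in Ioo 0 T', (∫⁻ m in ball o r, l4 𝟙 (u τ) m) < ⊤ := by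
  obtain ⟨C, hC, h⟩ := exists_lintegral_time_l4_le hs
  refine (h 0 _ IsMult.one u g D.meas_u D.meas_g D.wint_u D.fracLap (𝓛 T') o r).trans_lt ?_
  simp only [add_zero]
  exact mul_lt_top hC.lt_top (ENNReal.add_lt_top.2 ⟨D.ulocSup_g_lt_top _, D.ulocSup_u_lt_top _⟩)

lemma lintegral_wgt_lt_top (D : LerayData s T' M u g P) (o : E3) :
    ∫⁻ τ in Ioo 0 T', (∫⁻ x, wgt (x - o) * ‖u τ x‖ₑ ^ 2) < ⊤ := by
  obtain ⟨C, hC, h⟩ := exists_lintegral_wgt_le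
  have h1 := h (𝓛 T') (fun τ => sqd 𝟙 (u τ)) (measurable_sqd_uncurry measurable_const D.meas_u) o
  simp only [sqd_one] at h1; refine h1.trans_lt (mul_lt_top hC.lt_top ?_)
  have := D.ulocSup_u_lt_top 1
  simpa only [sqd_one] using this

lemma lintegral_cube_lt_top (D : LerayData s T' M u g P) (hs : s ∈ Ico (3 / 4) 1) (o : E3)
    (r : ℝ) : ∫⁻ τ in Ioo 0 T', (∫⁻ x in ball o r, ‖u τ x‖ₑ ^ 3) < ⊤ := by
  have hV0 : volume (ball (0 : E3) 1) ≠ 0 := (measure_ball_pos volume _ one_pos).ne'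
  refine lt_of_le_of_lt (lintegral_mono fun τ => ?_) (b := ∫⁻ τ in Ioo 0 T',
    (volume (ball (0 : E3) 1))⁻¹ * (M * ∫⁻ m in ball o (r + 1), l4 𝟙 (u τ) m)) ?_
  · have := setLIntegral_cubic_le (χ := fun _ => 1) measurable_const
      (D.meas_u.of_uncurry_left (x := τ)) (D.uloc τ) o r
    simpa using this
  · rw [lintegral_const_mul' _ _ (by finiteness), lintegral_const_mul' _ _ ENNReal.coe_ne_top]
    exact mul_lt_top (ENNReal.inv_lt_top.2 (pos_iff_ne_zero.2 hV0))
      (mul_lt_top ENNReal.coe_lt_top (D.lintegral_l4_lt_top hs o _))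

/-- Absolute convergence of the right-hand side of the pressure relation. -/
lemma integrable_pressure (D : LerayData s T' M u g P) (hs : s ∈ Ico (3 / 4) 1)
    {θ : ℝ → E3 → ℝ} (hθ : IsSpaceTimeTest (Ioo 0 T') θ) (i : Fin 3) :
    Integrable (fun p : ST => ∑ j, ∑ k, u p.1 p.2 j * u p.1 p.2 k *
      invLapDD j k (dd (bv i) (θ p.1)) p.2) := by
  have hθi := hθ.dd (bv i)
  obtain ⟨B1, hB1⟩ := hθ.exists_bound
  obtain ⟨B2, hB2⟩ := hθi.exists_bound
  obtain ⟨R1, hR1, hz1⟩ := hθ.exists_radius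
  obtain ⟨R2, hR2, hz2⟩ := hθi.exists_radius
  obtain ⟨C, hC, hst⟩ := exists_pressure_single (B1 + B2) (ρ := R1 + R2) (by linarith)
  have hcomp : ∀ l : Fin 3, Measurable fun p : ST => u p.1 p.2 l := fun l =>
    (𝐩 l).continuous.measurable.comp D.meas_u
  have hR : ∀ j k, Measurable fun p : ST => invLapDD j k (dd (bv i) (θ p.1)) p.2 := fun j k =>
    measurable_invLapDD_time j k (θ := fun t => dd (bv i) (θ t)) hθi.1.continuous
  refine integrable_finsetSum _ fun j _ => integrable_finsetSum _ fun k _ => ?_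
  have hm : Measurable fun p : ST => u p.1 p.2 j * u p.1 p.2 k *
      invLapDD j k (dd (bv i) (θ p.1)) p.2 := ((hcomp j).mul (hcomp k)).mul (hR j k)
  have hml : Measurable fun t => ∫⁻ m in ball 0 (4 * (R1 + R2) + 1), l4 𝟙 (u t) m :=
    Measurable.lintegral_prod_right' (measurable_l4_time measurable_const D.meas_u)
  have hpt : ∀ t, ∫⁻ x, ‖u t x j * u t x k * invLapDD j k (dd (bv i) (θ t)) x‖ₑ ≤
      C * ((∫⁻ m in ball 0 (4 * (R1 + R2) + 1), l4 𝟙 (u t) m) +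
        ∫⁻ x, wgt (x - 0) * ‖u t x‖ₑ ^ 2) := by
    intro t
    have h := hst i (u t) D.meas_u.of_uncurry_left (θ t) (hθ.slice t)
      (fun y => (hB1 t y).trans (by exact_mod_cast (le_self_add : B1 ≤ B1 + B2)))
      (fun y => (hB2 t y).trans (by exact_mod_cast (le_add_self : B2 ≤ B1 + B2)))
      (fun y hy => hz1 t y (by linarith)) (fun y hy => hz2 t y (by linarith)) j k
    refine le_trans (lintegral_mono fun x => ?_) h
    rw [enorm_mul, enorm_mul, sq]
    exact mul_le_mul_left (mul_le_mul' (enorm_apply_le _ _) (enorm_apply_le _ _)) _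
  refine integrable_uncurry_of_slices (I := Ioo 0 T') (f := fun t x => u t x j * u t x k *
    invLapDD j k (dd (bv i) (θ t)) x) hm measurableSet_Ioo (fun t ht x => ?_) hpt ?_
  · rw [hθi.eq_zero ht, invLapDD_zero, mul_zero]
  · rw [lintegral_const_mul' _ _ hC, lintegral_add_left hml]
    exact mul_lt_top hC.lt_top
      (ENNReal.add_lt_top.2 ⟨D.lintegral_l4_lt_top hs 0 _, D.lintegral_wgt_lt_top 0⟩)

end LerayData

/-- The spatial weight of the local energy: the square of a multiplier cut off near `o`. -/
def lwt (ρ : ℝ) (o : E3) (χ : E3 → ℝ) (x : E3) : ℝ := (bumpAt ρ o x * χ x) ^ 2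

section Weight

variable {ρ κ : ℝ} {o : E3} {χ : E3 → ℝ}

lemma lwt_nonneg (x : E3) : 0 ≤ lwt ρ o χ x := sq_nonneg _

lemma lwt_isTest (hρ : 0 < ρ) (hχ : IsMult κ χ) : IsTest (lwt ρ o χ) := by
  have h := hχ.isTest_mul (bumpAt_isTest hρ o)
  have := h.mul h
  have e : lwt ρ o χ = fun y => bumpAt ρ o y * χ y * (bumpAt ρ o y * χ y) := funext fun y => sq _
  rwa [e]

lemma lwt_eq_zero (hρ : 0 < ρ) {x} (hx : 2 * ρ ≤ dist x o) : lwt ρ o χ x = 0 := by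
  simp [lwt, bumpAt_eq_zero hρ hx]

lemma lwt_le (hχ : IsMult κ χ) (x : E3) : lwt ρ o χ x ≤ χ x ^ 2 := by
  have h1 : bumpAt ρ o x * χ x ≤ χ x := mul_le_of_le_one_left (hχ.nonneg x) (bumpAt_le_one ρ o x)
  exact pow_le_pow_left₀ (mul_nonneg (bumpAt_nonneg ρ o x) (hχ.nonneg x)) h1 2

lemma abs_dd_lwt_le (hρ : 0 < ρ) (hχ : IsMult κ χ) (v x : E3) :
    |dd v (lwt ρ o χ) x| ≤ 2 * (bumpAt ρ o x * χ x) * (bumpL * (χ x / ρ) + κ) * ‖v‖ := by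
  set f : E3 → ℝ := fun x => bumpAt ρ o x * χ x with hf
  have hft : IsTest f := hχ.isTest_mul (bumpAt_isTest hρ o)
  have hd : DifferentiableAt ℝ f x := hft.1.differentiable (by simp) x
  have hL : 0 ≤ bumpL * (χ x / ρ) + κ :=
    add_nonneg (mul_nonneg (zero_le_one.trans one_le_bumpL) (div_nonneg (hχ.nonneg x) hρ.le))
      hχ.kappa_nonneg
  have h1 : ‖fderiv ℝ f x‖ ≤ bumpL * (χ x / ρ) + κ := by
    refine hd.hasFDerivAt.le_of_lip' hL (.of_forall fun y => ?_)
    have e : f y - f x = χ x * (bumpAt ρ o y - bumpAt ρ o x) +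
        bumpAt ρ o y * (χ y - χ x) := by simp only [hf]; ring
    rw [e]; refine (norm_add_le _ _).trans ?_
    rw [norm_mul, norm_mul, norm_of_nonneg (hχ.nonneg x),
      norm_of_nonneg (bumpAt_nonneg _ _ _), norm_eq_abs, norm_eq_abs, add_mul]
    have h2 := bumpAt_lipschitz hρ o y x
    have h3 := (hχ.sub_le y x).trans (mul_le_mul_of_nonneg_left (modc_le_norm _) hχ.kappa_nonneg)
    refine add_le_add ?_ ((mul_le_of_le_one_left (abs_nonneg _) (bumpAt_le_one _ _ _)).trans h3)
    calc _ ≤ χ x * (bumpL / ρ * ‖y - x‖) := mul_le_mul_of_nonneg_left h2 (hχ.nonneg x)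
      _ = _ := by ring
  have e : dd v (lwt ρ o χ) x = 2 * f x * dd v f x := by
    have h := (hd.hasFDerivAt.pow 2).fderiv
    have h' : fderiv ℝ (lwt ρ o χ) x = _ := h
    rw [dd, h', dd]; simp [mul_assoc]
  have hf0 : 0 ≤ f x := mul_nonneg (bumpAt_nonneg _ _ _) (hχ.nonneg x)
  rw [e, abs_mul, abs_of_nonneg (by positivity), mul_assoc _ _ ‖v‖]
  exact mul_le_mul_of_nonneg_left (((fderiv ℝ f x).le_opNorm v).trans
    (mul_le_mul_of_nonneg_right h1 (norm_nonneg v))) (mul_nonneg zero_le_two hf0)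

lemma dd_lwt_eq_zero (hρ : 0 < ρ) (hχ : IsMult κ χ) (v : E3) {x}
    (hx : 2 * ρ ≤ dist x o) : dd v (lwt ρ o χ) x = 0 := by
  have h := abs_dd_lwt_le (o := o) hρ hχ v x
  rw [bumpAt_eq_zero hρ hx] at h; simpa using h

lemma enorm_dd_lwt_le (hρ : 0 < ρ) (hχ : IsMult κ χ) (v x : E3) : ‖dd v (lwt ρ o χ) x‖ₑ ≤
      ofReal (2 * bumpL * (χ x ^ 2 / ρ + κ * χ x)) * ‖v‖ₑ := by
  have h0 := hχ.nonneg x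
  have h1 := one_le_bumpL
  have h2 := hχ.kappa_nonneg
  rw [← ofReal_norm v, ← ofReal_mul (by positivity), ← ofReal_norm]
  refine ofReal_le_ofReal ((abs_dd_lwt_le hρ hχ v x).trans
    (mul_le_mul_of_nonneg_right ?_ (norm_nonneg v)))
  calc 2 * (bumpAt ρ o x * χ x) * (bumpL * (χ x / ρ) + κ)
      ≤ 2 * (1 * χ x) * (bumpL * (χ x / ρ) + bumpL * κ) := by
        gcongr
        · exact bumpAt_le_one _ _ _
        · exact le_mul_of_one_le_left h2 h1
    _ = _ := by ring

end Weight

/-- A smooth cutoff in time on `I`. -/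
structure IsTimeCut (I : Set ℝ) (η : ℝ → ℝ) : Prop where
  smooth : ContDiff ℝ (⊤ : ℕ∞) η
  compact : HasCompactSupport η
  subset : tsupport η ⊆ I
  nonneg : ∀ t, 0 ≤ η t
  le_one : ∀ t, η t ≤ 1

lemma IsTimeCut.spaceTimeTest {I} {η} (hη : IsTimeCut I η) {Φ}
    (hΦ : IsTest Φ) {f} (hf : ContDiff ℝ (⊤ : ℕ∞) f) :
    IsSpaceTimeTest I fun t x => η t * Φ x * f (t, x) := by
  have hsub : tsupport (uncurry fun t x => η t * Φ x * f (t, x)) ⊆ tsupport η ×ˢ tsupport Φ := by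
    refine closure_minimal (fun p hp => ?_) ((isClosed_tsupport _).prod (isClosed_tsupport _))
    rw [Function.mem_support, Function.uncurry_def] at hp
    exact ⟨subset_tsupport _ (left_ne_zero_of_mul (left_ne_zero_of_mul hp)),
      subset_tsupport _ (right_ne_zero_of_mul (left_ne_zero_of_mul hp))⟩
  refine ⟨?_, ?_, hsub.trans fun p hp => ⟨hη.subset hp.1, trivial⟩⟩
  · exact ((hη.smooth.comp contDiff_fst).mul (hΦ.1.comp contDiff_snd)).mul hf
  · exact (hη.compact.isCompact.prod hΦ.2.isCompact).of_isClosed_subset (isClosed_tsupport _) hsub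

lemma stm_congr {F : Type*} [NormedAddCommGroup F] [NormedSpace ℝ F] {n : ℕ} {f g : ST → F}
    {z} (h : ∀ w, ‖w‖ < ϵ[n] → f (z - w) = g (z - w)) :
    stm n f z = stm n g z := by
  refine integral_congr_ae (.of_forall fun w => ?_)
  by_cases hw : ‖w‖ < ϵ[n]
  · simp only [h w hw]
  · simp only [stj_eq_zero (not_lt.1 hw), map_zero, zero_apply]

/-- A uniform positive distance from the support of a time cutoff to the end points. -/
lemma IsTimeCut.eventually_closedBall_subset {I} (hI : IsOpen I) {η} (hη : IsTimeCut I η) :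
    ∀ᶠ n : ℕ in atTop, ∀ t ∈ tsupport η, closedBall t ϵ[n] ⊆ I := by
  obtain ⟨δ, hδ, h⟩ := hη.compact.isCompact.exists_cthickening_subset_open hI hη.subset
  have h1 : Tendsto (fun n : ℕ => ϵ[n]) atTop (𝓝 0) := by
    simpa only [one_div] using tendsto_one_div_add_atTop_nhds_zero_nat (𝕜 := ℝ)
  filter_upwards [h1.eventually (gt_mem_nhds hδ)] with n hn t ht
  exact ((Metric.closedBall_subset_closedBall hn.le).trans
    (Metric.closedBall_subset_cthickening ht δ)).trans h

/-- Convergence of the mollifications in `L³_loc`, in the form needed for the pressure term. -/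
lemma LerayData.tendsto_lintegral_mul_stm_sub {s T'} {M} {u g}
    {P} (D : LerayData s T' M u g P) (hs : s ∈ Ico (3 / 4) 1) {η}
    (hη : IsTimeCut (Ioo 0 T') η) (o : E3) (r : ℝ) :
    Tendsto (fun n => ∫⁻ p in tsupport η ×ˢ closedBall o r,
      ‖uncurry P p‖ₑ * ‖stm n (uncurry u) p - uncurry u p‖ₑ)
      atTop (𝓝 0) := by
  set K : Set ST := tsupport η ×ˢ closedBall o r with hK
  have hKc : IsCompact K := hη.compact.isCompact.prod (isCompact_closedBall _ _)
  have hP := D.memP K hKc fun p hp => ⟨hη.subset hp.1, trivial⟩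
  set A := ∫⁻ p in K, ‖uncurry P p‖ₑ ^ (3 / 2 : ℝ)
  have hPA : A ≠ ⊤ := by
    have := lintegral_rpow_enorm_lt_top_of_eLpNorm_lt_top (by norm_num) (by finiteness) hP.2
    norm_num at this; exact this.ne
  set S : Set ST := Ioo 0 T' ×ˢ ball o (r + 2) with hS
  have hSm : MeasurableSet S := measurableSet_Ioo.prod measurableSet_ball
  set f : ST → E3 := S.indicator (uncurry u) with hf
  have hfm : Measurable f := D.meas_u.indicator hSm
  have hf3 : ∫⁻ p, ‖f p‖ₑ ^ 3 < ⊤ := by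
    have e : (fun p => ‖f p‖ₑ ^ 3) = S.indicator fun p => ‖uncurry u p‖ₑ ^ 3 := by
      funext p; by_cases hp : p ∈ S <;> simp [hf, hp]
    rw [e, lintegral_indicator hSm, hS, volume_eq_prod, ← prod_restrict,
      lintegral_prod _ (D.meas_u.enorm.pow_const 3).aemeasurable]
    exact D.lintegral_cube_lt_top hs o (r + 2)
  have hlim := tendsto_lintegral_stm_sub hfm hf3
  have hev : ∀ᶠ n : ℕ in atTop, ∀ p ∈ K, stm n (uncurry u) p - uncurry u p = stm n f p - f p := by
    filter_upwards [hη.eventually_closedBall_subset isOpen_Ioo] with n hn p hp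
    have hn1 : ϵ[n] ≤ 1 := inv_le_one_of_one_le₀ (by linarith [n.cast_nonneg (α := ℝ)])
    have hmem : ∀ w, ‖w‖ < ϵ[n] → p - w ∈ S := fun w hw => by
      refine ⟨hn p.1 hp.1 ?_, ?_⟩
      · simpa [dist_eq_norm] using (norm_fst_le w).trans hw.le
      · rw [mem_ball]; have h1 : dist (p - w).2 p.2 = ‖w.2‖ := by simp
        have h2 := dist_triangle (p - w).2 p.2 o
        have h3 : dist p.2 o ≤ r := hp.2
        have h4 := norm_snd_le w
        linarith
    have h0 : p ∈ S := by
      have := hmem 0 (by rw [norm_zero]; positivity)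
      rwa [sub_zero] at this
    rw [stm_congr (g := f) fun w hw => (indicator_of_mem (hmem w hw) _).symm, hf,
      indicator_of_mem h0]
  have hbound : ∀ᶠ n : ℕ in atTop, ∫⁻ p in K,
      ‖uncurry P p‖ₑ * ‖stm n (uncurry u) p - uncurry u p‖ₑ ≤
      A ^ (1 / (3 / 2) : ℝ) * (∫⁻ p, ‖stm n f p - f p‖ₑ ^ 3) ^ (1 / 3 : ℝ) := by
    filter_upwards [hev] with n hn
    rw [setLIntegral_congr_fun hKc.measurableSet (fun p hp => by rw [hn p hp])]
    have hc : Continuous (stm n f) := by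
      refine (contDiff_stm n ?_).continuous
      have h3 : MemLp f 3 := ⟨hfm.aestronglyMeasurable, by
        rw [eLpNorm_lt_top_iff_lintegral_rpow_enorm_lt_top (by norm_num) (by simp)]
        simpa using hf3⟩
      exact h3.locallyIntegrable (by norm_num)
    refine (ENNReal.lintegral_mul_le_Lp_mul_Lq _ (by constructor <;> norm_num :
      (3 / 2 : ℝ).HolderConjugate 3) hP.1.enorm
      (hc.measurable.sub hfm).enorm.aemeasurable).trans ?_
    refine mul_le_mul_right (ENNReal.rpow_le_rpow ?_ (by norm_num)) _
    refine (setLIntegral_le_lintegral _ _).trans (le_of_eq ?_)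
    exact lintegral_congr fun p => by rw [← ENNReal.rpow_natCast]; norm_num
  refine tendsto_of_tendsto_of_tendsto_of_le_of_le' tendsto_const_nhds ?_
    (.of_forall fun _ => zero_le) hbound
  have h1 : Tendsto (fun n => (∫⁻ p, ‖stm n f p - f p‖ₑ ^ 3) ^ (1 / 3 : ℝ)) atTop
      (𝓝 (0 ^ (1 / 3 : ℝ))) := (ENNReal.continuous_rpow_const.tendsto 0).comp hlim
  rw [ENNReal.zero_rpow_of_pos (by norm_num)] at h1
  have h2 := ENNReal.Tendsto.const_mul (a := A ^ (1 / (3 / 2) : ℝ)) h1 (Or.inr (by finiteness))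
  rwa [mul_zero] at h2

/-- The pressure times a space-time test function is integrable. -/
lemma LerayData.integrable_pressure_mul {s T'} {M} {u g} {P} (D : LerayData s T' M u g P) {θ}
    (hθ : IsSpaceTimeTest (Ioo 0 T') θ) :
    Integrable fun p : ST => P p.1 p.2 * θ p.1 p.2 := by
  have hP := D.memP _ hθ.2.1.isCompact hθ.2.2
  obtain ⟨B, hB⟩ := hθ.2.1.exists_bound_of_continuous hθ.1.continuous
  have : IsFiniteMeasure (volume.restrict (tsupport (uncurry θ))) :=
    ⟨by rw [Measure.restrict_apply_univ]; exact hθ.2.1.isCompact.measure_lt_top⟩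
  have hPi : IntegrableOn (uncurry P) (tsupport (uncurry θ)) :=
    hP.integrable (by norm_num [ENNReal.le_div_iff_mul_le])
  have h : IntegrableOn (fun p : ST => uncurry P p * uncurry θ p) (tsupport (uncurry θ)) :=
    hPi.mul_bdd (c := B) hθ.1.continuous.aestronglyMeasurable (.of_forall hB)
  refine (integrableOn_iff_integrable_of_support_subset ?_).1 h
  exact fun p hp => subset_tsupport _ (right_ne_zero_of_mul hp)

/-- The weights of the pressure estimate: the near part and the far part. -/
def pressureBound (C Cρ : ℝ≥0∞) (M : ℝ≥0) (ρ κ : ℝ) (χ : E3 → ℝ) (o : E3) (U : E3 → E3) : ℝ≥0∞ :=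
  C * M * (ofReal ρ⁻¹ * (∫⁻ m in ball o (4 * ρ + 1), l4 χ U m) +
    ofReal κ * ∫⁻ m in ball o (4 * ρ + 1), l4 𝟙 U m) +
  Cρ * M * ∫⁻ x, wgt (x - o) * (ofReal (χ x ^ 2 + κ) * ‖U x‖ₑ ^ 2)

set_option maxHeartbeats 400000 in
/-- The pressure term for the mollified velocity: moving the Riesz transforms to the test
function reduces it to the static estimate, slice by slice. -/
lemma exists_pressure_stm_le {s} (hs : s ∈ Ico (3 / 4) 1) (K₀ : ℝ) :
    ∃ C, C ≠ ⊤ ∧ ∀ ρ, 1 ≤ ρ → ∃ Cρ, Cρ ≠ ⊤ ∧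
    ∀ T' M u g P, LerayData s T' M u g P →
    ∀ κ χ, IsMult κ χ → κ ≤ K₀ → ∀ o η, IsTimeCut (Ioo 0 T') η → ∀ n : ℕ,
      (∀ t ∈ tsupport η, closedBall t ϵ[n] ⊆ Ioo 0 T') →
      ‖∫ p : ST, P p.1 p.2 * (η p.1 * dd (stm n (uncurry u) p) (lwt ρ o χ) p.2)‖ₑ ≤
        9 * ∫⁻ t in Ioo 0 T', pressureBound C Cρ M ρ κ χ o (u t) := by
  obtain ⟨C, hC, hst⟩ := exists_pressure_static K₀ (2 * bumpL) (by linarith [one_le_bumpL])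
  refine ⟨C, hC, fun ρ hρ => ?_⟩
  obtain ⟨Cρ, hCρ, hst⟩ := hst ρ hρ
  refine ⟨Cρ, hCρ, fun T' M u g P D κ χ hχ hκ o η hη n hn => ?_⟩
  have hρ0 : 0 < ρ := by linarith
  set w : ST → E3 := stm n (uncurry u) with hw
  have hul := locallyIntegrable_uncurry D.meas_u (by finiteness) D.uloc
  have hws : ContDiff ℝ (⊤ : ℕ∞) w := contDiff_stm n hul
  have hwi : ∀ i, ContDiff ℝ (⊤ : ℕ∞) fun p => w p i := fun i => (𝐩 i).contDiff.comp hws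
  have hΦ : IsTest (lwt ρ o χ) := lwt_isTest hρ0 hχ
  let θ : Fin 3 → ℝ → E3 → ℝ := fun i t x => η t * lwt ρ o χ x * w (t, x) i
  have hθ : ∀ i, IsSpaceTimeTest (Ioo 0 T') (θ i) := fun i => hη.spaceTimeTest hΦ (hwi i)
  have hdiv : ∀ t x, ∑ i, dd (bv i) (θ i t) x = η t * dd (w (t, x)) (lwt ρ o χ) x := by
    intro t x
    have h1 : ∀ i, dd (bv i) (θ i t) x = η t * (w (t, x) i * dd (bv i) (lwt ρ o χ) x) +
        η t * lwt ρ o χ x * fderiv ℝ (fun y => w (t, y) i) x (bv i) := by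
      intro i
      have ha : DifferentiableAt ℝ (fun y => η t * lwt ρ o χ y) x :=
        (hΦ.1.differentiable (by simp) x).const_mul _
      have hb : DifferentiableAt ℝ (fun y => w (t, y) i) x :=
        ((hwi i).comp (contDiff_prodMk_right t)).differentiable (by simp) x
      have h : fderiv ℝ (θ i t) x = _ := fderiv_fun_mul ha hb
      rw [dd, h, fderiv_const_mul (hΦ.1.differentiable (by simp) x)]
      simp only [add_apply, smul_apply, smul_eq_mul, dd]; ring
    simp only [h1]; rw [Finset.sum_add_distrib, ← mul_sum, ← mul_sum, ← dd_eq_sum]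
    by_cases ht : t ∈ tsupport η
    · rw [sum_fderiv_stm_eq_zero n hul D.div_free t x (hn t ht), mul_zero, add_zero]
    · rw [image_eq_zero_of_notMem_tsupport ht]; simp
  have hlhs : ∫ p : ST, P p.1 p.2 * (η p.1 * dd (w p) (lwt ρ o χ) p.2) =
      ∑ i, ∫ t, ∫ x, P t x * gradient (θ i t) x i := by
    have h1 : ∀ i, Integrable fun p : ST => P p.1 p.2 * dd (bv i) (θ i p.1) p.2 := fun i =>
      D.integrable_pressure_mul ((hθ i).dd (bv i))
    have h2 : ∀ i, ∫ t, ∫ x, P t x * gradient (θ i t) x i =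
        ∫ p : ST, P p.1 p.2 * dd (bv i) (θ i p.1) p.2 := fun i => by
      simp only [gradient_apply]; exact (integral_prod _ (h1 i)).symm
    simp only [h2]; rw [← integral_finsetSum _ fun i _ => h1 i]; refine integral_congr' fun p => ?_
    simp only [← mul_sum]; rw [hdiv]
  have hrhs : ∑ i, ∫ t, ∫ x, P t x * gradient (θ i t) x i =
      -∫ p : ST, ∑ j, ∑ k, u p.1 p.2 j * u p.1 p.2 k *
        invLapDD j k (fun y => ∑ i, dd (bv i) (θ i p.1) y) p.2 := by
    have h1 := fun i => D.integrable_pressure hs (hθ i) i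
    have h2 : ∀ i, ∫ t, ∫ x, P t x * gradient (θ i t) x i =
        -∫ p : ST, ∑ j, ∑ k, u p.1 p.2 j * u p.1 p.2 k *
          invLapDD j k (dd (bv i) (θ i p.1)) p.2 := fun i => by
      rw [D.pressure (θ i) (hθ i) i]; simp only [gradient_apply]
      exact congrArg Neg.neg (integral_prod _ (h1 i)).symm
    simp only [h2]; rw [Finset.sum_neg_distrib, ← integral_finsetSum _ fun i _ => h1 i]
    congr 1; refine integral_congr' fun p => ?_
    simp only; rw [Finset.sum_comm]; refine Finset.sum_congr rfl fun j _ => ?_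
    rw [Finset.sum_comm]; refine Finset.sum_congr rfl fun k _ => ?_
    rw [← mul_sum, invLapDD_sum j k fun i => ((hθ i).slice p.1).dd (bv i)]
  rw [hlhs, hrhs, enorm_neg]; let H : ℝ → E3 → ℝ := fun t y => ∑ i, dd (bv i) (θ i t) y
  have hh : ∀ t, IsTest (H t) := fun t => by
    simp only [H, Fin.sum_univ_three]
    exact ((((hθ 0).slice t).dd _).add (((hθ 1).slice t).dd _)).add (((hθ 2).slice t).dd _)
  have hum : ∀ t, Measurable (u t) := fun t => D.meas_u.of_uncurry_left
  have hstat : ∀ t (j k : Fin 3), ∫⁻ x, ‖u t x‖ₑ ^ 2 * ‖invLapDD j k (H t) x‖ₑ ≤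
        pressureBound C Cρ M ρ κ χ o (u t) := by
    intro t; have hη1 : ‖η t‖ₑ ≤ 1 := enorm_le_one_of_mem (hη.nonneg t) (hη.le_one t)
    refine hst κ χ hχ hκ (u t) (hum t) (fun i => θ i t) (fun x => ‖w (t, x)‖ₑ) M o
      (fun i => (hθ i).slice t) (hws.continuous.measurable.comp measurable_prodMk_left).enorm
      (fun m => setLIntegral_stm_sq_le n D.meas_u D.uloc t m) (fun i y => ?_)
      (fun i y hy => ?_) (fun y => ?_) (fun y hy => ?_)
    · rw [enorm_mul, enorm_mul, enorm_of_nonneg (lwt_nonneg y)]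
      calc _ ≤ 1 * ofReal (χ y ^ 2) * ‖w (t, y)‖ₑ :=
            mul_le_mul' (mul_le_mul' hη1 (ofReal_le_ofReal (lwt_le hχ y))) (enorm_apply_le _ _)
        _ = _ := by rw [one_mul]
    · simp only [θ, lwt_eq_zero hρ0 hy, mul_zero, zero_mul]
    · rw [hdiv, enorm_mul]
      calc _ ≤ 1 * _ := mul_le_mul' hη1 (enorm_dd_lwt_le hρ0 hχ _ y)
        _ = _ := one_mul _
    · rw [hdiv, dd_lwt_eq_zero hρ0 hχ _ hy, mul_zero]
  calc _ ≤ ∫⁻ p : ST, ∑ j : Fin 3, ∑ k : Fin 3, ‖u p.1 p.2‖ₑ ^ 2 * ‖invLapDD j k (H p.1) p.2‖ₑ := by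
        refine (enorm_integral_le_lintegral_enorm _).trans (lintegral_mono fun p => ?_)
        refine (enorm_sum_le _ _).trans (sum_le_sum fun j _ => ?_)
        refine (enorm_sum_le _ _).trans (sum_le_sum fun k _ => ?_)
        rw [enorm_mul, enorm_mul, sq]
        exact mul_le_mul_left (mul_le_mul' (enorm_apply_le _ _) (enorm_apply_le _ _)) _
    _ ≤ ∫⁻ t, ∫⁻ x, ∑ j : Fin 3, ∑ k : Fin 3, ‖u t x‖ₑ ^ 2 *
        ‖invLapDD j k (H t) x‖ₑ := lintegral_prod_le _
    _ = ∫⁻ t in Ioo 0 T', ∫⁻ x, ∑ j : Fin 3, ∑ k : Fin 3, ‖u t x‖ₑ ^ 2 *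
        ‖invLapDD j k (H t) x‖ₑ := by
        refine lintegral_eq_setLIntegral_of_zero measurableSet_Ioo fun t ht => ?_
        have h0 : H t = fun _ => 0 := by
          funext y; rw [show H t y = _ from hdiv t y,
            image_eq_zero_of_notMem_tsupport fun h => ht (hη.subset h), zero_mul]
        simp only [h0, invLapDD_zero, enorm_zero, mul_zero, Finset.sum_const_zero, lintegral_zero]
    _ ≤ ∫⁻ t in Ioo 0 T', 9 * pressureBound C Cρ M ρ κ χ o (u t) := by
        refine lintegral_mono fun t => ?_
        have hm : ∀ j k, Measurable fun x => ‖u t x‖ₑ ^ 2 * ‖invLapDD j k (H t) x‖ₑ := fun j k =>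
          ((hum t).enorm.pow_const 2).mul ((hh t).continuous_invLapDD j k).measurable.enorm
        rw [lintegral_finsetSum _ fun j _ => Finset.measurable_sum _ fun k _ => hm j k]
        simp only [lintegral_finsetSum _ fun k _ => hm _ k]
        refine (sum_le_sum fun j _ => sum_le_sum fun k _ => hstat t j k).trans ?_
        simp only [Finset.sum_const, Finset.card_univ, Fintype.card_fin, nsmul_eq_mul, ← mul_assoc]
        norm_num
    _ = _ := lintegral_cmul

/-- The pressure term of the local energy inequality. -/
lemma exists_pressure_le {s} (hs : s ∈ Ico (3 / 4) 1) (K₀ : ℝ) :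
    ∃ C, C ≠ ⊤ ∧ ∀ ρ, 1 ≤ ρ → ∃ Cρ, Cρ ≠ ⊤ ∧
    ∀ T' M u g P, LerayData s T' M u g P →
    ∀ κ χ, IsMult κ χ → κ ≤ K₀ → ∀ o η, IsTimeCut (Ioo 0 T') η →
      ‖∫ τ in Ioo 0 T', ∫ x, P τ x * ⟪u τ x, gradient (fun y => η τ * lwt ρ o χ y) x⟫‖ₑ ≤
        9 * ∫⁻ t in Ioo 0 T', pressureBound C Cρ M ρ κ χ o (u t) := by
  obtain ⟨C, hC, h⟩ := exists_pressure_stm_le hs K₀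
  refine ⟨C, hC, fun ρ hρ => ?_⟩
  obtain ⟨Cρ, hCρ, h⟩ := h ρ hρ
  refine ⟨Cρ, hCρ, fun T' M u g P D κ χ hχ hκ o η hη => ?_⟩
  have hρ0 : 0 < ρ := by linarith
  have hΦ : IsTest (lwt ρ o χ) := lwt_isTest hρ0 hχ
  have hgrad : ∀ τ x, ⟪u τ x, gradient (fun y => η τ * lwt ρ o χ y) x⟫ =
      η τ * dd (u τ x) (lwt ρ o χ) x := fun τ x => by
    rw [inner_gradient, dd, fderiv_const_mul (hΦ.1.differentiable (by simp) x)]; rfl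
  set F : (ST → E3) → ST → ℝ := fun w p => P p.1 p.2 * (η p.1 * dd (w p) (lwt ρ o χ) p.2)
    with hF
  have hFm : ∀ w, Measurable w → AEStronglyMeasurable (F w) volume := fun w hw => by
    have h1 : ∀ i, AEStronglyMeasurable (fun p : ST =>
      P p.1 p.2 * (η p.1 * dd (bv i) (lwt ρ o χ) p.2 * 1) * w p i) volume := fun i =>
      (D.integrable_pressure_mul (hη.spaceTimeTest (hΦ.dd (bv i))
        (f := fun _ => 1) contDiff_const)).aestronglyMeasurable.mul
        ((𝐩 i).continuous.measurable.comp hw).aestronglyMeasurable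
    refine (Finset.aestronglyMeasurable_fun_sum Finset.univ fun i _ => h1 i).congr
      (.of_forall fun p => ?_)
    simp only [hF]; rw [dd_eq_sum (w p), mul_sum, mul_sum]
    exact Finset.sum_congr rfl fun i _ => by ring
  have hul := locallyIntegrable_uncurry D.meas_u (by finiteness) D.uloc
  let w : ℕ → ST → E3 := fun n => stm n (uncurry u)
  have hws : ∀ n, ContDiff ℝ (⊤ : ℕ∞) (w n) := fun n => contDiff_stm n hul
  have hFi : ∀ n, Integrable (F (w n)) := fun n => by
    have h1 : ∀ i, Integrable fun p : ST => P p.1 p.2 *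
        (η p.1 * dd (bv i) (lwt ρ o χ) p.2 * w n p i) := fun i =>
      D.integrable_pressure_mul (hη.spaceTimeTest (hΦ.dd (bv i)) ((𝐩 i).contDiff.comp (hws n)))
    refine (integrable_finsetSum Finset.univ fun i _ => h1 i).congr (.of_forall fun p => ?_)
    simp only [hF]; rw [dd_eq_sum (w n p), mul_sum, mul_sum]
    exact Finset.sum_congr rfl fun i _ => by ring
  set K : Set ST := tsupport η ×ˢ closedBall o (2 * ρ) with hK
  have hKm : MeasurableSet K :=
    (isClosed_tsupport _).measurableSet.prod Metric.isClosed_closedBall.measurableSet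
  set B := 2 * bumpL * (1 / ρ + κ) with hB
  have hdiff : ∀ n, ∫⁻ p, ‖F (w n) p - F (uncurry u) p‖ₑ ≤ ofReal (B) * ∫⁻ p in K, ‖uncurry P p‖ₑ *
        ‖w n p - uncurry u p‖ₑ := fun n => by
    rw [← lintegral_cmul, ← lintegral_indicator hKm]; refine lintegral_mono fun p => ?_
    have e : F (w n) p - F (uncurry u) p = P p.1 p.2 *
        (η p.1 * dd (w n p - uncurry u p) (lwt ρ o χ) p.2) := by
      simp only [hF, dd, map_sub]; ring
    rw [e]; by_cases hp : p ∈ K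
    · rw [indicator_of_mem hp, enorm_mul, enorm_mul]
      have h1 : ‖η p.1‖ₑ ≤ 1 := enorm_le_one_of_mem (hη.nonneg _) (hη.le_one _)
      have h2 := enorm_dd_lwt_le (o := o) hρ0 hχ (w n p - uncurry u p) p.2
      have h3 : 2 * bumpL * (χ p.2 ^ 2 / ρ + κ * χ p.2) ≤ B := by
        have := one_le_bumpL
        have := hχ.kappa_nonneg
        have : χ p.2 ^ 2 ≤ 1 := pow_le_one₀ (hχ.nonneg _) (hχ.le_one _)
        have : κ * χ p.2 ≤ κ := mul_le_of_le_one_right ‹_› (hχ.le_one _)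
        rw [hB]; gcongr
      calc _ ≤ ‖uncurry P p‖ₑ * (1 * (ofReal (B) * ‖w n p - uncurry u p‖ₑ)) :=
        mulL (mul_le_mul' h1 (h2.trans (mulR (ofReal_le_ofReal h3))))
        _ = _ := by ring
    · rw [indicator_of_notMem hp]
      have h0 : P p.1 p.2 * (η p.1 * dd (w n p - uncurry u p) (lwt ρ o χ) p.2) = 0 := by
        by_cases hp1 : p.1 ∈ tsupport η
        · have : 2 * ρ ≤ dist p.2 o := by
            by_contra hcon
            exact hp ⟨hp1, (not_le.1 hcon).le⟩
          rw [dd_lwt_eq_zero hρ0 hχ _ this, mul_zero, mul_zero]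
        · rw [image_eq_zero_of_notMem_tsupport hp1, zero_mul, mul_zero]
      rw [h0, enorm_zero]
  have hlim : Tendsto (fun n => ∫⁻ p, ‖F (w n) p - F (uncurry u) p‖ₑ) atTop (𝓝 0) := by
    have h1 := ENNReal.Tendsto.const_mul (a := ofReal (B))
      (D.tendsto_lintegral_mul_stm_sub hs hη o (2 * ρ)) (Or.inr ofReal_ne_top)
    rw [mul_zero] at h1
    exact tendsto_of_tendsto_of_tendsto_of_le_of_le tendsto_const_nhds h1 (fun _ => zero_le) hdiff
  have hFu : Integrable (F (uncurry u)) := by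
    obtain ⟨n, hn⟩ := (hlim.eventually (gt_mem_nhds ENNReal.zero_lt_top)).exists
    have h1 : Integrable fun p => F (w n) p - F (uncurry u) p :=
      ⟨(hFi n).aestronglyMeasurable.sub (hFm _ D.meas_u), hn⟩
    exact ((hFi n).sub h1).congr (.of_forall fun p => by simp)
  have hint : ∫ τ in Ioo 0 T', ∫ x, P τ x * ⟪u τ x, gradient (fun y => η τ * lwt ρ o χ y) x⟫ =
      ∫ p, F (uncurry u) p := by
    rw [setIntegral_eq_integral_of_forall_compl_eq_zero fun τ hτ => by
      simp only [hgrad]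
      simp only [image_eq_zero_of_notMem_tsupport fun h => hτ (hη.subset h), zero_mul,
        mul_zero, integral_zero]]
    simp only [hgrad]; exact (integral_prod _ hFu).symm
  rw [hint]
  have hc := (tendsto_integral_of_L1 _ hFu.aestronglyMeasurable (.of_forall hFi) hlim).enorm
  refine le_of_tendsto hc ?_
  filter_upwards [hη.eventually_closedBall_subset isOpen_Ioo] with n hn
  exact h T' M u g P D κ χ hχ hκ o η hη n hn

/-! ### The terms of the local energy inequality -/

lemma ennreal_young {a b δ : ℝ≥0∞} (h0 : δ ≠ 0) (ht : δ ≠ ⊤) : a * b ≤ δ * a ^ 2 + δ⁻¹ * b ^ 2 := by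
  have hc : δ⁻¹ * δ = 1 := ENNReal.inv_mul_cancel h0 ht
  rcases le_total (δ * a) b with h | h
  · refine le_trans ?_ le_add_self
    calc a * b = δ⁻¹ * δ * a * b := by rw [hc, one_mul]
      _ = δ⁻¹ * (δ * a) * b := by ring
      _ ≤ δ⁻¹ * b * b := by gcongr
      _ = _ := by ring
  · refine le_trans ?_ le_self_add
    calc a * b ≤ a * (δ * a) := by gcongr
      _ = _ := by ring

section UlocSup

variable {T : Type*} [MeasurableSpace T] {μ : Measure T} {r : ℝ}

lemma ulocSup_mono {F G} (h : ∀ τ x, F τ x ≤ G τ x) : ulocSup μ r F ≤ ulocSup μ r G :=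
  iSup_mono fun _ => lintegral_mono fun τ => lintegral_mono fun x => h τ x

lemma ulocSup_add_le [SFinite μ] {F G} (hF : Measurable (uncurry F)) :
    ulocSup μ r (fun τ x => F τ x + G τ x) ≤ ulocSup μ r F + ulocSup μ r G := by
  refine iSup_le fun x => ?_
  calc _ = ∫⁻ τ, ((∫⁻ y in ball x r, F τ y) + ∫⁻ y in ball x r, G τ y) ∂μ :=
    lintegral_congr fun τ => lintegral_add_left (hF.of_uncurry_left) _
    _ = (∫⁻ τ, (∫⁻ y in ball x r, F τ y) ∂μ) + ∫⁻ τ, (∫⁻ y in ball x r, G τ y) ∂μ :=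
      lintegral_add_left (Measurable.lintegral_prod_right' hF) _
    _ ≤ _ := add_le_add (le_ulocSup μ r F x) (le_ulocSup μ r G x)

lemma ulocSup_const_mul {c} (hc : c ≠ ⊤) (F : T → E3 → ℝ≥0∞) :
    ulocSup μ r (fun τ x => c * F τ x) = c * ulocSup μ r F := by
  simp only [ulocSup, ENNReal.mul_iSup, lintegral_const_mul' _ _ hc]

lemma lintegral_ball_mul_lconv_le [SFinite μ] {k} (hk : Measurable k)
    {F G} (hF : Measurable (uncurry F))
    (hG : Measurable (uncurry G)) {δ} (h0 : δ ≠ 0) (ht : δ ≠ ⊤) (o : E3) :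
    ∫⁻ τ, (∫⁻ x in ball o r, F τ x * lconv k (G τ) x) ∂μ ≤ δ * ulocSup μ r (fun τ x => F τ x ^ 2) +
        δ⁻¹ * ((∫⁻ z, k z) ^ 2 * ulocSup μ r (fun τ x => G τ x ^ 2)) := by
  have hF2 : Measurable (uncurry fun τ x => F τ x ^ 2) := hF.pow_const 2
  have hG2 : Measurable (uncurry fun τ x => G τ x ^ 2) := hG.pow_const 2
  have hGl : ∀ τ, Measurable (G τ) := fun τ => hG.of_uncurry_left
  have hδi : δ⁻¹ ≠ ⊤ := by finiteness
  have hL := measurable_lconv_time hk hG2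
  have a1 : Measurable fun τ => ∫⁻ x in ball o r, F τ x ^ 2 := Measurable.lintegral_prod_right' hF2
  have a2 : Measurable fun τ => ∫⁻ x in ball o r, lconv k (fun y => G τ y ^ 2) x :=
    Measurable.lintegral_prod_right' hL
  calc _ ≤ ∫⁻ τ, (∫⁻ x in ball o r, (δ * F τ x ^ 2 +
        δ⁻¹ * ((∫⁻ z, k z) * lconv k (fun y => G τ y ^ 2) x))) ∂μ := by
        refine lintegral_mono fun τ => lintegral_mono fun x => (ennreal_young h0 ht).trans ?_
        exact add_le_add le_rfl (mulL (lconv_sq_le hk (hGl τ) x))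
    _ = δ * (∫⁻ τ, (∫⁻ x in ball o r, F τ x ^ 2) ∂μ) + δ⁻¹ * ((∫⁻ z, k z) *
          ∫⁻ τ, (∫⁻ x in ball o r, lconv k (fun y => G τ y ^ 2) x) ∂μ) := by
        have h1 : ∀ τ, ∫⁻ x in ball o r, (δ * F τ x ^ 2 +
            δ⁻¹ * ((∫⁻ z, k z) * lconv k (fun y => G τ y ^ 2) x)) =
            δ * (∫⁻ x in ball o r, F τ x ^ 2) + δ⁻¹ * ((∫⁻ z, k z) *
              ∫⁻ x in ball o r, lconv k (fun y => G τ y ^ 2) x) := fun τ => by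
          rw [lintegral_add_left ((hF2.of_uncurry_left (x := τ)).const_mul δ),
            lintegral_const_mul' _ _ ht, lintegral_const_mul' _ _ hδi,
            lintegral_const_mul _ (hL.of_uncurry_left (x := τ))]
        simp only [h1]
        rw [lintegral_add_left (a1.const_mul δ),
          lintegral_const_mul' _ _ ht, lintegral_const_mul' _ _ hδi,
          lintegral_const_mul _ a2]
    _ ≤ δ * ulocSup μ r (fun τ x => F τ x ^ 2) + δ⁻¹ * ((∫⁻ z, k z) *
          ((∫⁻ z, k z) * ulocSup μ r (fun τ x => G τ x ^ 2))) :=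
        add_le_add (mulL (le_ulocSup μ r _ o)) (mulL (mulL (lintegral_ball_lconv_le μ hk hG2 o r)))
    _ = _ := by rw [sq, mul_assoc]

lemma ulocSup_sqd_add_le {κ} {χ} (hχ : IsMult κ χ) {μ} [SFinite μ]
    {f : ℝ → E3 → E3} (hf : Measurable (uncurry f)) :
    ulocSup μ r (fun τ => sqd (χ · + κ) (f τ)) ≤ 2 * (ulocSup μ r (fun τ => sqd χ (f τ)) +
        ofReal κ ^ 2 * ulocSup μ r (fun τ => sqd 𝟙 (f τ))) := by
  have hm := measurable_sqd_uncurry hχ.measurable hf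
  rw [← ulocSup_const_mul (by finiteness)]; refine le_trans ?_ (mulL (ulocSup_add_le hm))
  rw [← ulocSup_const_mul (by finiteness)]; refine ulocSup_mono fun τ x => ?_
  simp only [sqd, ofReal_one, one_mul]; rw [ofReal_add (hχ.nonneg x) hχ.kappa_nonneg, add_mul]
  calc _ ≤ 2 * (ofReal (χ x) * ‖f τ x‖ₑ) ^ 2 + 2 * (ofReal κ * ‖f τ x‖ₑ) ^ 2 :=
    ennreal_add_sq_le _ _
    _ = _ := by ring

end UlocSup

section Increments

variable {ρ κ : ℝ} {o : E3} {χ : E3 → ℝ}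

lemma mul_abs_bumpAt_sub_le (hρ : 1 ≤ ρ) (hχ : IsMult κ χ) (x y : E3) :
    χ x * |bumpAt ρ o x - bumpAt ρ o y| ≤ bumpL * (χ y + κ) * modc (x - y) := by
  have h1 := bumpAt_modc hρ o x y
  have h2 := hχ.le_add y x
  rw [← modc_neg, neg_sub] at h2
  have h3 : |bumpAt ρ o x - bumpAt ρ o y| ≤ 1 := by
    rw [abs_le]
    constructor <;> linarith [bumpAt_nonneg ρ o x, bumpAt_nonneg ρ o y, bumpAt_le_one ρ o x,
      bumpAt_le_one ρ o y]
  have h4 := modc_nonneg (x - y)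
  have h5 := hχ.kappa_nonneg
  have h6 := hχ.nonneg y
  have h7 := one_le_bumpL
  calc _ ≤ (χ y + κ * modc (x - y)) * |bumpAt ρ o x - bumpAt ρ o y| := by gcongr
    _ = χ y * |bumpAt ρ o x - bumpAt ρ o y| +
        κ * modc (x - y) * |bumpAt ρ o x - bumpAt ρ o y| := by ring
    _ ≤ χ y * (bumpL * modc (x - y)) + κ * modc (x - y) * bumpL := by gcongr; linarith
    _ = _ := by ring

lemma abs_lwt_sub_le (hρ : 1 ≤ ρ) (hχ : IsMult κ χ) (x y : E3) :
    |lwt ρ o χ x - lwt ρ o χ y| ≤ 2 * bumpL * (χ x + κ) * (χ y + κ) * modc (x - y) := by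
  have hL := one_le_bumpL
  have hm := modc_nonneg (x - y)
  have hκ := hχ.kappa_nonneg
  have key : ∀ x y, χ x * |bumpAt ρ o x * χ x - bumpAt ρ o y * χ y| ≤
      bumpL * (χ x + κ) * (χ y + κ) * modc (x - y) := fun x y => by
    have hx := hχ.nonneg x
    have hy := hχ.nonneg y
    have hm := modc_nonneg (x - y)
    have h1 : |bumpAt ρ o x * χ x - bumpAt ρ o y * χ y| ≤ bumpL * (χ y + κ) * modc (x - y) := by
      have e : bumpAt ρ o x * χ x - bumpAt ρ o y * χ y =
          bumpAt ρ o x * (χ x - χ y) + χ y * (bumpAt ρ o x - bumpAt ρ o y) := by ring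
      rw [e]; refine (abs_add_le _ _).trans ?_
      rw [abs_mul, abs_mul, abs_of_nonneg (bumpAt_nonneg _ _ _), abs_of_nonneg hy]
      have h2 := bumpAt_modc hρ o x y
      have h3 := hχ.sub_le x y
      calc _ ≤ 1 * (κ * modc (x - y)) + χ y * (bumpL * modc (x - y)) := by
            gcongr; exact bumpAt_le_one _ _ _
        _ ≤ bumpL * (κ * modc (x - y)) + χ y * (bumpL * modc (x - y)) := by gcongr
        _ = _ := by ring
    calc _ ≤ (χ x + κ) * (bumpL * (χ y + κ) * modc (x - y)) := by gcongr; linarith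
      _ = _ := by ring
  have hfx : bumpAt ρ o x * χ x ≤ χ x := mul_le_of_le_one_left (hχ.nonneg x) (bumpAt_le_one _ _ _)
  have hfy : bumpAt ρ o y * χ y ≤ χ y := mul_le_of_le_one_left (hχ.nonneg y) (bumpAt_le_one _ _ _)
  have h0x : 0 ≤ bumpAt ρ o x * χ x := mul_nonneg (bumpAt_nonneg _ _ _) (hχ.nonneg x)
  have h0y : 0 ≤ bumpAt ρ o y * χ y := mul_nonneg (bumpAt_nonneg _ _ _) (hχ.nonneg y)
  have e : lwt ρ o χ x - lwt ρ o χ y = (bumpAt ρ o x * χ x + bumpAt ρ o y * χ y) *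
      (bumpAt ρ o x * χ x - bumpAt ρ o y * χ y) := by simp only [lwt]; ring
  have k1 := key x y
  have k2 := key y x
  rw [abs_sub_comm, ← modc_neg, neg_sub] at k2; rw [e, abs_mul, abs_of_nonneg (add_nonneg h0x h0y)]
  calc _ ≤ (χ x + χ y) * |bumpAt ρ o x * χ x - bumpAt ρ o y * χ y| := by gcongr
    _ ≤ bumpL * (χ x + κ) * (χ y + κ) * modc (x - y) +
        bumpL * (χ y + κ) * (χ x + κ) * modc (x - y) := by rw [add_mul]; linarith
    _ = _ := by ring

end Increments

lemma ofReal_mul_lintegral_increment_le {s κ A p q} {χ φ : E3 → ℝ} (hχ : IsMult κ χ)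
    {f : E3 → E3} {x} (hp : 0 ≤ p) (hA : 0 ≤ A) (hq : 0 ≤ q)
    (h : ∀ y, p * |φ x - φ y| ≤ A * q * (χ y + κ) * modc (x - y)) :
    ofReal p * ∫⁻ y, ofReal (|φ x - φ y| * ‖x - y‖ ^ (-3 - s)) * ‖f y‖ₑ ≤ ofReal A * (ofReal q *
        lconv (ker s) (fun y => ofReal (χ y + κ) * ‖f y‖ₑ) x) := by
  rw [lconv_eq_swap, ← lintegral_cmul, ← lintegral_cmul,
    ← lintegral_cmul]
  refine lintegral_mono fun y => ?_
  have hy : 0 ≤ χ y + κ := add_nonneg (hχ.nonneg y) hχ.kappa_nonneg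
  have h1 := ofReal_modc_le_ker (s := s) (z := x - y) (A := A * q * (χ y + κ)) (by positivity) (h y)
  rw [ofReal_mul (p := A * q) (by positivity), ofReal_mul hA] at h1
  rw [← mul_assoc, ← ofReal_mul hp, ← mul_assoc p]
  calc _ ≤ ofReal A * ofReal q * ofReal (χ y + κ) * ker s (x - y) * ‖f y‖ₑ := mulR h1
    _ = _ := by ring

lemma enorm_inner_le (v w : E3) : ‖⟪v, w⟫‖ₑ ≤ ‖v‖ₑ * ‖w‖ₑ := by
  rw [← ofReal_norm, ← ofReal_norm, ← ofReal_norm, ← ofReal_mul (norm_nonneg _)]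
  exact ofReal_le_ofReal (norm_inner_le_norm v w)

/-- The commutator terms of the local energy inequality. -/
lemma exists_commutator_terms_le {s} (hs : s ∈ Ico (3 / 4) 1) :
    ∃ C, C ≠ ⊤ ∧ ∀ T' M (u g : ℝ → E3 → E3) P,
    LerayData s T' M u g P → ∀ ρ, 1 ≤ ρ →
    ∀ κ χ, IsMult κ χ → ∀ o η, IsTimeCut (Ioo 0 T') η →
    ∀ δ, δ ≠ 0 → δ ≠ ⊤ → ∀ c : ℝ → E3 → E3, ∀ X,
    X = δ⁻¹ * 𝓤[T', 4 * ρ, (χ · + κ), u] +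
      δ * 𝓤[T', 4 * ρ, (χ · + κ), g] →
    ((∀ᵐ t ∂(𝓛 T'), HasCommutator s (bumpAt (2 * ρ) o) (g t) (c t)) →
      ‖∫ τ in Ioo 0 T', ∫ x, ⟪-c τ x, (η τ * lwt ρ o χ x) • u τ x⟫‖ₑ ≤ C * X) ∧
    ((∀ᵐ t ∂(𝓛 T'), HasCommutator s (fun x => η t * lwt ρ o χ x) (u t) (c t)) →
      ‖∫ τ in Ioo 0 T', ∫ x, ⟪c τ x, bumpAt (2 * ρ) o x • g τ x⟫‖ₑ ≤ C * X) := by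
  have hs1 : 1 / 2 ≤ s := by linarith [hs.1]
  obtain ⟨C₀, hC₀, hcomm⟩ := exists_enorm_commutator_le hs1 hs.2
  have hk : ∫⁻ z, ker s z ≠ ⊤ := (lintegral_ker_lt_top (by linarith [hs.1]) hs.2).ne
  have hL := one_le_bumpL
  refine ⟨ofReal C₀ * ofReal (2 * bumpL) * (1 + (∫⁻ z, ker s z) ^ 2),
    by finiteness, fun T' M u g P D ρ hρ κ χ hχ o η hη δ hδ0 hδt c X hX => ?_⟩
  have hρ0 : 0 < ρ := by linarith
  have hκ := hχ.kappa_nonneg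
  have hχm : Measurable fun y => ofReal (χ y + κ) := (hχ.measurable.add_const κ).ennreal_ofReal
  let H : (ℝ → E3 → E3) → ℝ → E3 → ℝ≥0∞ := fun f τ y => ofReal (χ y + κ) * ‖f τ y‖ₑ
  have hH : ∀ f, Measurable (uncurry f) → Measurable (uncurry (H f)) := fun f hf =>
    (hχm.comp measurable_snd).mul hf.enorm
  -- both terms reduce to an integral of `H f` against the convolution of `H f'`
  have hfin : ∀ f f', Measurable (uncurry f) → Measurable (uncurry f') → ∀ ε, ε ≠ 0 → ε ≠ ⊤ →
      ε * 𝓤[T', 4 * ρ, (χ · + κ), f] +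
      ε⁻¹ * 𝓤[T', 4 * ρ, (χ · + κ), f'] = X → ∀ F : ℝ → E3 → ℝ,
      (∀ᵐ τ ∂(𝓛 T'), ∀ᵐ x, ‖F τ x‖ₑ ≤ (ball o (4 * ρ)).indicator (fun x => ofReal C₀ *
          ofReal (2 * bumpL) * (H f τ x * lconv (ker s) (H f' τ) x)) x) →
      ‖∫ τ in Ioo 0 T', ∫ x, F τ x‖ₑ ≤
        ofReal C₀ * ofReal (2 * bumpL) * (1 + (∫⁻ z, ker s z) ^ 2) * X := by
    intro f f' hf hf' ε hε0 hεt hεX F hF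
    have hy := lintegral_ball_mul_lconv_le (μ := volume.restrict (Ioo 0 T')) (r := 4 * ρ)
      (measurable_ker s) (hH f hf) (hH f' hf') hε0 hεt o
    calc _ ≤ ∫⁻ τ in Ioo 0 T', ∫⁻ x, ‖F τ x‖ₑ := (enorm_integral_le_lintegral_enorm _).trans
            (lintegral_mono fun τ => enorm_integral_le_lintegral_enorm _)
      _ ≤ ∫⁻ τ in Ioo 0 T', ofReal C₀ * ofReal (2 * bumpL) *
          ∫⁻ x in ball o (4 * ρ), H f τ x * lconv (ker s) (H f' τ) x := by
          refine lintegral_mono_ae (hF.mono fun τ hτ => (lintegral_mono_ae hτ).trans (le_of_eq ?_))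
          rw [lintegral_indicator measurableSet_ball, lintegral_cmul]
      _ = ofReal C₀ * ofReal (2 * bumpL) * ∫⁻ τ in Ioo 0 T',
          ∫⁻ x in ball o (4 * ρ), H f τ x * lconv (ker s) (H f' τ) x :=
          lintegral_cmul
      _ ≤ ofReal C₀ * ofReal (2 * bumpL) * ((1 + (∫⁻ z, ker s z) ^ 2) * X) := by
          refine mulL (hy.trans ?_)
          rw [← hεX, mul_add (1 + (∫⁻ z, ker s z) ^ 2)]; refine add_le_add ?_ ?_
          · exact le_mul_of_one_le_left zero_le le_self_add
          · rw [← mul_assoc, mul_comm ε⁻¹, mul_assoc]; exact mulR le_add_self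
      _ = _ := by ring
  refine ⟨fun hc => ?_, fun hc => ?_⟩
  · refine hfin u g D.meas_u D.meas_g δ⁻¹ (ENNReal.inv_ne_zero.2 hδt) (by finiteness)
      (by rw [hX, inv_inv]) _ (hc.mono fun τ hτ => ?_)
    filter_upwards [hcomm _ (bumpAt_isTest (by linarith) o) (g τ) (c τ) (D.wint_g τ) hτ] with x hx
    by_cases hxb : x ∈ ball o (4 * ρ)
    · rw [indicator_of_mem hxb]
      have h1 := ofReal_mul_lintegral_increment_le (s := s) (f := g τ) (x := x) (p := χ x) (q := 1)
        (A := bumpL) (φ := bumpAt (2 * ρ) o) hχ (hχ.nonneg x) (by linarith) zero_le_one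
        fun y => by rw [mul_one]; exact mul_abs_bumpAt_sub_le (by linarith) hχ x y
      rw [ofReal_one, one_mul] at h1
      have h2 : ‖η τ * lwt ρ o χ x‖ₑ ≤ ofReal (χ x) * ofReal (χ x) := by
        rw [enorm_mul, ← sq, ← ofReal_pow (hχ.nonneg x), enorm_of_nonneg (lwt_nonneg x)]
        calc _ ≤ 1 * ofReal (χ x ^ 2) := mul_le_mul'
              (enorm_le_one_of_mem (hη.nonneg τ) (hη.le_one τ))
              (ofReal_le_ofReal (lwt_le hχ x))
          _ = _ := one_mul _
      calc ‖⟪-c τ x, (η τ * lwt ρ o χ x) • u τ x⟫‖ₑ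
          ≤ ‖c τ x‖ₑ * (‖η τ * lwt ρ o χ x‖ₑ * ‖u τ x‖ₑ) := by
            refine (enorm_inner_le _ _).trans (le_of_eq ?_)
            rw [enorm_neg, enorm_smul]
        _ ≤ (ofReal C₀ * ∫⁻ y, ofReal (|bumpAt (2 * ρ) o x - bumpAt (2 * ρ) o y| *
            ‖x - y‖ ^ (-3 - s)) * ‖g τ y‖ₑ) *
            (ofReal (χ x) * ofReal (χ x) * ‖u τ x‖ₑ) :=
            mul_le_mul' hx (mulR h2)
        _ = ofReal C₀ * ((ofReal (χ x) * ∫⁻ y, ofReal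
            (|bumpAt (2 * ρ) o x - bumpAt (2 * ρ) o y| * ‖x - y‖ ^ (-3 - s)) * ‖g τ y‖ₑ) *
            (ofReal (χ x) * ‖u τ x‖ₑ)) := by ring
        _ ≤ ofReal C₀ * ((ofReal (2 * bumpL) * lconv (ker s) (H g τ) x) * H u τ x) := by
            refine mulL (mul_le_mul' (h1.trans (mul_le_mul' ?_ le_rfl))
              (mulR (ofReal_le_ofReal (by linarith))))
            exact ofReal_le_ofReal (by linarith)
        _ = _ := by ring
    · have h0 : lwt ρ o χ x = 0 := lwt_eq_zero hρ0 (by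
        have : 4 * ρ ≤ dist x o := not_lt.1 hxb
        linarith)
      rw [h0]; simp
  · refine hfin g u D.meas_g D.meas_u δ hδ0 hδt (by rw [hX, add_comm]) _ (hc.mono fun τ hτ => ?_)
    have htest : IsTest fun x => η τ * lwt ρ o χ x := by
      have h := (hη.spaceTimeTest (lwt_isTest (o := o) hρ0 hχ) (f := fun _ => 1)
        contDiff_const).slice τ
      simpa only [mul_one] using h
    filter_upwards [hcomm _ htest (u τ) (c τ) (D.wint_u τ) hτ] with x hx
    by_cases hxb : x ∈ ball o (4 * ρ)
    · rw [indicator_of_mem hxb]; have hq : 0 ≤ χ x + κ := add_nonneg (hχ.nonneg x) hκ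
      have h1 := ofReal_mul_lintegral_increment_le (s := s) (f := u τ) (x := x) (p := 1)
        (q := χ x + κ) (A := 2 * bumpL) (φ := fun x => η τ * lwt ρ o χ x) hχ zero_le_one
        (by linarith) hq
        fun y => by
          rw [one_mul, ← mul_sub, abs_mul, abs_of_nonneg (hη.nonneg τ)]
          exact (mul_le_of_le_one_left (abs_nonneg _) (hη.le_one τ)).trans
            (abs_lwt_sub_le hρ hχ x y)
      rw [ofReal_one, one_mul] at h1
      calc ‖⟪c τ x, bumpAt (2 * ρ) o x • g τ x⟫‖ₑ
          ≤ ‖c τ x‖ₑ * (‖bumpAt (2 * ρ) o x‖ₑ * ‖g τ x‖ₑ) := by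
            refine (enorm_inner_le _ _).trans (le_of_eq ?_)
            rw [enorm_smul]
        _ ≤ (ofReal C₀ * (ofReal (2 * bumpL) * (ofReal (χ x + κ) *
            lconv (ker s) (H u τ) x))) * (1 * ‖g τ x‖ₑ) :=
            mul_le_mul' (hx.trans (mulL h1)) (mul_le_mul'
              (enorm_le_one_of_mem (bumpAt_nonneg _ _ _) (bumpAt_le_one _ _ _)) le_rfl)
        _ = _ := by simp only [H]; ring
    · rw [bumpAt_eq_zero (by linarith) (by
        have : 4 * ρ ≤ dist x o := not_lt.1 hxb
        linarith)]
      simp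

/-! ### The weighted local energy inequality -/

lemma inner_gradient_cut {ρ κ} {o} {χ} (hρ : 0 < ρ) (hχ : IsMult κ χ) (c : ℝ)
    (v x : E3) : ⟪v, gradient (fun y => c * lwt ρ o χ y) x⟫ = c * dd v (lwt ρ o χ) x := by
  rw [inner_gradient, dd, fderiv_const_mul ((lwt_isTest hρ hχ).1.differentiable (by simp) x)]; rfl

/-- The cubic term of the local energy inequality, slice by slice. -/
lemma exists_cubic_term_le : ∃ C, C ≠ ⊤ ∧ ∀ (M : ℝ≥0) U, Measurable U →
    (∀ m, ∫⁻ x in ball m 1, ‖U x‖ₑ ^ 2 ≤ (M : ℝ≥0∞) ^ 2) → ∀ ρ, 1 ≤ ρ →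
    ∀ κ χ, IsMult κ χ → ∀ o c, 0 ≤ c → c ≤ 1 →
      ‖∫ x, ‖U x‖ ^ 2 * ⟪U x, gradient (fun y => c * lwt ρ o χ y) x⟫‖ₑ ≤
        C * M * (ofReal ρ⁻¹ * (∫⁻ m in ball o (4 * ρ + 1), l4 χ U m) +
          ofReal κ * ∫⁻ m in ball o (4 * ρ + 1), l4 𝟙 U m) := by
  have hV0 : volume (ball (0 : E3) 1) ≠ 0 := (measure_ball_pos volume _ one_pos).ne'
  have hL := one_le_bumpL
  refine ⟨ofReal (2 * bumpL) * (volume (ball (0 : E3) 1))⁻¹,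
    ENNReal.mul_ne_top ofReal_ne_top (by finiteness),
    fun M U hU hM ρ hρ κ χ hχ o c hc0 hc1 => ?_⟩
  have hρ0 : 0 < ρ := by linarith
  have hκ := hχ.kappa_nonneg
  have hχm := hχ.measurable
  set V : ℝ≥0∞ := (volume (ball (0 : E3) 1))⁻¹ with hV
  have hcub : ∀ f, Measurable f → ∫⁻ x in ball o (2 * ρ), ofReal (f x) ^ 2 * ‖U x‖ₑ ^ 3 ≤
        V * (M * ∫⁻ m in ball o (4 * ρ + 1), l4 f U m) := fun f hf =>
    (setLIntegral_cubic_le hf hU hM o (2 * ρ)).trans (mulL (mulL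
      (lintegral_mono_set (ball_subset_ball (by linarith)))))
  calc _ ≤ ∫⁻ x, ‖‖U x‖ ^ 2 * ⟪U x, gradient (fun y => c * lwt ρ o χ y) x⟫‖ₑ :=
    enorm_integral_le_lintegral_enorm _
    _ ≤ ofReal (2 * bumpL) * (ofReal ρ⁻¹ * (V * (M * ∫⁻ m in ball o (4 * ρ + 1), l4 χ U m)) +
          ofReal κ * (V * (M * ∫⁻ m in ball o (4 * ρ + 1), l4 𝟙 U m))) := by
      refine lintegral_le_mul_of_support (s := ball o (2 * ρ))
        (v := fun x => ofReal ρ⁻¹ * (ofReal (χ x) ^ 2 * ‖U x‖ₑ ^ 3) +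
          ofReal κ * (ofReal ((fun _ => (1 : ℝ)) x) ^ 2 * ‖U x‖ₑ ^ 3)) measurableSet_ball
        (by finiteness) (fun x _ => ?_) (fun x hx => ?_) ?_
      · rw [inner_gradient_cut hρ0 hχ]; have h0 := hχ.nonneg x
        have h1 : ofReal (2 * bumpL * (χ x ^ 2 / ρ + κ * χ x)) ≤ ofReal (2 * bumpL) *
            (ofReal ρ⁻¹ * ofReal (χ x) ^ 2 + ofReal κ) := by
          rw [← ofReal_pow h0, ← ofReal_mul (by positivity),
            ← ofReal_add (by positivity) hκ, ← ofReal_mul (by positivity)]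
          refine ofReal_le_ofReal ?_
          have : κ * χ x ≤ κ := mul_le_of_le_one_right hκ (hχ.le_one x)
          rw [div_eq_inv_mul]; gcongr
        rw [enorm_mul, enorm_mul, enorm_pow, enorm_norm]
        calc _ ≤ ‖U x‖ₑ ^ 2 * (1 * ((ofReal (2 * bumpL) *
              (ofReal ρ⁻¹ * ofReal (χ x) ^ 2 + ofReal κ)) * ‖U x‖ₑ)) :=
          mulL (mul_le_mul' (enorm_le_one_of_mem hc0 hc1)
            ((enorm_dd_lwt_le hρ0 hχ _ x).trans (mulR h1)))
          _ = _ := by rw [ofReal_one]; ring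
      · rw [inner_gradient_cut hρ0 hχ, dd_lwt_eq_zero hρ0 hχ _ (not_lt.1 hx)]; simp
      · have hm : Measurable fun x => ofReal (χ x) ^ 2 * ‖U x‖ₑ ^ 3 := by fun_prop
        rw [lintegral_add_left (hm.const_mul _), lintegral_cmul, lintegral_cmul]
        exact add_le_add (mulL (hcub χ hχm)) (mulL (hcub 𝟙 measurable_const))
    _ = _ := by ring

section Core

variable {s : ℝ}

/-- The transport and pressure terms of the local energy inequality. The radius `ρ` is a large
parameter: its inverse multiplies the critical quantity, the local enstrophy. -/
lemma exists_transport_terms_le (hs : s ∈ Ico (3 / 4) 1) (K₀ : ℝ) :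
    ∃ C, C ≠ ⊤ ∧ ∀ ρ, 1 ≤ ρ → ∃ Cρ, Cρ ≠ ⊤ ∧
    ∀ T' M u g P, LerayData s T' M u g P →
    ∀ κ χ, IsMult κ χ → κ ≤ K₀ → ∀ o η, IsTimeCut (Ioo 0 T') η → ∀ A B G V,
      A = 𝓤[T', ρ, χ, u] →
      B = 𝓤[T', ρ, χ, g] →
      G = 𝓤[T', ρ, 𝟙, g] →
      V = 𝓤[T', ρ, 𝟙, u] →
      ‖∫ τ in Ioo 0 T', ∫ x, ‖u τ x‖ ^ 2 * ⟪u τ x, gradient (fun y => η τ * lwt ρ o χ y) x⟫‖ₑ +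
        2 * ‖∫ τ in Ioo 0 T', ∫ x, P τ x * ⟪u τ x, gradient (fun y => η τ * lwt ρ o χ y) x⟫‖ₑ ≤
      C * M * (ofReal ρ⁻¹ * (B + (A + ofReal κ ^ 2 * V)) +
        ofReal κ * (G + V)) + Cρ * M * (A + ofReal κ * V) := by
  obtain ⟨C1, hC1, hcub⟩ := exists_cubic_term_le
  obtain ⟨C2, hC2, hpr⟩ := exists_pressure_le hs K₀
  obtain ⟨C4, hC4, hl4⟩ := exists_lintegral_time_l4_le hs
  obtain ⟨Cw, hCw, hwgt⟩ := exists_lintegral_wgt_le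
  obtain ⟨N, -, hN⟩ := exists_ulocSup_mul_le 7
  refine ⟨(C1 + 18 * C2) * (2 * C4 * N), by finiteness, fun ρ hρ => ?_⟩
  obtain ⟨Cρ, hCρ, hpr⟩ := hpr ρ hρ
  refine ⟨18 * Cρ * Cw, by finiteness, fun T' M u g P D κ χ hχ hκ o η hη A B G V hA hB hG hV => ?_⟩
  have hρ0 : 0 < ρ := by linarith
  have hχm := hχ.measurable
  set μ : Measure ℝ := volume.restrict (Ioo 0 T') with hμ
  set k := ofReal κ with hk
  have hcov : ∀ F, Measurable (uncurry F) →
      ulocSup μ (4 * ρ + 1 + 2) F ≤ N * ulocSup μ ρ F := fun F hF =>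
    (ulocSup_mono_radius μ (by linarith) F).trans (hN μ ρ hρ0 F hF)
  set Lχ : ℝ≥0∞ := ∫⁻ τ, (∫⁻ m in ball o (4 * ρ + 1), l4 χ (u τ) m) ∂μ with hLχ
  set L1 : ℝ≥0∞ := ∫⁻ τ, (∫⁻ m in ball o (4 * ρ + 1), l4 𝟙 (u τ) m) ∂μ with hL1
  set W : ℝ≥0∞ := ∫⁻ τ, (∫⁻ x, wgt (x - o) * (ofReal (χ x ^ 2 + κ) * ‖u τ x‖ₑ ^ 2)) ∂μ
    with hW
  have mχ : Measurable fun τ => ∫⁻ m in ball o (4 * ρ + 1), l4 χ (u τ) m :=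
    Measurable.lintegral_prod_right' (measurable_l4_time hχm D.meas_u)
  have m1 : Measurable fun τ => ∫⁻ m in ball o (4 * ρ + 1), l4 𝟙 (u τ) m :=
    Measurable.lintegral_prod_right' (measurable_l4_time measurable_const D.meas_u)
  have b1 : Lχ ≤ 2 * C4 * N * (B + (A + k ^ 2 * V)) := by
    refine (hl4 κ χ hχ u g D.meas_u D.meas_g D.wint_u D.fracLap μ o (4 * ρ + 1)).trans ?_
    have e1 := hcov _ (measurable_sqd_uncurry hχm D.meas_g)
    have e2 := hcov _ (measurable_sqd_uncurry (hχm.add_const κ) D.meas_u)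
    have e3 := ulocSup_sqd_add_le (r := ρ) hχ (μ := μ) D.meas_u
    rw [← hA, ← hV] at e3; rw [← hB] at e1
    calc _ ≤ C4 * (N * (2 * B) + N * (2 * (A + k ^ 2 * V))) := by
          refine mulL (add_le_add (e1.trans ?_) (e2.trans (mulL e3)))
          exact mulL (le_mul_of_one_le_left zero_le one_le_two)
      _ = _ := by ring
  have b2 : L1 ≤ 2 * C4 * N * (G + V) := by
    refine (hl4 0 _ IsMult.one u g D.meas_u D.meas_g D.wint_u D.fracLap μ o (4 * ρ + 1)).trans ?_
    simp only [add_zero]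
    have e1 := hcov _ (measurable_sqd_uncurry (χ := fun _ => 1) measurable_const D.meas_g)
    have e2 := hcov _ (measurable_sqd_uncurry (χ := fun _ => 1) measurable_const D.meas_u)
    rw [← hG] at e1; rw [← hV] at e2
    calc _ ≤ C4 * (N * G + N * V) := mulL (add_le_add e1 e2)
      _ = C4 * N * (G + V) := by ring
      _ ≤ _ := by rw [mul_assoc 2, mul_assoc 2]; exact le_mul_of_one_le_left zero_le one_le_two
  have b3 : W ≤ Cw * (A + k * V) := by
    have hm2 : Measurable (uncurry fun (τ : ℝ) (x : E3) => ofReal (χ x ^ 2 + κ) * ‖u τ x‖ₑ ^ 2) :=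
      ((((hχm.comp measurable_snd).pow_const 2).add_const κ).ennreal_ofReal).mul
        (D.meas_u.enorm.pow_const 2)
    refine (hwgt μ _ hm2 o).trans (mulL ((ulocSup_mono_radius μ hρ _).trans ?_))
    rw [hA, hV, ← ulocSup_const_mul ofReal_ne_top]
    refine le_trans (ulocSup_mono fun τ x => ?_)
      (ulocSup_add_le (measurable_sqd_uncurry hχm D.meas_u))
    rw [ofReal_add (sq_nonneg _) hχ.kappa_nonneg, ofReal_pow (hχ.nonneg x), add_mul]
    simp only [sqd, mul_pow, ofReal_one, one_mul, le_refl]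
  have t3 : ‖∫ τ in Ioo 0 T', ∫ x, ‖u τ x‖ ^ 2 *
      ⟪u τ x, gradient (fun y => η τ * lwt ρ o χ y) x⟫‖ₑ ≤
      C1 * M * (ofReal ρ⁻¹ * Lχ + k * L1) := by
    refine (enorm_integral_le_lintegral_enorm _).trans ((lintegral_mono fun τ =>
      hcub M (u τ) D.meas_u.of_uncurry_left (D.uloc τ) ρ hρ κ χ hχ o (η τ) (hη.nonneg τ)
        (hη.le_one τ)).trans (le_of_eq ?_))
    rw [lintegral_cmul, lintegral_add_left (mχ.const_mul _), lintegral_cmul,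
      lintegral_cmul]
  have t4 := hpr T' M u g P D κ χ hχ hκ o η hη
  have t4' : ∫⁻ t in Ioo 0 T', pressureBound C2 Cρ M ρ κ χ o (u t) =
      C2 * M * (ofReal ρ⁻¹ * Lχ + k * L1) + Cρ * M * W := by
    unfold pressureBound
    have m2 : Measurable fun τ => ofReal ρ⁻¹ * (∫⁻ m in ball o (4 * ρ + 1), l4 χ (u τ) m) +
          ofReal κ * ∫⁻ m in ball o (4 * ρ + 1), l4 𝟙 (u τ) m :=
      (mχ.const_mul _).add (m1.const_mul _)
    rw [lintegral_add_left (m2.const_mul _), lintegral_cmul, lintegral_cmul,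
      lintegral_add_left (mχ.const_mul _), lintegral_cmul,
      lintegral_cmul]
  rw [t4'] at t4
  calc _ ≤ C1 * M * (ofReal ρ⁻¹ * Lχ + k * L1) +
        2 * (9 * (C2 * M * (ofReal ρ⁻¹ * Lχ + k * L1) + Cρ * M * W)) :=
        add_le_add t3 (mulL t4)
    _ = (C1 + 18 * C2) * M * (ofReal ρ⁻¹ * Lχ + k * L1) + 18 * Cρ * M * W := by ring
    _ ≤ (C1 + 18 * C2) * M * (ofReal ρ⁻¹ * (2 * C4 * N * (B + (A + k ^ 2 * V))) +
          k * (2 * C4 * N * (G + V))) + 18 * Cρ * M * (Cw * (A + k * V)) := by gcongr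
    _ = _ := by ring

/-- The local energy inequality after all terms on the right have been estimated by the local
energy `A`, the local enstrophy `B` and the commutator errors. The coefficient of `B` is smaller
than on the left-hand side. -/
lemma exists_energy_le (hs : s ∈ Ico (3 / 4) 1) (K₀ : ℝ) (M : ℝ≥0) : ∃ ρ, 1 ≤ ρ ∧ ∃ C, C ≠ ⊤ ∧
    ∀ T' u g P, LerayData s T' M u g P →
    0 < T' → ∀ κ χ, IsMult κ χ → κ ≤ K₀ → ∀ o η, IsTimeCut (Ioo 0 T') η → ∀ A B G V,
      A = 𝓤[T', ρ, χ, u] →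
      B = 𝓤[T', ρ, χ, g] →
      G = 𝓤[T', ρ, 𝟙, g] →
      V = 𝓤[T', ρ, 𝟙, u] →
      ofReal (2 * (∫ τ in Ioo 0 T', η τ * ∫ x, lwt ρ o χ x * ‖g τ x‖ ^ 2) -
        ∫ τ in Ioo 0 T', deriv η τ * ∫ x, lwt ρ o χ x * ‖u τ x‖ ^ 2) ≤
      B + C * (A + ofReal κ * (G + V)) := by
  obtain ⟨C1, hC1, hcomm⟩ := exists_commutator_terms_le hs
  obtain ⟨C2, hC2, htr⟩ := exists_transport_terms_le hs K₀
  obtain ⟨N, -, hN⟩ := exists_ulocSup_mul_le 4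
  -- The commutators use half of the coefficient of `B`, and this fixes `δ`. The terms critical for
  -- `s = 3/4` use the other half, and this fixes `ρ`.
  obtain ⟨δ, hδ0, hδ⟩ : ∃ δ, δ ≠ 0 ∧ δ ≠ ⊤ ∧ 4 * C1 * (2 * N) * δ ≤ 2⁻¹ := by
    refine ⟨2⁻¹ / (4 * C1 * (2 * N) + 1), ?_, ?_, ?_⟩
    · exact (ENNReal.div_pos (by norm_num) (by finiteness)).ne'
    · exact (ENNReal.div_lt_top (by norm_num) (by simp)).ne
    · rw [← mul_div_assoc]; refine ENNReal.div_le_of_le_mul ?_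
      rw [mul_comm 2⁻¹]; exact mulR le_self_add
  obtain ⟨hδt, hδ⟩ := hδ
  obtain ⟨ρ, hρ, hρM⟩ : ∃ ρ, 1 ≤ ρ ∧ C2 * M * ofReal ρ⁻¹ ≤ 2⁻¹ := by
    have hfin : C2 * M ≠ ⊤ := by finiteness
    refine ⟨2 * (C2 * M).toReal + 1, by linarith [ENNReal.toReal_nonneg (a := C2 * M)], ?_⟩
    have h0 := ENNReal.toReal_nonneg (a := C2 * M)
    rw [← ofReal_toReal hfin, ← ofReal_mul h0, ENNReal.toReal_ofReal h0]
    have : (2⁻¹ : ℝ≥0∞) = ofReal 2⁻¹ := by rw [ofReal_inv_of_pos two_pos]; norm_num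
    rw [this]; refine ofReal_le_ofReal ?_; rw [mul_inv_le_iff₀ (by linarith)]; linarith
  obtain ⟨Cρ, hCρ, htr⟩ := htr ρ hρ
  set k₀ := ofReal K₀ with hk₀
  have hδi : δ⁻¹ ≠ ⊤ := by finiteness
  refine ⟨ρ, hρ, 4 * C1 * (2 * N) * δ⁻¹ * (1 + k₀) + (1 + k₀) + (1 + k₀) + C2 * M + Cρ * M,
    by finiteness, fun T' u g P D hT' κ χ hχ hκ o η hη A B G V hA hB hG hV => ?_⟩
  have hρ0 : 0 < ρ := by linarith
  have hχm := hχ.measurable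
  set k := ofReal κ with hk
  have hkk : k ≤ k₀ := ofReal_le_ofReal hκ
  have htest := hη.spaceTimeTest (lwt_isTest (o := o) hρ0 hχ) (f := fun _ => 1) contDiff_const
  obtain ⟨c₁, c₂, hc₁, hc₂, hen⟩ := D.energy (fun t x => η t * lwt ρ o χ x) (bumpAt (2 * ρ) o)
    (by simpa only [mul_one] using htest)
    (fun t x => mul_nonneg (hη.nonneg t) (lwt_nonneg x)) (bumpAt_isTest (by linarith) o)
    (fun x => bumpAt_nonneg _ _ _) fun t x => by
      by_cases hx : 2 * ρ ≤ dist x o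
      · rw [lwt_eq_zero hρ0 hx, mul_zero, mul_zero]
      · rw [bumpAt_eq_one (by linarith) (not_le.1 hx).le, one_mul]
  have hen := hen T' hT' le_rfl
  obtain ⟨X, hX⟩ : ∃ X, X = δ⁻¹ * ulocSup (𝓛 T') (4 * ρ)
      (fun τ => sqd (χ · + κ) (u τ)) + δ * ulocSup (𝓛 T') (4 * ρ)
      (fun τ => sqd (χ · + κ) (g τ)) := ⟨_, rfl⟩
  have t1 := (hcomm T' M u g P D ρ hρ κ χ hχ o η hη δ hδ0 hδt c₁ X hX).1 hc₁
  have t2 := (hcomm T' M u g P D ρ hρ κ χ hχ o η hη δ hδ0 hδt c₂ X hX).2 hc₂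
  have t34 := htr T' M u g P D κ χ hχ hκ o η hη A B G V hA hB hG hV
  have hS : ∀ f, Measurable (uncurry f) → 𝓤[T', 4 * ρ, (χ · + κ), f] ≤
        N * (2 * (𝓤[T', ρ, χ, f] +
          k ^ 2 * 𝓤[T', ρ, 𝟙, f])) :=
    fun f hf => (hN _ ρ hρ0 _ (measurable_sqd_uncurry (hχm.add_const κ) hf)).trans
      (mulL (ulocSup_sqd_add_le hχ hf))
  have hSu := hS u D.meas_u
  have hSg := hS g D.meas_g
  rw [← hA, ← hV] at hSu; rw [← hB, ← hG] at hSg; set Y : ℝ≥0∞ := A + k * (G + V) with hY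
  have hkY : k * (G + V) ≤ Y := le_add_self
  have hkV : k * V ≤ k * (G + V) := mulL le_add_self
  have hkG : k * G ≤ k * (G + V) := mulL le_self_add
  have y1 : A + k ^ 2 * V ≤ (1 + k₀) * Y := by
    rw [add_mul, one_mul, sq, mul_assoc]
    have : k * (k * V) ≤ k₀ * Y := mul_le_mul' hkk (hkV.trans hkY)
    exact add_le_add le_self_add this
  have y2 : k ^ 2 * G ≤ (1 + k₀) * Y := by
    rw [sq, mul_assoc]; exact mul_le_mul' (hkk.trans le_add_self) (hkG.trans hkY)
  have y3 : A + k * V ≤ Y := add_le_add le_rfl hkV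
  have hXY : X ≤ 2 * N * δ⁻¹ * ((1 + k₀) * Y) + 2 * N * δ * (B + (1 + k₀) * Y) := by
    rw [hX]
    calc _ ≤ δ⁻¹ * (N * (2 * ((1 + k₀) * Y))) + δ * (N * (2 * (B + (1 + k₀) * Y))) := by
          refine add_le_add (mulL (hSu.trans ?_)) (mulL (hSg.trans ?_))
          · exact mulL (mulL y1)
          · exact mulL (mulL (add_le_add le_rfl y2))
      _ = _ := by ring
  have hEg : ∀ τ, ∫ x, η τ * lwt ρ o χ x * ‖g τ x‖ ^ 2 =
      η τ * ∫ x, lwt ρ o χ x * ‖g τ x‖ ^ 2 := fun τ => by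
    simp only [mul_assoc, integral_const_mul]
  have hEu : ∀ τ, ∫ x, ‖u τ x‖ ^ 2 * deriv (fun r => η r * lwt ρ o χ x) τ =
      deriv η τ * ∫ x, lwt ρ o χ x * ‖u τ x‖ ^ 2 := fun τ => by
    rw [← integral_const_mul]; refine integral_congr_ae (.of_forall fun x => ?_)
    simp only; rw [deriv_mul_const (hη.smooth.differentiable (by simp) τ)]; ring
  simp only [hEg, hEu] at hen
  have hsum : ∀ I₁ I₂ I₃ I₄, ofReal (-2 * I₁ - 2 * I₂ + I₃ + 2 * I₄) ≤
      2 * ‖I₁‖ₑ + 2 * ‖I₂‖ₑ + (‖I₃‖ₑ + 2 * ‖I₄‖ₑ) := fun I₁ I₂ I₃ I₄ => by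
    have e2 : (2 : ℝ≥0∞) = ofReal 2 := by norm_num
    simp only [← ofReal_norm]
    rw [e2, ← ofReal_mul zero_le_two, ← ofReal_mul zero_le_two,
      ← ofReal_mul zero_le_two, ← ofReal_add (by positivity) (by positivity),
      ← ofReal_add (by positivity) (by positivity),
      ← ofReal_add (by positivity) (by positivity)]
    refine ofReal_le_ofReal ?_
    have h1 := neg_abs_le I₁
    have h2 := neg_abs_le I₂
    have h3 := le_abs_self I₃
    have h4 := le_abs_self I₄
    simp only [norm_eq_abs]; linarith
  calc _ ≤ _ := ofReal_le_ofReal (by linarith [hen])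
    _ ≤ _ := hsum _ _ _ _
    _ ≤ 2 * (C1 * X) + 2 * (C1 * X) + (C2 * M * (ofReal ρ⁻¹ * (B + (A + k ^ 2 * V)) +
          k * (G + V)) + Cρ * M * (A + k * V)) :=
        add_le_add (add_le_add (mulL t1) (mulL t2)) t34
    _ ≤ 4 * C1 * (2 * N * δ⁻¹ * ((1 + k₀) * Y) + 2 * N * δ * (B + (1 + k₀) * Y)) +
          (C2 * M * (ofReal ρ⁻¹ * (B + (1 + k₀) * Y) + Y) + Cρ * M * Y) := by
        refine add_le_add ?_ (add_le_add (mulL (add_le_add (mulL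
          (add_le_add le_rfl y1)) hkY)) (mulL y3))
        calc 2 * (C1 * X) + 2 * (C1 * X) = 4 * C1 * X := by ring
          _ ≤ _ := mulL hXY
    _ = 4 * C1 * (2 * N) * δ * (B + (1 + k₀) * Y) + C2 * M * ofReal ρ⁻¹ * (B + (1 + k₀) * Y) +
          (4 * C1 * (2 * N) * δ⁻¹ * (1 + k₀) + C2 * M + Cρ * M) * Y := by ring
    _ ≤ 2⁻¹ * (B + (1 + k₀) * Y) + 2⁻¹ * (B + (1 + k₀) * Y) +
          (4 * C1 * (2 * N) * δ⁻¹ * (1 + k₀) + C2 * M + Cρ * M) * Y :=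
        add_le_add (add_le_add (mulR hδ) (mulR hρM)) le_rfl
    _ = B + ((1 + k₀) + (4 * C1 * (2 * N) * δ⁻¹ * (1 + k₀) + C2 * M + Cρ * M)) * Y := by
        rw [← add_mul, ENNReal.inv_two_add_inv_two, one_mul]; ring
    _ ≤ _ := by
        refine add_le_add le_rfl (mul_le_mul' ?_ le_rfl)
        calc _ ≤ ((1 + k₀) + (4 * C1 * (2 * N) * δ⁻¹ * (1 + k₀) + C2 * M + Cρ * M)) + (1 + k₀) :=
              le_self_add
          _ = _ := by ring

end Core

/-! ### From cutoffs in time to a bound at almost every time -/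

/-- A bump of width `(n + 1)⁻¹` on the line. -/
def lineBump (n : ℕ) : ContDiffBump (0 : ℝ) :=
  ⟨ϵ[n] / 2, ϵ[n], by positivity, half_lt_self (by positivity)⟩

/-- The approximate identity on the line given by `lineBump`. -/
def lineKer (n : ℕ) : ℝ → ℝ := (lineBump n).normed volume

/-- A smooth step, the primitive of `lineKer n`. -/
def step (n : ℕ) (t : ℝ) : ℝ := ∫ τ in (-1 : ℝ)..t, lineKer n τ

lemma lineKer_nonneg (n : ℕ) (t : ℝ) : 0 ≤ lineKer n t := (lineBump n).nonneg_normed t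

lemma contDiff_lineKer (n : ℕ) : ContDiff ℝ (⊤ : ℕ∞) (lineKer n) := (lineBump n).contDiff_normed

lemma lineKer_eq_zero {n : ℕ} {t} (h : ϵ[n] ≤ |t|) : lineKer n t = 0 := by
  have h1 : t ∉ Function.support (lineKer n) := by
    rw [lineKer, (lineBump n).support_normed_eq, mem_ball, dist_zero_right, not_lt]; exact h
  simpa using h1

lemma integral_lineKer (n : ℕ) : ∫ t, lineKer n t = 1 := (lineBump n).integral_normed

lemma integrable_lineKer (n : ℕ) : Integrable (lineKer n) := (lineBump n).integrable_normed

lemma lineKer_neg (n : ℕ) (t : ℝ) : lineKer n (-t) = lineKer n t := (lineBump n).normed_neg t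

lemma hasDerivAt_step (n : ℕ) (t : ℝ) : HasDerivAt (step n) (lineKer n t) t :=
  intervalIntegral.integral_hasDerivAt_right (integrable_lineKer n).intervalIntegrable
    (contDiff_lineKer n).continuous.aestronglyMeasurable.stronglyMeasurableAtFilter
    (contDiff_lineKer n).continuous.continuousAt

lemma contDiff_step (n : ℕ) : ContDiff ℝ (⊤ : ℕ∞) (step n) := by
  rw [contDiff_infty_iff_deriv]; refine ⟨fun t => (hasDerivAt_step n t).differentiableAt, ?_⟩
  rw [funext fun t => (hasDerivAt_step n t).deriv]; exact contDiff_lineKer n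

lemma step_mono (n : ℕ) : Monotone (step n) :=
  monotone_of_deriv_nonneg (fun t => (hasDerivAt_step n t).differentiableAt) fun t => by
  rw [(hasDerivAt_step n t).deriv]; exact lineKer_nonneg n t

lemma inv_succ_le_one (n : ℕ) : ϵ[n] ≤ 1 :=
  inv_le_one_of_one_le₀ (by linarith [n.cast_nonneg (α := ℝ)])

lemma step_eq_zero {n : ℕ} {t} (h : t ≤ -ϵ[n]) : step n t = 0 := by
  refine intervalIntegral.integral_zero_ae (.of_forall fun τ hτ => lineKer_eq_zero ?_)
  have h1 := inv_succ_le_one n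
  have : τ ≤ -ϵ[n] := by
    rcases hτ with ⟨-, h2⟩
    exact h2.trans (max_le (by linarith) h)
  exact le_abs.2 (Or.inr (by linarith))

lemma step_eq_one {n : ℕ} {t} (h : ϵ[n] ≤ t) : step n t = 1 := by
  have h1 := inv_succ_le_one n
  have h0 : 0 < ϵ[n] := by positivity
  rw [step, intervalIntegral.integral_eq_integral_of_support_subset, integral_lineKer]; intro τ hτ
  by_contra hcon
  refine hτ (lineKer_eq_zero ?_)
  rw [le_abs]; by_contra hcon2; push Not at hcon2
  exact hcon ⟨by linarith [hcon2.2], by linarith [hcon2.1]⟩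

lemma step_nonneg (n : ℕ) (t : ℝ) : 0 ≤ step n t := by
  rcases le_total t (-ϵ[n]) with h | h
  · rw [step_eq_zero h]
  · rw [← step_eq_zero (n := n) le_rfl]; exact step_mono n h

lemma step_le_one (n : ℕ) (t : ℝ) : step n t ≤ 1 := by
  rcases le_total t (ϵ[n]) with h | h
  · rw [← step_eq_one (n := n) le_rfl]; exact step_mono n h
  · rw [step_eq_one h]

/-- A smooth approximation of the indicator function of `(p, q)`. -/
def ramp (n : ℕ) (p q t : ℝ) : ℝ := step n (t - p) - step n (t - q)

lemma deriv_ramp (n : ℕ) (p q t : ℝ) :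
    deriv (ramp n p q) t = lineKer n (t - p) - lineKer n (t - q) :=
  (((hasDerivAt_step n _).comp_sub_const t _).sub ((hasDerivAt_step n _).comp_sub_const t q)).deriv

lemma ramp_isTimeCut {n : ℕ} {a b p q} (h1 : a < p - ϵ[n]) (hpq : p ≤ q)
    (h2 : q + ϵ[n] < b) : IsTimeCut (Ioo a b) (ramp n p q) := by
  have hsub : tsupport (ramp n p q) ⊆ Icc (p - ϵ[n]) (q + ϵ[n]) := by
    refine closure_minimal (fun t ht => ?_) isClosed_Icc
    by_contra hcon
    refine ht ?_
    rw [mem_Icc, not_and_or, not_le, not_le] at hcon; rcases hcon with h | h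
    · rw [ramp, step_eq_zero (by linarith), step_eq_zero (by linarith), sub_zero]
    · rw [ramp, step_eq_one (by linarith), step_eq_one (by linarith), sub_self]
  refine ⟨?_, isCompact_Icc.of_isClosed_subset (isClosed_tsupport _) hsub,
    hsub.trans fun t ht => ⟨h1.trans_le ht.1, ht.2.trans_lt h2⟩, fun t => ?_, fun t => ?_⟩
  · exact ((contDiff_step n).comp (contDiff_id.sub contDiff_const)).sub
      ((contDiff_step n).comp (contDiff_id.sub contDiff_const))
  · exact sub_nonneg.2 (step_mono n (by linarith))
  · rw [ramp]; linarith [step_le_one n (t - p), step_nonneg n (t - q)]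

lemma tendsto_inv_succ : Tendsto (fun n : ℕ => ϵ[n]) atTop (𝓝 0) := by
  simpa only [one_div] using tendsto_one_div_add_atTop_nhds_zero_nat (𝕜 := ℝ)

lemma eventually_inv_succ_lt {c} (hc : 0 < c) : ∀ᶠ n : ℕ in atTop, 4 * ϵ[n] < c := by
  have h := tendsto_inv_succ.const_mul 4
  rw [mul_zero] at h; exact h.eventually (gt_mem_nhds hc)

lemma tendsto_step {p : ℕ → ℝ} {p₀ t} (hp : Tendsto p atTop (𝓝 p₀)) (ht : t ≠ p₀) :
    Tendsto (fun n => step n (t - p n)) atTop (𝓝 ((Ioi p₀).indicator 𝟙 t)) := by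
  refine tendsto_const_nhds.congr' ?_
  have hd : 0 < |t - p₀| / 2 := half_pos (abs_pos.2 (sub_ne_zero.2 ht))
  filter_upwards [eventually_inv_succ_lt hd, hp.eventually (ball_mem_nhds p₀ hd)]
    with n h1 h2
  have h0 : 0 < ϵ[n] := by positivity
  rw [Real.dist_eq, abs_lt] at h2; rcases lt_or_gt_of_ne ht with h | h
  · rw [abs_of_neg (sub_neg.2 h)] at h1 h2
    rw [indicator_of_notMem (fun hm => absurd (mem_Ioi.1 hm) h.not_gt), step_eq_zero (by linarith)]
  · rw [abs_of_pos (sub_pos.2 h)] at h1 h2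
    rw [indicator_of_mem (mem_Ioi.2 h), step_eq_one (by linarith)]

lemma tendsto_integral_ramp {b} (hb : Integrable b) {p} {p₀ q}
    (hp : Tendsto p atTop (𝓝 p₀)) (hpq : p₀ ≤ q) :
    Tendsto (fun n => ∫ τ, ramp n (p n) q τ * b τ) atTop (𝓝 (∫ τ in Ioc p₀ q, b τ)) := by
  have e : ∫ τ in Ioc p₀ q, b τ = ∫ τ, ((Ioi p₀).indicator (fun _ => (1 : ℝ)) τ -
      (Ioi q).indicator (fun _ => (1 : ℝ)) τ) * b τ := by
    rw [← integral_indicator measurableSet_Ioc]; refine integral_congr' fun τ => ?_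
    simp only [indicator_apply, mem_Ioc, mem_Ioi]; split_ifs <;> grind
  rw [e]
  refine tendsto_integral_of_dominated_convergence (fun τ => ‖b τ‖) (fun n => ?_) hb.norm
    (fun n => .of_forall fun τ => ?_) ?_
  · have hc : Continuous (ramp n (p n) q) := by
      have := (contDiff_step n).continuous
      unfold ramp; fun_prop
    exact hc.aestronglyMeasurable.mul hb.aestronglyMeasurable
  · rw [norm_mul]; refine mul_le_of_le_one_left (norm_nonneg _) ?_; rw [norm_eq_abs, ramp, abs_le]
    constructor <;> linarith [step_nonneg n (τ - q), step_le_one n (τ - q),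
      step_nonneg n (τ - p n), step_le_one n (τ - p n)]
  · have hne : ∀ c, ∀ᵐ τ : ℝ, τ ≠ c := fun c => by simp [ae_iff]
    filter_upwards [hne p₀, hne q] with τ h1 h2
    exact ((tendsto_step hp h1).sub (tendsto_step tendsto_const_nhds h2)).mul_const _

lemma ae_tendsto_integral_lineKer {a} (ha : Integrable a) :
    ∀ᵐ q : ℝ, Tendsto (fun n => ∫ τ, lineKer n (τ - q) * a τ) atTop (𝓝 (a q)) := by
  have h := ContDiffBump.ae_convolution_tendsto_right_of_locallyIntegrable (μ := volume) (K := 2)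
    (φ := lineBump) (by simpa [lineBump] using tendsto_inv_succ) (.of_forall fun n => by
    simp only [lineBump]; linarith [mul_div_cancel₀ (ϵ[n]) (two_ne_zero' ℝ)])
    ha.locallyIntegrable
  filter_upwards [h] with q hq
  refine hq.congr fun n => ?_
  rw [convolution_eq_swap]; refine integral_congr' fun τ => ?_
  simp only [ContinuousLinearMap.lsmul_apply, smul_eq_mul]; rw [← neg_sub τ q]
  exact congrArg (· * a τ) (lineKer_neg n (τ - q))

lemma integrable_lineKer_mul {a} (ha : Integrable a) (n : ℕ) (c : ℝ) :
    Integrable fun τ => lineKer n (τ - c) * a τ := by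
  obtain ⟨B, hB⟩ := (lineBump n).hasCompactSupport_normed (μ := volume)
    |>.exists_bound_of_continuous (contDiff_lineKer n).continuous
  exact ha.bdd_mul (c := B) ((contDiff_lineKer n).continuous.comp
    (continuous_id.sub continuous_const)).aestronglyMeasurable
    (.of_forall fun τ => hB (τ - c))

lemma integral_deriv_ramp_mul {a} (ha : Integrable a) (n : ℕ) (p q : ℝ) :
    ∫ τ, deriv (ramp n p q) τ * a τ =
      (∫ τ, lineKer n (τ - p) * a τ) - ∫ τ, lineKer n (τ - q) * a τ := by
  rw [← integral_sub (integrable_lineKer_mul ha n p) (integrable_lineKer_mul ha n q)]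
  simp only [deriv_ramp, sub_mul]

lemma setIntegral_mul_eq {I} (hI : MeasurableSet I) (η a : ℝ → ℝ) :
    ∫ τ in I, η τ * a τ = ∫ τ, η τ * I.indicator a τ := by
  rw [← integral_indicator hI]; refine integral_congr' fun τ => ?_
  by_cases hτ : τ ∈ I <;> simp [hτ]

/-- An inequality in the sense of distributions in time, with a bound at the initial time, yields
the inequality at almost every time. -/
lemma ae_le_of_timeCut {T'} {a b} (ha : IntegrableOn a (Ioo 0 T'))
    (hb : IntegrableOn b (Ioo 0 T')) {a₀ X}
    (hX : ∀ η, IsTimeCut (Ioo 0 T') η →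
      2 * (∫ τ in Ioo 0 T', η τ * b τ) - ∫ τ in Ioo 0 T', deriv η τ * a τ ≤ X)
    (h0 : ∀ δ, 0 < δ → ∀ᶠ t in 𝓝[>] (0 : ℝ) ⊓ ae volume, a t ≤ a₀ + δ) :
    ∀ᵐ q ∂(𝓛 T'), a q + 2 * ∫ τ in Ioo 0 q, b τ ≤ a₀ + X := by
  set a' : ℝ → ℝ := (Ioo 0 T').indicator a with ha'
  have hai : Integrable a' := (integrable_indicator_iff measurableSet_Ioo).2 ha
  have hbi := (integrable_indicator_iff measurableSet_Ioo).2 hb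
  have hp : Tendsto (fun n : ℕ => 2 * ϵ[n]) atTop (𝓝 0) := by
    simpa using tendsto_inv_succ.const_mul 2
  rw [ae_restrict_iff' measurableSet_Ioo]
  filter_upwards [ae_tendsto_integral_lineKer hai] with q hq hqT
  refine le_of_forall_pos_le_add fun δ hδ => ?_
  rw [ha', indicator_of_mem hqT] at hq; have hblim := tendsto_integral_ramp hbi hp hqT.1.le
  have hstart : ∀ᶠ n : ℕ in atTop, ∫ τ, lineKer n (τ - 2 * ϵ[n]) * a' τ ≤ a₀ + δ := by
    obtain ⟨h, hh, hae⟩ : ∃ h, 0 < h ∧ ∀ᵐ t : ℝ, t ∈ Ioo 0 h → a t ≤ a₀ + δ := by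
      have h1 := h0 δ hδ
      rw [Filter.eventually_inf] at h1; obtain ⟨S, hS, S', hS', hSS⟩ := h1
      obtain ⟨h, hh, hsub⟩ := mem_nhdsGT_iff_exists_Ioo_subset.1 hS
      refine ⟨h, hh, ?_⟩
      filter_upwards [hS'] with t ht ht'
      exact hSS t ⟨hsub ht', ht⟩
    filter_upwards [eventually_inv_succ_lt hh, eventually_inv_succ_lt (hqT.1.trans hqT.2)]
      with n hn hnT
    have hr : 0 < ϵ[n] := by positivity
    have hi : Integrable fun τ => lineKer n (τ - 2 * ϵ[n]) :=
      (integrable_lineKer n).comp_sub_right _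
    calc _ ≤ ∫ τ, lineKer n (τ - 2 * ϵ[n]) * (a₀ + δ) := by
          refine integral_mono_ae (integrable_lineKer_mul hai n _) (hi.mul_const _) ?_
          filter_upwards [hae] with τ hτ
          by_cases hc : ϵ[n] ≤ |τ - 2 * ϵ[n]|
          · simp only [lineKer_eq_zero hc, zero_mul, le_refl]
          · rw [not_le, abs_lt] at hc; refine mul_le_mul_of_nonneg_left ?_ (lineKer_nonneg n _)
            rw [ha', indicator_of_mem (show τ ∈ Ioo 0 T' from
              ⟨by linarith [hc.1], by linarith [hc.2]⟩)]
            exact hτ ⟨by linarith [hc.1], by linarith [hc.2]⟩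
      _ = a₀ + δ := by
          rw [integral_mul_const, integral_sub_right_eq_self (lineKer n), integral_lineKer, one_mul]
  have hev : ∀ᶠ n : ℕ in atTop, (∫ τ, lineKer n (τ - q) * a' τ) +
      2 * (∫ τ, ramp n (2 * ϵ[n]) q τ * (Ioo 0 T').indicator b τ) ≤ a₀ + X + δ := by
    filter_upwards [hstart, eventually_inv_succ_lt hqT.1,
      eventually_inv_succ_lt (sub_pos.2 hqT.2)] with n h1 h2 h3
    have hr : 0 < ϵ[n] := by positivity
    have h4 := hX _ (ramp_isTimeCut (n := n) (p := 2 * ϵ[n]) (q := q) (by linarith)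
      (by linarith) (by linarith))
    rw [setIntegral_mul_eq measurableSet_Ioo, setIntegral_mul_eq measurableSet_Ioo,
      integral_deriv_ramp_mul hai] at h4
    linarith
  have h5 := le_of_tendsto (hq.add (hblim.const_mul 2)) hev
  rwa [setIntegral_indicator measurableSet_Ioo, inter_comm, Ioo_inter_Ioc_of_right_lt hqT.2,
    max_self, integral_Ioc_eq_integral_Ioo] at h5

/-- If the distributional derivative in time of `U` is an integrable function, then `U` has a
continuous representative. -/
lemma exists_continuous_of_timeCut {a b} (hab : a < b) {U F}
    (hU : IntegrableOn U (Ioo a b)) (hF : IntegrableOn F (Ioo a b))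
    (h : ∀ η, IsTimeCut (Ioo a b) η →
      (∫ t in Ioo a b, deriv η t * U t) + ∫ t in Ioo a b, η t * F t = 0) :
    ∃ W, Continuous W ∧ ∀ᵐ t ∂(volume.restrict (Ioo a b)), U t = W t := by
  have hUi := (integrable_indicator_iff measurableSet_Ioo).2 hU
  have hFi := (integrable_indicator_iff measurableSet_Ioo).2 hF
  have key : ∀ p q, p ∈ Ioo a b → q ∈ Ioo a b → p ≤ q →
      Tendsto (fun n => ∫ τ, lineKer n (τ - p) * (Ioo a b).indicator U τ) atTop (𝓝 (U p)) →
      Tendsto (fun n => ∫ τ, lineKer n (τ - q) * (Ioo a b).indicator U τ) atTop (𝓝 (U q)) →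
      U q = U p + ∫ τ in p..q, (Ioo a b).indicator F τ := by
    intro p q hp hq hpq h1 h2
    have h3 := (h1.sub h2).add (tendsto_integral_ramp hFi (tendsto_const_nhds (x := p)) hpq)
    have h4 : U p - U q + ∫ τ in Ioc p q, (Ioo a b).indicator F τ = 0 := by
      refine tendsto_nhds_unique h3 (tendsto_const_nhds.congr' ?_)
      filter_upwards [eventually_inv_succ_lt (sub_pos.2 hp.1),
        eventually_inv_succ_lt (sub_pos.2 hq.2)] with n hn1 hn2
      have hr : 0 < ϵ[n] := by positivity
      have h5 := h _ (ramp_isTimeCut (n := n) (by linarith) hpq (by linarith))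
      rw [setIntegral_mul_eq measurableSet_Ioo, setIntegral_mul_eq measurableSet_Ioo,
        integral_deriv_ramp_mul hUi] at h5
      exact h5.symm
    rw [intervalIntegral.integral_of_le hpq]; linarith
  have hgood : ∀ᵐ q ∂(volume.restrict (Ioo a b)), q ∈ Ioo a b ∧
      Tendsto (fun n => ∫ τ, lineKer n (τ - q) * (Ioo a b).indicator U τ) atTop (𝓝 (U q)) := by
    rw [ae_restrict_iff' measurableSet_Ioo]
    filter_upwards [ae_tendsto_integral_lineKer hUi] with q hq hq'
    exact ⟨hq', by rwa [indicator_of_mem hq'] at hq⟩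
  have : (ae (volume.restrict (Ioo a b))).NeBot := by
    rw [ae_neBot, Ne, Measure.restrict_eq_zero, Real.volume_Ioo, ofReal_eq_zero, not_le]
    exact sub_pos.2 hab
  obtain ⟨p, hp, hpl⟩ := hgood.exists
  refine ⟨fun t => U p + ∫ τ in p..t, (Ioo a b).indicator F τ,
    continuous_const.add (intervalIntegral.continuous_primitive
      (fun _ _ => hFi.intervalIntegrable) p), ?_⟩
  filter_upwards [hgood] with q ⟨hq, hql⟩
  rcases le_total p q with hpq | hpq
  · exact key p q hp hq hpq hpl hql
  · rw [intervalIntegral.integral_symm, key q p hq hp hpq hql hpl]; ring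

/-! ### The weighted energy estimate -/

section LocalEnergy

variable {ρ κ : ℝ} {o : E3} {χ : E3 → ℝ}

lemma setLIntegral_sqd_le (hρ : 0 < ρ) (χ : E3 → ℝ) (f : E3 → E3) (o : E3) :
    ∫⁻ x in ball o ρ, sqd χ f x ≤ ∫⁻ x, ofReal (lwt ρ o χ x) * ‖f x‖ₑ ^ 2 := by
  rw [← lintegral_indicator measurableSet_ball]; refine lintegral_mono fun x => ?_
  by_cases hx : x ∈ ball o ρ
  · rw [indicator_of_mem hx, lwt, bumpAt_eq_one hρ (le_of_lt hx), one_mul, sqd, mul_pow]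
    refine mul_le_mul' ?_ le_rfl
    rcases le_total 0 (χ x) with h | h
    · rw [ofReal_pow h]
    · rw [ENNReal.ofReal_of_nonpos h]; simp
  · rw [indicator_of_notMem hx]; exact zero_le

lemma lintegral_lwt_le (hρ : 0 < ρ) (hχ : IsMult κ χ) (f : E3 → E3) (o : E3) :
    ∫⁻ x, ofReal (lwt ρ o χ x) * ‖f x‖ₑ ^ 2 ≤ ∫⁻ x in ball o (2 * ρ), sqd χ f x := by
  refine (lintegral_le_mul_of_support measurableSet_ball ENNReal.one_ne_top (fun x _ => ?_)
    (fun x hx => ?_) le_rfl).trans_eq (one_mul _)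
  · rw [one_mul, sqd, mul_pow, ← ofReal_pow (hχ.nonneg x)]
    exact mulR (ofReal_le_ofReal (lwt_le hχ x))
  · simp [lwt_eq_zero hρ (not_lt.1 hx)]

lemma sqd_le_sqd_one (hχ : IsMult κ χ) (f : E3 → E3) (x : E3) : sqd χ f x ≤ sqd 𝟙 f x := by
  simp only [sqd]; gcongr; exact hχ.le_one x

/-- The weighted local energy as a real-valued function of time. -/
lemma integrableOn_local_energy (hρ : 0 < ρ) (hχ : IsMult κ χ) (o : E3) {T'}
    {f : ℝ → E3 → E3} (hf : Measurable (uncurry f))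
    (hfin : 𝓤[T', 2 * ρ, 𝟙, f] < ⊤) :
    IntegrableOn (fun τ => ∫ x, lwt ρ o χ x * ‖f τ x‖ ^ 2) (Ioo 0 T') ∧
    (∀ᵐ τ ∂(𝓛 T'), ofReal (∫ x, lwt ρ o χ x * ‖f τ x‖ ^ 2) =
      ∫⁻ x, ofReal (lwt ρ o χ x) * ‖f τ x‖ₑ ^ 2) ∧
    ∀ q ≤ T', ofReal (∫ τ in Ioo 0 q, ∫ x, lwt ρ o χ x * ‖f τ x‖ ^ 2) =
      ∫⁻ τ in Ioo 0 q, ∫⁻ x, ofReal (lwt ρ o χ x) * ‖f τ x‖ₑ ^ 2 := by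
  have hw : Measurable (lwt ρ o χ) := (lwt_isTest hρ hχ).continuous.measurable
  have hm : Measurable fun p : ℝ × E3 => lwt ρ o χ p.2 * ‖f p.1 p.2‖ ^ 2 :=
    (hw.comp measurable_snd).mul (hf.norm.pow_const 2)
  have he : ∀ τ x, ofReal (lwt ρ o χ x * ‖f τ x‖ ^ 2) =
      ofReal (lwt ρ o χ x) * ‖f τ x‖ₑ ^ 2 := fun τ x => by
    rw [ofReal_mul (lwt_nonneg x), ofReal_pow (norm_nonneg _), ofReal_norm]
  have hnn : ∀ τ x, 0 ≤ lwt ρ o χ x * ‖f τ x‖ ^ 2 := fun τ x =>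
    mul_nonneg (lwt_nonneg x) (sq_nonneg _)
  have hi : Integrable (fun p : ℝ × E3 => lwt ρ o χ p.2 * ‖f p.1 p.2‖ ^ 2)
      ((𝓛 T').prod volume) := by
    refine ⟨hm.aestronglyMeasurable, ?_⟩
    unfold HasFiniteIntegral; rw [lintegral_prod _ hm.enorm.aemeasurable]
    refine lt_of_le_of_lt ?_ hfin
    refine le_trans (lintegral_mono fun τ => ?_) (le_ulocSup _ _ _ o)
    calc _ = ∫⁻ x, ofReal (lwt ρ o χ x) * ‖f τ x‖ₑ ^ 2 :=
      lintegral_congr fun x => by rw [enorm_of_nonneg (hnn τ x), he]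
      _ ≤ _ := (lintegral_lwt_le hρ hχ _ o).trans (lintegral_mono fun x => sqd_le_sqd_one hχ _ x)
  refine ⟨hi.integral_prod_left, ?_, fun q hq => ?_⟩
  · filter_upwards [hi.prod_right_ae] with τ hτ
    rw [ofReal_integral_eq_lintegral_ofReal hτ (.of_forall (hnn τ))]
    exact lintegral_congr fun x => he τ x
  · have hiq : Integrable (fun p : ℝ × E3 => lwt ρ o χ p.2 * ‖f p.1 p.2‖ ^ 2) ((𝓛 q).prod volume) :=
      hi.mono_measure (Measure.prod_mono (Measure.restrict_mono (Ioo_subset_Ioo_right hq) le_rfl)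
        le_rfl)
    rw [← integral_prod _ hiq, ofReal_integral_eq_lintegral_ofReal hiq
      (.of_forall fun p => hnn p.1 p.2),
      lintegral_prod _ hm.ennreal_ofReal.aemeasurable]
    exact lintegral_congr fun τ => lintegral_congr fun x => he τ x

end LocalEnergy

lemma LerayData.mono {s T'} {M} {u g} {P}
    (D : LerayData s T' M u g P) {t₀} (h : t₀ ≤ T') : LerayData s t₀ M u g P where
  meas_u := D.meas_u
  meas_g := D.meas_g
  uloc := D.uloc
  wint_u := D.wint_u
  wint_g := D.wint_g
  fracLap := D.fracLap
  g_fin := (iSup_mono fun _ => lintegral_mono_set (Ioo_subset_Ioo_right h)).trans_lt D.g_fin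
  div_free θ hθ := D.div_free θ
    ⟨hθ.1, hθ.2.1, hθ.2.2.trans (prod_mono_left (Ioo_subset_Ioo_right h))⟩
  memP K hK hsub := D.memP K hK (hsub.trans (prod_mono_left (Ioo_subset_Ioo_right h)))
  pressure θ hθ := D.pressure θ
    ⟨hθ.1, hθ.2.1, hθ.2.2.trans (prod_mono_left (Ioo_subset_Ioo_right h))⟩
  energy ψ ψ' h1 h2 h3 h4 h5 := by
    obtain ⟨c₁, c₂, hc₁, hc₂, he⟩ := D.energy ψ ψ'
      ⟨h1.1, h1.2.1, h1.2.2.trans (prod_mono_left (Ioo_subset_Ioo_right h))⟩ h2 h3 h4 h5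
    exact ⟨c₁, c₂, ae_restrict_of_ae_restrict_of_subset (Ioo_subset_Ioo_right h) hc₁,
      ae_restrict_of_ae_restrict_of_subset (Ioo_subset_Ioo_right h) hc₂,
      fun t ht htt => he t ht (htt.trans h)⟩

lemma ennreal_absorb {x y : ℝ≥0∞} (hx : x ≠ ⊤) (h : 2 * x ≤ y + x) : x ≤ y := by
  rw [two_mul] at h; exact (ENNReal.add_le_add_iff_right hx).1 h

/-- The local energy at almost every time, and the local enstrophy, on each subinterval. -/
lemma exists_energy_step {s} (hs : s ∈ Ico (3 / 4) 1) (K₀ : ℝ) (M : ℝ≥0) : ∃ ρ, 1 ≤ ρ ∧ ∃ C, C ≠ ⊤ ∧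
    ∀ T' u g P, LerayData s T' M u g P →
    0 < T' → ∀ κ χ, IsMult κ χ → κ ≤ K₀ → ∀ (a₀ : ℝ≥0),
      (∀ o δ, 0 < δ → ∀ᶠ t in 𝓝[>] (0 : ℝ) ⊓ ae volume,
        ∫ x, lwt ρ o χ x * ‖u t x‖ ^ 2 ≤ a₀ + δ) → ∀ A B G V,
      A = 𝓤[T', ρ, χ, u] →
      B = 𝓤[T', ρ, χ, g] →
      G = 𝓤[T', ρ, 𝟙, g] →
      V = 𝓤[T', ρ, 𝟙, u] →
      B ≤ a₀ + C * (A + ofReal κ * (G + V)) ∧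
      ∀ o, ∀ᵐ q ∂(𝓛 T'), ∫⁻ x, ofReal (lwt ρ o χ x) * ‖u q x‖ₑ ^ 2 ≤
          2 * (a₀ + C * (A + ofReal κ * (G + V))) := by
  obtain ⟨ρ, hρ, C, hC, hen⟩ := exists_energy_le hs K₀ M
  refine ⟨ρ, hρ, C, hC, fun T' u g P D hT' κ χ hχ hκ a₀ hinit A B G V hA hB hG hV => ?_⟩
  have hρ0 : 0 < ρ := by linarith
  set Y : ℝ≥0∞ := C * (A + ofReal κ * (G + V)) with hY
  have hGt : G ≠ ⊤ := by rw [hG]; exact (D.ulocSup_g_lt_top ρ).ne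
  have hVt : V ≠ ⊤ := by rw [hV]; exact (D.ulocSup_u_lt_top ρ).ne
  have hAt : A ≠ ⊤ := by
    rw [hA]
    exact ((ulocSup_mono fun τ x => sqd_le_sqd_one hχ _ x).trans_lt (D.ulocSup_u_lt_top ρ)).ne
  have hBt : B ≠ ⊤ := by
    rw [hB]
    exact ((ulocSup_mono fun τ x => sqd_le_sqd_one hχ _ x).trans_lt (D.ulocSup_g_lt_top ρ)).ne
  have hYt : Y ≠ ⊤ := by finiteness
  have hX : B + Y ≠ ⊤ := by finiteness
  have hsplit : ofReal (a₀ + (B + Y).toReal) = a₀ + (B + Y) := by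
    rw [ofReal_add (NNReal.coe_nonneg a₀) ENNReal.toReal_nonneg, ofReal_toReal hX,
      ofReal_coe_nnreal]
  have key : ∀ o, ∀ᵐ q ∂(𝓛 T'),
      (∫ x, lwt ρ o χ x * ‖u q x‖ ^ 2) + 2 * ∫ τ in Ioo 0 q, ∫ x, lwt ρ o χ x * ‖g τ x‖ ^ 2 ≤
        a₀ + (B + Y).toReal := fun o => by
    refine ae_le_of_timeCut (a := fun q => ∫ x, lwt ρ o χ x * ‖u q x‖ ^ 2)
      (b := fun q => ∫ x, lwt ρ o χ x * ‖g q x‖ ^ 2)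
      (integrableOn_local_energy hρ0 hχ o D.meas_u (D.ulocSup_u_lt_top _)).1
      (integrableOn_local_energy hρ0 hχ o D.meas_g (D.ulocSup_g_lt_top _)).1
      (fun η hη => ?_) (hinit o)
    have h := hen T' u g P D hT' κ χ hχ hκ o η hη A B G V hA hB hG hV
    exact (ENNReal.ofReal_le_iff_le_toReal hX).1 h
  have hnn : ∀ (f : E3 → E3) o, 0 ≤ ∫ x, lwt ρ o χ x * ‖f x‖ ^ 2 := fun f o =>
    integral_nonneg fun x => mul_nonneg (lwt_nonneg x) (sq_nonneg _)
  have hB2 : B ≤ a₀ + Y := by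
    refine ennreal_absorb hBt ?_
    have hU : Ioo 0 T' = ⋃ n : ℕ, Ioo 0 (T' - T' * ϵ[n]) := by
      refine Subset.antisymm (fun τ hτ => ?_) (iUnion_subset fun n => Ioo_subset_Ioo_right
        (sub_le_self _ (by positivity)))
      have h1 : Tendsto (fun n : ℕ => T' - T' * ϵ[n]) atTop (𝓝 T') := by
        simpa using tendsto_const_nhds.sub (tendsto_inv_succ.const_mul T')
      obtain ⟨n, hn⟩ := (h1.eventually (lt_mem_nhds hτ.2)).exists
      exact mem_iUnion.2 ⟨n, hτ.1, hn⟩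
    have hd : Monotone fun n : ℕ => Ioo 0 (T' - T' * ϵ[n]) := fun m n h =>
      Ioo_subset_Ioo_right (by gcongr)
    have hx : ∀ o, 2 * ∫⁻ τ in Ioo 0 T', (∫⁻ x in ball o ρ, sqd χ (g τ) x) ≤
        a₀ + (B + Y) := fun o => by
      rw [hU, setLIntegral_iUnion_of_directed _ hd.directed_le, ENNReal.mul_iSup]
      refine iSup_le fun n => ?_
      have hr : 0 < T' * ϵ[n] := by positivity
      have hr1 : T' * ϵ[n] ≤ T' := mul_le_of_le_one_right hT'.le (inv_succ_le_one n)
      have hae := ae_restrict_of_ae_restrict_of_subset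
        (Ioo_subset_Ioo_left (by linarith : 0 ≤ T' - T' * ϵ[n])) (key o)
      have hne : (ae (volume.restrict (Ioo (T' - T' * ϵ[n]) T'))).NeBot := by
        rw [ae_neBot, Ne, Measure.restrict_eq_zero, Real.volume_Ioo, ofReal_eq_zero, not_le]
        linarith
      obtain ⟨q, hq1, hq2⟩ := (hae.and (ae_restrict_mem measurableSet_Ioo)).exists
      calc _ ≤ 2 * ∫⁻ τ in Ioo 0 q, ∫⁻ x, ofReal (lwt ρ o χ x) * ‖g τ x‖ₑ ^ 2 :=
            mulL ((lintegral_mono_set (Ioo_subset_Ioo_right hq2.1.le)).trans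
              (lintegral_mono fun τ => setLIntegral_sqd_le hρ0 χ (g τ) o))
        _ = ofReal (2 * ∫ τ in Ioo 0 q, ∫ x, lwt ρ o χ x * ‖g τ x‖ ^ 2) := by
            rw [ofReal_mul zero_le_two, (integrableOn_local_energy hρ0 hχ o D.meas_g
              (D.ulocSup_g_lt_top _)).2.2 q hq2.2.le]
            norm_num
        _ ≤ ofReal (a₀ + (B + Y).toReal) := ofReal_le_ofReal (by linarith [hnn (u q) o])
        _ = _ := hsplit
    calc 2 * B ≤ a₀ + (B + Y) := by
          rw [hB, ulocSup, ENNReal.mul_iSup]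
          exact iSup_le fun x => (hx x).trans (le_of_eq (by rw [hB]; rfl))
      _ = _ := by ring
  refine ⟨hB2, fun o => ?_⟩
  filter_upwards [key o, (integrableOn_local_energy hρ0 hχ o D.meas_u
    (D.ulocSup_u_lt_top _)).2.1] with q hq1 hq2
  rw [← hq2]
  have h0 : 0 ≤ ∫ τ in Ioo 0 q, ∫ x, lwt ρ o χ x * ‖g τ x‖ ^ 2 := integral_nonneg fun τ => hnn _ o
  calc _ ≤ ofReal (a₀ + (B + Y).toReal) := ofReal_le_ofReal (by linarith)
    _ = a₀ + (B + Y) := hsplit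
    _ ≤ a₀ + ((a₀ + Y) + Y) := by gcongr
    _ = _ := by ring

/-- The weighted local energy estimate. The local energy on `(0, T')` is bounded by iterating the
estimate over finitely many short time intervals, on each of which it is absorbed. -/
lemma exists_energy_bound {s} (hs : s ∈ Ico (3 / 4) 1) (K₀ : ℝ) (M : ℝ≥0) {T'}
    (hT' : 0 < T') : ∃ ρ, 1 ≤ ρ ∧ ∃ C, C ≠ ⊤ ∧
    ∀ u g P, LerayData s T' M u g P →
    ∀ κ χ, IsMult κ χ → κ ≤ K₀ → ∀ (a₀ : ℝ≥0), (∀ o δ, 0 < δ → ∀ᶠ t in 𝓝[>] (0 : ℝ) ⊓ ae volume,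
        ∫ x, lwt ρ o χ x * ‖u t x‖ ^ 2 ≤ a₀ + δ) → ∀ E,
      E = ofReal κ * (𝓤[T', ρ, 𝟙, g] + 𝓤[T', ρ, 𝟙, u]) →
      𝓤[T', ρ, χ, g] ≤ C * (a₀ + E) ∧
      ∀ o, ∀ᵐ q ∂(𝓛 T'), ∫⁻ x, ofReal (lwt ρ o χ x) * ‖u q x‖ₑ ^ 2 ≤ C * (a₀ + E) := by
  obtain ⟨ρ, hρ, C, hC, hst⟩ := exists_energy_step hs K₀ M
  -- steps of length `T' / n` are short enough for the energy on one step to be absorbed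
  obtain ⟨n, hn0, hn⟩ : ∃ n : ℕ, 0 < n ∧ ofReal (T' / n) * (2 * C) ≤ 2⁻¹ := by
    obtain ⟨n, hn⟩ := exists_nat_gt (4 * T' * C.toReal)
    have hpos : (0 : ℝ) < (n + 1 : ℕ) := by positivity
    refine ⟨n + 1, n.succ_pos, ?_⟩
    have e1 : (2⁻¹ : ℝ≥0∞) = ofReal 2⁻¹ := by rw [ofReal_inv_of_pos two_pos]; norm_num
    have e2 : 2 * C = ofReal (2 * C.toReal) := by
      rw [ofReal_mul zero_le_two, ofReal_toReal hC]; norm_num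
    rw [e1, e2, ← ofReal_mul (by positivity)]; refine ofReal_le_ofReal ?_
    rw [div_mul_eq_mul_div, div_le_iff₀ hpos]; push_cast; linarith
  set h : ℝ := T' / n with hh
  have hh0 : 0 < h := div_pos hT' (by exact_mod_cast hn0)
  set Q : ℝ≥0∞ := ofReal h * (2 * (1 + C)) with hQ
  refine ⟨ρ, hρ, 2 * (1 + C * (2 ^ (n + 1) * Q + 1)), by finiteness,
    fun u g P D κ χ hχ hκ a₀ hinit E hE => ?_⟩
  have hρ0 : 0 < ρ := by linarith
  have hχm := hχ.measurable
  let A : ℝ → ℝ≥0∞ := fun t => 𝓤[t, ρ, χ, u]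
  have hAt : ∀ t ≤ T', A t ≠ ⊤ := fun t ht =>
    ((ulocSup_mono fun τ x => sqd_le_sqd_one hχ _ x).trans_lt ((D.mono ht).ulocSup_u_lt_top ρ)).ne
  have hgood : ∀ t, 0 < t → t ≤ T' → ∀ o, ∀ᵐ q ∂(𝓛 t),
      ∫⁻ x, ofReal (lwt ρ o χ x) * ‖u q x‖ₑ ^ 2 ≤ 2 * (a₀ + C * (A t + E)) := by
    intro t ht0 ht o
    filter_upwards [(hst t u g P (D.mono ht) ht0 κ χ hχ hκ a₀ hinit _ _ _ _ rfl rfl rfl rfl).2 o]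
      with q hq
    refine hq.trans ?_
    rw [hE]; gcongr 2 * (_ + C * (_ + _ * (?_ + ?_)))
    · exact iSup_mono fun _ => lintegral_mono_set (Ioo_subset_Ioo_right ht)
    · exact iSup_mono fun _ => lintegral_mono_set (Ioo_subset_Ioo_right ht)
  have hiter : ∀ k, k ≤ n → A (k * h) + 2 * (Q * (a₀ + E)) ≤ 2 ^ (k + 1) * (Q * (a₀ + E)) := by
    intro k; induction k with
    | zero =>
      intro _; have : A ((0 : ℕ) * h) = 0 := by simp [A, ulocSup]
      rw [this]; simp
    | succ k ih =>
      intro hk; have ih := ih (by omega)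
      have hkn : ((k + 1 : ℕ) : ℝ) * h ≤ T' := by
        rw [hh, mul_div_assoc', div_le_iff₀ (by exact_mod_cast hn0), mul_comm]
        exact mul_le_mul_of_nonneg_left (by exact_mod_cast hk) hT'.le
      have hk0 : 0 ≤ (k : ℝ) * h := by positivity
      have hk1 : ((k + 1 : ℕ) : ℝ) * h = k * h + h := by push_cast; ring
      have hpos : 0 < ((k + 1 : ℕ) : ℝ) * h := by rw [hk1]; linarith
      have hrec : A ((k + 1 : ℕ) * h) ≤ A (k * h) +
          ofReal h * (2 * (a₀ + C * (A ((k + 1 : ℕ) * h) + E))) := by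
        refine iSup_le fun o => ?_
        have hsub : Ioo 0 (((k + 1 : ℕ) : ℝ) * h) ⊆
            Ioo 0 (k * h) ∪ Ico (k * h) (((k + 1 : ℕ) : ℝ) * h) := fun τ hτ => by
          rcases lt_or_ge τ (k * h) with h1 | h1
          · exact Or.inl ⟨hτ.1, h1⟩
          · exact Or.inr ⟨h1, hτ.2⟩
        refine (lintegral_mono_set hsub).trans ((lintegral_union_le _ _ _).trans
          (add_le_add (le_ulocSup _ ρ _ o) ?_))
        have hae : ∀ᵐ q ∂(volume.restrict (Ico (k * h) (((k + 1 : ℕ) : ℝ) * h))),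
            ∫⁻ x in ball o ρ, sqd χ (u q) x ≤ 2 * (a₀ + C * (A ((k + 1 : ℕ) * h) + E)) := by
          have h1 := hgood _ hpos hkn o
          rw [Measure.restrict_congr_set Ioo_ae_eq_Ico] at h1
          exact (ae_restrict_of_ae_restrict_of_subset (Ico_subset_Ico_left hk0) h1).mono
            fun q hq => (setLIntegral_sqd_le hρ0 χ (u q) o).trans hq
        refine (lintegral_mono_ae hae).trans (le_of_eq ?_)
        rw [lintegral_const, Measure.restrict_apply_univ, Real.volume_Ico, hk1, add_sub_cancel_left,
          mul_comm]
      have habs : A ((k + 1 : ℕ) * h) ≤ 2 * A (k * h) + 2 * (Q * (a₀ + E)) := by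
        refine ennreal_absorb (hAt _ hkn) ?_
        calc 2 * A ((k + 1 : ℕ) * h) ≤ 2 * (A (k * h) +
              ofReal h * (2 * (a₀ + C * (A ((k + 1 : ℕ) * h) + E)))) :=
              mulL hrec
          _ = 2 * (A (k * h) + ofReal h * (2 * (a₀ + C * E))) +
              2 * (ofReal h * (2 * C) * A ((k + 1 : ℕ) * h)) := by ring
          _ ≤ 2 * (A (k * h) + ofReal h * (2 * ((1 + C) * (a₀ + E)))) +
              2 * (2⁻¹ * A ((k + 1 : ℕ) * h)) := by
              have e1 : a₀ + C * E ≤ (1 + C) * (a₀ + E) := by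
                calc (a₀ : ℝ≥0∞) + C * E ≤ (a₀ + C * E) + (E + C * a₀) := le_self_add
                  _ = _ := by ring
              gcongr
          _ = _ := by
              rw [← mul_assoc 2 2⁻¹, ENNReal.mul_inv_cancel two_ne_zero ENNReal.ofNat_ne_top, one_mul, hQ]
              ring
      calc A ((k + 1 : ℕ) * h) + 2 * (Q * (a₀ + E)) ≤
            (2 * A (k * h) + 2 * (Q * (a₀ + E))) + 2 * (Q * (a₀ + E)) := add_le_add habs le_rfl
        _ = 2 * (A (k * h) + 2 * (Q * (a₀ + E))) := by ring
        _ ≤ 2 * (2 ^ (k + 1) * (Q * (a₀ + E))) := mulL ih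
        _ = _ := by ring
  have hAT : A T' ≤ 2 ^ (n + 1) * (Q * (a₀ + E)) := by
    have h1 := hiter n le_rfl
    rw [hh, mul_div_cancel₀ T' (by exact_mod_cast hn0.ne')] at h1; exact le_self_add.trans h1
  have hfin : a₀ + C * (A T' + E) ≤ (1 + C * (2 ^ (n + 1) * Q + 1)) * (a₀ + E) := by
    calc a₀ + C * (A T' + E) ≤ (a₀ + E) + C * (2 ^ (n + 1) * (Q * (a₀ + E)) + (a₀ + E)) := by
          gcongr
          · exact le_self_add
          · exact le_add_self
      _ = _ := by ring
  constructor
  · refine ((hst T' u g P D hT' κ χ hχ hκ a₀ hinit _ _ _ _ rfl rfl rfl rfl).1).trans ?_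
    rw [← hE, mul_assoc 2]; exact hfin.trans (le_mul_of_one_le_left zero_le one_le_two)
  · intro o; filter_upwards [hgood T' hT' le_rfl o] with q hq
    rw [mul_assoc 2]; exact hq.trans (mulL hfin)

/-! ### Weakly continuous representatives -/

section WeakLimit

variable {H : Type*} [NormedAddCommGroup H] [InnerProductSpace ℝ H]

instance neBot_nhds_inf_ae (t : ℝ) : (𝓝 t ⊓ ae (volume : Measure ℝ)).NeBot := by
  refine neBot_iff.2 fun h => ?_
  obtain ⟨U, hU, V, hV, hd⟩ := Filter.inf_eq_bot_iff.1 h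
  obtain ⟨W, hWU, hW, ht⟩ := mem_nhds_iff.1 hU
  refine (hW.measure_pos volume ⟨t, ht⟩).ne' (measure_mono_null (t := Vᶜ) (fun x hx hxV => ?_) hV)
  exact (hd.subset ⟨hWU hx, hxV⟩ : x ∈ (∅ : Set ℝ))

lemma eventually_nhds_inf_ae {t} {U} {p : ℝ → Prop} (hU : IsOpen U) (ht : t ∈ U)
    (h : ∀ᵐ τ, τ ∈ U → p τ) : ∀ᶠ τ in 𝓝 t ⊓ ae volume, p τ := by
  filter_upwards [mem_inf_of_left (hU.mem_nhds ht), mem_inf_of_right h] with τ h1 h2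
  exact h2 h1

/-- Closed balls of a Hilbert space are weakly compact. -/
lemma exists_weak_limit [CompleteSpace H] {ι : Type*} (𝒰 : Ultrafilter ι) {f : ι → H} {B}
    (hf : ∀ᶠ i in (𝒰 : Filter ι), ‖f i‖ ≤ B) :
    ∃ v, ∀ φ, Tendsto (fun i => ⟪f i, φ⟫) 𝒰 (𝓝 ⟪v, φ⟫) := by
  let F : ι → WeakDual ℝ H := fun i => StrongDual.toWeakDual (InnerProductSpace.toDual ℝ H (f i))
  have hF : ∀ᶠ i in (𝒰 : Filter ι), F i ∈
      WeakDual.toStrongDual ⁻¹' closedBall (0 : StrongDual ℝ H) B := by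
    filter_upwards [hf] with i hi
    simpa [F] using hi
  obtain ⟨x, -, hx⟩ := (WeakDual.isCompact_closedBall (0 : StrongDual ℝ H) B).ultrafilter_le_nhds
    (𝒰.map F) (le_principal_iff.2 hF)
  refine ⟨(InnerProductSpace.toDual ℝ H).symm (WeakDual.toStrongDual x), fun φ => ?_⟩
  rw [InnerProductSpace.toDual_symm_apply]; exact ((WeakDual.eval_continuous φ).tendsto x).comp hx

/-- A locally bounded curve in a Hilbert space whose pairings with the elements of a total set
have continuous representatives has a weakly continuous representative, the values of which are
weak limits along sets of full measure. -/
lemma exists_weaklyContinuous [CompleteSpace H] [SecondCountableTopology H] {I}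
    {f : ℝ → H} {D} (hD : (Submodule.span ℝ D).topologicalClosure = ⊤)
    (hb : ∀ t ∈ I, ∃ B, ∃ U, IsOpen U ∧ t ∈ U ∧ ∀ᵐ τ, τ ∈ U → ‖f τ‖ ≤ B)
    (hW : ∀ φ ∈ D, ∀ t ∈ I, ∃ U, IsOpen U ∧ t ∈ U ∧ ∃ W, Continuous W ∧
      ∀ᵐ τ, τ ∈ U → ⟪f τ, φ⟫ = W τ) :
    ∃ V : ℝ → H, (∀ φ, ContinuousOn (fun t => ⟪V t, φ⟫) I) ∧ (∀ᵐ t, t ∈ I → V t = f t) ∧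
      ∀ t ∈ I, ∃ 𝒰 : Ultrafilter ℝ, (𝒰 : Filter ℝ) ≤ 𝓝 t ⊓ ae volume ∧
        ∀ φ, Tendsto (fun τ => ⟪f τ, φ⟫) 𝒰 (𝓝 ⟪V t, φ⟫) := by
  have hex : ∀ t, ∃ v, t ∈ I → ∃ 𝒰 : Ultrafilter ℝ, (𝒰 : Filter ℝ) ≤ 𝓝 t ⊓ ae volume ∧
      ∀ φ, Tendsto (fun τ => ⟪f τ, φ⟫) 𝒰 (𝓝 ⟪v, φ⟫) := fun t => by
    by_cases ht : t ∈ I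
    · obtain ⟨B, U, hU, htU, hB⟩ := hb t ht
      obtain ⟨v, hv⟩ := exists_weak_limit (Ultrafilter.of (𝓝 t ⊓ ae volume))
        (Ultrafilter.of_le _ (eventually_nhds_inf_ae hU htU hB))
      exact ⟨v, fun _ => ⟨_, Ultrafilter.of_le _, hv⟩⟩
    · exact ⟨0, fun h => absurd h ht⟩
  choose V hV using hex
  have hVB : ∀ t ∈ I, ∃ B, ∀ᶠ τ in 𝓝[I] t, ‖V τ‖ ≤ B := fun t ht => by
    obtain ⟨B, U, hU, htU, hB⟩ := hb t ht
    refine ⟨B, ?_⟩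
    filter_upwards [mem_nhdsWithin_of_mem_nhds (hU.mem_nhds htU), self_mem_nhdsWithin]
      with τ hτU hτ
    obtain ⟨𝒰, h𝒰, hlim⟩ := hV τ hτ
    have h1 : ⟪V τ, V τ⟫ ≤ B * ‖V τ‖ := le_of_tendsto (hlim (V τ)) <| by
      filter_upwards [h𝒰 (eventually_nhds_inf_ae hU hτU hB)] with r hr
      exact (real_inner_le_norm _ _).trans (mul_le_mul_of_nonneg_right hr (norm_nonneg _))
    rw [real_inner_self_eq_norm_mul_norm] at h1; rcases (norm_nonneg (V τ)).eq_or_lt with h0 | h0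
    · rw [← h0]; obtain ⟨r, hr⟩ := ((eventually_nhds_inf_ae hU hτU hB).filter_mono h𝒰).exists
      exact (norm_nonneg _).trans hr
    · exact le_of_mul_le_mul_right h1 h0
  -- The vectors against which `V` is continuous and represents `f` form a closed subspace.
  let S : Submodule ℝ H :=
    { carrier := {φ | ContinuousOn (fun t => ⟪V t, φ⟫) I ∧ ∀ᵐ t, t ∈ I → ⟪V t, φ⟫ = ⟪f t, φ⟫}
      zero_mem' := by simpa using continuousOn_const
      add_mem' := fun {a b} ha hb => by
        simp only [mem_ofPred_eq, inner_add_right]; refine ⟨ha.1.add hb.1, ?_⟩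
        filter_upwards [ha.2, hb.2] with t h1 h2 ht
        rw [h1 ht, h2 ht]
      smul_mem' := fun c a ha => by
        simp only [mem_ofPred_eq, inner_smul_right]; refine ⟨continuousOn_const.mul ha.1, ?_⟩
        filter_upwards [ha.2] with t h1 ht
        rw [h1 ht] }
  have hSD : D ⊆ S := fun φ hφ => by
    have hloc : ∀ t ∈ I, ∃ U, IsOpen U ∧ t ∈ U ∧ ∃ W, Continuous W ∧
        (∀ τ ∈ U ∩ I, ⟪V τ, φ⟫ = W τ) ∧ ∀ᵐ τ, τ ∈ U → ⟪f τ, φ⟫ = W τ := fun t ht => by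
      obtain ⟨U, hU, htU, W, hW, hfW⟩ := hW φ hφ t ht
      refine ⟨U, hU, htU, W, hW, fun τ hτ => ?_, hfW⟩
      obtain ⟨𝒰, h𝒰, hlim⟩ := hV τ hτ.2
      refine tendsto_nhds_unique (hlim φ) (((hW.tendsto τ).mono_left
        (h𝒰.trans inf_le_left)).congr' ?_)
      filter_upwards [h𝒰 (eventually_nhds_inf_ae hU hτ.1 hfW)] with r hr
      exact hr.symm
    refine ⟨fun t ht => ?_, ?_⟩
    · obtain ⟨U, hU, htU, W, hW, h1, -⟩ := hloc t ht
      refine (hW.continuousWithinAt).congr_of_eventuallyEq ?_ (h1 t ⟨htU, ht⟩)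
      filter_upwards [mem_nhdsWithin_of_mem_nhds (hU.mem_nhds htU), self_mem_nhdsWithin]
        with τ h2 h3
      exact h1 τ ⟨h2, h3⟩
    · choose! U hU htU W hW h1 h2 using hloc
      obtain ⟨c, hc, hcI, hcov⟩ := TopologicalSpace.countable_cover_nhdsWithin (f := U)
        fun t ht => mem_nhdsWithin_of_mem_nhds ((hU t ht).mem_nhds (htU t ht))
      filter_upwards [(ae_ball_iff hcI).2 fun t ht => h2 t (hc ht)] with τ hτ hτI
      obtain ⟨t, htc, htτ⟩ := mem_iUnion₂.1 (hcov hτI)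
      rw [h1 t (hc htc) τ ⟨htτ, hτI⟩, hτ t htc htτ]
  have hScl : IsClosed (S : Set H) := by
    refine isClosed_of_closure_subset fun φ hφ => ?_
    obtain ⟨ψ, hψS, hψ⟩ := mem_closure_iff_seq_limit.1 hφ
    refine ⟨fun t ht => ?_, ?_⟩
    · obtain ⟨B, hB⟩ := hVB t ht
      refine continuousWithinAt_of_locally_uniform_approx_of_continuousWithinAt ht fun u hu => ?_
      obtain ⟨ε, hε, hεu⟩ := Metric.mem_uniformity_dist.1 hu
      have h1 : Tendsto (fun n => B * ‖φ - ψ n‖) atTop (𝓝 0) := by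
        simpa using ((tendsto_const_nhds (x := φ)).sub hψ).norm.const_mul B
      obtain ⟨n, hn⟩ := (h1.eventually (gt_mem_nhds hε)).exists
      refine ⟨_, hB, _, (hψS n).1 t ht, fun τ hτ => hεu ?_⟩
      rw [Real.dist_eq, ← inner_sub_right]
      exact (abs_real_inner_le_norm _ _).trans_lt
        ((mul_le_mul_of_nonneg_right hτ (norm_nonneg _)).trans_lt hn)
    · filter_upwards [ae_all_iff.2 fun n => (hψS n).2] with t ht htI
      exact tendsto_nhds_unique (tendsto_const_nhds.inner hψ)
        ((tendsto_const_nhds.inner hψ).congr fun n => (ht n htI).symm)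
  have hST : ∀ φ, φ ∈ S := fun φ => by
    have h1 : (Submodule.span ℝ D).topologicalClosure ≤ S :=
      Submodule.topologicalClosure_minimal _ (Submodule.span_le.2 hSD) hScl
    exact h1 (hD ▸ Submodule.mem_top)
  refine ⟨V, fun φ => (hST φ).1, ?_, hV⟩
  filter_upwards [ae_all_iff.2 fun n => (hST (TopologicalSpace.denseSeq H n)).2] with t ht htI
  exact (TopologicalSpace.denseRange_denseSeq H) |>.eq_of_inner_left (𝕜 := ℝ) fun n => ht n htI

end WeakLimit

/-- A smooth weight the square of which is integrable against uniformly local densities. -/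
def smw (x : E3) : ℝ := (1 + ‖x‖ ^ 2)⁻¹

lemma smw_pos (x : E3) : 0 < smw x := by unfold smw; positivity

lemma contDiff_one_add_norm_sq : ContDiff ℝ (⊤ : ℕ∞) fun x : E3 => 1 + ‖x‖ ^ 2 :=
  contDiff_const.add (contDiff_norm_sq ℝ)

lemma contDiff_smw : ContDiff ℝ (⊤ : ℕ∞) smw := contDiff_one_add_norm_sq.inv fun x => by positivity

lemma one_add_mul_smw (x : E3) : (1 + ‖x‖ ^ 2) * smw x = 1 := mul_inv_cancel₀ (by positivity)

lemma enorm_smw_sq_le (x : E3) : ‖smw x‖ₑ ^ 2 ≤ wgt x := by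
  rw [enorm_of_nonneg (smw_pos x).le, ← ofReal_pow (smw_pos x).le, wgt]; refine ofReal_le_ofReal ?_
  rw [← one_mul (pker 0 (7 / 2) x)]; refine le_mul_pker (fun _ => ?_) fun h => ?_
  · rw [neg_zero, Real.rpow_zero, mul_one]
    exact pow_le_one₀ (smw_pos x).le (inv_le_one_of_one_le₀ (by nlinarith [norm_nonneg x]))
  · have h1 : smw x ≤ ‖x‖ ^ (-2 : ℝ) := by
      rw [rpow_neg (norm_nonneg x), Real.rpow_two]; exact inv_anti₀ (by positivity) (by linarith)
    calc smw x ^ 2 ≤ (‖x‖ ^ (-2 : ℝ)) ^ 2 := pow_le_pow_left₀ (smw_pos x).le h1 2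
      _ = ‖x‖ ^ (-4 : ℝ) := by rw [← rpow_natCast, ← rpow_mul (norm_nonneg x)]; norm_num
      _ ≤ 1 * ‖x‖ ^ (-(7 / 2) : ℝ) := by
        rw [one_mul]; exact rpow_le_rpow_of_exponent_le h (by norm_num)

lemma eLpNorm_two_sq {α F : Type*} [MeasurableSpace α] [NormedAddCommGroup F] (f : α → F)
    (μ : Measure α) : eLpNorm f 2 μ ^ 2 = ∫⁻ x, ‖f x‖ₑ ^ 2 ∂μ := by
  have h := eLpNorm_nnreal_pow_eq_lintegral (p := 2) (f := f) (μ := μ) two_ne_zero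
  simpa only [NNReal.coe_ofNat, ENNReal.rpow_ofNat, ENNReal.coe_ofNat] using h

lemma inner_toLp {f g : E3 → E3} (hf : MemLp f 2) (hg : MemLp g 2) :
    ⟪hf.toLp f, hg.toLp g⟫ = ∫ x, ⟪f x, g x⟫ := by
  rw [L2.inner_def]; refine integral_congr_ae ?_
  filter_upwards [hf.coeFn_toLp, hg.coeFn_toLp] with x h1 h2
  rw [h1, h2]

lemma integrable_inner_of_memLp {f g : E3 → E3} (hf : MemLp f 2) (hg : MemLp g 2) :
    Integrable fun x => ⟪f x, g x⟫ := by
  refine (L2.integrable_inner (𝕜 := ℝ) (hf.toLp f) (hg.toLp g)).congr ?_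
  filter_upwards [hf.coeFn_toLp, hg.coeFn_toLp] with x h1 h2
  rw [h1, h2]

lemma IsTest.memLp_smul_bv {Θ} (hΘ : IsTest Θ) (i : Fin 3) : MemLp (fun x => Θ x • bv i) 2 := by
  exact Continuous.memLp_of_hasCompactSupport (hΘ.continuous.smul continuous_const) hΘ.2.smul_right

/-- A field that is locally bounded in weighted `L²`, and whose pairings with test functions agree almost
everywhere with continuous functions of time, has a weakly continuous representative `v`. As `v t` is a
weak limit of nearby slices, weighted `L²` bounds pass from almost every time near `t` to `t`. -/
lemma exists_weakRep {I : Set ℝ} {u : ℝ → E3 → E3}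
    (hm : ∀ᵐ τ, τ ∈ I → AEStronglyMeasurable (u τ) volume)
    (hb : ∀ t ∈ I, ∃ A : ℝ≥0, ∃ U ⊆ I, IsOpen U ∧ t ∈ U ∧
      ∀ᵐ τ, τ ∈ U → ∫⁻ x, wgt x * ‖u τ x‖ₑ ^ 2 ≤ A)
    (hW : ∀ Θ, IsTest Θ → ∀ i, ∀ t ∈ I, ∃ U, IsOpen U ∧ t ∈ U ∧ ∃ W,
      Continuous W ∧ ∀ᵐ τ, τ ∈ U → ∫ x, Θ x * u τ x i = W τ) :
    ∃ v : ℝ → E3 → E3, (∀ t, AEStronglyMeasurable (v t)) ∧ (∀ᵐ τ, τ ∈ I → v τ =ᵐ[volume] u τ) ∧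
      (∀ Θ, IsTest Θ → ContinuousOn (fun t => ∫ x, Θ x • v t x) I) ∧
      ∀ t ∈ I, ∀ Φ, Measurable Φ → (∀ x, 0 ≤ Φ x) → (∀ x, Φ x ≤ 1) →
        ∀ R, (∀ x, R ≤ ‖x‖ → Φ x = 0) → ∀ A : ℝ≥0,
        (∀ᶠ τ in 𝓝 t ⊓ ae volume, ∫⁻ x, ofReal (Φ x) * ‖u τ x‖ₑ ^ 2 ≤ A) →
          ∫⁻ x, ofReal (Φ x) * ‖v t x‖ₑ ^ 2 ≤ A := by
  have : Fact ((2 : ℝ≥0∞) ≠ ⊤) := ⟨ENNReal.ofNat_ne_top⟩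
  classical
  let f : ℝ → Lp E3 2 (volume : Measure E3) := fun τ =>
    if h : MemLp (fun x => smw x • u τ x) 2 then h.toLp _ else 0
  have hcont : Continuous smw := contDiff_smw.continuous
  have hbound : ∀ t ∈ I, ∃ B, ∃ U, IsOpen U ∧ t ∈ U ∧ ∀ᵐ τ, τ ∈ U →
      MemLp (fun x => smw x • u τ x) 2 ∧ ‖f τ‖ ≤ B := fun t ht => by
    obtain ⟨A, U, hUI, hU, htU, hA⟩ := hb t ht
    refine ⟨(A : ℝ) + 1, U, hU, htU, ?_⟩
    filter_upwards [hA, hm] with τ h1 h2 hτ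
    have h3 : eLpNorm (fun x => smw x • u τ x) 2 volume ^ 2 ≤ A := by
      rw [eLpNorm_two_sq]; refine le_trans (lintegral_mono fun x => ?_) (h1 hτ)
      rw [enorm_smul, mul_pow]; exact mul_le_mul_left (enorm_smw_sq_le x) _
    have h4 : eLpNorm (fun x => smw x • u τ x) 2 volume ≤ (A : ℝ≥0∞) + 1 := by
      by_contra! hc
      refine (h3.trans_lt ?_).false
      calc (A : ℝ≥0∞) < A + 1 := ENNReal.lt_add_right ENNReal.coe_ne_top one_ne_zero
        _ ≤ (A + 1) ^ 2 := le_self_pow₀ le_add_self two_ne_zero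
        _ ≤ _ := pow_le_pow_left' hc.le 2
    have h5 : MemLp (fun x => smw x • u τ x) 2 :=
      ⟨hcont.aestronglyMeasurable.smul (h2 (hUI hτ)), h4.trans_lt (by finiteness)⟩
    refine ⟨h5, ?_⟩
    simp only [f, dif_pos h5, Lp.norm_toLp]
    exact toReal_le_of_le_ofReal (by positivity)
      (h4.trans (by rw [ofReal_add (by positivity) zero_le_one]; simp))
  let D : Set (Lp E3 2 (volume : Measure E3)) :=
    {φ | ∃ Θ, ∃ hΘ : IsTest Θ, ∃ i, φ = (hΘ.memLp_smul_bv i).toLp _}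
  have hpair : ∀ Θ (hΘ : IsTest Θ) (i : Fin 3) (h : E3 → E3) (hh : MemLp h 2),
      ⟪hh.toLp h, (hΘ.memLp_smul_bv i).toLp _⟫ = ∫ x, Θ x * h x i := fun Θ hΘ i h hh => by
    rw [inner_toLp]; simp only [inner_smul_right, inner_bv]
  have hD : (Submodule.span ℝ D).topologicalClosure = ⊤ := by
    rw [Submodule.topologicalClosure_eq_top_iff, Submodule.eq_bot_iff]; intro h hh
    have h0 : ∀ i, ∀ᵐ x, h x i = 0 := fun i => by
      refine ae_eq_zero_of_integral_contDiff_smul_eq_zero ?_ fun Θ h1 h2 => ?_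
      · have hl : LocallyIntegrable (h : E3 → E3) := (Lp.memLp h).locallyIntegrable (by norm_num)
        exact fun x => by
          obtain ⟨s, hs, hi⟩ := hl x
          exact ⟨s, hs, (𝐩 i).integrable_comp hi⟩
      · have h3 := hpair Θ ⟨h1, h2⟩ i h (Lp.memLp h)
        rw [Lp.toLp_coeFn, real_inner_comm] at h3; simp only [smul_eq_mul, ← h3]
        exact (Submodule.mem_orthogonal _ _).1 hh _ (Submodule.subset_span ⟨Θ, ⟨h1, h2⟩, i, rfl⟩)
    refine Lp.ext ?_
    filter_upwards [ae_all_iff.2 h0, Lp.coeFn_zero E3 2 (volume : Measure E3)] with x hx hz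
    rw [hz]; ext i; exact hx i
  obtain ⟨V, hVc, hVf, hVw⟩ := exists_weaklyContinuous (f := f) hD (fun t ht => by
      obtain ⟨B, U, hU, htU, h⟩ := hbound t ht
      exact ⟨B, U, hU, htU, h.mono fun τ hτ hτU => (hτ hτU).2⟩)
    (by
      rintro _ ⟨Θ, hΘ, i, rfl⟩ t ht
      have hΘ' : IsTest fun x => smw x * Θ x := ⟨contDiff_smw.mul hΘ.1, hΘ.2.mul_left⟩
      obtain ⟨U, hU, htU, W, hWc, hUW⟩ := hW _ hΘ' i t ht
      obtain ⟨B, U', hU', htU', h⟩ := hbound t ht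
      refine ⟨U ∩ U', hU.inter hU', ⟨htU, htU'⟩, W, hWc, ?_⟩
      filter_upwards [hUW, h] with τ h1 h2 hτ
      rw [← h1 hτ.1]; simp only [f, dif_pos (h2 hτ.2).1]
      rw [hpair Θ hΘ]; refine integral_congr' fun x => ?_
      simp only [PiLp.smul_apply, smul_eq_mul]; ring)
  have hint : ∀ t Θ (hΘ : IsTest Θ), Integrable fun x => Θ x • ((1 + ‖x‖ ^ 2) • V t x) :=
    fun t Θ hΘ => by
      have h1 : LocallyIntegrable (V t : E3 → E3) :=
        (Lp.memLp (V t)).locallyIntegrable (by norm_num)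
      simp only [smul_smul]
      exact h1.integrable_smul_left_of_hasCompactSupport
        (hΘ.continuous.mul contDiff_one_add_norm_sq.continuous) hΘ.2.mul_right
  refine ⟨fun t x => (1 + ‖x‖ ^ 2) • V t x, fun t => ?_, ?_, fun Θ hΘ => ?_, ?_⟩
  · exact contDiff_one_add_norm_sq.continuous.aestronglyMeasurable.smul
      (Lp.aestronglyMeasurable (V t))
  · have hmem : ∀ᵐ τ, τ ∈ I → MemLp (fun x => smw x • u τ x) 2 := by
      choose! B U hU htU h using hbound
      obtain ⟨c, hc, hcI, hcov⟩ := TopologicalSpace.countable_cover_nhdsWithin (f := U)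
        fun t ht => mem_nhdsWithin_of_mem_nhds ((hU t ht).mem_nhds (htU t ht))
      filter_upwards [(ae_ball_iff hcI).2 fun t ht => h t (hc ht)] with τ hτ hτI
      obtain ⟨t, htc, htτ⟩ := mem_iUnion₂.1 (hcov hτI)
      exact (hτ t htc htτ).1
    filter_upwards [hVf, hmem] with τ h1 h2 hτ
    have h3 := (h2 hτ).coeFn_toLp
    rw [h1 hτ]; simp only [f, dif_pos (h2 hτ)]; filter_upwards [h3] with x hx
    rw [hx, smul_smul, one_add_mul_smw, one_smul]
  · have hc : ∀ i, ContinuousOn (fun t => (∫ x, Θ x • ((1 + ‖x‖ ^ 2) • V t x)) i) I := fun i => by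
      have hΘ' : IsTest fun x => Θ x * (1 + ‖x‖ ^ 2) :=
        ⟨hΘ.1.mul contDiff_one_add_norm_sq, hΘ.2.mul_right⟩
      refine (hVc ((hΘ'.memLp_smul_bv i).toLp _)).congr fun t _ => ?_
      have h1 := hpair _ hΘ' i _ (Lp.memLp (V t))
      rw [Lp.toLp_coeFn] at h1; refine Eq.trans ?_ h1.symm
      rw [integral_apply_E3 (hint t Θ hΘ)]; refine integral_congr' fun x => ?_
      simp only [PiLp.smul_apply, smul_eq_mul]; ring
    exact (PiLp.continuous_toLp 2 _).comp_continuousOn (continuousOn_pi.2 hc)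
  · intro t ht Φ hΦm hΦ0 hΦ1 R hΦR A hA; obtain ⟨𝒰, h𝒰, hlim⟩ := hVw t ht
    have hφ : MemLp (fun x => (Φ x * (1 + ‖x‖ ^ 2) ^ 2) • V t x) 2 := by
      refine MemLp.of_le_mul (c := (1 + R ^ 2) ^ 2) (Lp.memLp (V t)) ((hΦm.mul
        (contDiff_one_add_norm_sq.continuous.measurable.pow_const 2)).aestronglyMeasurable.smul
        (Lp.aestronglyMeasurable (V t))) (.of_forall fun x => ?_)
      rw [norm_smul]; refine mul_le_mul_of_nonneg_right ?_ (norm_nonneg _)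
      rcases le_or_gt R ‖x‖ with h | h
      · rw [hΦR x h, zero_mul, norm_zero]; positivity
      · rw [norm_of_nonneg (mul_nonneg (hΦ0 x) (by positivity))]
        refine (mul_le_of_le_one_left (by positivity) (hΦ1 x)).trans ?_
        gcongr
    have hpt : ∀ h x, ⟪smw x • h, (Φ x * (1 + ‖x‖ ^ 2) ^ 2) • V t x⟫ =
        Φ x * ⟪h, (1 + ‖x‖ ^ 2) • V t x⟫ := fun h x => by
      simp only [real_inner_smul_left, real_inner_smul_right]
      linear_combination (Φ x * (1 + ‖x‖ ^ 2) * ⟪h, V t x⟫) * one_add_mul_smw x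
    have hJ : ∀ x, ⟪V t x, (Φ x * (1 + ‖x‖ ^ 2) ^ 2) • V t x⟫ =
        Φ x * ‖(1 + ‖x‖ ^ 2) • V t x‖ ^ 2 := fun x => by
      rw [norm_smul, mul_pow, norm_eq_abs, sq_abs, real_inner_smul_right,
        real_inner_self_eq_norm_sq]
      ring
    have hJi : Integrable fun x => Φ x * ‖(1 + ‖x‖ ^ 2) • V t x‖ ^ 2 := by
      simp only [← hJ]; exact integrable_inner_of_memLp (Lp.memLp (V t)) hφ
    have hJe : ⟪V t, hφ.toLp _⟫ = ∫ x, Φ x * ‖(1 + ‖x‖ ^ 2) • V t x‖ ^ 2 := by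
      have h1 := inner_toLp (Lp.memLp (V t)) hφ
      rw [Lp.toLp_coeFn] at h1; simp only [h1, hJ]
    obtain ⟨B, U, hU, htU, hB⟩ := hbound t ht
    have hev : ∀ᶠ τ in (𝒰 : Filter ℝ), ⟪f τ, hφ.toLp _⟫ ≤
        (A + ∫ x, Φ x * ‖(1 + ‖x‖ ^ 2) • V t x‖ ^ 2) / 2 := by
      filter_upwards [hA.filter_mono h𝒰, h𝒰 (mem_inf_of_left (hU.mem_nhds htU)),
        h𝒰 (mem_inf_of_right hB)] with τ h1 h2 h3
      have h4 := (h3 h2).1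
      have hum : AEStronglyMeasurable (u τ) volume := by
        refine (contDiff_one_add_norm_sq.continuous.aestronglyMeasurable.smul h4.1).congr
          (.of_forall fun x => ?_)
        change (1 + ‖x‖ ^ 2) • (smw x • u τ x) = _
        rw [smul_smul, one_add_mul_smw, one_smul]
      have hnn : ∀ x, 0 ≤ Φ x * ‖u τ x‖ ^ 2 := fun x => mul_nonneg (hΦ0 x) (by positivity)
      have he : ∫⁻ x, ofReal (Φ x * ‖u τ x‖ ^ 2) ≤ A := by
        simpa only [ofReal_mul (hΦ0 _), ofReal_pow (norm_nonneg _), ofReal_norm] using h1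
      have hm2 : AEStronglyMeasurable (fun x => Φ x * ‖u τ x‖ ^ 2) volume :=
        hΦm.aestronglyMeasurable.mul (hum.norm.pow 2)
      have hui : Integrable fun x => Φ x * ‖u τ x‖ ^ 2 :=
        (lintegral_ofReal_ne_top_iff_integrable hm2 (.of_forall hnn)).1
          (he.trans_lt ENNReal.coe_lt_top).ne
      have hle : ∫ x, Φ x * ‖u τ x‖ ^ 2 ≤ A := by
        rw [integral_eq_lintegral_of_nonneg_ae (.of_forall hnn) hm2]
        exact ENNReal.toReal_le_coe_of_le_coe he
      simp only [f, dif_pos h4]; rw [inner_toLp]; simp only [hpt]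
      refine (integral_mono (g := fun x => (Φ x * ‖u τ x‖ ^ 2 +
        Φ x * ‖(1 + ‖x‖ ^ 2) • V t x‖ ^ 2) / 2) ?_ ((hui.add hJi).div_const 2) fun x => ?_).trans ?_
      · simp only [← hpt]; exact integrable_inner_of_memLp h4 hφ
      · have h5 := real_inner_le_norm (u τ x) ((1 + ‖x‖ ^ 2) • V t x)
        have h6 := two_mul_le_add_sq ‖u τ x‖ ‖(1 + ‖x‖ ^ 2) • V t x‖
        have h7 : ⟪u τ x, (1 + ‖x‖ ^ 2) • V t x⟫ ≤
          (‖u τ x‖ ^ 2 + ‖(1 + ‖x‖ ^ 2) • V t x‖ ^ 2) / 2 := by linarith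
        exact (mul_le_mul_of_nonneg_left h7 (hΦ0 x)).trans (by linarith)
      · rw [integral_div, integral_add hui hJi]; linarith
    have hfin := le_of_tendsto (hlim (hφ.toLp _)) hev
    rw [hJe] at hfin
    calc _ = ∫⁻ x, ofReal (Φ x * ‖(1 + ‖x‖ ^ 2) • V t x‖ ^ 2) := by
          simp only [ofReal_mul (hΦ0 _), ofReal_pow (norm_nonneg _), ofReal_norm]
      _ = ofReal (∫ x, Φ x * ‖(1 + ‖x‖ ^ 2) • V t x‖ ^ 2) :=
          (ofReal_integral_eq_lintegral_ofReal hJi (.of_forall fun x =>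
            mul_nonneg (hΦ0 x) (by positivity))).symm
      _ ≤ A := by rw [← ofReal_coe_nnreal]; exact ofReal_le_ofReal (by linarith)

/-! ### The momentum equation and weak continuity in time -/

lemma setLIntegral_ball_le_ulocNorm_sq (f : E3 → E3) (m : E3) :
    ∫⁻ x in ball m 1, ‖f x‖ₑ ^ 2 ≤ ulocNorm f ^ 2 := by
  rw [← eLpNorm_two_sq]
  exact pow_le_pow_left' (le_iSup (fun o => eLpNorm f 2 (volume.restrict (ball o 1))) m) 2

lemma exists_lintegral_wgt_uloc_le : ∃ C : ℝ≥0∞, C ≠ ⊤ ∧ ∀ f : E3 → E3,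
    AEStronglyMeasurable f volume → ∫⁻ x, wgt x * ‖f x‖ₑ ^ 2 ≤ C * ulocNorm f ^ 2 := by
  obtain ⟨C, hC, h⟩ := exists_lintegral_wgt_static_le
  refine ⟨C, hC, fun f hf => ?_⟩
  have h1 := h (fun x => ‖hf.mk f x‖ₑ ^ 2)
    (hf.stronglyMeasurable_mk.measurable.enorm.pow_const 2) (ulocNorm f ^ 2) (fun m => ?_) 0
  · refine le_of_eq_of_le (lintegral_congr_ae ?_) h1
    filter_upwards [hf.ae_eq_mk] with x hx
    rw [hx, sub_zero]
  · refine le_of_eq_of_le (lintegral_congr_ae ?_) (setLIntegral_ball_le_ulocNorm_sq f m)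
    filter_upwards [ae_restrict_of_ae hf.ae_eq_mk] with x hx
    rw [hx]

lemma isOpen_timeInterval (T : EReal) : IsOpen (timeInterval T) :=
  isOpen_Ioi.inter (isOpen_Iio.preimage continuous_coe_real_ereal)

lemma Ioo_subset_timeInterval {T : EReal} {a b : ℝ} (ha : 0 ≤ a) (h : (b : EReal) ≤ T) :
    Ioo a b ⊆ timeInterval T :=
  fun _ ht => ⟨ha.trans_lt ht.1, (EReal.coe_lt_coe ht.2).trans_le h⟩

lemma MeasOn.prod {T : EReal} {f : ℝ → E3 → E3} (hf : MeasOn T f) {I : Set ℝ}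
    (hI : I ⊆ timeInterval T) :
    AEStronglyMeasurable (uncurry f) ((volume.restrict I).prod volume) := by
  have h : (volume.restrict I).prod (volume : Measure E3) = volume.restrict (I ×ˢ univ) := by
    rw [volume_eq_prod, ← prod_restrict, Measure.restrict_univ]
  rw [h]; exact hf.mono_measure (Measure.restrict_mono (prod_mono_left hI) le_rfl)

lemma fracLap_const_mul {σ : ℝ} (h0 : 0 < σ) (h2 : σ < 2) (c : ℝ) {θ : E3 → ℝ} (hθ : IsTest θ)
    (x : E3) : fracLap σ (fun y => c * θ y) x = c * fracLap σ θ x := by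
  obtain ⟨C, -, h⟩ := exists_fracLap_eq h0 h2
  have e : ∀ z : E3, (2 * (c * θ x) - c * θ (x + z) - c * θ (x - z)) * ‖z‖ ^ (-3 - σ) =
      c * ((2 * θ x - θ (x + z) - θ (x - z)) * ‖z‖ ^ (-3 - σ)) := fun z => by ring
  rw [(h _ ⟨contDiff_const.mul hθ.1, hθ.2.mul_left⟩ x).2, (h θ hθ x).2]
  simp only [e, integral_const_mul]; ring

lemma IsTest.continuous_fracLap {σ : ℝ} (h0 : 0 ≤ σ) {θ : E3 → ℝ} (hθ : IsTest θ) :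
    Continuous (fracLap σ θ) :=
  continuous_re_fourierInv (hθ.memLp_symbol h0).1

lemma IsTest.continuous_gradient {θ : E3 → ℝ} (hθ : IsTest θ) :
    Continuous (gradient θ) ∧ HasCompactSupport (gradient θ) :=
  ⟨(InnerProductSpace.toDual ℝ E3).symm.continuous.comp (hθ.1.continuous_fderiv (by simp)),
    (hθ.2.fderiv (𝕜 := ℝ)).comp_left (map_zero _)⟩

/-- The pairing of the velocity with a test function is continuous in time, after a change on a
null set: the momentum equation gives an integrable derivative in time. -/
lemma exists_moment_continuous {s : ℝ} (hs : s ∈ Ico (3 / 4) 1) {a b : ℝ} (hab : a < b)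
    {u : ℝ → E3 → E3} {P : ℝ → E3 → ℝ}
    (hu : AEStronglyMeasurable (uncurry u) ((volume.restrict (Ioo a b)).prod volume))
    {A : ℝ≥0∞} (hA : A ≠ ⊤)
    (hb : ∀ᵐ τ ∂(volume.restrict (Ioo a b)), ∫⁻ x, wgt x * ‖u τ x‖ₑ ^ 2 ≤ A)
    (hP : ∀ R, IntegrableOn (uncurry P) (Ioo a b ×ˢ closedBall 0 R))
    (hmom : ∀ θ : ℝ → E3 → ℝ, IsSpaceTimeTest (Ioo a b) θ →
      ∫ t, ∫ x, ((deriv (fun τ => θ τ x) t - fracLap (2 * s) (θ t) x) • u t x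
        + ⟪u t x, gradient (θ t) x⟫ • u t x + P t x • gradient (θ t) x) = 0)
    {Θ : E3 → ℝ} (hΘ : IsTest Θ) (i : Fin 3) :
    ∃ W : ℝ → ℝ, Continuous W ∧ ∀ᵐ τ ∂(volume.restrict (Ioo a b)), ∫ x, Θ x * u τ x i = W τ := by
  set μ := (volume.restrict (Ioo a b)).prod (volume : Measure E3) with hμ
  have hs0 : 0 < 2 * s := by linarith [hs.1]
  have hs2 : 2 * s < 2 := by linarith [hs.2]
  have hdom : ∀ f : ℝ × E3 → E3, AEStronglyMeasurable f μ → (∃ C : ℝ≥0∞, C ≠ ⊤ ∧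
      ∀ p, ‖f p‖ₑ ≤ C * (wgt p.2 * (1 + ‖u p.1 p.2‖ₑ ^ 2))) → Integrable f μ := by
    rintro f hf ⟨C, hC, hfC⟩; refine ⟨hf, (lintegral_mono hfC).trans_lt ?_⟩
    rw [lintegral_const_mul' _ _ hC]
    refine mul_lt_top hC.lt_top ((lintegral_prod_le _).trans_lt ?_)
    refine (lintegral_mono_ae (g := fun _ => (∫⁻ x, wgt x) + A) ?_).trans_lt ?_
    · filter_upwards [hb] with τ hτ
      simp only [mul_add, mul_one]; rw [lintegral_add_left measurable_wgt]
      exact add_le_add le_rfl hτ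
    · rw [lintegral_const, Measure.restrict_apply_univ, Real.volume_Ioo]
      have := lintegral_wgt_lt_top
      finiteness
  have hle : ∀ y : ℝ≥0∞, y ≤ 1 + y ^ 2 := fun y => by
    rcases le_total y 1 with h | h
    · exact h.trans le_self_add
    · exact (le_self_pow₀ h two_ne_zero).trans le_add_self
  have hlin : ∀ k : E3 → ℝ, Continuous k → (∃ C : ℝ≥0∞, C ≠ ⊤ ∧ ∀ x, ‖k x‖ₑ ≤ C * wgt x) →
      Integrable (fun p : ℝ × E3 => k p.2 • u p.1 p.2) μ := by
    rintro k hk ⟨C, hC, hkC⟩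
    refine hdom _ ((hk.comp continuous_snd).aestronglyMeasurable.smul hu) ⟨C, hC, fun p => ?_⟩
    rw [enorm_smul, ← mul_assoc]; exact mul_le_mul' (hkC _) (hle _)
  obtain ⟨hgc, hgs⟩ := hΘ.continuous_gradient
  have h1 := hlin Θ hΘ.continuous (exists_enorm_le_wgt hΘ.continuous hΘ.2)
  have h2 : Integrable (fun p : ℝ × E3 => fracLap (2 * s) Θ p.2 • u p.1 p.2) μ := by
    obtain ⟨C, hC, hCk⟩ := hΘ.exists_fracLap_le (σ := 2 * s) (by linarith [hs.1]) hs2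
    refine hlin _ (hΘ.continuous_fracLap hs0.le) ⟨ofReal C, ofReal_ne_top, fun x => ?_⟩
    rw [wgt, ← ofReal_mul hC, enorm_eq_ofReal_abs]; exact ofReal_le_ofReal (hCk x)
  have h3 : Integrable (fun p : ℝ × E3 => ⟪u p.1 p.2, gradient Θ p.2⟫ • u p.1 p.2) μ := by
    obtain ⟨C, hC, hCk⟩ := exists_enorm_le_wgt hgc hgs
    refine hdom _ ((hu.inner (𝕜 := ℝ) (hgc.comp continuous_snd).aestronglyMeasurable).smul hu)
      ⟨C, hC, fun p => ?_⟩
    rw [enorm_smul]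
    calc _ ≤ ‖u p.1 p.2‖ₑ * ‖gradient Θ p.2‖ₑ * ‖u p.1 p.2‖ₑ := mulR (enorm_inner_le _ _)
      _ = ‖gradient Θ p.2‖ₑ * ‖u p.1 p.2‖ₑ ^ 2 := by ring
      _ ≤ C * wgt p.2 * (1 + ‖u p.1 p.2‖ₑ ^ 2) := mul_le_mul' (hCk _) le_add_self
      _ = _ := mul_assoc _ _ _
  have h4 : Integrable (fun p : ℝ × E3 => P p.1 p.2 • gradient Θ p.2) μ := by
    obtain ⟨R, hR⟩ := hgs.isCompact.isBounded.subset_closedBall 0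
    obtain ⟨B, hB⟩ := hgs.exists_bound_of_continuous hgc
    have h5 : IntegrableOn (fun p : ℝ × E3 => P p.1 p.2 • gradient Θ p.2)
        (Ioo a b ×ˢ closedBall 0 R) := by
      exact (hP R).smul_bdd B (hgc.comp continuous_snd).aestronglyMeasurable
        (Eventually.of_forall fun p => hB p.2)
    have h6 : μ = volume.restrict (Ioo a b ×ˢ univ) := by
      rw [hμ, volume_eq_prod, ← prod_restrict, Measure.restrict_univ]
    rw [h6]
    refine IntegrableOn.of_forall_sdiff_eq_zero h5 (measurableSet_Ioo.prod MeasurableSet.univ)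
      fun p hp => ?_
    have : p.2 ∉ tsupport (gradient Θ) := fun h => hp.2 ⟨hp.1.1, hR h⟩
    rw [image_eq_zero_of_notMem_tsupport this, smul_zero]
  let h : ℝ → E3 → E3 := fun t x => -(fracLap (2 * s) Θ x • u t x) +
    ⟪u t x, gradient Θ x⟫ • u t x + P t x • gradient Θ x
  have hF : Integrable (uncurry h) μ := (h2.neg.add h3).add h4
  have hslice : ∀ᵐ t ∂(volume.restrict (Ioo a b)), Integrable (fun x => Θ x • u t x) ∧
      Integrable (h t) := h1.prod_right_ae.and hF.prod_right_ae
  have hUi : IntegrableOn (fun t => ∫ x, Θ x • u t x) (Ioo a b) := h1.integral_prod_left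
  have hFi : IntegrableOn (fun t => ∫ x, h t x) (Ioo a b) := hF.integral_prod_left
  obtain ⟨W, hW, hWU⟩ := exists_continuous_of_timeCut hab (U := fun t => (∫ x, Θ x • u t x) i)
    (F := fun t => (∫ x, h t x) i)
    ((𝐩 i).integrable_comp hUi)
    ((𝐩 i).integrable_comp hFi) fun η hη => by
    have htest := hmom _ (hη.spaceTimeTest hΘ (f := fun _ => 1) contDiff_const)
    simp only [mul_one] at htest
    have hd : ∀ t x, deriv (fun τ => η τ * Θ x) t = deriv η t * Θ x := fun t x =>
      deriv_mul_const (hη.smooth.differentiable (by simp) t) _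
    have hg : ∀ (c : ℝ) x, gradient (fun y => c * Θ y) x = c • gradient Θ x := fun c x => by
      ext j
      rw [gradient_apply, PiLp.smul_apply, gradient_apply, dd,
        fderiv_const_mul (hΘ.1.differentiable (by simp) x)]
      rfl
    simp only [hd, hg, fracLap_const_mul hs0 hs2 _ hΘ] at htest
    have hz : ∀ t, t ∉ Ioo a b → η t = 0 ∧ deriv η t = 0 := fun t ht =>
      ⟨image_eq_zero_of_notMem_tsupport fun h => ht (hη.subset h),
        image_eq_zero_of_notMem_tsupport fun h => ht (hη.subset (tsupport_deriv_subset h))⟩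
    rw [← setIntegral_eq_integral_of_forall_compl_eq_zero (s := Ioo a b) fun t ht => by
      simp [hz t ht]] at htest
    have hbd : ∀ {φ : ℝ → ℝ} {f : ℝ → E3}, Continuous φ → HasCompactSupport φ →
        IntegrableOn f (Ioo a b) → IntegrableOn (fun t => φ t • f t) (Ioo a b) :=
      fun hφ hφs hf => by
        obtain ⟨B, hB⟩ := hφs.exists_bound_of_continuous hφ
        exact hf.bdd_smul B hφ.aestronglyMeasurable (Eventually.of_forall hB)
    have hUη := hbd (hη.smooth.continuous_deriv (by simp)) hη.compact.deriv hUi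
    have hFη := hbd hη.smooth.continuous hη.compact hFi
    have e : ∫ t in Ioo a b, (deriv η t • (∫ x, Θ x • u t x) + η t • ∫ x, h t x) = 0 := by
      rw [← htest]; refine integral_congr_ae ?_; filter_upwards [hslice] with t ht
      rw [← integral_smul, ← integral_smul]
      refine (integral_add (ht.1.smul (deriv η t)) (ht.2.smul (η t))).symm.trans
        (integral_congr_ae (Eventually.of_forall fun x => ?_))
      simp only [h, Pi.smul_apply, inner_smul_right]; module
    have e2 := congrArg (fun y : E3 => y i) e
    rw [integral_add hUη hFη] at e2
    simp only [PiLp.add_apply, integral_apply_E3 hUη, integral_apply_E3 hFη, PiLp.smul_apply,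
      smul_eq_mul, PiLp.zero_apply] at e2
    exact e2
  refine ⟨W, hW, ?_⟩
  filter_upwards [hWU, hslice] with t ht hts
  rw [← ht, integral_apply_E3 hts.1]; simp only [PiLp.smul_apply, smul_eq_mul]

/-- Almost everywhere bounds for a local Leray solution near a positive time. -/
lemma IsLocalLeraySolution.exists_bound {s : ℝ} {T : EReal} {u₀ : E3 → E3} {u : ℝ → E3 → E3}
    (h : IsLocalLeraySolution s T u₀ u) {t : ℝ} (ht : t ∈ timeInterval T) :
    ∃ a b : ℝ, 0 < a ∧ a < t ∧ t < b ∧ (b : EReal) < T ∧ ∃ A : ℝ≥0,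
      ∀ᵐ τ, τ ∈ Ioo a b → AEStronglyMeasurable (u τ) volume ∧ ulocNorm (u τ) ≤ A := by
  obtain ⟨b, htb, hbT⟩ := EReal.lt_iff_exists_real_btwn.1 ht.2
  have hb : supUlocNorm b u < ⊤ := h.bounded b hbT
  refine ⟨t / 2, b, half_pos ht.1, half_lt_self ht.1, EReal.coe_lt_coe_iff.1 htb, hbT,
    (supUlocNorm b u).toNNReal, ?_⟩
  have h1 := (h.meas.prod (Ioo_subset_timeInterval le_rfl hbT.le)).prodMk_left
  have h2 : ∀ᵐ τ ∂(𝓛 b), ulocNorm (u τ) ≤ supUlocNorm b u := ae_le_essSup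
  rw [coe_toNNReal hb.ne]
  filter_upwards [(ae_restrict_iff' measurableSet_Ioo).1 (h1.and h2)] with τ hτ hτI
  exact hτ ⟨(half_pos ht.1).trans hτI.1, hτI.2⟩

/-- The momentum equation makes the pairings of the solution with test functions continuous in time, so
`exists_weakRep` applies. -/
lemma IsLocalLeraySolution.exists_weaklyContinuousRep {s : ℝ} {T : EReal} {u₀ : E3 → E3}
    {u : ℝ → E3 → E3} (h : IsLocalLeraySolution s T u₀ u) :
    ∃ v : ℝ → E3 → E3, IsWeaklyContinuousRep T u v ∧
      ∀ t ∈ timeInterval T, ∀ Φ : E3 → ℝ, Measurable Φ → (∀ x, 0 ≤ Φ x) → (∀ x, Φ x ≤ 1) →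
        ∀ R, (∀ x, R ≤ ‖x‖ → Φ x = 0) → ∀ A : ℝ≥0,
        (∀ᶠ τ in 𝓝 t ⊓ ae volume, ∫⁻ x, ofReal (Φ x) * ‖u τ x‖ₑ ^ 2 ≤ A) →
          ∫⁻ x, ofReal (Φ x) * ‖v t x‖ₑ ^ 2 ≤ A := by
  obtain ⟨g, P, -, -, hP, hmom, -, -⟩ := h.suitable
  obtain ⟨C, hC, hCw⟩ := exists_lintegral_wgt_uloc_le
  have hIo := isOpen_timeInterval T
  have hwgt : ∀ {A : ℝ≥0} {τ : ℝ}, AEStronglyMeasurable (u τ) volume ∧ ulocNorm (u τ) ≤ A →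
      ∫⁻ x, wgt x * ‖u τ x‖ₑ ^ 2 ≤ (C * A ^ 2).toNNReal := fun hτ => by
    rw [coe_toNNReal (by finiteness)]; exact (hCw _ hτ.1).trans (mulL (pow_le_pow_left' hτ.2 2))
  obtain ⟨v, hv, hvu, hvc, hlsc⟩ := exists_weakRep (I := timeInterval T) (u := u)
    ((ae_restrict_iff' hIo.measurableSet).1 (h.meas.prod subset_rfl).prodMk_left)
    (fun t ht => by
    obtain ⟨a, b, ha, hat, htb, hbT, A, hA⟩ := h.exists_bound ht
    exact ⟨_, Ioo a b, Ioo_subset_timeInterval ha.le hbT.le, isOpen_Ioo, ⟨hat, htb⟩,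
      hA.mono fun τ hτ hτI => hwgt (hτ hτI)⟩)
    (fun Θ hΘ i t ht => by
    obtain ⟨a, b, ha, hat, htb, hbT, A, hA⟩ := h.exists_bound ht
    have hsub := Ioo_subset_timeInterval ha.le hbT.le
    have hcpt : Icc a b ⊆ timeInterval T := fun τ hτ =>
      ⟨ha.trans_le hτ.1, (EReal.coe_le_coe hτ.2).trans_lt hbT⟩
    obtain ⟨W, hW, hWu⟩ := exists_moment_continuous h.exponent (hat.trans htb)
      (h.meas.prod hsub) (A := (C * A ^ 2).toNNReal) ENNReal.coe_ne_top
      ((ae_restrict_iff' measurableSet_Ioo).2 (hA.mono fun τ hτ hτI => hwgt (hτ hτI)))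
      (P := P) (fun R => by
      have hK : IsCompact (Icc a b ×ˢ closedBall (0 : E3) R) :=
        isCompact_Icc.prod (isCompact_closedBall 0 R)
      have : IsFiniteMeasure (volume.restrict (Icc a b ×ˢ closedBall (0 : E3) R)) :=
        ⟨by rw [Measure.restrict_apply_univ]; exact hK.measure_lt_top⟩
      have hi : IntegrableOn (uncurry P) (Icc a b ×ˢ closedBall 0 R) :=
        (hP _ hK (prod_mono hcpt (subset_univ _))).integrable
          (by norm_num [ENNReal.le_div_iff_mul_le])
      exact hi.mono_set (prod_mono_left Ioo_subset_Icc_self))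
      (fun θ hθ => hmom θ ⟨hθ.1, hθ.2.1, hθ.2.2.trans (prod_mono_left hsub)⟩) hΘ i
    exact ⟨Ioo a b, isOpen_Ioo, ⟨hat, htb⟩, W, hW, (ae_restrict_iff' measurableSet_Ioo).1 hWu⟩)
  refine ⟨v, ⟨(ae_restrict_iff' hIo.measurableSet).2 hvu, fun t ht => ⟨hv t, ?_⟩, hvc⟩, hlsc⟩
  obtain ⟨a, b, ha, hat, htb, hbT, A, hA⟩ := h.exists_bound ht
  refine (iSup_le fun o => ?_).trans_lt (ENNReal.coe_lt_top (r := A))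
  rw [← ENNReal.pow_le_pow_left_iff two_ne_zero, eLpNorm_two_sq]
  have hind : ∀ f : E3 → E3, ∫⁻ x, ofReal ((ball o 1).indicator 𝟙 x) *
      ‖f x‖ₑ ^ 2 = ∫⁻ x in ball o 1, ‖f x‖ₑ ^ 2 := fun f => by
    rw [← lintegral_indicator measurableSet_ball]; refine lintegral_congr fun x => ?_
    by_cases hx : x ∈ ball o 1 <;> simp [hx]
  have h1 := hlsc t ht ((ball o 1).indicator fun _ => 1)
    (measurable_const.indicator measurableSet_ball)
    (fun x => indicator_nonneg (fun _ _ => zero_le_one) x)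
    (fun x => indicator_le_self' (fun _ _ => zero_le_one) x) (‖o‖ + 1)
    (fun x hx => indicator_of_notMem (fun hm => by
    have := norm_le_norm_add_norm_sub' x o
    rw [mem_ball_iff_norm] at hm; linarith) _) (A ^ 2)
    (eventually_nhds_inf_ae isOpen_Ioo ⟨hat, htb⟩ (hA.mono fun τ hτ hτI => by
    rw [hind, ENNReal.coe_pow]
    exact (setLIntegral_ball_le_ulocNorm_sq _ _).trans (pow_le_pow_left' (hτ hτI).2 2)))
  rwa [hind, ENNReal.coe_pow] at h1

/-! ### Regularized versions of a local Leray solution -/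

lemma HasFracLap.congr {σ} {f f' g g'} (h : HasFracLap σ f g)
    (hf : f =ᵐ[volume] f') (hg : g =ᵐ[volume] g') : HasFracLap σ f' g' := by
  refine ⟨h.1.congr hg, fun θ hθ => ⟨(h.2 θ hθ).1.congr ?_,
    (integral_congr_ae ?_).trans ((h.2 θ hθ).2.trans (integral_congr_ae ?_))⟩⟩ <;>
  · filter_upwards [hf, hg] with x hx hx'
    simp only [hx, hx']

lemma HasFracLap.ae_eq {σ} {f g g'} (h : HasFracLap σ f g)
    (h' : HasFracLap σ f g') : g =ᵐ[volume] g' :=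
  ae_eq_of_integral_contDiff_smul_eq h.1 h'.1 fun θ h1 h2 =>
  (h.2 θ ⟨h1, h2⟩).2.trans (h'.2 θ ⟨h1, h2⟩).2.symm

lemma HasCommutator.congr {σ} {φ} {f f' c} (h : HasCommutator σ φ f c)
    (hf : f =ᵐ[volume] f') : HasCommutator σ φ f' c := by
  refine ⟨h.1, fun θ hθ => ⟨(h.2 θ hθ).1.congr ?_, (h.2 θ hθ).2.trans (integral_congr_ae ?_)⟩⟩ <;>
  · filter_upwards [hf] with x hx
    rw [hx]

lemma eLpNorm_uncurry_sq {f : ℝ → E3 → E3} {I} (B : Set E3)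
    (hf : AEStronglyMeasurable (uncurry f) ((volume.restrict I).prod volume)) :
    eLpNorm (uncurry f) 2 (volume.restrict (I ×ˢ B)) ^ 2 = ∫⁻ τ in I, ∫⁻ x in B, ‖f τ x‖ₑ ^ 2 := by
  rw [eLpNorm_two_sq, volume_eq_prod, ← prod_restrict, lintegral_prod]
  · rfl
  · exact (hf.mono_measure (Measure.prod_mono le_rfl Measure.restrict_le_self)).enorm.pow_const 2

/-- Jointly measurable versions `u'`, `g'` of the solution and of `Λ^s u` for which the bounds that hold for
almost every time hold for every time: both are set to zero on a null set of times. -/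
lemma IsLocalLeraySolution.exists_lerayData {s} {T} {u₀}
    {u} (h : IsLocalLeraySolution s T u₀ u) {T' : ℝ} (hT : (T' : EReal) < T)
    {M : ℝ≥0} (hM : supUlocNorm T' u ≤ M) :
    ∃ u' g P, LerayData s T' M u' g P ∧ ∀ᵐ τ, τ ∈ Ioo 0 T' →
      u' τ =ᵐ[volume] u τ ∧ HasFracLap s (u τ) (g τ) := by
  obtain ⟨g, P, hg, hgn, hP, -, hPr, hE⟩ := h.suitable
  have hsub : Ioo 0 T' ⊆ timeInterval T := Ioo_subset_timeInterval le_rfl hT.le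
  set μ := volume.restrict (Ioo 0 T') with hμ
  have hum := h.meas.prod hsub
  have hgm := hg.1.prod hsub
  let U : ℝ → E3 → E3 := fun τ x => hum.mk _ (τ, x)
  let G : ℝ → E3 → E3 := fun τ x => hgm.mk _ (τ, x)
  have hU : Measurable (uncurry U) := hum.stronglyMeasurable_mk.measurable
  have hG : Measurable (uncurry G) := hgm.stronglyMeasurable_mk.measurable
  have hUu : ∀ᵐ τ ∂μ, u τ =ᵐ[volume] U τ := Measure.ae_ae_of_ae_prod hum.ae_eq_mk
  have hGg : ∀ᵐ τ ∂μ, g τ =ᵐ[volume] G τ := Measure.ae_ae_of_ae_prod hgm.ae_eq_mk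
  have hGsup : ulocSup μ 1 (fun τ x => ‖G τ x‖ₑ ^ 2) ≤ ulocNorm22 T' g ^ 2 := by
    refine iSup_le fun o => ?_
    calc _ = ∫⁻ τ in Ioo 0 T', ∫⁻ x in ball o 1, ‖g τ x‖ₑ ^ 2 := by
          refine lintegral_congr_ae ?_
          filter_upwards [hGg] with τ hτ
          refine lintegral_congr_ae ?_
          filter_upwards [ae_restrict_of_ae hτ] with x hx
          rw [hx]
      _ = _ := (eLpNorm_uncurry_sq _ hgm).symm
      _ ≤ _ := pow_le_pow_left' (le_iSup (fun o => eLpNorm (uncurry g) 2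
          (volume.restrict (Ioo 0 T' ×ˢ ball o 1))) o) 2
  have hGlt : ulocNorm22 T' g ^ 2 < ⊤ := ENNReal.pow_lt_top (hgn T' hT)
  obtain ⟨Cw, hCw, hw⟩ := exists_lintegral_wgt_le
  obtain ⟨Cu, hCu, hwu⟩ := exists_lintegral_wgt_uloc_le
  have hGw : ∀ᵐ τ ∂μ, ∫⁻ x, wgt x * ‖G τ x‖ₑ ^ 2 < ⊤ := by
    have hm : Measurable (uncurry fun τ x => wgt x * ‖G τ x‖ₑ ^ 2) :=
      (measurable_wgt.comp measurable_snd).mul (hG.enorm.pow_const 2)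
    refine ae_lt_top hm.lintegral_prod_right ?_
    have h1 := hw μ (fun τ x => ‖G τ x‖ₑ ^ 2) (hG.enorm.pow_const 2) 0
    simp only [sub_zero] at h1; exact (h1.trans_lt (mul_lt_top hCw.lt_top (hGsup.trans_lt hGlt))).ne
  have hbd : ∀ᵐ τ ∂μ, ulocNorm (u τ) ≤ M := by
    filter_upwards [ae_le_essSup (μ := μ) (f := fun τ => ulocNorm (u τ))] with τ hτ
    exact hτ.trans hM
  have hgood : ∀ᵐ τ ∂μ, τ ∈ Ioo 0 T' ∧ u τ =ᵐ[volume] U τ ∧ g τ =ᵐ[volume] G τ ∧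
      HasFracLap s (u τ) (g τ) ∧ (∀ m, ∫⁻ x in ball m 1, ‖U τ x‖ₑ ^ 2 ≤ (M : ℝ≥0∞) ^ 2) ∧
      WInt (U τ) ∧ WInt (G τ) := by
    filter_upwards [hUu, hGg, hGw, hbd, ae_restrict_of_ae_restrict_of_subset hsub hg.2,
      ae_restrict_mem measurableSet_Ioo] with τ h1 h2 h3 h4 h5 h6
    have h7 : ulocNorm (U τ) = ulocNorm (u τ) :=
      iSup_congr fun m => (eLpNorm_congr_ae (ae_restrict_of_ae h1)).symm
    have hUτ : Measurable (U τ) := hU.of_uncurry_left (x := τ)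
    refine ⟨h6, h1, h2, h5, fun m => (setLIntegral_ball_le_ulocNorm_sq _ m).trans
      (pow_le_pow_left' (h7.trans_le h4) 2), WInt.of_lintegral_sq hUτ ?_,
      WInt.of_lintegral_sq (hG.of_uncurry_left (x := τ)) h3⟩
    refine (hwu _ hUτ.aestronglyMeasurable).trans_lt ?_
    rw [h7]; have := h4.trans_lt ENNReal.coe_lt_top; finiteness
  obtain ⟨S, hSμ, hS, hSp⟩ := hgood.exists_measurable_mem
  let u' : ℝ → E3 → E3 := fun τ x => (Prod.fst ⁻¹' S).indicator (uncurry U) (τ, x)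
  let g' : ℝ → E3 → E3 := fun τ x => (Prod.fst ⁻¹' S).indicator (uncurry G) (τ, x)
  have hin : ∀ τ ∈ S, u' τ = U τ ∧ g' τ = G τ := fun τ hτ => by
    constructor <;> funext x <;> exact indicator_of_mem (show (τ, x) ∈ Prod.fst ⁻¹' S from hτ) _
  have hout : ∀ τ, τ ∉ S → u' τ = 0 ∧ g' τ = 0 := fun τ hτ => by
    constructor <;> funext x <;> exact indicator_of_notMem (s := Prod.fst ⁻¹' S) hτ _
  have hall : ∀ p : (E3 → E3) → (E3 → E3) → Prop, p 0 0 → (∀ τ ∈ S, p (U τ) (G τ)) →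
      ∀ τ, p (u' τ) (g' τ) := fun p h0 h1 τ => by
    by_cases hτ : τ ∈ S
    · rw [(hin τ hτ).1, (hin τ hτ).2]; exact h1 τ hτ
    · rw [(hout τ hτ).1, (hout τ hτ).2]; exact h0
  have hae : ∀ᵐ τ, τ ∈ Ioo 0 T' → u' τ =ᵐ[volume] u τ ∧ g' τ =ᵐ[volume] g τ ∧
      HasFracLap s (u τ) (g' τ) := by
    rw [← ae_restrict_iff' measurableSet_Ioo]; filter_upwards [hSμ] with τ hτ
    obtain ⟨-, h1, h2, h3, -⟩ := hSp τ hτ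
    rw [(hin τ hτ).1, (hin τ hτ).2]; exact ⟨h1.symm, h2.symm, h3.congr .rfl h2⟩
  have hW0 : WInt (0 : E3 → E3) := ⟨aestronglyMeasurable_const, by simp⟩
  have hmono : ∀ {θ}, IsSpaceTimeTest (Ioo 0 T') θ → ∀ {J}, Ioo 0 T' ⊆ J → IsSpaceTimeTest J θ :=
    fun hθ _ hJ => ⟨hθ.1, hθ.2.1, hθ.2.2.trans (prod_mono_left hJ)⟩
  -- A functional of the slices that vanishes off the time interval takes the same value at both.
  have hint : ∀ F F' : ℝ → E3 → ℝ, (∀ t, t ∉ Ioo 0 T' → F t = F' t) →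
      (∀ t, u' t =ᵐ[volume] u t → F t =ᵐ[volume] F' t) → ∫ t, ∫ x, F t x = ∫ t, ∫ x, F' t x :=
    fun F F' h1 h2 => by
      refine integral_congr_ae ?_
      filter_upwards [hae] with t ht
      by_cases hI : t ∈ Ioo 0 T'
      · exact integral_congr_ae (h2 t (ht hI).1)
      · simp only [h1 t hI]
  have hint' : ∀ t ≤ T', ∀ F F' : ℝ → E3 → ℝ, (∀ τ, u' τ =ᵐ[volume] u τ →
      g' τ =ᵐ[volume] g τ → F τ =ᵐ[volume] F' τ) →
      ∫ τ in Ioo 0 t, ∫ x, F τ x = ∫ τ in Ioo 0 t, ∫ x, F' τ x := fun t ht F F' h2 => by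
    refine integral_congr_ae ((ae_restrict_iff' measurableSet_Ioo).2 ?_)
    filter_upwards [hae] with τ hτ hτt
    have h3 := hτ ⟨hτt.1, hτt.2.trans_le ht⟩
    exact integral_congr_ae (h2 τ h3.1 h3.2.1)
  refine ⟨u', g', P, ⟨hU.indicator (measurable_fst hS), hG.indicator (measurable_fst hS),
    fun t => hall (fun f _ => ∀ m, ∫⁻ x in ball m 1, ‖f x‖ₑ ^ 2 ≤ (M : ℝ≥0∞) ^ 2)
      (fun m => by simp) (fun τ hτ => (hSp τ hτ).2.2.2.2.1) t,
    hall (fun f _ => WInt f) hW0 fun τ hτ => (hSp τ hτ).2.2.2.2.2.1,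
    hall (fun _ f => WInt f) hW0 fun τ hτ => (hSp τ hτ).2.2.2.2.2.2,
    hall (fun f f' => HasFracLap s f f') ⟨locallyIntegrable_zero, fun θ _ => by simp⟩
      fun τ hτ => (hSp τ hτ).2.2.2.1.congr (hSp τ hτ).2.1 (hSp τ hτ).2.2.1,
    ?_, fun θ hθ => ?_, fun K hK hKI => hP K hK (hKI.trans (prod_mono_left hsub)),
    fun θ hθ i => ?_, fun ψ ψ' hψ hψ0 hψ' hψ0' hψψ => ?_⟩,
    hae.mono fun τ hτ hI => ⟨(hτ hI).1, (hτ hI).2.2⟩⟩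
  · refine (ulocSup_mono fun τ x => ?_).trans_lt (hGsup.trans_lt hGlt)
    rw [LerayData.sqd_one]; refine pow_le_pow_left' ?_ 2; by_cases hτ : τ ∈ S
    · rw [(hin τ hτ).2]
    · rw [(hout τ hτ).2, Pi.zero_apply, enorm_zero]; exact zero_le
  · refine (hint _ _ (fun t ht => ?_) fun t ht => ?_).trans (h.div_free θ (hmono hθ hsub))
    · simp only [hθ.eq_zero ht, gradient_fun_const, inner_zero_right]
    · filter_upwards [ht] with x hx; rw [hx]
  · refine (hPr θ (hmono hθ hsub) i).trans (congrArg Neg.neg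
      (hint _ _ (fun t ht => ?_) fun t ht => ?_).symm)
    · simp only [hθ.eq_zero ht, gradient_fun_const, PiLp.zero_apply, invLapDD_zero, mul_zero]
    · filter_upwards [ht] with x hx; rw [hx]
  · obtain ⟨c₁, c₂, h1, h2, h3⟩ := hE ψ ψ' (hmono hψ fun t ht => ht.1) hψ0 hψ' hψ0' hψψ
    refine ⟨c₁, c₂, ?_, ?_, fun t ht0 htT => ?_⟩
    · filter_upwards [ae_restrict_of_ae_restrict_of_subset hsub h1.2,
        (ae_restrict_iff' measurableSet_Ioo).2 hae] with τ h4 h5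
      exact h4.congr h5.2.1.symm
    · filter_upwards [ae_restrict_of_ae_restrict_of_subset hsub h2.2,
        (ae_restrict_iff' measurableSet_Ioo).2 hae] with τ h4 h5
      exact h4.congr h5.1.symm
    · refine le_of_eq_of_le (congrArg (2 * ·) (hint' t htT _ _ fun τ _ h => ?_))
        ((h3 t ⟨ht0, (EReal.coe_le_coe htT).trans_lt hT⟩).trans_eq
        (congrArg₂ (· + ·) (congrArg₂ (· + ·) (congrArg₂ (· - ·) (congrArg₂ (· - ·)
        (hint' t htT _ _ fun τ h _ => ?_).symm
        (congrArg (2 * ·) (hint' t htT _ _ fun τ h _ => ?_).symm))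
        (congrArg (2 * ·) (hint' t htT _ _ fun τ _ h => ?_).symm))
        (hint' t htT _ _ fun τ h _ => ?_).symm)
        (congrArg (2 * ·) (hint' t htT _ _ fun τ h _ => ?_).symm)))
      all_goals filter_upwards [h] with x hx; rw [hx]

/-! ### The initial energy and the cutoffs at scale `R` -/

/-- Strong convergence to the initial datum on compact sets bounds the weighted energy at small times. -/
lemma eventually_energy_le {ρ κ} (hρ : 0 < ρ) {χ} (hχ : IsMult κ χ) {T' : ℝ} (hT' : 0 < T')
    {u u' : ℝ → E3 → E3} {u₀ : E3 → E3} (hu₀ : AEStronglyMeasurable u₀ volume)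
    (hu' : Measurable (uncurry u')) (hae : ∀ᵐ τ, τ ∈ Ioo 0 T' → u' τ =ᵐ[volume] u τ)
    (h : ∀ K, IsCompact K →
      Tendsto (fun t => eLpNorm (fun x => u t x - u₀ x) 2 (volume.restrict K))
        (𝓝[>] (0 : ℝ) ⊓ ae volume) (𝓝 0)) {o} {a₀ : ℝ≥0}
    (ha₀ : ∫⁻ x, ofReal (lwt ρ o χ x) * ‖u₀ x‖ₑ ^ 2 ≤ a₀) {δ : ℝ} (hδ : 0 < δ) :
    ∀ᶠ t in 𝓝[>] (0 : ℝ) ⊓ ae volume, ∫ x, lwt ρ o χ x * ‖u' t x‖ ^ 2 ≤ a₀ + δ := by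
  set w : E3 → ℝ := fun x => bumpAt ρ o x * χ x with hw
  have hwc : Continuous w := ((bumpAt_isTest hρ o).1.mul hχ.smooth).continuous
  have hw0 : ∀ x, 0 ≤ w x := fun x => mul_nonneg (bumpAt_nonneg _ _ _) (hχ.nonneg x)
  have hN : ∀ f : E3 → E3, eLpNorm (fun x => w x • f x) 2 volume ^ 2 =
      ∫⁻ x, ofReal (lwt ρ o χ x) * ‖f x‖ₑ ^ 2 := fun f => by
    rw [eLpNorm_two_sq]; refine lintegral_congr fun x => ?_
    rw [enorm_smul, mul_pow, enorm_of_nonneg (hw0 x), ← ofReal_pow (hw0 x)]; rfl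
  have hK := h _ (isCompact_closedBall o (2 * ρ))
  have hNB : ∀ f : E3 → E3, eLpNorm (fun x => w x • f x) 2 volume ≤
      eLpNorm f 2 (volume.restrict (closedBall o (2 * ρ))) := fun f => by
    rw [← ENNReal.pow_le_pow_left_iff two_ne_zero, hN, eLpNorm_two_sq]
    refine (lintegral_lwt_le hρ hχ f o).trans ((lintegral_mono fun x => ?_).trans
      (lintegral_mono_set Metric.ball_subset_closedBall))
    exact (sqd_le_sqd_one hχ f x).trans_eq (by rw [LerayData.sqd_one])
  have hsq : eLpNorm (fun x => w x • u₀ x) 2 volume ≤ NNReal.sqrt a₀ := by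
    rw [← ENNReal.pow_le_pow_left_iff two_ne_zero, hN]; refine ha₀.trans_eq ?_
    rw [← ENNReal.coe_pow, NNReal.sq_sqrt]
  have hlim : Tendsto (fun t => ((NNReal.sqrt a₀ : ℝ≥0∞) + eLpNorm (fun x => u t x - u₀ x) 2
      (volume.restrict (closedBall o (2 * ρ)))) ^ 2)
      (𝓝[>] (0 : ℝ) ⊓ ae volume) (𝓝 (a₀ : ℝ≥0∞)) := by
    have h1 := ENNReal.Tendsto.pow (n := 2) (tendsto_const_nhds (x := (NNReal.sqrt a₀ : ℝ≥0∞)).add hK)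
    rwa [add_zero, ← ENNReal.coe_pow, NNReal.sq_sqrt] at h1
  have hlt : (a₀ : ℝ≥0∞) < ofReal (a₀ + δ) := by
    rw [← ofReal_coe_nnreal]; exact (ENNReal.ofReal_lt_ofReal_iff (by positivity)).2 (by linarith)
  filter_upwards [hlim.eventually (gt_mem_nhds hlt), mem_inf_of_left (Ioo_mem_nhdsGT hT'),
    mem_inf_of_right hae] with t h1 h2 h3
  have hut : Measurable (u' t) := hu'.of_uncurry_left (x := t)
  rw [integral_eq_lintegral_of_nonneg_ae (Eventually.of_forall fun x =>
    mul_nonneg (lwt_nonneg x) (by positivity)) ((lwt_isTest hρ hχ).continuous.aestronglyMeasurable.mul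
    (hut.norm.pow_const 2).aestronglyMeasurable)]
  refine toReal_le_of_le_ofReal (by positivity) (le_trans ?_ h1.le)
  simp only [ofReal_mul (lwt_nonneg _), ofReal_pow (norm_nonneg _), ofReal_norm]; rw [← hN]
  refine pow_le_pow_left' ?_ 2
  have h4 : (fun x => w x • u' t x) = (fun x => w x • u₀ x) + fun x => w x • (u' t x - u₀ x) := by
    funext x; simp only [Pi.add_apply, ← smul_add, add_sub_cancel]
  rw [h4]
  refine (eLpNorm_add_le (hwc.aestronglyMeasurable.smul hu₀)
    (hwc.aestronglyMeasurable.smul (hut.aestronglyMeasurable.sub hu₀)) one_le_two).trans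
    (add_le_add hsq ((hNB _).trans_eq (eLpNorm_congr_ae (ae_restrict_of_ae ?_))))
  filter_upwards [h3 h2] with x hx
  rw [Pi.sub_apply, hx]

/-- The cutoff at scale `R` has modulus `κ modc` with `κ ~ R^{-1/2}`: its increments are at most
`min(1, L |z| / R)`. -/
lemma IsCutoff.exists_isMult {χ} (hχ : IsCutoff χ) : ∃ L : ℝ, 1 ≤ L ∧
    ∀ R, 1 ≤ R → IsMult (L / √R) fun x => χ (R⁻¹ • x) := by
  obtain ⟨h1, -, h2, h3⟩ := hχ
  have ht : IsTest fun x => 1 - χ x := by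
    refine ⟨contDiff_const.sub h1, HasCompactSupport.intro (isCompact_closedBall 0 2) fun x hx => ?_⟩
    rw [mem_closedBall_zero_iff, not_le] at hx; rw [h2 x hx.le, sub_self]
  obtain ⟨L, hL, hLip⟩ := ht.exists_lipschitz
  refine ⟨L + 1, by linarith, fun R hR => ?_⟩
  have hR0 : 0 < R := by linarith
  have hs1 : 1 ≤ √R := Real.one_le_sqrt.2 hR
  have hsR : √R * √R = R := Real.mul_self_sqrt hR0.le
  refine ⟨h1.comp (contDiff_const_smul _), fun x => (h3 _).1, fun x => (h3 _).2, by positivity,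
    fun x y => ?_⟩
  have hd : |χ (R⁻¹ • x) - χ (R⁻¹ • y)| ≤ (L + 1) * (‖x - y‖ / R) := by
    have h := hLip (R⁻¹ • x) (R⁻¹ • y)
    rw [sub_sub_sub_cancel_left, abs_sub_comm, ← smul_sub, norm_smul, norm_inv,
      norm_of_nonneg hR0.le] at h
    refine h.trans ?_
    rw [div_eq_inv_mul]; exact mul_le_mul_of_nonneg_right (by linarith) (by positivity)
  have hd1 : |χ (R⁻¹ • x) - χ (R⁻¹ • y)| ≤ 1 :=
    abs_le.2 ⟨by linarith [(h3 (R⁻¹ • x)).1, (h3 (R⁻¹ • y)).2],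
      by linarith [(h3 (R⁻¹ • y)).1, (h3 (R⁻¹ • x)).2]⟩
  rw [modc, mul_min_of_nonneg _ _ (by positivity)]; refine le_min (hd.trans ?_) ?_
  · rw [mul_div_assoc', div_mul_eq_mul_div]
    exact div_le_div_of_nonneg_left (by positivity) (by positivity) (by nlinarith)
  · have h4 : √‖x - y‖ * √‖x - y‖ = ‖x - y‖ := Real.mul_self_sqrt (norm_nonneg _)
    have h5 : ‖x - y‖ / R = (√‖x - y‖ / √R) * (√‖x - y‖ / √R) := by rw [div_mul_div_comm, h4, hsR]
    rw [div_mul_eq_mul_div, mul_div_assoc]; set q := √‖x - y‖ / √R; have hq : 0 ≤ q := by positivity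
    rcases le_total q 1 with h | h
    · refine hd.trans (mul_le_mul_of_nonneg_left ?_ (by positivity))
      rw [h5]; exact mul_le_of_le_one_left hq h
    · nlinarith

lemma exists_setLIntegral_ball_le_ulocNorm_sq (r : ℝ) : ∃ N : ℕ, ∀ f : E3 → E3,
    AEStronglyMeasurable f volume → ∀ o, ∫⁻ x in ball o r, ‖f x‖ₑ ^ 2 ≤ N * ulocNorm f ^ 2 := by
  obtain ⟨N, -, h⟩ := exists_setLIntegral_ball_le r
  refine ⟨N, fun f hf o => ?_⟩
  have hc : ∀ B : Set E3, ∫⁻ x in B, ‖f x‖ₑ ^ 2 = ∫⁻ x in B, ‖hf.mk f x‖ₑ ^ 2 := fun B => by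
    refine lintegral_congr_ae ?_
    filter_upwards [ae_restrict_of_ae hf.ae_eq_mk] with x hx
    rw [hx]
  rw [hc]
  exact h _ (hf.stronglyMeasurable_mk.measurable.enorm.pow_const 2) _ (fun m => by
    rw [← hc]; exact setLIntegral_ball_le_ulocNorm_sq f m) o

/-- The two passes of the main estimate, for the regularized solution: the uniformly local bound
comes from the multiplier `1`, and makes the error terms of the multiplier `χ_R` of order
`R^{-1/2}`. For `R < 1` the multiplier `1` does for both. -/
lemma exists_decay {χ} (hχ : IsCutoff χ) {s} (hs : s ∈ Ico (3 / 4) 1) {T' : ℝ}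
    (hT' : 0 < T') (M : ℝ≥0) : ∃ ρ, 1 ≤ ρ ∧ ∃ C, C ≠ ⊤ ∧
    ∀ T u₀ (u u' g : ℝ → E3 → E3) P,
      IsLocalLeraySolution s T u₀ u → LerayData s T' M u' g P →
      (∀ᵐ τ, τ ∈ Ioo 0 T' → u' τ =ᵐ[volume] u τ) → ∀ R, 0 < R →
      ∃ κ ψ, IsMult κ ψ ∧ (∀ x, χ (R⁻¹ • x) ≤ ψ x) ∧ ∀ X,
        X = C * (ulocNorm (cutoffMul χ R u₀) + ofReal (R ^ (-(1 / 4) : ℝ))) ^ 2 →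
        𝓤[T', ρ, ψ, g] ≤ X ∧
        ∀ o, ∀ᵐ q ∂(𝓛 T'), ∫⁻ x, ofReal (lwt ρ o ψ x) * ‖u' q x‖ₑ ^ 2 ≤ X := by
  obtain ⟨L, hL, hmult⟩ := hχ.exists_isMult
  obtain ⟨ρ, hρ, C, hC, hmain⟩ := exists_energy_bound hs L M hT'
  obtain ⟨N, -, hN⟩ := exists_setLIntegral_ball_le (2 * ρ)
  obtain ⟨N', hN'⟩ := exists_setLIntegral_ball_le_ulocNorm_sq (2 * ρ)
  have hρ0 : 0 < ρ := by linarith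
  set A : ℝ≥0∞ := N * (M : ℝ≥0∞) ^ 2
  have hAt : A ≠ ⊤ := by finiteness
  set Q : ℝ≥0∞ := C * A + A * ofReal T'
  refine ⟨ρ, hρ, C * A + C * (N' + ofReal L * Q), by finiteness,
    fun T u₀ u u' g P h D hae R hR => ?_⟩
  have hR4 : ofReal (R ^ (-(1 / 4) : ℝ)) ^ 2 = ofReal (1 / √R) := by
    rw [← ofReal_pow (by positivity), ← rpow_natCast, ← rpow_mul hR.le,
      sqrt_eq_rpow, one_div (R ^ _), ← rpow_neg hR.le]
    norm_num
  set r := ofReal (R ^ (-(1 / 4) : ℝ))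
  have hone := hmain u' g P D 0 _ IsMult.one (by linarith) A.toNNReal
    (fun o δ hδ => Eventually.of_forall fun t => by
      have hut : Measurable (u' t) := D.meas_u.of_uncurry_left (x := t)
      rw [integral_eq_lintegral_of_nonneg_ae (Eventually.of_forall fun x =>
        mul_nonneg (lwt_nonneg x) (by positivity))
        ((lwt_isTest hρ0 IsMult.one).continuous.aestronglyMeasurable.mul
          (hut.norm.pow_const 2).aestronglyMeasurable)]
      refine (ENNReal.toReal_le_coe_of_le_coe ?_).trans (le_add_of_nonneg_right hδ.le)
      simp only [ofReal_mul (lwt_nonneg _), ofReal_pow (norm_nonneg _), ofReal_norm]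
      rw [coe_toNNReal hAt]; refine (lintegral_lwt_le hρ0 IsMult.one (u' t) o).trans ?_
      rw [LerayData.sqd_one]; exact hN _ (hut.enorm.pow_const 2) _ (D.uloc t) o) 0 (by simp)
  rw [coe_toNNReal hAt, add_zero] at hone; rcases lt_or_ge R 1 with h1 | h1
  · refine ⟨0, _, IsMult.one, fun x => (hχ.2.2.2 _).2, fun X hX => ?_⟩
    have hle : C * A ≤ X := by
      rw [hX]; refine le_self_add.trans (le_mul_of_one_le_right' ?_)
      refine one_le_pow₀ (le_add_left ?_)
      rw [one_le_ofReal]; exact Real.one_le_rpow_of_pos_of_le_one_of_nonpos hR h1.le (by norm_num)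
    exact ⟨hone.1.trans hle, fun o => (hone.2 o).mono fun q hq => hq.trans hle⟩
  · have hm := hmult R h1
    refine ⟨_, _, hm, fun x => le_rfl, fun X hX => ?_⟩
    set Y := ulocNorm (cutoffMul χ R u₀)
    have hcut : ∀ f : E3 → E3, sqd (fun x => χ (R⁻¹ • x)) f = fun x => ‖cutoffMul χ R f x‖ₑ ^ 2 :=
      fun f => by funext x; rw [sqd, cutoffMul, enorm_smul, enorm_of_nonneg (hχ.2.2.2 _).1]
    have hYt : Y < ⊤ := by
      refine lt_of_le_of_lt (iSup_mono fun o => eLpNorm_mono fun x => ?_) h.data_uloc.2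
      rw [cutoffMul, norm_smul, norm_of_nonneg (hχ.2.2.2 _).1]
      exact mul_le_of_le_one_left (norm_nonneg _) (hχ.2.2.2 _).2
    have hN0 : (N' : ℝ≥0∞) * Y ^ 2 ≠ ⊤ := by finiteness
    have hres := hmain u' g P D _ _ hm (div_le_self (by linarith) (Real.one_le_sqrt.2 h1))
      (N' * Y ^ 2).toNNReal (fun o δ hδ => by
        refine eventually_energy_le hρ0 hm hT' h.data_uloc.1 D.meas_u hae h.initial ?_ hδ
        rw [coe_toNNReal hN0]; refine (lintegral_lwt_le hρ0 hm u₀ o).trans ?_; rw [hcut]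
        exact hN' _ ((hχ.1.continuous.comp (continuous_const_smul _)).aestronglyMeasurable.smul
          h.data_uloc.1) o) _ rfl
    rw [coe_toNNReal hN0] at hres
    have hU : 𝓤[T', ρ, 𝟙, u'] ≤ A * ofReal T' := by
      refine (ulocSup_mono_radius _ (by linarith) _).trans ((D.ulocSup_u_le hN _).trans_eq ?_)
      rw [Real.volume_Ioo, sub_zero]
    have hle : C * (N' * Y ^ 2 + ofReal (L / √R) * (𝓤[T', ρ, 𝟙, g] +
          𝓤[T', ρ, 𝟙, u'])) ≤ X := by
      have h2 : ofReal (L / √R) = ofReal L * r ^ 2 := by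
        rw [hR4, ← ofReal_mul (by linarith), mul_one_div]
      have h3 : Y ^ 2 ≤ (Y + r) ^ 2 := pow_le_pow_left' le_self_add 2
      have h4 : r ^ 2 ≤ (Y + r) ^ 2 := pow_le_pow_left' le_add_self 2
      rw [hX, h2]
      calc _ ≤ C * (N' * (Y + r) ^ 2 + ofReal L * (Y + r) ^ 2 * Q) := by
            gcongr; exact add_le_add (by simpa using hone.1) hU
        _ = C * (N' + ofReal L * Q) * (Y + r) ^ 2 := by ring
        _ ≤ _ := mulR le_add_self
    exact ⟨hres.1.trans hle, fun o => (hres.2 o).mono fun q hq => hq.trans hle⟩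

lemma iSup_pow_two_le {ι : Type*} {f : ι → ℝ≥0∞} {a} (h : ∀ i, f i ^ 2 ≤ a) :
    (⨆ i, f i) ^ 2 ≤ a := by
  rw [ENNReal.iSup_pow_of_ne_zero two_ne_zero]; exact iSup_le h

end FNS

end

open FNS ENNReal Metric Function

theorem theorem4p1 (χ : FNS.E3 → ℝ) (hχ : FNS.IsCutoff χ)
    (s : ℝ) (hs : s ∈ Set.Ico (3 / 4 : ℝ) 1) (T' : ℝ) (hT' : 0 < T') (M : ℝ≥0) :
    ∃ C : ℝ≥0, 0 < C ∧
      ∀ (T : EReal) (u₀ : FNS.E3 → FNS.E3) (u : ℝ → FNS.E3 → FNS.E3),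
        (T' : EReal) < T →
        FNS.MemE2 u₀ → FNS.IsSolenoidal u₀ →
        FNS.IsLocalLeraySolution s T u₀ u →
        FNS.supUlocNorm T' u + FNS.ulocNorm22 T' u ≤ (M : ℝ≥0∞) →
        ∃ v : ℝ → FNS.E3 → FNS.E3, FNS.IsWeaklyContinuousRep T u v ∧
          ∀ g : ℝ → FNS.E3 → FNS.E3, FNS.IsFracLapOn s T u g →
            ∀ R : ℝ, 0 < R → ∀ t ∈ Set.Ioo (0 : ℝ) T',
              FNS.ulocNorm (FNS.cutoffMul χ R (v t)) +
                  FNS.ulocNorm22 t (fun τ => FNS.cutoffMul χ R (g τ)) ≤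
                (C : ℝ≥0∞) * (FNS.ulocNorm (FNS.cutoffMul χ R u₀) +
                  ENNReal.ofReal (R ^ (-(1 / 4) : ℝ))) := by
  obtain ⟨ρ, hρ, C, hC, hdec⟩ := exists_decay hχ hs hT' M
  refine ⟨(1 + C + (1 + C)).toNNReal, toNNReal_pos (by positivity) (by finiteness),
    fun T u₀ u hT hE2 hdiv h hM => ?_⟩
  obtain ⟨u', g', P, D, hae⟩ := h.exists_lerayData hT (le_self_add.trans hM)
  obtain ⟨v, hv, hlsc⟩ := h.exists_weaklyContinuousRep
  refine ⟨v, hv, fun g hg R hR t ht => ?_⟩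
  obtain ⟨κ, ψ, hψ, hχψ, hX⟩ :=
    hdec T u₀ u u' g' P h D (hae.mono fun τ hτ hI => (hτ hI).1) R hR
  obtain ⟨hXg, hXu⟩ := hX _ rfl
  set Y := ulocNorm (cutoffMul χ R u₀) + ENNReal.ofReal (R ^ (-(1 / 4) : ℝ)) with hY
  have hρ0 : 0 < ρ := by linarith
  have hYt : Y < ⊤ := by
    refine add_lt_top.2 ⟨lt_of_le_of_lt (iSup_mono fun x₀ => eLpNorm_mono fun x => ?_)
      h.data_uloc.2, ofReal_lt_top⟩
    rw [cutoffMul, norm_smul, Real.norm_of_nonneg (hχ.2.2.2 _).1]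
    exact mul_le_of_le_one_left (norm_nonneg _) (hχ.2.2.2 _).2
  have hcut : ∀ (f : E3 → E3) x, ‖cutoffMul χ R f x‖ₑ ^ 2 ≤ sqd ψ f x :=
    fun f x => by
      rw [sqd, cutoffMul, enorm_smul, Real.enorm_of_nonneg (hχ.2.2.2 _).1]
      gcongr
      exact hχψ x
  have hball : ∀ x₀ : E3, ball x₀ 1 ⊆ ball x₀ ρ := fun x₀ =>
    ball_subset_ball hρ
  have hsub : Ioo 0 t ⊆ timeInterval T :=
    Ioo_subset_timeInterval le_rfl ((EReal.coe_le_coe ht.2.le).trans hT.le)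
  have hsubT : Ioo 0 T' ⊆ timeInterval T := Ioo_subset_timeInterval le_rfl hT.le
  rw [coe_toNNReal (by finiteness), add_mul]
  refine add_le_add (le_of_sq_le_mul_sq ?_) (le_of_sq_le_mul_sq ?_)
  · refine iSup_pow_two_le fun x₀ => ?_
    rw [eLpNorm_two_sq]
    have hK : C * Y ^ 2 ≠ ⊤ := mul_ne_top hC (pow_ne_top hYt.ne)
    have h1 := hlsc t (hsubT ht) (lwt ρ x₀ ψ) (lwt_isTest hρ0 hψ).continuous.measurable
      lwt_nonneg (fun x => (lwt_le hψ x).trans (pow_le_one₀ (hψ.nonneg x) (hψ.le_one x)))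
      (‖x₀‖ + 2 * ρ) (fun x hx => lwt_eq_zero hρ0 (by
        rw [dist_eq_norm]
        linarith [norm_le_norm_add_norm_sub' x x₀])) (C * Y ^ 2).toNNReal
      (eventually_nhds_inf_ae isOpen_Ioo ht (by
        filter_upwards [(ae_restrict_iff' measurableSet_Ioo).1 (hXu x₀), hae] with τ h2 h3 hτ
        rw [coe_toNNReal hK]
        refine le_of_eq_of_le (lintegral_congr_ae ?_) (h2 hτ)
        filter_upwards [(h3 hτ).1] with x hx
        rw [hx]))
    rw [coe_toNNReal hK] at h1
    exact (lintegral_mono (hcut _)).trans ((lintegral_mono_set (hball x₀)).trans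
      ((setLIntegral_sqd_le hρ0 ψ (v t) x₀).trans h1))
  · refine iSup_pow_two_le fun x₀ => ?_
    have hm : AEStronglyMeasurable (uncurry fun τ => cutoffMul χ R (g τ))
        ((volume.restrict (Ioo 0 t)).prod volume) :=
      (hχ.1.continuous.comp ((continuous_const_smul _).comp continuous_snd)).aestronglyMeasurable.smul
        (hg.1.prod hsub)
    rw [eLpNorm_uncurry_sq _ hm]
    calc _ ≤ ∫⁻ τ in Ioo 0 t, ∫⁻ x in ball x₀ ρ, sqd ψ (g' τ) x := by
          refine lintegral_mono_ae ((ae_restrict_iff' measurableSet_Ioo).2 ?_)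
          filter_upwards [hae, (ae_restrict_iff' (isOpen_timeInterval T).measurableSet).1 hg.2]
            with τ h2 h3 hτ
          have h4 := (h3 (hsub hτ)).ae_eq (h2 ⟨hτ.1, hτ.2.trans ht.2⟩).2
          refine (lintegral_mono_ae ?_).trans (lintegral_mono_set (hball x₀))
          filter_upwards [ae_restrict_of_ae h4] with x hx
          refine (hcut _ x).trans_eq ?_
          rw [sqd, sqd, hx]
      _ ≤ ∫⁻ τ in Ioo 0 T', ∫⁻ x in ball x₀ ρ, sqd ψ (g' τ) x :=
          lintegral_mono_set (Ioo_subset_Ioo_right ht.2.le)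
      _ ≤ _ := (le_ulocSup _ _ _ _).trans hXg
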